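/- **Setting.** All vector spaces are over $\mathbb C$; repeated indices are summed unless a sum is written or the index belongs to $d_i$. Let $q\in\mathbb C$ be transcendental (fix a square root of $q$ if half-integral powers of $q$ occur), and let $G_q$ be one of $GL_q(N)$, $SL_q(N)$ ($N\ge 2$), $O_q(N)$, $SO_q(N)$ ($N\ge 3$), $Sp_q(N)$ ($N\ge 3$ even). Let $A=\mathcal O(G_q)$ be its coordinate Hopf algebra in the sense of Faddeev–Reshetikhin–Takhtajan, with comultiplication $\Delta$, counit $\varepsilon$, antipode $S$, fundamental matrix corepresentation $u=(u^i_j)$, standard matrix $\hat R$ with $\hat R u_1u_2=u_1u_2\hat R$ and, for the orthogonal and symplectic series, matrix $C$ of the metric ($uCu^tC^{-1}=1=Cu^tC^{-1}u$). In $GL_q(N)$ the quantum determinant is invertible; in $SL_q(N)$ and $SO_q(N)$ it is $1$ (for $SO_q(N)$: $u^{\otimes N}$ acts trivially on the $q$-antisymmetric tensors of rank $N$). Let $D=\mathrm{diag}(d_i)$ with $d_i=q^{N+1-2i}$ for $GL_q(N)$, $SL_q(N)$ and $D=C^tC^{-1}$ otherwise, and $\mathfrak s=\operatorname{tr}D$.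 Call $x\in\mathbb C$ admissible if $x\ne0$ for $GL_q(N)$, $x^N=q$ for $SL_q(N)$, $x^2=1$ for $O_q(N)$, $Sp_q(N)$ and $SO_q(2n)$, $x=1$ for $SO_q(2n+1)$. For admissible $x$ let $\mathbf r_x$ be the universal $r$-form on $A$ with $\mathbf r_x(u^i_j,u^k_l)=x^{-1}\hat R^{ki}_{jl}$. Fix admissible $x,y$ and put $$\ell^{+i}{}_j(a)=\mathbf r_x(a,u^i_j),\qquad \ell^{-i}{}_j(a)=\mathbf r_y(S(u^i_j),a).$$ Functionals on $A$ are multiplied by convolution, and $S(f)=f\circ S$. **Calculi.** For $\tau\in\{+,-\}$ let $\Gamma_\tau$ be the Hopf bimodule, free as a left $A$-module on a basis $\omega^\tau_{ij}$, $1\le i,j\le N$, of left-coinvariant elements, with right coaction and right adjoint action $\omega\triangleleft a=S(a_{(1)})\omega a_{(2)}$ given by $$\Delta_R(\omega^+_{ij})=\omega^+_{kl}\otimes u^k_iS(u^j_l),\qquad \omega^+_{ij}\triangleleft a=\bigl(S(\ell^{-k}{}_i)\,\ell^{+j}{}_l\bigr)(a)\,\omega^+_{kl},$$ $$\Delta_R(\omega^-_{ij})=\omega^-_{kl}\otimes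 S^2(u^k_i)S(u^j_l),\qquad \omega^-_{ij}\triangleleft a=\bigl(S^{-1}(\ell^{+k}{}_i)\,\ell^{-j}{}_l\bigr)(a)\,\omega^-_{kl}.$$ Put $\omega^+_0=\sum_i\omega^+_{ii}$, $\omega^-_0=\sum_i d_i^{-1}\omega^-_{ii}$, and let $g$ be the $A$-bimodule map on $\Gamma_+\otimes_A\Gamma_-\oplus\Gamma_-\otimes_A\Gamma_+$ with $g(\omega^+_{ij},\omega^-_{kl})=D^j_k(D^{-1})^l_i$ and $g(\omega^-_{ij},\omega^+_{kl})=\delta_{jk}\delta_{il}$. Further let $$X^+_{ij}=S(\ell^{-i}{}_k)\ell^{+k}{}_j-\delta_{ij}\varepsilon,\qquad X_0^+=\mathfrak s^{-1}(D^{-1})^i_jX^+_{ij},$$ $$X^-_{ij}=d_i^{-1}\bigl(S(\ell^{+i}{}_k)\ell^{-k}{}_j-\delta_{ij}\varepsilon\bigr),\qquad X_0^-=\mathfrak s^{-1}\sum_iX^-_{ii},$$ and $X_0=X_0^++X_0^-$. **Forms.** Let $\sigma$ be the braiding of $\Gamma_\tau\otimes_A\Gamma_\tau$, that is, the bimodule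 map with $\sigma(\alpha\otimes\beta)=\beta_{(0)}\otimes(\alpha\triangleleft\beta_{(1)})$ for left-coinvariant $\alpha,\beta$, and let $\sigma^{+}=\sigma$, $\sigma^-=\sigma^{-1}$. For $\pi$ in the symmetric group $S_k$ with reduced expression $\pi=s_{i_1}\cdots s_{i_r}$ put $\sigma^\pm_\pi=\sigma^\pm_{i_1}\cdots\sigma^\pm_{i_r}$ on $\Gamma_\tau^{\otimes k}$. Let $A_k^\pm=\sum_{\pi\in S_k}\mathrm{sgn}(\pi)\sigma^\pm_\pi$ and $B^\pm_{i,j}=\sum_{\pi}\mathrm{sgn}(\pi)\sigma^\pm_\pi$, where $\pi$ runs through the $\pi\in S_{i+j}$ with $\pi^{-1}(1)<\dots<\pi^{-1}(i)$ and $\pi^{-1}(i+1)<\dots<\pi^{-1}(i+j)$. Put $\Gamma_\tau^{\wedge k}=\Gamma_\tau^{\otimes k}/\ker A_k^+$. For $\rho\in\Gamma_\tau^{\wedge k}$ define $$\mathrm d\rho=\omega_0^\tau\wedge\rho-(-1)^k\rho\wedge\omega_0^\tau,\qquad \partial^\pm\rho=\langle\rho,\omega_0^{-\tau}\rangle_\pm+(-1)^k\langle\omega_0^{-\tau},\rho\rangle_\pm\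 (k\ge1),\qquad \partial^\pm=0\ (k=0),$$ where $\langle\rho,\zeta\rangle_\pm$ and $\langle\zeta,\rho\rangle_\pm$, for $\zeta\in\Gamma_{-\tau}$, are obtained by applying $g$ to the last two factors of $B^\pm_{k-1,1}\rho\otimes_A\zeta$ and to the first two factors of $\zeta\otimes_AB^\pm_{1,k-1}\rho$, respectively. Let $$\Delta^\pm=-\mathrm d\,\partial^\pm+\partial^\pm\,\mathrm d$$ be the quantum Laplace–Beltrami operators on $\Gamma_\tau^{\wedge k}$. With the right coaction $\rho\mapsto\rho_{(0)}\otimes\rho_{(1)}$ and the left coaction $\rho\mapsto\rho_{(-1)}\otimes\rho_{(0)}$ of $A$ on $\Gamma_\tau^{\wedge k}$ put $X*\rho=\rho_{(0)}X(\rho_{(1)})$ and $\rho*X=X(\rho_{(-1)})\rho_{(0)}$ for functionals $X$ on $A$. **Proposition 5.3.** The maps $\mathrm d$, $\partial^+$, $\partial^-$ and both coactions are well defined on the quotients $\Gamma_\tau^{\wedge k}$. For $\tau\in\{+,-\}$, $k\ge0$ and all $\rho\in\Gamma_\tau^{\wedge k}$, $$\Delta^+\rho=(-1)^k\,\mathfrak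 s\,\bigl(X_0^\tau*\rho+\rho*X_0^{-\tau}\bigr),\qquad \Delta^-\rho=(-1)^k\,\mathfrak s\,\bigl(X_0^{-\tau}*\rho+\rho*X_0^{\tau}\bigr).$$ In particular $\Delta^+a=\Delta^-a=\mathfrak s\,X_0*a=\mathfrak s\,a*X_0$ for all $a\in A=\Gamma_\tau^{\wedge0}$. -/

import Mathlib

open scoped TensorProduct

namespace QuantumGroups

/-! ### Quantum groups of type A, B, C, D -/

/-- The five families of quantum groups. -/
inductive Series
  | typeGL
  | typeSL
  | typeO
  | typeSO
  | typeSp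

/-- Parameters of a quantum group `G_q(N)`: the family, the size `N`, the transcendental
deformation parameter `q`, and a fixed square root `p` of `q` (half-integral powers of `q` enter
the `R`-matrix of `O_q(N)` for odd `N`; in the other cases `p` plays no role). -/
structure QuantumGroup where
  series : Series
  N : ℕ
  q : ℂ
  p : ℂ
  transcendental : Transcendental ℚ q
  sq : p ^ 2 = q
  size : match series with
    | .typeGL => 2 ≤ N
    | .typeSL => 2 ≤ N
    | .typeO => 3 ≤ N
    | .typeSO => 3 ≤ N
    | .typeSp => 3 ≤ N ∧ Even N

/-- Type A. -/
def Series.IsA : Series → Prop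
  | .typeGL => True
  | .typeSL => True
  | _ => False

/-- The matrix `R̂` of type A:
`R̂^{ij}_{mn} = q^{δ_ij} δ_in δ_jm + (q - q⁻¹) θ(j - i) δ_im δ_jn`. -/
noncomputable def braidA (N : ℕ) (q : ℂ) : Matrix (Fin N × Fin N) (Fin N × Fin N) ℂ :=
  Matrix.of fun a b =>
    (if a.1 = b.2 ∧ a.2 = b.1 then (if a.1 = a.2 then q else 1) else 0)
      + (if a.1 < a.2 ∧ a = b then q - q⁻¹ else 0)

namespace QuantumGroup

variable (G : QuantumGroup)

/-- Twice the number `ρ_i` of the B, C, D series (with the index `i` running from `0`). -/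
def rho2 (i : Fin G.N) : ℤ :=
  let c : ℤ := match G.series with
    | .typeSp => G.N
    | _ => (G.N : ℤ) - 2
  if i < i.rev then c - 2 * (i : ℤ)
  else if i = i.rev then 0
  else -(c - 2 * (i.rev : ℤ))

/-- The signs `ε_i`. -/
def sgn (i : Fin G.N) : ℂ :=
  match G.series with
  | .typeSp => if i < i.rev then 1 else -1
  | _ => 1

/-- The matrix of the metric, `C^i_j = ε_i δ_{ij'} q^{-ρ_i}`, where `i' = N + 1 - i`. -/
noncomputable def C : Matrix (Fin G.N) (Fin G.N) ℂ :=
  Matrix.of fun i j => if j = i.rev then G.sgn i * G.p ^ (-G.rho2 i) else 0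

/-- The matrix `R̂` of the B, C, D series, `R̂^{ij}_{mn} = R^{ji}_{mn}` with
`R = ∑ q^{δ_ij - δ_ij'} e_ii ⊗ e_jj
  + (q - q⁻¹) ∑_{i > j} (e_ij ⊗ e_ji - q^{ρ_i - ρ_j} ε_i ε_j e_ij ⊗ e_i'j')`. -/
noncomputable def braidBCD : Matrix (Fin G.N × Fin G.N) (Fin G.N × Fin G.N) ℂ :=
  Matrix.of fun a b =>
    (if a.1 = b.2 ∧ a.2 = b.1 then
      G.q ^ ((if a.1 = a.2 then 1 else 0) - (if a.1 = a.2.rev then 1 else 0) : ℤ) else 0)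
    + (G.q - G.q⁻¹) * (if b.1 < a.2 then
        (if a = b then 1 else 0)
          - (if a.1 = a.2.rev ∧ b.2 = b.1.rev then
              G.p ^ (G.rho2 a.2 - G.rho2 b.1) * G.sgn a.2 * G.sgn b.1 else 0)
      else 0)

/-- The matrix `R̂` of the vector corepresentation. -/
noncomputable def Rhat : Matrix (Fin G.N × Fin G.N) (Fin G.N × Fin G.N) ℂ :=
  match G.series with
  | .typeGL => braidA G.N G.q
  | .typeSL => braidA G.N G.q
  | _ => G.braidBCD

/-- The diagonal matrix `D`, which intertwines the second contragredient of `u` with `u`. -/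
noncomputable def D : Matrix (Fin G.N) (Fin G.N) ℂ :=
  match G.series with
  | .typeGL => Matrix.diagonal fun i => G.q ^ ((G.N : ℤ) - 1 - 2 * (i : ℤ))
  | .typeSL => Matrix.diagonal fun i => G.q ^ ((G.N : ℤ) - 1 - 2 * (i : ℤ))
  | _ => G.C.transpose * G.C⁻¹

/-- The number `𝔰 = tr D`. -/
noncomputable def s : ℂ := G.D.trace

/-- Admissible parameters. -/
def Admissible (x : ℂ) : Prop :=
  match G.series with
  | .typeGL => x ≠ 0
  | .typeSL => x ^ G.N = G.q
  | .typeO => x ^ 2 = 1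
  | .typeSO => if Even G.N then x ^ 2 = 1 else x = 1
  | .typeSp => x ^ 2 = 1

end QuantumGroup

/-! ### Tensor powers in coordinates -/

/-- The matrix of the `k`-th tensor power of a corepresentation `U`, with entries
`U^{i₁}_{j₁} U^{i₂}_{j₂} ⋯ U^{i_k}_{j_k}`. -/
def tensorPow {B ι : Type} [Monoid B] (U : Matrix ι ι B) (k : ℕ) :
    Matrix (Fin k → ι) (Fin k → ι) B :=
  Matrix.of fun I J => ((List.finRange k).map fun m => U (I m) (J m)).prod

/-- Leg numbering: the operator on tensors `ρ = ∑ ρ_I e_I` of rank `k` which applies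
`e_a ⊗ e_b ↦ ∑ S^{cd}_{ab} e_c ⊗ e_d` to the legs `i` and `j`. -/
def onLegs {ι M : Type} [Fintype ι] [AddCommMonoid M] [Module ℂ M]
    (S : Matrix (ι × ι) (ι × ι) ℂ) {k : ℕ} (i j : Fin k) :
    ((Fin k → ι) → M) →ₗ[ℂ] ((Fin k → ι) → M) where
  toFun ρ J := ∑ a : ι × ι,
    S (J i, J j) a • ρ (Function.update (Function.update J i a.1) j a.2)
  map_add' ρ ζ := by
    funext J
    simp [smul_add, Finset.sum_add_distrib]
  map_smul' c ρ := by
    funext J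
    simp [Finset.smul_sum, smul_comm c]

/-- The number of inversions of a permutation. -/
def inversions {N : ℕ} (π : Equiv.Perm (Fin N)) : ℕ :=
  (Finset.univ.filter fun a : Fin N × Fin N => a.1 < a.2 ∧ π a.2 < π a.1).card

/-- The quantum determinant `∑_π (-q)^{ℓ(π)} U^1_{π(1)} ⋯ U^N_{π(N)}` of type A. -/
noncomputable def qdet {B : Type} [Ring B] [Algebra ℂ B] (q : ℂ) {N : ℕ}
    (U : Matrix (Fin N) (Fin N) B) : B :=
  ∑ π : Equiv.Perm (Fin N), (-q) ^ inversions π • tensorPow U N id π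

namespace QuantumGroup

variable (G : QuantumGroup)

/-- The `q`-antisymmetric tensors of top degree, that is, the tensors of rank `N` on which each
`R̂` acting on two neighbouring legs is `-q⁻¹`. -/
def Antisymmetric (w : (Fin G.N → Fin G.N) → ℂ) : Prop :=
  ∀ i j : Fin G.N, (i : ℕ) + 1 = j → onLegs G.Rhat i j w = -G.q⁻¹ • w

/-- The index set of the generators: the entries of `u`, and for `GL_q(N)` moreover the inverse of
the quantum determinant. -/
abbrev Gen : Type := (Fin G.N × Fin G.N) ⊕ {_t : Unit // G.series = Series.typeGL}

/-- The matrix of generators in the free algebra. -/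
noncomputable def freeU : Matrix (Fin G.N) (Fin G.N) (FreeAlgebra ℂ G.Gen) :=
  Matrix.of fun i j => FreeAlgebra.ι ℂ (Sum.inl (i, j))

/-- The defining relations of the coordinate algebra `O(G_q)`. -/
inductive Rel : FreeAlgebra ℂ G.Gen → FreeAlgebra ℂ G.Gen → Prop
  /-- `R̂ u₁ u₂ = u₁ u₂ R̂` -/
  | rtt (i j k l : Fin G.N) :
      Rel (∑ a : Fin G.N × Fin G.N, G.Rhat (i, j) a • (G.freeU a.1 k * G.freeU a.2 l))
        (∑ a : Fin G.N × Fin G.N, G.Rhat a (k, l) • (G.freeU i a.1 * G.freeU j a.2))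
  /-- `u C uᵗ C⁻¹ = 1` for the B, C, D series -/
  | metric_right (h : ¬ G.series.IsA) (i j : Fin G.N) :
      Rel ((G.freeU * G.C.map (algebraMap ℂ (FreeAlgebra ℂ G.Gen)) * G.freeU.transpose
        * G.C⁻¹.map (algebraMap ℂ (FreeAlgebra ℂ G.Gen))) i j)
        ((1 : Matrix (Fin G.N) (Fin G.N) (FreeAlgebra ℂ G.Gen)) i j)
  /-- `C uᵗ C⁻¹ u = 1` for the B, C, D series -/
  | metric_left (h : ¬ G.series.IsA) (i j : Fin G.N) :
      Rel ((G.C.map (algebraMap ℂ (FreeAlgebra ℂ G.Gen)) * G.freeU.transpose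
        * G.C⁻¹.map (algebraMap ℂ (FreeAlgebra ℂ G.Gen)) * G.freeU) i j)
        ((1 : Matrix (Fin G.N) (Fin G.N) (FreeAlgebra ℂ G.Gen)) i j)
  /-- for `GL_q(N)` the quantum determinant is invertible -/
  | det_mul_inv (h : G.series = Series.typeGL) :
      Rel (qdet G.q G.freeU * FreeAlgebra.ι ℂ (Sum.inr ⟨(), h⟩)) 1
  | inv_mul_det (h : G.series = Series.typeGL) :
      Rel (FreeAlgebra.ι ℂ (Sum.inr ⟨(), h⟩) * qdet G.q G.freeU) 1
  /-- for `SL_q(N)` the quantum determinant is `1` -/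
  | det_SL (h : G.series = Series.typeSL) : Rel (qdet G.q G.freeU) 1
  /-- for `SO_q(N)` the quantum determinant is `1`: the quantum determinant of `O_q(N)` is the
  matrix element of the one-dimensional corepresentation on the `q`-antisymmetric tensors -/
  | det_SO (h : G.series = Series.typeSO) (w : (Fin G.N → Fin G.N) → ℂ) (hw : G.Antisymmetric w)
      (I : Fin G.N → Fin G.N) :
      Rel (∑ J, w J • tensorPow G.freeU G.N I J) (w I • 1)

/-- The coordinate algebra `O(G_q)`. -/
def Coord : Type := RingQuot G.Rel

noncomputable instance : Ring G.Coord := inferInstanceAs (Ring (RingQuot G.Rel))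

noncomputable instance : Algebra ℂ G.Coord := inferInstanceAs (Algebra ℂ (RingQuot G.Rel))

/-- The canonical projection of the free algebra. -/
noncomputable def proj : FreeAlgebra ℂ G.Gen →ₐ[ℂ] G.Coord := RingQuot.mkAlgHom ℂ G.Rel

/-- The fundamental matrix corepresentation `u`. -/
noncomputable def u : Matrix (Fin G.N) (Fin G.N) G.Coord :=
  Matrix.of fun i j => G.proj (FreeAlgebra.ι ℂ (Sum.inl (i, j)))

/-- The inverse of the quantum determinant of `GL_q(N)`. -/
noncomputable def detInv (t : {_t : Unit // G.series = Series.typeGL}) : G.Coord :=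
  G.proj (FreeAlgebra.ι ℂ (Sum.inr t))

end QuantumGroup
end QuantumGroups

namespace QuantumGroups

section tensorPow
variable {B ι : Type}

theorem tensorPow_zero [Monoid B] (U : Matrix ι ι B) (I J : Fin 0 → ι) :
    tensorPow U 0 I J = 1 := by
  simp [tensorPow]

theorem tensorPow_cons [Monoid B] (U : Matrix ι ι B) (k : ℕ) (a b : ι) (I J : Fin k → ι) :
    tensorPow U (k + 1) (Fin.cons a I) (Fin.cons b J) = U a b * tensorPow U k I J := by
  simp [tensorPow, List.finRange_succ, Function.comp_def]

theorem tensorPow_snoc [Monoid B] (U : Matrix ι ι B) (k : ℕ) (a b : ι) (I J : Fin k → ι) :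
    tensorPow U (k + 1) (Fin.snoc I a : Fin (k + 1) → ι) (Fin.snoc J b : Fin (k + 1) → ι)
      = tensorPow U k I J * U a b := by
  simp [tensorPow, List.finRange_succ_last, Function.comp_def]

theorem sum_cons [Fintype ι] {M : Type} [AddCommMonoid M] (k : ℕ) (F : (Fin (k + 1) → ι) → M) :
    ∑ I, F I = ∑ a, ∑ I : Fin k → ι, F (Fin.cons a I) := by
  rw [← (Fin.consEquiv (fun _ => ι)).sum_comp,
    ← Fintype.sum_prod_type' (fun a (I : Fin k → ι) => F (Fin.cons a I))]
  rfl

theorem sum_snoc [Fintype ι] {M : Type} [AddCommMonoid M] (k : ℕ) (F : (Fin (k + 1) → ι) → M) :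
    ∑ I, F I = ∑ a, ∑ I : Fin k → ι, F (Fin.snoc I a : Fin (k + 1) → ι) := by
  rw [← (Fin.snocEquiv (fun _ => ι)).sum_comp,
    ← Fintype.sum_prod_type' (fun a (I : Fin k → ι) => F (Fin.snoc I a : Fin (k + 1) → ι))]
  rfl

theorem tensorPow_commute [Monoid B] (U : Matrix ι ι B) (k : ℕ) (I J : Fin k → ι) (b : B)
    (h : ∀ i j, Commute b (U i j)) : Commute b (tensorPow U k I J) := by
  induction k with
  | zero => rw [tensorPow_zero]; exact Commute.one_right b
  | succ k ih =>
    rw [← Fin.cons_self_tail I, ← Fin.cons_self_tail J, tensorPow_cons]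
    exact (h _ _).mul_right (ih _ _)

/-- The tensor power of a product of matrices with commuting entries. -/
theorem tensorPow_mul [Ring B] [Fintype ι] (U V : Matrix ι ι B)
    (h : ∀ i j k l, Commute (U i j) (V k l)) (k : ℕ) :
    tensorPow (U * V) k = tensorPow U k * tensorPow V k := by
  induction k with
  | zero => ext I J; simp [Matrix.mul_apply, tensorPow_zero]
  | succ k ih =>
    ext I J
    rw [← Fin.cons_self_tail I, ← Fin.cons_self_tail J, tensorPow_cons, ih]
    simp only [Matrix.mul_apply, sum_cons, tensorPow_cons, Finset.sum_mul, Finset.mul_sum]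
    rw [Finset.sum_comm]
    refine Finset.sum_congr rfl fun a _ => ?_
    refine Finset.sum_congr rfl fun K _ => ?_
    have := tensorPow_commute U k (Fin.tail I) K (V a (J 0)) (fun i j => (h i j _ _).symm)
    simp only [mul_assoc]
    rw [← mul_assoc (V a (J 0)), this.eq, mul_assoc]

theorem tensorPow_one [Ring B] [DecidableEq ι] (k : ℕ) :
    tensorPow (1 : Matrix ι ι B) k = 1 := by
  induction k with
  | zero =>
    ext I J
    rw [tensorPow_zero, Subsingleton.elim I J, Matrix.one_apply_eq]
  | succ k ih =>
    ext I J
    rw [← Fin.cons_self_tail I, ← Fin.cons_self_tail J, tensorPow_cons, ih]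
    simp only [Matrix.one_apply, Fin.cons_inj]
    split_ifs <;> simp_all

theorem map_tensorPow {B' : Type} [Monoid B] [Monoid B'] {F : Type} [FunLike F B B']
    [MonoidHomClass F B B'] (φ : F) (U : Matrix ι ι B) (k : ℕ) (I J : Fin k → ι) :
    φ (tensorPow U k I J) = tensorPow (U.map φ) k I J := by
  simp [tensorPow, map_list_prod, Function.comp_def]

/-- The tensor power of an inverse matrix over the opposite ring. -/
theorem tensorPow_op_mul [Ring B] [Fintype ι] [DecidableEq ι] (U V : Matrix ι ι B)
    (h : V * U = 1) (k : ℕ) (I J : Fin k → ι) :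
    ∑ K, (tensorPow (V.map MulOpposite.op) k I K).unop * tensorPow U k K J
      = (1 : Matrix (Fin k → ι) (Fin k → ι) B) I J := by
  induction k with
  | zero =>
    rw [Subsingleton.elim I J, Matrix.one_apply_eq]
    simp [tensorPow_zero]
  | succ k ih =>
    rw [← Fin.cons_self_tail I, ← Fin.cons_self_tail J, sum_cons, Finset.sum_comm]
    have h' : ∀ i j, ∑ a, V i a * U a j = (1 : Matrix ι ι B) i j := fun i j => by
      rw [← h, Matrix.mul_apply]
    have key : ∀ K : Fin k → ι, ∑ a,
        (tensorPow (V.map MulOpposite.op) (k + 1) (Fin.cons (I 0) (Fin.tail I))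
          (Fin.cons a K)).unop
          * tensorPow U (k + 1) (Fin.cons a K) (Fin.cons (J 0) (Fin.tail J))
        = (tensorPow (V.map MulOpposite.op) k (Fin.tail I) K).unop
          * ((1 : Matrix ι ι B) (I 0) (J 0) * tensorPow U k K (Fin.tail J)) := by
      intro K
      rw [← h', Finset.sum_mul, Finset.mul_sum]
      refine Finset.sum_congr rfl fun a _ => ?_
      simp only [tensorPow_cons, Matrix.map_apply, MulOpposite.unop_mul, MulOpposite.unop_op,
        mul_assoc]
    rw [Finset.sum_congr rfl fun K _ => key K]
    simp only [Matrix.one_apply, Fin.cons_inj]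
    by_cases h0 : I 0 = J 0
    · simp only [h0, if_true, one_mul, true_and]
      rw [ih, Matrix.one_apply]
    · simp [h0]

end tensorPow

section legs
variable {B ι : Type}

theorem finRange_split {k : ℕ} (i j : Fin k) (h : (i : ℕ) + 1 = j) :
    ∃ l₁ l₂ : List (Fin k), List.finRange k = l₁ ++ i :: j :: l₂
      ∧ i ∉ l₁ ∧ j ∉ l₁ ∧ i ∉ l₂ ∧ j ∉ l₂ := by
  have hi : (i : ℕ) < (List.finRange k).length := by simp
  have hj : (i : ℕ) + 1 < (List.finRange k).length := by simp [h]
  have hs : List.finRange k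
      = (List.finRange k).take i ++ i :: j :: (List.finRange k).drop (i + 2) := by
    conv_lhs => rw [← List.take_append_drop i (List.finRange k)]
    congr 1
    rw [List.drop_eq_getElem_cons hi, List.drop_eq_getElem_cons hj]
    congr 1
    · simp
    · congr 1
      simp [h]
  refine ⟨_, _, hs, ?_⟩
  have hn := List.nodup_finRange k
  rw [hs] at hn
  simp only [List.nodup_append, List.nodup_cons, List.mem_cons] at hn
  grind

/-- The relation `R̂ U₁ U₂ = U₁ U₂ R̂`. -/
def RTT [Fintype ι] [Ring B] [Algebra ℂ B] (R : Matrix (ι × ι) (ι × ι) ℂ) (U : Matrix ι ι B) :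
    Prop :=
  ∀ i j k l : ι, ∑ a : ι × ι, R (i, j) a • (U a.1 k * U a.2 l)
    = ∑ a : ι × ι, R a (k, l) • (U i a.1 * U j a.2)

theorem RTT.tensorPow [Fintype ι] [Ring B] [Algebra ℂ B] {R : Matrix (ι × ι) (ι × ι) ℂ}
    {U : Matrix ι ι B} (hU : RTT R U) {k : ℕ} (i j : Fin k) (h : (i : ℕ) + 1 = j)
    (I J : Fin k → ι) :
    ∑ a : ι × ι, R (I i, I j) a
        • tensorPow U k (Function.update (Function.update I i a.1) j a.2) J
      = ∑ a : ι × ι, R a (J i, J j)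
        • tensorPow U k I (Function.update (Function.update J i a.1) j a.2) := by
  obtain ⟨l₁, l₂, hs, h1, h2, h3, h4⟩ := finRange_split i j h
  have hij : i ≠ j := by
    intro hh
    rw [hh] at h
    omega
  have aux : ∀ (l : List (Fin k)) (I' J' : Fin k → ι), i ∉ l → j ∉ l →
      (∀ m, m ≠ i → m ≠ j → I' m = I m) → (∀ m, m ≠ i → m ≠ j → J' m = J m) →
      (l.map fun m => U (I' m) (J' m)) = l.map fun m => U (I m) (J m) := by
    intro l I' J' hi hj hI hJ
    refine List.map_congr_left fun m hm => ?_
    rw [hI m (fun e => hi (e ▸ hm)) (fun e => hj (e ▸ hm)),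
      hJ m (fun e => hi (e ▸ hm)) (fun e => hj (e ▸ hm))]
  have split : ∀ (I' J' : Fin k → ι),
      (∀ m, m ≠ i → m ≠ j → I' m = I m) → (∀ m, m ≠ i → m ≠ j → J' m = J m) →
      QuantumGroups.tensorPow U k I' J' = (l₁.map fun m => U (I m) (J m)).prod
        * (U (I' i) (J' i) * U (I' j) (J' j)) * (l₂.map fun m => U (I m) (J m)).prod := by
    intro I' J' hI hJ
    simp only [QuantumGroups.tensorPow, Matrix.of_apply]
    rw [hs, List.map_append, List.prod_append, List.map_cons, List.map_cons, List.prod_cons,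
      List.prod_cons, aux l₁ I' J' h1 h2 hI hJ, aux l₂ I' J' h3 h4 hI hJ]
    simp only [mul_assoc]
  have upd : ∀ (I : Fin k → ι) (a : ι × ι) (m : Fin k), m ≠ i → m ≠ j →
      Function.update (Function.update I i a.1) j a.2 m = I m := by
    intro I a m hi hj
    simp [hi, hj]
  have e1 : ∀ a : ι × ι,
      QuantumGroups.tensorPow U k (Function.update (Function.update I i a.1) j a.2) J
      = (l₁.map fun m => U (I m) (J m)).prod * (U a.1 (J i) * U a.2 (J j))
        * (l₂.map fun m => U (I m) (J m)).prod := by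
    intro a
    rw [split _ _ (upd I a) (fun _ _ _ => rfl)]
    simp [hij]
  have e2 : ∀ a : ι × ι,
      QuantumGroups.tensorPow U k I (Function.update (Function.update J i a.1) j a.2)
      = (l₁.map fun m => U (I m) (J m)).prod * (U (I i) a.1 * U (I j) a.2)
        * (l₂.map fun m => U (I m) (J m)).prod := by
    intro a
    rw [split _ _ (fun _ _ _ => rfl) (upd J a)]
    simp [hij]
  have pull : ∀ (c : ι × ι → ℂ) (x z : B) (y : ι × ι → B),
      ∑ a, c a • (x * y a * z) = x * (∑ a, c a • y a) * z := by
    intro c x z y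
    rw [Finset.mul_sum, Finset.sum_mul]
    refine Finset.sum_congr rfl fun a _ => ?_
    rw [mul_smul_comm, smul_mul_assoc]
  simp only [e1, e2]
  rw [pull, pull, hU]

/-- Exchange of the two summations over tensor indices and over a pair of legs. -/
theorem sum_update [Fintype ι] {M : Type} [AddCommMonoid M] {k : ℕ} (i j : Fin k) (hij : i ≠ j)
    (F : (Fin k → ι) → (Fin k → ι) → M) :
    ∑ I, ∑ a : ι × ι, F I (Function.update (Function.update I i a.1) j a.2)
      = ∑ I, ∑ a : ι × ι, F (Function.update (Function.update I i a.1) j a.2) I := by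
  rw [← Fintype.sum_prod_type', ← Fintype.sum_prod_type']
  refine Finset.sum_nbij' (fun x => (Function.update (Function.update x.1 i x.2.1) j x.2.2,
      (x.1 i, x.1 j))) (fun x => (Function.update (Function.update x.1 i x.2.1) j x.2.2,
      (x.1 i, x.1 j))) (by simp) (by simp) ?_ ?_ ?_
  all_goals
    rintro ⟨I, a, b⟩ _
    have e : ∀ a b, Function.update (Function.update (Function.update (Function.update I i a) j b)
        i (I i)) j (I j) = I := by
      intro a b
      funext m
      by_cases h1 : m = j
      · subst h1; simp
      · by_cases h2 : m = i
        · subst h2; simp [h1]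
        · simp [h1, h2]
    simp [hij, e]

end legs

end QuantumGroups

namespace QuantumGroups

section typeA

variable {N : ℕ} {q : ℂ}

theorem braidA_symm (a b : Fin N × Fin N) : braidA N q a b = braidA N q b a := by
  obtain ⟨a1, a2⟩ := a
  obtain ⟨b1, b2⟩ := b
  simp only [braidA, Matrix.of_apply, Prod.mk.injEq]
  grind

theorem braidA_sum {M : Type} [AddCommGroup M] [Module ℂ M] (x y : Fin N)
    (F : Fin N × Fin N → M) :
    ∑ a, braidA N q (x, y) a • F a = (if x = y then q else 1) • F (y, x)
      + (if x < y then q - q⁻¹ else 0) • F (x, y) := by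
  simp only [braidA, Matrix.of_apply, add_smul, Finset.sum_add_distrib]
  congr 1
  · rw [Finset.sum_eq_single (y, x)]
    · simp
    · rintro ⟨b1, b2⟩ _ hb
      rw [if_neg, zero_smul]
      rintro ⟨h1, h2⟩
      exact hb (by simp_all)
    · simp
  · rw [Finset.sum_eq_single (x, y)]
    · simp
    · rintro ⟨b1, b2⟩ _ hb
      rw [if_neg, zero_smul]
      rintro ⟨h1, h2⟩
      exact hb h2.symm
    · simp

/-- The coefficient attached to a pair of values of a tensor index. -/
noncomputable def pairCoeff (q : ℂ) {n : ℕ} (a b : Fin n) : ℂ :=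
  if a < b then 1 else if a = b then 0 else -q

/-- The `q`-antisymmetric tensor `ε` of type A, `ε_{π(1) … π(N)} = (-q)^{ℓ(π)}`. -/
noncomputable def qeps (q : ℂ) {k n : ℕ} (f : Fin k → Fin n) : ℂ :=
  ∏ a ∈ Finset.univ.filter (fun a : Fin k × Fin k => a.1 < a.2), pairCoeff q (f a.1) (f a.2)

theorem qeps_eq_zero {k n : ℕ} (f : Fin k → Fin n) (hf : ¬ Function.Injective f) :
    qeps q f = 0 := by
  simp only [Function.Injective, not_forall] at hf
  obtain ⟨a, b, h1, h2⟩ := hf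
  rcases lt_or_gt_of_ne h2 with h | h
  · exact Finset.prod_eq_zero (i := (a, b)) (by simp [h]) (by simp [pairCoeff, h1])
  · exact Finset.prod_eq_zero (i := (b, a)) (by simp [h]) (by simp [pairCoeff, h1])

theorem qeps_perm (π : Equiv.Perm (Fin N)) : qeps q π = (-q) ^ inversions π := by
  have : ∀ a ∈ Finset.univ.filter (fun a : Fin N × Fin N => a.1 < a.2),
      pairCoeff q (π a.1) (π a.2) = if π a.2 < π a.1 then -q else 1 := by
    intro a ha
    have h1 : π a.1 ≠ π a.2 := fun h => by
      have := π.injective h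
      simp [this] at ha
    unfold pairCoeff
    rcases lt_or_gt_of_ne h1 with h | h
    · simp [h, h.not_gt]
    · simp [h, h.not_gt, h1]
  rw [qeps, Finset.prod_congr rfl this, Finset.prod_ite]
  simp [inversions, Finset.filter_filter]

theorem qeps_strictMono {k n m : ℕ} (g : Fin n → Fin m) (hg : StrictMono g) (f : Fin k → Fin n) :
    qeps q (g ∘ f) = qeps q f := by
  refine Finset.prod_congr rfl fun a _ => ?_
  simp [pairCoeff, hg.lt_iff_lt, hg.injective.eq_iff]

theorem qeps_id : qeps q (id : Fin N → Fin N) = 1 := by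
  refine Finset.prod_eq_one fun a ha => ?_
  simp only [Finset.mem_filter] at ha
  simp [pairCoeff, ha.2]

theorem qeps_swap {k n : ℕ} (f : Fin k → Fin n) (i j : Fin k) (hij : (i : ℕ) + 1 = j)
    (h : f i < f j) : qeps q (f ∘ Equiv.swap i j) = -q * qeps q f := by
  have hlt : i < j := by
    rw [Fin.lt_def]; omega
  have hmem : (i, j) ∈ Finset.univ.filter (fun a : Fin k × Fin k => a.1 < a.2) := by simp [hlt]
  rw [qeps, qeps, ← Finset.mul_prod_erase _ _ hmem, ← Finset.mul_prod_erase _ _ hmem, ← mul_assoc]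
  have e1 : pairCoeff q ((f ∘ Equiv.swap i j) i) ((f ∘ Equiv.swap i j) j) = -q := by
    simp [pairCoeff, h.not_gt, h.ne']
  have e2 : pairCoeff q (f i) (f j) = 1 := by simp [pairCoeff, h]
  simp only [e1, e2, mul_one]
  congr 1
  have hmaps : ∀ a ∈ (Finset.univ.filter (fun a : Fin k × Fin k => a.1 < a.2)).erase (i, j),
      (Equiv.swap i j a.1, Equiv.swap i j a.2)
        ∈ (Finset.univ.filter (fun a : Fin k × Fin k => a.1 < a.2)).erase (i, j) := by
    rintro ⟨a, b⟩ hab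
    simp only [Finset.mem_erase, ne_eq, Prod.mk.injEq, Finset.mem_filter, Finset.mem_univ,
      true_and, Equiv.swap_apply_def, Fin.lt_def, Fin.ext_iff] at hab ⊢
    split_ifs <;> omega
  refine Finset.prod_nbij' (fun a => (Equiv.swap i j a.1, Equiv.swap i j a.2))
    (fun a => (Equiv.swap i j a.1, Equiv.swap i j a.2)) hmaps hmaps ?_ ?_ ?_
  · intro a _; simp
  · intro a _; simp
  · intro a _; simp

theorem update_swap {ι : Type} {k : ℕ} (f : Fin k → ι) (i j : Fin k) :
    Function.update (Function.update f i (f j)) j (f i) = f ∘ Equiv.swap i j := by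
  funext m
  simp only [Function.comp, Equiv.swap_apply_def, Function.update_apply]
  grind

theorem update_self {ι : Type} {k : ℕ} (f : Fin k → ι) (i j : Fin k) :
    Function.update (Function.update f i (f i)) j (f j) = f := by
  simp

section
variable {M : Type} [AddCommGroup M] [Module ℂ M]

/-- A tensor on which `R̂` is `-q⁻¹` on all neighbouring legs and which vanishes at the identity
vanishes. -/
theorem eq_zero_of_antisymm (hq0 : q ≠ 0) (hq : q ^ 2 + 1 ≠ 0) (w : (Fin N → Fin N) → M)
    (hw : ∀ i j : Fin N, (i : ℕ) + 1 = j → onLegs (braidA N q) i j w = -q⁻¹ • w)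
    (h0 : w id = 0) : w = 0 := by
  have step : ∀ (f : Fin N → Fin N) (i j : Fin N), (i : ℕ) + 1 = j →
      (if f i = f j then q else 1) • w (f ∘ Equiv.swap i j)
        + (if f i < f j then q - q⁻¹ else 0) • w f = -q⁻¹ • w f := by
    intro f i j hij
    have h := congrFun (hw i j hij) f
    simp only [onLegs, LinearMap.coe_mk, AddHom.coe_mk] at h
    rw [braidA_sum (F := fun a => w (Function.update (Function.update f i a.1) j a.2))] at h
    simpa [update_swap] using h
  suffices ∀ (n : ℕ) (f : Fin N → Fin N), ∑ k : Fin N, (N - k) * (f k : ℕ) = n → w f = 0 by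
    funext f
    exact this _ f rfl
  intro n
  induction n using Nat.strong_induction_on with
  | _ n ih =>
  intro f hf
  by_cases hm : ∀ i j : Fin N, (i : ℕ) + 1 = j → f i < f j
  · have hmono : StrictMono f := by
      intro a b hab
      have : ∀ (d : ℕ) (a b : Fin N), (a : ℕ) + d + 1 = b → f a < f b := by
        intro d
        induction d with
        | zero => intro a b h; exact hm a b h
        | succ d ihd =>
          intro a b h
          have hc : (a : ℕ) + d + 1 < N := by have := b.2; omega
          exact (ihd a ⟨_, hc⟩ rfl).trans (hm ⟨_, hc⟩ b (by simp; omega))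
      exact this (b - a - 1) a b (by have : (a : ℕ) < b := hab; omega)
    have : f = id := by
      funext a
      refine le_antisymm ?_ (hmono.le_apply)
      have h2 : StrictMono (fun a : Fin N => (f a.rev).rev) := by
        intro a b hab
        exact Fin.rev_lt_rev.mpr (hmono (Fin.rev_lt_rev.mpr hab))
      have h3 := h2.le_apply (x := a.rev)
      simp only [Fin.rev_rev] at h3
      exact Fin.rev_le_rev.mp h3
    rw [this, h0]
  · push Not at hm
    obtain ⟨i, j, hij, hle⟩ := hm
    have hst := step f i j hij
    rcases hle.eq_or_lt with he | hlt
    · have hs : f ∘ Equiv.swap i j = f := by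
        rw [← update_swap, he]
        conv_lhs => rw [← he]
        simp [he]
      rw [hs, if_pos he.symm, if_neg (by rw [he]; exact lt_irrefl _), zero_smul, add_zero,
        ← sub_eq_zero, ← sub_smul] at hst
      rcases smul_eq_zero.mp hst with h | h
      · exfalso
        apply hq
        field_simp at h
        linear_combination h
      · exact h
    · rw [if_neg hlt.ne', if_neg hlt.not_gt, zero_smul, add_zero, one_smul] at hst
      have hne : i ≠ j := by
        intro e
        rw [e] at hij
        omega
      have hlt' : ∑ k : Fin N, (N - k) * ((f ∘ Equiv.swap i j) k : ℕ) < n := by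
        rw [← hf]
        rw [← Finset.add_sum_erase _ _ (Finset.mem_univ i),
          ← Finset.add_sum_erase (Finset.univ.erase i) _ (a := j) (by simp [hne.symm]),
          ← Finset.add_sum_erase _ (fun k : Fin N => (N - k) * (f k : ℕ)) (Finset.mem_univ i),
          ← Finset.add_sum_erase (Finset.univ.erase i) (fun k : Fin N => (N - k) * (f k : ℕ))
            (a := j) (by simp [hne.symm]), ← add_assoc, ← add_assoc]
        have hc : ∑ k ∈ (Finset.univ.erase i).erase j, (N - k) * ((f ∘ Equiv.swap i j) k : ℕ)
            = ∑ k ∈ (Finset.univ.erase i).erase j, (N - (k : ℕ)) * (f k : ℕ) := by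
          refine Finset.sum_congr rfl fun k hk => ?_
          simp only [Finset.mem_erase] at hk
          simp [Equiv.swap_apply_of_ne_of_ne hk.2.1 hk.1]
        rw [hc]
        apply Nat.add_lt_add_right
        simp only [Function.comp, Equiv.swap_apply_left, Equiv.swap_apply_right]
        have hjN := j.2
        have : N - (i : ℕ) = (N - j) + 1 := by omega
        rw [this]
        have hlt2 : (f j : ℕ) < f i := hlt
        nlinarith
      have h5 := ih _ hlt' _ rfl
      rw [h5] at hst
      have : -q⁻¹ ≠ 0 := by simpa using hq0
      exact (smul_eq_zero.mp hst.symm).resolve_left this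

theorem onLegs_qeps (hq0 : q ≠ 0) (i j : Fin N) (hij : (i : ℕ) + 1 = j) (m : M) :
    onLegs (braidA N q) i j (fun f => qeps q f • m) = -q⁻¹ • fun f => qeps q f • m := by
  have hne : i ≠ j := by
    intro e
    rw [e] at hij
    omega
  funext f
  simp only [onLegs, LinearMap.coe_mk, AddHom.coe_mk]
  rw [braidA_sum
    (F := fun a => qeps q (Function.update (Function.update f i a.1) j a.2) • m)]
  simp only [update_swap, update_self, Pi.smul_apply, smul_smul, ← add_smul]
  congr 1
  rcases lt_trichotomy (f i) (f j) with h | h | h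
  · rw [qeps_swap f i j hij h]
    simp only [h.ne, h, if_true, if_false]
    ring
  · have h1 : qeps q f = 0 := qeps_eq_zero f fun hi => hne (hi h)
    have h2 : qeps q (f ∘ Equiv.swap i j) = 0 := by
      refine qeps_eq_zero _ fun hi => hne (hi ?_)
      simp [h]
    simp [h1, h2]
  · have h1 := qeps_swap (q := q) (f ∘ Equiv.swap i j) i j hij (by simpa using h)
    have h2 : (f ∘ Equiv.swap i j) ∘ Equiv.swap i j = f := by
      funext m; simp
    rw [h2] at h1
    rw [h1]
    simp only [h.ne', h.not_gt, if_false]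
    field_simp
    ring

theorem eq_qeps_smul (hq0 : q ≠ 0) (hq : q ^ 2 + 1 ≠ 0) (w : (Fin N → Fin N) → M)
    (hw : ∀ i j : Fin N, (i : ℕ) + 1 = j → onLegs (braidA N q) i j w = -q⁻¹ • w)
    (f : Fin N → Fin N) : w f = qeps q f • w id := by
  have h := eq_zero_of_antisymm hq0 hq (w - fun f => qeps q f • w id) (fun i j hij => by
    rw [map_sub, hw i j hij, onLegs_qeps hq0 i j hij, smul_sub]) (by simp [qeps_id])
  have := congrFun h f
  simpa [sub_eq_zero] using this

end

end typeA

end QuantumGroups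

namespace QuantumGroups

section det

theorem sum_qeps_sq_ne_zero {q : ℂ} (hq : Transcendental ℚ q) (k : ℕ) :
    ∑ b : Fin k → Fin k, qeps q b ^ 2 ≠ 0 := by
  classical
  let P : (Fin k → Fin k) → Polynomial ℚ := fun b =>
    ∏ a ∈ Finset.univ.filter (fun a : Fin k × Fin k => a.1 < a.2),
      if b a.1 < b a.2 then 1 else if b a.1 = b a.2 then 0 else -Polynomial.X
  have h1 : ∑ b : Fin k → Fin k, qeps q b ^ 2 = Polynomial.aeval q (∑ b, P b ^ 2) := by
    rw [map_sum]
    refine Finset.sum_congr rfl fun b _ => ?_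
    rw [map_pow, map_prod]
    congr 1
    refine Finset.prod_congr rfl fun a _ => ?_
    unfold pairCoeff
    split_ifs <;> simp
  rw [h1]
  refine (transcendental_iff.mp hq _).mt ?_
  intro h
  have h2 := congrArg (Polynomial.eval 1) h
  rw [Polynomial.eval_finsetSum, Polynomial.eval_zero] at h2
  have h3 := (Finset.sum_eq_zero_iff_of_nonneg (fun b _ => by
    rw [Polynomial.eval_pow]; exact sq_nonneg _)).mp h2 id (Finset.mem_univ _)
  rw [Polynomial.eval_pow, Polynomial.eval_prod, Finset.prod_eq_one] at h3
  · norm_num at h3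
  · intro a ha
    simp only [Finset.mem_filter] at ha
    simp [ha.2]

theorem ne_zero_of_transcendental {q : ℂ} (hq : Transcendental ℚ q) : q ≠ 0 := by
  rintro rfl
  exact hq (isAlgebraic_zero)

theorem sq_add_one_ne_zero {q : ℂ} (hq : Transcendental ℚ q) : q ^ 2 + 1 ≠ 0 := by
  intro h
  have h1 := transcendental_iff.mp hq (Polynomial.X ^ 2 + 1) (by simpa using h)
  have h2 := congrArg (Polynomial.eval 0) h1
  simp at h2

theorem qeps_eq_prod {q : ℂ} {k n : ℕ} (f : Fin k → Fin n) :
    qeps q f = ∏ i, ∏ j, if i < j then pairCoeff q (f i) (f j) else 1 := by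
  rw [qeps, Finset.prod_filter, Fintype.prod_prod_type]

theorem qeps_cons {q : ℂ} {k n : ℕ} (i : Fin n) (a : Fin k → Fin n) :
    qeps q (Fin.cons i a : Fin (k + 1) → Fin n) = (∏ j, pairCoeff q i (a j)) * qeps q a := by
  simp [qeps_eq_prod, Fin.prod_univ_succ]

theorem qeps_snoc {q : ℂ} {k n : ℕ} (i : Fin n) (a : Fin k → Fin n) :
    qeps q (Fin.snoc a i : Fin (k + 1) → Fin n) = qeps q a * ∏ j, pairCoeff q (a j) i := by
  simp [qeps_eq_prod, Fin.prod_univ_castSucc, Finset.prod_mul_distrib,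
    (Fin.le_last _).not_gt]

theorem qeps_contract {q : ℂ} {m : ℕ} (i k : Fin (m + 1)) :
    ∑ a : Fin m → Fin (m + 1), qeps q (Fin.snoc a k : Fin (m + 1) → Fin (m + 1))
        * qeps q (Fin.cons i a : Fin (m + 1) → Fin (m + 1))
      = if i = k then (-q) ^ m * ∑ b : Fin m → Fin m, qeps q b ^ 2 else 0 := by
  by_cases hik : i = k
  · subst hik
    rw [if_pos rfl, Finset.mul_sum]
    symm
    refine Fintype.sum_of_injective (fun b => i.succAbove ∘ b) ?_ _ _ ?_ ?_
    · intro b b' h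
      funext x
      exact Fin.succAbove_right_injective (congrFun h x)
    · intro a ha
      have : ∃ j, a j = i := by
        by_contra hcon
        push Not at hcon
        apply ha
        choose b hb using fun j => Fin.exists_succAbove_eq (hcon j)
        exact ⟨b, funext hb⟩
      obtain ⟨j, hj⟩ := this
      rw [qeps_cons, Finset.prod_eq_zero (Finset.mem_univ j)]
      · ring
      · simp [pairCoeff, hj]
    · intro b
      rw [qeps_cons, qeps_snoc, qeps_strictMono _ (Fin.strictMono_succAbove i)]
      have : ∀ j, pairCoeff q ((i.succAbove ∘ b) j) i * pairCoeff q i ((i.succAbove ∘ b) j)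
          = -q := by
        intro j
        have hne : i.succAbove (b j) ≠ i := Fin.succAbove_ne i (b j)
        simp only [pairCoeff, Function.comp]
        rcases lt_or_gt_of_ne hne with h | h
        · simp [h, h.not_gt, hne.symm]
        · simp [h, h.not_gt, hne]
      calc (-q) ^ m * qeps q b ^ 2
          = (∏ j, (pairCoeff q ((i.succAbove ∘ b) j) i
              * pairCoeff q i ((i.succAbove ∘ b) j))) * qeps q b ^ 2 := by
            rw [Finset.prod_congr rfl fun j _ => this j]
            simp
        _ = _ := by rw [Finset.prod_mul_distrib]; ring
  · rw [if_neg hik]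
    refine Finset.sum_eq_zero fun a _ => ?_
    by_cases hi : ∃ j, a j = i
    · obtain ⟨j, hj⟩ := hi
      rw [qeps_cons, Finset.prod_eq_zero (Finset.mem_univ j)]
      · ring
      · simp [pairCoeff, hj]
    · have : qeps q (Fin.snoc a k : Fin (m + 1) → Fin (m + 1)) = 0 := by
        refine qeps_eq_zero _ fun hinj => ?_
        have hsurj := Finite.surjective_of_injective hinj
        obtain ⟨x, hx⟩ := hsurj i
        induction x using Fin.lastCases with
        | last =>
          rw [Fin.snoc_last] at hx
          exact hik hx.symm
        | cast x =>
          rw [Fin.snoc_castSucc] at hx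
          exact hi ⟨x, hx⟩
      rw [this, zero_mul]

variable {B : Type} [Ring B] [Algebra ℂ B]

theorem RTT.row {ι : Type} [Fintype ι] {R : Matrix (ι × ι) (ι × ι) ℂ} {U : Matrix ι ι B}
    (hU : RTT R U) {k : ℕ} (i j : Fin k) (h : (i : ℕ) + 1 = j) (w : (Fin k → ι) → ℂ) (c : ℂ)
    (hw : onLegs R i j w = c • w) :
    onLegs R i j (fun I => ∑ J, w J • QuantumGroups.tensorPow U k I J)
      = c • fun I => ∑ J, w J • QuantumGroups.tensorPow U k I J := by
  have hij : i ≠ j := by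
    intro e
    rw [e] at h
    omega
  funext I
  simp only [onLegs, LinearMap.coe_mk, AddHom.coe_mk, Pi.smul_apply]
  simp_rw [Finset.smul_sum]
  rw [Finset.sum_comm]
  have e1 : ∀ J, ∑ a : ι × ι, R (I i, I j) a
        • w J • QuantumGroups.tensorPow U k (Function.update (Function.update I i a.1) j a.2) J
      = ∑ a : ι × ι, (R a (J i, J j) * w J)
        • QuantumGroups.tensorPow U k I (Function.update (Function.update J i a.1) j a.2) := by
    intro J
    have := congrArg (fun x => w J • x) (hU.tensorPow i j h I J)
    simp only [Finset.smul_sum, smul_smul] at this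
    simp only [smul_smul]
    rw [← sub_eq_zero] at this ⊢
    rw [← this]
    congr 1
    all_goals
      refine Finset.sum_congr rfl fun a _ => ?_
      rw [mul_comm]
  rw [Finset.sum_congr rfl fun J _ => e1 J]
  have e2 : ∀ J, ∑ a : ι × ι, (R a (J i, J j) * w J)
        • QuantumGroups.tensorPow U k I (Function.update (Function.update J i a.1) j a.2)
      = ∑ a : ι × ι, (fun J J' => (R (J' i, J' j) (J i, J j) * w J)
        • QuantumGroups.tensorPow U k I J') J
          (Function.update (Function.update J i a.1) j a.2) := by
    intro J
    refine Finset.sum_congr rfl fun a _ => ?_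
    simp [hij]
  rw [Finset.sum_congr rfl fun J _ => e2 J]
  refine (sum_update i j hij (fun J J' => (R (J' i, J' j) (J i, J j) * w J)
    • QuantumGroups.tensorPow U k I J')).trans ?_
  refine Finset.sum_congr rfl fun J _ => ?_
  have := congrFun hw J
  simp only [onLegs, LinearMap.coe_mk, AddHom.coe_mk, Pi.smul_apply] at this
  rw [smul_smul, ← smul_eq_mul, ← this, Finset.sum_smul]
  refine Finset.sum_congr rfl fun a _ => ?_
  simp [hij]

theorem RTT.col {ι : Type} [Fintype ι] {R : Matrix (ι × ι) (ι × ι) ℂ} {U : Matrix ι ι B}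
    (hR : ∀ a b, R a b = R b a)
    (hU : RTT R U) {k : ℕ} (i j : Fin k) (h : (i : ℕ) + 1 = j) (w : (Fin k → ι) → ℂ) (c : ℂ)
    (hw : onLegs R i j w = c • w) :
    onLegs R i j (fun J => ∑ I, w I • QuantumGroups.tensorPow U k I J)
      = c • fun J => ∑ I, w I • QuantumGroups.tensorPow U k I J := by
  have hij : i ≠ j := by
    intro e
    rw [e] at h
    omega
  funext J
  simp only [onLegs, LinearMap.coe_mk, AddHom.coe_mk, Pi.smul_apply]
  simp_rw [Finset.smul_sum]
  rw [Finset.sum_comm]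
  have e1 : ∀ I, ∑ a : ι × ι, R (J i, J j) a
        • w I • QuantumGroups.tensorPow U k I (Function.update (Function.update J i a.1) j a.2)
      = ∑ a : ι × ι, (R (I i, I j) a * w I)
        • QuantumGroups.tensorPow U k (Function.update (Function.update I i a.1) j a.2) J := by
    intro I
    have := congrArg (fun x => w I • x) (hU.tensorPow i j h I J)
    simp only [Finset.smul_sum, smul_smul] at this
    simp only [smul_smul]
    rw [eq_comm, ← sub_eq_zero] at this ⊢
    rw [← neg_eq_zero, neg_sub, ← this]
    congr 1
    all_goals
      refine Finset.sum_congr rfl fun a _ => ?_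
      rw [mul_comm]
      try rw [hR]
  rw [Finset.sum_congr rfl fun I _ => e1 I]
  have e2 : ∀ I, ∑ a : ι × ι, (R (I i, I j) a * w I)
        • QuantumGroups.tensorPow U k (Function.update (Function.update I i a.1) j a.2) J
      = ∑ a : ι × ι, (fun I I' => (R (I i, I j) (I' i, I' j) * w I)
        • QuantumGroups.tensorPow U k I' J) I
          (Function.update (Function.update I i a.1) j a.2) := by
    intro I
    refine Finset.sum_congr rfl fun a _ => ?_
    simp [hij]
  rw [Finset.sum_congr rfl fun I _ => e2 I]
  refine (sum_update i j hij (fun I I' => (R (I i, I j) (I' i, I' j) * w I)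
    • QuantumGroups.tensorPow U k I' J)).trans ?_
  refine Finset.sum_congr rfl fun I _ => ?_
  have := congrFun hw I
  simp only [onLegs, LinearMap.coe_mk, AddHom.coe_mk, Pi.smul_apply] at this
  rw [smul_smul, ← smul_eq_mul, ← this, Finset.sum_smul]
  refine Finset.sum_congr rfl fun a _ => ?_
  simp [hij, hR (I i, I j) a]

variable {N : ℕ} {q : ℂ} {U : Matrix (Fin N) (Fin N) B}

theorem qdet_eq_sum_qeps : qdet q U = ∑ J, qeps q J • tensorPow U N id J := by
  classical
  rw [qdet]
  refine Fintype.sum_of_injective (fun π : Equiv.Perm (Fin N) => (π : Fin N → Fin N))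
    DFunLike.coe_injective _ _ ?_ ?_
  · intro J hJ
    rw [qeps_eq_zero, zero_smul]
    intro hinj
    exact hJ ⟨Equiv.ofBijective J (Finite.injective_iff_bijective.mp hinj), rfl⟩
  · intro π
    rw [qeps_perm]

theorem qdet_row (hq : Transcendental ℚ q) (hU : RTT (braidA N q) U) (I : Fin N → Fin N) :
    ∑ J, qeps q J • tensorPow U N I J = qeps q I • qdet q U := by
  have hq0 := ne_zero_of_transcendental hq
  rw [qdet_eq_sum_qeps]
  refine eq_qeps_smul hq0 (sq_add_one_ne_zero hq)
    (fun I => ∑ J, qeps q J • tensorPow U N I J) (fun i j hij => ?_) I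
  refine hU.row i j hij _ _ ?_
  simpa using onLegs_qeps hq0 i j hij (1 : ℂ)

theorem qdet_col (hq : Transcendental ℚ q) (hU : RTT (braidA N q) U) (J : Fin N → Fin N) :
    ∑ I, qeps q I • tensorPow U N I J = qeps q J • qdet q U := by
  have hq0 := ne_zero_of_transcendental hq
  obtain ⟨D, h1⟩ : ∃ D : B, ∀ J, ∑ I, qeps q I • tensorPow U N I J = qeps q J • D :=
    ⟨_, eq_qeps_smul hq0 (sq_add_one_ne_zero hq)
      (fun J => ∑ I, qeps q I • tensorPow U N I J) (fun i j hij => by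
        refine hU.col braidA_symm i j hij _ _ ?_
        simpa using onLegs_qeps hq0 i j hij (1 : ℂ))⟩
  rw [h1]
  congr 1
  have h2 : ∑ J, qeps q J • ∑ I, qeps q I • tensorPow U N I J
      = ∑ I, qeps q I • ∑ J, qeps q J • tensorPow U N I J := by
    simp_rw [Finset.smul_sum]
    rw [Finset.sum_comm]
    refine Finset.sum_congr rfl fun I _ => Finset.sum_congr rfl fun J _ => ?_
    rw [smul_comm]
  simp_rw [h1, qdet_row hq hU, smul_smul, ← Finset.sum_smul, ← pow_two] at h2
  rw [← sub_eq_zero, ← smul_sub] at h2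
  have := (smul_eq_zero.mp h2).resolve_left (sum_qeps_sq_ne_zero hq N)
  exact sub_eq_zero.mp this

/-- The quantum adjugate. -/
theorem exists_adjugate (hq : Transcendental ℚ q) (hN : 0 < N) (hU : RTT (braidA N q) U) :
    ∃ V : Matrix (Fin N) (Fin N) B,
      U * V = Matrix.scalar _ (qdet q U) ∧ V * U = Matrix.scalar _ (qdet q U) := by
  obtain ⟨m, rfl⟩ : ∃ m, N = m + 1 := ⟨N - 1, by omega⟩
  have hq0 := ne_zero_of_transcendental hq
  set c : ℂ := (-q) ^ m * ∑ b : Fin m → Fin m, qeps q b ^ 2 with hc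
  have hc0 : c ≠ 0 := mul_ne_zero (pow_ne_zero _ (neg_ne_zero.mpr hq0))
    (sum_qeps_sq_ne_zero hq m)
  refine ⟨Matrix.of fun j k => c⁻¹ • ∑ a : Fin m → Fin (m + 1), ∑ b : Fin m → Fin (m + 1),
    (qeps q (Fin.snoc a k : Fin (m + 1) → Fin (m + 1))
      * qeps q (Fin.cons j b : Fin (m + 1) → Fin (m + 1))) • tensorPow U m a b, ?_, ?_⟩
  · ext i k
    have key : ∀ a : Fin m → Fin (m + 1), ∑ j, ∑ b : Fin m → Fin (m + 1),
        qeps q (Fin.cons j b : Fin (m + 1) → Fin (m + 1)) • (U i j * tensorPow U m a b)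
        = qeps q (Fin.cons i a : Fin (m + 1) → Fin (m + 1)) • qdet q U := by
      intro a
      rw [← qdet_row hq hU, sum_cons]
      simp_rw [tensorPow_cons]
    have : ∑ j, U i j * ∑ a : Fin m → Fin (m + 1), ∑ b : Fin m → Fin (m + 1),
        (qeps q (Fin.snoc a k : Fin (m + 1) → Fin (m + 1))
          * qeps q (Fin.cons j b : Fin (m + 1) → Fin (m + 1))) • tensorPow U m a b
        = ∑ a : Fin m → Fin (m + 1), qeps q (Fin.snoc a k : Fin (m + 1) → Fin (m + 1))
          • ∑ j, ∑ b : Fin m → Fin (m + 1),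
        qeps q (Fin.cons j b : Fin (m + 1) → Fin (m + 1)) • (U i j * tensorPow U m a b) := by
      simp_rw [Finset.mul_sum, Finset.smul_sum, mul_smul_comm, smul_smul]
      rw [Finset.sum_comm]
    simp_rw [Matrix.mul_apply, Matrix.of_apply, mul_smul_comm]
    rw [← Finset.smul_sum, this]
    simp_rw [key, smul_smul]
    rw [← Finset.sum_smul, qeps_contract, Matrix.scalar_apply, Matrix.diagonal_apply, smul_smul]
    split_ifs
    · rw [inv_mul_cancel₀ hc0, one_smul]
    · simp
  · ext j l
    have key : ∀ b : Fin m → Fin (m + 1), ∑ k, ∑ a : Fin m → Fin (m + 1),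
        qeps q (Fin.snoc a k : Fin (m + 1) → Fin (m + 1)) • (tensorPow U m a b * U k l)
        = qeps q (Fin.snoc b l : Fin (m + 1) → Fin (m + 1)) • qdet q U := by
      intro b
      rw [← qdet_col hq hU, sum_snoc]
      simp_rw [tensorPow_snoc]
    have : ∑ k, (∑ a : Fin m → Fin (m + 1), ∑ b : Fin m → Fin (m + 1),
        (qeps q (Fin.snoc a k : Fin (m + 1) → Fin (m + 1))
          * qeps q (Fin.cons j b : Fin (m + 1) → Fin (m + 1))) • tensorPow U m a b) * U k l
        = ∑ b : Fin m → Fin (m + 1), qeps q (Fin.cons j b : Fin (m + 1) → Fin (m + 1))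
          • ∑ k, ∑ a : Fin m → Fin (m + 1),
        qeps q (Fin.snoc a k : Fin (m + 1) → Fin (m + 1)) • (tensorPow U m a b * U k l) := by
      simp_rw [Finset.sum_mul, Finset.smul_sum, smul_mul_assoc, smul_smul]
      rw [Finset.sum_comm (γ := Fin m → Fin (m + 1))]
      refine Finset.sum_congr rfl fun k _ => ?_
      rw [Finset.sum_comm]
      refine Finset.sum_congr rfl fun b _ => Finset.sum_congr rfl fun a _ => ?_
      rw [mul_comm]
    simp_rw [Matrix.mul_apply, Matrix.of_apply, smul_mul_assoc]
    rw [← Finset.smul_sum, this]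
    simp_rw [key, smul_smul, mul_comm (qeps q (Fin.cons j _ : Fin (m + 1) → Fin (m + 1)))]
    rw [← Finset.sum_smul, qeps_contract, Matrix.scalar_apply, Matrix.diagonal_apply, smul_smul]
    split_ifs
    · rw [inv_mul_cancel₀ hc0, one_smul]
    · simp

end det

end QuantumGroups

namespace QuantumGroups

namespace QuantumGroup

variable (G : QuantumGroup)

theorem N_pos : 0 < G.N := by
  have := G.size
  revert this
  cases G.series <;> simp <;> omega

theorem p_ne_zero : G.p ≠ 0 := by
  intro h
  have := G.sq
  rw [h] at this
  exact ne_zero_of_transcendental G.transcendental (by rw [← this]; simp)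

theorem sgn_ne_zero (i : Fin G.N) : G.sgn i ≠ 0 := by
  unfold sgn
  cases G.series <;> simp
  split_ifs <;> simp

theorem C_unit : IsUnit G.C.det := by
  rw [← Matrix.isUnit_iff_isUnit_det]
  refine ⟨⟨G.C, Matrix.of fun j k => if k = j.rev then (G.sgn k)⁻¹ * G.p ^ G.rho2 k else 0,
    ?_, ?_⟩, rfl⟩
  · ext i k
    rw [Matrix.mul_apply, Finset.sum_eq_single i.rev]
    · simp only [C, Matrix.of_apply, if_true, Fin.rev_rev, Matrix.one_apply, eq_comm (a := k)]
      split_ifs with h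
      · subst h
        have := G.sgn_ne_zero i
        have := zpow_ne_zero (G.rho2 i) G.p_ne_zero
        rw [zpow_neg]
        field_simp
      · simp
    · intro b _ hb
      simp [C, hb]
    · simp
  · ext i k
    rw [Matrix.mul_apply, Finset.sum_eq_single i.rev]
    · simp only [C, Matrix.of_apply, if_true, Fin.rev_rev, Matrix.one_apply, eq_comm (a := k)]
      split_ifs with h
      · subst h
        have := G.sgn_ne_zero i.rev
        have := zpow_ne_zero (G.rho2 i.rev) G.p_ne_zero
        rw [zpow_neg]
        field_simp
      · simp
    · intro b _ hb
      simp [hb]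
    · simp

variable {G} {B : Type} [Ring B] [Algebra ℂ B]

/-- The matrix `U` and the elements `t` satisfy the defining relations of `O(G_q)`. -/
structure Sat (U : Matrix (Fin G.N) (Fin G.N) B) (t : {_t : Unit // G.series = Series.typeGL} → B) :
    Prop where
  rtt : RTT G.Rhat U
  metric_right : ¬ G.series.IsA →
    U * G.C.map (algebraMap ℂ B) * U.transpose * G.C⁻¹.map (algebraMap ℂ B) = 1
  metric_left : ¬ G.series.IsA →
    G.C.map (algebraMap ℂ B) * U.transpose * G.C⁻¹.map (algebraMap ℂ B) * U = 1
  det_mul_inv : ∀ h, qdet G.q U * t h = 1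
  inv_mul_det : ∀ h, t h * qdet G.q U = 1
  det_SL : G.series = Series.typeSL → qdet G.q U = 1
  det_SO : G.series = Series.typeSO → ∀ w, G.Antisymmetric w → ∀ I,
    ∑ J, w J • tensorPow U G.N I J = w I • 1

theorem map_qdet {B' : Type} [Ring B'] [Algebra ℂ B'] (φ : B →ₐ[ℂ] B') (q : ℂ) {N : ℕ}
    (U : Matrix (Fin N) (Fin N) B) : φ (qdet q U) = qdet q (U.map φ) := by
  simp [qdet, map_sum, map_tensorPow]

theorem Rhat_of_isA (h : G.series.IsA) : G.Rhat = braidA G.N G.q := by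
  unfold Rhat
  cases hs : G.series <;> simp_all [Series.IsA]

theorem CC : G.C.map (algebraMap ℂ B) * G.C⁻¹.map (algebraMap ℂ B) = 1 := by
  rw [← Matrix.map_mul, Matrix.mul_nonsing_inv _ G.C_unit, Matrix.map_one _ (map_zero _) (map_one _)]

theorem CC' : G.C⁻¹.map (algebraMap ℂ B) * G.C.map (algebraMap ℂ B) = 1 := by
  rw [← Matrix.map_mul, Matrix.nonsing_inv_mul _ G.C_unit, Matrix.map_one _ (map_zero _) (map_one _)]

/-- The algebra homomorphism on `O(G_q)` given by a solution of the defining relations. -/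
noncomputable def lift {U : Matrix (Fin G.N) (Fin G.N) B}
    {t : {_t : Unit // G.series = Series.typeGL} → B} (h : Sat U t) : G.Coord →ₐ[ℂ] B :=
  RingQuot.liftAlgHom ℂ ⟨FreeAlgebra.lift ℂ (Sum.elim (fun a => U a.1 a.2) t), by
    set φ := FreeAlgebra.lift ℂ (Sum.elim (fun a : Fin G.N × Fin G.N => U a.1 a.2) t) with hφ
    have hU : G.freeU.map φ = U := by
      ext i j
      simp [freeU, hφ]
    have hUt : G.freeU.transpose.map φ = U.transpose := by rw [← hU]; rfl
    have hu : ∀ i j, φ (G.freeU i j) = U i j := fun i j => by rw [← hU]; rfl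
    have hC : ∀ M : Matrix (Fin G.N) (Fin G.N) ℂ,
        (M.map (algebraMap ℂ (FreeAlgebra ℂ G.Gen))).map φ = M.map (algebraMap ℂ B) := by
      intro M
      ext i j
      simp
    have ht : ∀ s, φ (FreeAlgebra.ι ℂ (Sum.inr s)) = t s := fun s => by simp [hφ]
    intro x y hxy
    cases hxy with
    | rtt i j k l => simpa [hu] using h.rtt i j k l
    | metric_right hA i j =>
      have := congrFun (congrFun (h.metric_right hA) i) j
      rw [← hU, ← hC, ← hC, ← Matrix.transpose_map, ← Matrix.map_mul, ← Matrix.map_mul,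
        ← Matrix.map_mul, Matrix.map_apply] at this
      rw [this, Matrix.one_apply, Matrix.one_apply]
      split_ifs <;> simp
    | metric_left hA i j =>
      have := congrFun (congrFun (h.metric_left hA) i) j
      rw [← hU, ← hC, ← hC, ← Matrix.transpose_map, ← Matrix.map_mul, ← Matrix.map_mul,
        ← Matrix.map_mul, Matrix.map_apply] at this
      rw [this, Matrix.one_apply, Matrix.one_apply]
      split_ifs <;> simp
    | det_mul_inv hs => rw [map_mul, map_qdet, hU, ht, h.det_mul_inv, map_one]
    | inv_mul_det hs => rw [map_mul, map_qdet, hU, ht, h.inv_mul_det, map_one]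
    | det_SL hs => rw [map_qdet, hU, h.det_SL hs, map_one]
    | det_SO hs w hw I =>
      have := h.det_SO hs w hw I
      simp only [map_sum, map_smul, map_tensorPow, hU, map_one]
      exact this⟩

theorem lift_u {U : Matrix (Fin G.N) (Fin G.N) B}
    {t : {_t : Unit // G.series = Series.typeGL} → B} (h : Sat U t) (i j : Fin G.N) :
    lift h (G.u i j) = U i j :=
  (RingQuot.liftAlgHom_mkAlgHom_apply ℂ _ _ _).trans (by simp)

theorem lift_detInv {U : Matrix (Fin G.N) (Fin G.N) B}
    {t : {_t : Unit // G.series = Series.typeGL} → B} (h : Sat U t)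
    (s : {_t : Unit // G.series = Series.typeGL}) : lift h (G.detInv s) = t s :=
  (RingQuot.liftAlgHom_mkAlgHom_apply ℂ _ _ _).trans (by simp)

theorem proj_eq {x y : FreeAlgebra ℂ G.Gen} (h : G.Rel x y) : G.proj x = G.proj y :=
  RingQuot.mkAlgHom_rel ℂ h

theorem sat_u : Sat G.u G.detInv := by
  have hU : G.freeU.map G.proj = G.u := rfl
  have hu : ∀ i j, G.proj (G.freeU i j) = G.u i j := fun i j => rfl
  have hC : ∀ M : Matrix (Fin G.N) (Fin G.N) ℂ,
      (M.map (algebraMap ℂ (FreeAlgebra ℂ G.Gen))).map G.proj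
        = M.map (algebraMap ℂ G.Coord) := by
    intro M
    ext i j
    simp
  refine ⟨?_, ?_, ?_, ?_, ?_, ?_, ?_⟩
  · intro i j k l
    simpa [hu] using proj_eq (Rel.rtt i j k l)
  · intro hA
    rw [← hU, ← hC, ← hC, ← Matrix.transpose_map, ← Matrix.map_mul, ← Matrix.map_mul,
      ← Matrix.map_mul]
    ext i j
    rw [Matrix.map_apply, proj_eq (Rel.metric_right hA i j), Matrix.one_apply, Matrix.one_apply]
    split_ifs <;> simp
  · intro hA
    rw [← hU, ← hC, ← hC, ← Matrix.transpose_map, ← Matrix.map_mul, ← Matrix.map_mul,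
      ← Matrix.map_mul]
    ext i j
    rw [Matrix.map_apply, proj_eq (Rel.metric_left hA i j), Matrix.one_apply, Matrix.one_apply]
    split_ifs <;> simp
  · rintro ⟨⟨⟩, h⟩
    rw [← hU, ← map_qdet, detInv, ← map_mul, proj_eq (Rel.det_mul_inv h), map_one]
  · rintro ⟨⟨⟩, h⟩
    rw [← hU, ← map_qdet, detInv, ← map_mul, proj_eq (Rel.inv_mul_det h), map_one]
  · intro h
    rw [← hU, ← map_qdet, proj_eq (Rel.det_SL h), map_one]
  · intro h w hw I
    have := proj_eq (Rel.det_SO h w hw I)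
    simpa only [map_sum, map_smul, map_tensorPow, hU, map_one] using this

@[ext]
theorem Coord.algHom_ext {φ ψ : G.Coord →ₐ[ℂ] B} (h : ∀ i j, φ (G.u i j) = ψ (G.u i j))
    (ht : ∀ s, φ (G.detInv s) = ψ (G.detInv s)) : φ = ψ := by
  refine RingQuot.ringQuot_ext' ℂ φ ψ ?_
  refine FreeAlgebra.hom_ext ?_
  funext x
  rcases x with ⟨i, j⟩ | s
  · exact h i j
  · exact ht s

theorem Coord.induction {P : G.Coord → Prop} (hc : ∀ c, P (algebraMap ℂ _ c))
    (hu : ∀ i j, P (G.u i j)) (ht : ∀ s, P (G.detInv s))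
    (hm : ∀ a b, P a → P b → P (a * b)) (ha : ∀ a b, P a → P b → P (a + b)) (a : G.Coord) :
    P a := by
  obtain ⟨x, rfl⟩ := RingQuot.mkAlgHom_surjective ℂ G.Rel a
  change P (G.proj x)
  induction x using FreeAlgebra.induction with
  | grade0 c => rw [AlgHom.commutes]; exact hc c
  | grade1 x =>
    rcases x with ⟨i, j⟩ | s
    · exact hu i j
    · exact ht s
  | mul a b iha ihb => rw [map_mul]; exact hm _ _ iha ihb
  | add a b iha ihb => rw [map_add]; exact ha _ _ iha ihb

theorem sat_one : Sat (1 : Matrix (Fin G.N) (Fin G.N) ℂ) (fun _ => 1) := by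
  have hdet : qdet G.q (1 : Matrix (Fin G.N) (Fin G.N) ℂ) = 1 := by
    rw [qdet_eq_sum_qeps, tensorPow_one, Finset.sum_eq_single id]
    · simp [qeps_id]
    · intro J _ hJ
      simp [Matrix.one_apply_ne hJ.symm]
    · simp
  refine ⟨?_, ?_, ?_, ?_, ?_, ?_, ?_⟩
  · intro i j k l
    rw [Finset.sum_eq_single (k, l), Finset.sum_eq_single (i, j)]
    · simp
    · rintro ⟨a, b⟩ _ h
      simp only [Matrix.one_apply]
      by_cases h1 : a = k <;> by_cases h2 : b = l <;> by_cases h3 : i = a <;>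
        by_cases h4 : j = b <;> simp_all
    · simp
    · rintro ⟨a, b⟩ _ h
      simp only [Matrix.one_apply]
      by_cases h1 : a = k <;> by_cases h2 : b = l <;> by_cases h3 : i = a <;>
        by_cases h4 : j = b <;> simp_all
    · simp
  · intro _
    rw [one_mul, Matrix.transpose_one, mul_one, CC]
  · intro _
    rw [mul_one, Matrix.transpose_one, mul_one, CC]
  · intro _; rw [hdet, one_mul]
  · intro _; rw [hdet, one_mul]
  · intro _; exact hdet
  · intro _ w _ I
    rw [tensorPow_one, Finset.sum_eq_single I]
    · simp
    · intro J _ hJ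
      simp [Matrix.one_apply_ne hJ.symm]
    · simp

/-- The matrix with entries `U^i_k U^j_l`. -/
def pairs (U : Matrix (Fin G.N) (Fin G.N) B) :
    Matrix (Fin G.N × Fin G.N) (Fin G.N × Fin G.N) B :=
  Matrix.of fun a b => U a.1 b.1 * U a.2 b.2

theorem rtt_iff (U : Matrix (Fin G.N) (Fin G.N) B) :
    RTT G.Rhat U ↔ G.Rhat.map (algebraMap ℂ B) * pairs U
      = pairs U * G.Rhat.map (algebraMap ℂ B) := by
  constructor
  · intro h
    ext ⟨i, j⟩ ⟨k, l⟩
    simpa [Matrix.mul_apply, pairs, ← Algebra.smul_def, ← Algebra.commutes] using h i j k l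
  · intro h i j k l
    simpa [Matrix.mul_apply, pairs, ← Algebra.smul_def, ← Algebra.commutes] using
      congrFun (congrFun h (i, j)) (k, l)

theorem qdet_mul (hA : G.series.IsA) {U V : Matrix (Fin G.N) (Fin G.N) B}
    (hV : RTT G.Rhat V) (hUV : ∀ i j k l, Commute (U i j) (V k l)) :
    qdet G.q (U * V) = qdet G.q U * qdet G.q V := by
  rw [Rhat_of_isA hA] at hV
  rw [qdet_eq_sum_qeps (U := U * V), qdet_eq_sum_qeps (U := U), tensorPow_mul U V hUV]
  simp_rw [Matrix.mul_apply, Finset.smul_sum, Finset.sum_mul]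
  rw [Finset.sum_comm]
  refine Finset.sum_congr rfl fun K _ => ?_
  rw [smul_mul_assoc, ← mul_smul_comm, ← qdet_row G.transcendental hV, Finset.mul_sum]
  refine Finset.sum_congr rfl fun J _ => ?_
  rw [mul_smul_comm]

theorem Sat.mul {U V : Matrix (Fin G.N) (Fin G.N) B}
    {t s : {_t : Unit // G.series = Series.typeGL} → B} (hU : Sat U t) (hV : Sat V s)
    (hUV : ∀ i j k l, Commute (U i j) (V k l)) : Sat (U * V) (fun h => s h * t h) := by
  have hT : (U * V).transpose = V.transpose * U.transpose := by
    ext i j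
    simp only [Matrix.transpose_apply, Matrix.mul_apply]
    exact Finset.sum_congr rfl fun k _ => hUV _ _ _ _
  refine ⟨?_, ?_, ?_, ?_, ?_, ?_, ?_⟩
  · have h1 := (rtt_iff U).mp hU.rtt
    have h2 := (rtt_iff V).mp hV.rtt
    have h3 : pairs (G := G) (U * V) = pairs U * pairs V := by
      ext ⟨i, j⟩ ⟨k, l⟩
      simp only [pairs, Matrix.of_apply, Matrix.mul_apply, Finset.sum_mul_sum,
        Fintype.sum_prod_type]
      refine Finset.sum_congr rfl fun a _ => Finset.sum_congr rfl fun b _ => ?_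
      have := (hUV j b a k).eq
      simp only [mul_assoc]
      rw [← mul_assoc (V a k), ← this, mul_assoc]
    rw [rtt_iff, h3, ← mul_assoc, h1, mul_assoc, h2, mul_assoc]
  · intro hA
    have h1 := hU.metric_right hA
    have h2 := hV.metric_right hA
    have h3 : V * G.C.map (algebraMap ℂ B) * V.transpose = G.C.map (algebraMap ℂ B) := by
      have := congrArg (· * G.C.map (algebraMap ℂ B)) h2
      simpa only [mul_assoc, CC', mul_one, one_mul] using this
    calc U * V * G.C.map (algebraMap ℂ B) * (U * V).transpose * G.C⁻¹.map (algebraMap ℂ B)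
        = U * (V * G.C.map (algebraMap ℂ B) * V.transpose) * U.transpose
          * G.C⁻¹.map (algebraMap ℂ B) := by rw [hT]; simp only [mul_assoc]
      _ = 1 := by rw [h3, h1]
  · intro hA
    have h1 := hU.metric_left hA
    have h2 := hV.metric_left hA
    have h3 : U.transpose * G.C⁻¹.map (algebraMap ℂ B) * U = G.C⁻¹.map (algebraMap ℂ B) := by
      have := congrArg (G.C⁻¹.map (algebraMap ℂ B) * ·) h1
      simpa only [← mul_assoc, CC', mul_one, one_mul] using this
    calc G.C.map (algebraMap ℂ B) * (U * V).transpose * G.C⁻¹.map (algebraMap ℂ B) * (U * V)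
        = G.C.map (algebraMap ℂ B) * V.transpose
          * (U.transpose * G.C⁻¹.map (algebraMap ℂ B) * U) * V := by
            rw [hT]; simp only [mul_assoc]
      _ = 1 := by rw [h3, h2]
  · intro h
    rw [qdet_mul (by simp [h.2, Series.IsA]) hV.rtt hUV, mul_assoc, ← mul_assoc (qdet G.q V),
      hV.det_mul_inv, one_mul, hU.det_mul_inv]
  · intro h
    rw [qdet_mul (by simp [h.2, Series.IsA]) hV.rtt hUV, mul_assoc, ← mul_assoc (t h),
      hU.inv_mul_det, one_mul, hV.inv_mul_det]
  · intro h
    rw [qdet_mul (by simp [h, Series.IsA]) hV.rtt hUV, hU.det_SL h, hV.det_SL h, one_mul]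
  · intro h w hw I
    rw [tensorPow_mul U V hUV]
    simp_rw [Matrix.mul_apply, Finset.smul_sum]
    rw [Finset.sum_comm]
    simp_rw [← mul_smul_comm, ← Finset.mul_sum, hV.det_SO h w hw]
    simpa using hU.det_SO h w hw I

theorem Sat.exists_inv {U : Matrix (Fin G.N) (Fin G.N) B}
    {t : {_t : Unit // G.series = Series.typeGL} → B} (h : Sat U t) :
    ∃ V : Matrix (Fin G.N) (Fin G.N) B, U * V = 1 ∧ V * U = 1 := by
  by_cases hA : G.series.IsA
  · have hr := h.rtt
    rw [Rhat_of_isA hA] at hr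
    obtain ⟨V, h1, h2⟩ := exists_adjugate G.transcendental G.N_pos hr
    have hs : ∃ s : B, qdet G.q U * s = 1 ∧ s * qdet G.q U = 1 := by
      cases hs : G.series with
      | typeGL => exact ⟨t ⟨(), hs⟩, h.det_mul_inv _, h.inv_mul_det _⟩
      | typeSL => exact ⟨1, by rw [h.det_SL hs, one_mul], by rw [h.det_SL hs, one_mul]⟩
      | typeO => simp [hs, Series.IsA] at hA
      | typeSO => simp [hs, Series.IsA] at hA
      | typeSp => simp [hs, Series.IsA] at hA
    obtain ⟨s, hs1, hs2⟩ := hs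
    refine ⟨V * Matrix.scalar _ s, ?_, ?_⟩
    · rw [← mul_assoc, h1, ← map_mul, hs1, map_one]
    · have e1 : U * (V * Matrix.scalar _ s) = 1 := by
        rw [← mul_assoc, h1, ← map_mul, hs1, map_one]
      have e2 : (Matrix.scalar _ s * V) * U = 1 := by
        rw [mul_assoc, h2, ← map_mul, hs2, map_one]
      rw [← left_inv_eq_right_inv e2 e1]
      exact e2
  · refine ⟨G.C.map (algebraMap ℂ B) * U.transpose * G.C⁻¹.map (algebraMap ℂ B), ?_,
      h.metric_left hA⟩
    rw [← h.metric_right hA]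
    simp only [mul_assoc]

theorem map_op_mul (U V : Matrix (Fin G.N) (Fin G.N) B) :
    (V.transpose.map MulOpposite.op) * (U.transpose.map MulOpposite.op)
      = (U * V).transpose.map MulOpposite.op := by
  ext i j
  simp [Matrix.mul_apply]

theorem map_op_algebraMap (M : Matrix (Fin G.N) (Fin G.N) ℂ) :
    M.map (algebraMap ℂ Bᵐᵒᵖ)
      = (M.map (algebraMap ℂ B)).transpose.transpose.map MulOpposite.op := by
  ext i j
  simp [MulOpposite.algebraMap_apply]

theorem transpose_sandwich (M M' : Matrix (Fin G.N) (Fin G.N) ℂ)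
    (U : Matrix (Fin G.N) (Fin G.N) B) :
    (M.map (algebraMap ℂ B) * U * M'.map (algebraMap ℂ B)).transpose
      = M'.transpose.map (algebraMap ℂ B) * U.transpose
        * M.transpose.map (algebraMap ℂ B) := by
  ext i j
  simp only [Matrix.transpose_apply, Matrix.mul_apply, Matrix.map_apply, Finset.sum_mul]
  rw [Finset.sum_comm]
  refine Finset.sum_congr rfl fun a _ => Finset.sum_congr rfl fun b _ => ?_
  rw [← Algebra.commutes, ← Algebra.commutes, ← mul_assoc, ← mul_assoc, ← map_mul, ← map_mul,
    mul_comm]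

theorem metric_op {U V : Matrix (Fin G.N) (Fin G.N) B}
    {t : {_t : Unit // G.series = Series.typeGL} → B} (h : Sat U t) (h1 : U * V = 1)
    (hA : ¬ G.series.IsA) :
    G.C⁻¹.transpose.map (algebraMap ℂ B) * (V * (G.C.transpose.map (algebraMap ℂ B)
        * V.transpose)) = 1 ∧
    V.transpose * (G.C⁻¹.transpose.map (algebraMap ℂ B) * (V
        * G.C.transpose.map (algebraMap ℂ B))) = 1 := by
  have hV : V = G.C.map (algebraMap ℂ B) * U.transpose * G.C⁻¹.map (algebraMap ℂ B) :=
    (left_inv_eq_right_inv (h.metric_left hA) h1).symm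
  have hVt : V.transpose = G.C⁻¹.transpose.map (algebraMap ℂ B) * U
      * G.C.transpose.map (algebraMap ℂ B) := by
    rw [hV, transpose_sandwich, Matrix.transpose_transpose]
  have t1 : G.C.transpose.map (algebraMap ℂ B) * G.C⁻¹.transpose.map (algebraMap ℂ B) = 1 := by
    rw [← Matrix.map_mul, ← Matrix.transpose_mul, Matrix.nonsing_inv_mul _ G.C_unit,
      Matrix.transpose_one, Matrix.map_one _ (map_zero _) (map_one _)]
  have t2 : G.C⁻¹.transpose.map (algebraMap ℂ B) * G.C.transpose.map (algebraMap ℂ B) = 1 := by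
    rw [← Matrix.map_mul, ← Matrix.transpose_mul, Matrix.mul_nonsing_inv _ G.C_unit,
      Matrix.transpose_one, Matrix.map_one _ (map_zero _) (map_one _)]
  refine ⟨?_, ?_⟩
  · have hm := h.metric_left hA
    have h3 : U.transpose * G.C⁻¹.map (algebraMap ℂ B) * U
        = G.C⁻¹.map (algebraMap ℂ B) := by
      have := congrArg (G.C⁻¹.map (algebraMap ℂ B) * ·) hm
      simpa only [← mul_assoc, CC', mul_one, one_mul] using this
    rw [hVt, hV]
    calc _ = G.C⁻¹.transpose.map (algebraMap ℂ B) * (G.C.map (algebraMap ℂ B)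
          * (U.transpose * G.C⁻¹.map (algebraMap ℂ B)
          * (G.C.transpose.map (algebraMap ℂ B) * G.C⁻¹.transpose.map (algebraMap ℂ B)) * U)
          * G.C.transpose.map (algebraMap ℂ B)) := by simp only [mul_assoc]
      _ = 1 := by
        rw [t1, mul_one, h3, CC, one_mul, t2]
  · have h3 := h.metric_right hA
    rw [hVt]
    calc _ = G.C⁻¹.transpose.map (algebraMap ℂ B) * U
          * (G.C.transpose.map (algebraMap ℂ B) * G.C⁻¹.transpose.map (algebraMap ℂ B)) * V
          * G.C.transpose.map (algebraMap ℂ B) := by simp only [mul_assoc]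
      _ = G.C⁻¹.transpose.map (algebraMap ℂ B) * (U * V)
          * G.C.transpose.map (algebraMap ℂ B) := by
            rw [t1, mul_one]; simp only [mul_assoc]
      _ = 1 := by rw [h1, mul_one, t2]

theorem Sat.op {U V : Matrix (Fin G.N) (Fin G.N) B}
    {t : {_t : Unit // G.series = Series.typeGL} → B} (h : Sat U t) (h1 : U * V = 1)
    (h2 : V * U = 1) :
    Sat (V.map MulOpposite.op) (fun _ => MulOpposite.op (qdet G.q U)) := by
  have hw : ∀ (w : (Fin G.N → Fin G.N) → ℂ) (d d' : B), d * d' = 1 →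
      (∀ I, ∑ J, w J • tensorPow U G.N I J = w I • d) → ∀ I,
      ∑ J, w J • tensorPow (V.map MulOpposite.op) G.N I J = w I • MulOpposite.op d' := by
    intro w d d' hd hdet I
    have e1 : ∑ K, (tensorPow (V.map MulOpposite.op) G.N I K).unop
        * (∑ J, w J • tensorPow U G.N K J) = w I • 1 := by
      simp_rw [Finset.mul_sum, mul_smul_comm]
      rw [Finset.sum_comm]
      simp_rw [← Finset.smul_sum, tensorPow_op_mul U V h2]
      rw [Finset.sum_eq_single I]
      · simp
      · intro J _ hJ
        simp [Matrix.one_apply_ne hJ.symm]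
      · simp
    simp_rw [hdet, mul_smul_comm, ← smul_mul_assoc] at e1
    rw [← Finset.sum_mul] at e1
    have e2 := congrArg (· * d') e1
    simp only [mul_assoc, hd, mul_one, smul_mul_assoc, one_mul] at e2
    apply MulOpposite.unop_injective
    rw [MulOpposite.unop_smul, MulOpposite.unop_op, ← e2]
    simp [Finset.unop_sum]
  have hdet : G.series.IsA → ∀ d' : B, qdet G.q U * d' = 1 →
      qdet G.q (V.map MulOpposite.op) = MulOpposite.op d' := by
    intro hA d' hd
    have hr := h.rtt
    rw [Rhat_of_isA hA] at hr
    have := hw (qeps G.q) (qdet G.q U) d' hd (qdet_row G.transcendental hr) id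
    rw [qdet_eq_sum_qeps, this, qeps_id, one_smul]
  refine ⟨?_, ?_, ?_, ?_, ?_, ?_, ?_⟩
  · let VV : Matrix (Fin G.N × Fin G.N) (Fin G.N × Fin G.N) B :=
      Matrix.of fun a b => V a.2 b.2 * V a.1 b.1
    have hUV : ∀ i j, ∑ k, U i k * V k j = (1 : Matrix _ _ B) i j := fun i j => by
      rw [← h1, Matrix.mul_apply]
    have hVU : ∀ i j, ∑ k, V i k * U k j = (1 : Matrix _ _ B) i j := fun i j => by
      rw [← h2, Matrix.mul_apply]
    have e1 : pairs U * VV = 1 := by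
      ext ⟨i, j⟩ ⟨k, l⟩
      simp only [Matrix.mul_apply, pairs, VV, Matrix.of_apply, Fintype.sum_prod_type]
      have : ∀ a b, U i a * U j b * (V b l * V a k) = U i a * (U j b * V b l) * V a k := by
        intro a b; simp only [mul_assoc]
      simp_rw [this, ← Finset.sum_mul, ← Finset.mul_sum, hUV, Matrix.one_apply, Prod.mk.injEq]
      by_cases hjl : j = l
      · simp [hjl, hUV, Matrix.one_apply]
      · simp [hjl]
    have e2 : VV * pairs U = 1 := by
      ext ⟨i, j⟩ ⟨k, l⟩
      simp only [Matrix.mul_apply, pairs, VV, Matrix.of_apply, Fintype.sum_prod_type]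
      have : ∀ a b, V j b * V i a * (U a k * U b l) = V j b * (V i a * U a k) * U b l := by
        intro a b; simp only [mul_assoc]
      simp_rw [this]
      rw [Finset.sum_comm]
      simp_rw [← Finset.sum_mul, ← Finset.mul_sum, hVU, Matrix.one_apply, Prod.mk.injEq]
      by_cases hik : i = k
      · simp [hik, hVU, Matrix.one_apply]
      · simp [hik]
    have e3 := (rtt_iff U).mp h.rtt
    have e4 : G.Rhat.map (algebraMap ℂ B) * VV = VV * G.Rhat.map (algebraMap ℂ B) := by
      calc _ = VV * (pairs U * G.Rhat.map (algebraMap ℂ B)) * VV := by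
            rw [← mul_assoc, e2, one_mul]
        _ = VV * G.Rhat.map (algebraMap ℂ B) * (pairs U * VV) := by
            rw [← e3]; simp only [mul_assoc]
        _ = _ := by rw [e1, mul_one]
    intro i j k l
    have := congrFun (congrFun e4 (i, j)) (k, l)
    simp only [Matrix.mul_apply, Matrix.map_apply, VV, Matrix.of_apply, ← Algebra.smul_def,
      ← Algebra.commutes] at this
    apply MulOpposite.unop_injective
    simpa [Finset.unop_sum] using this
  · intro hA
    obtain ⟨key, -⟩ := metric_op h h1 hA
    have e : V.map MulOpposite.op = V.transpose.transpose.map MulOpposite.op := by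
      rw [Matrix.transpose_transpose]
    have e' : (V.map MulOpposite.op).transpose = V.transpose.map MulOpposite.op := rfl
    rw [map_op_algebraMap, map_op_algebraMap, e', e, map_op_mul, map_op_mul, map_op_mul,
      ← Matrix.transpose_map, ← Matrix.transpose_map, key, Matrix.transpose_one,
      Matrix.map_one _ MulOpposite.op_zero MulOpposite.op_one]
  · intro hA
    obtain ⟨-, key⟩ := metric_op h h1 hA
    have e : V.map MulOpposite.op = V.transpose.transpose.map MulOpposite.op := by
      rw [Matrix.transpose_transpose]
    have e' : (V.map MulOpposite.op).transpose = V.transpose.map MulOpposite.op := rfl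
    rw [map_op_algebraMap, map_op_algebraMap, e', e, map_op_mul, map_op_mul, map_op_mul,
      ← Matrix.transpose_map, ← Matrix.transpose_map, key, Matrix.transpose_one,
      Matrix.map_one _ MulOpposite.op_zero MulOpposite.op_one]
  · rintro ⟨x, hs⟩
    have hA : G.series.IsA := by simp [hs, Series.IsA]
    rw [hdet hA _ (h.det_mul_inv ⟨x, hs⟩), ← MulOpposite.op_mul, h.det_mul_inv,
      MulOpposite.op_one]
  · rintro ⟨x, hs⟩
    have hA : G.series.IsA := by simp [hs, Series.IsA]
    rw [hdet hA _ (h.det_mul_inv ⟨x, hs⟩), ← MulOpposite.op_mul, h.inv_mul_det,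
      MulOpposite.op_one]
  · intro hs
    have hA : G.series.IsA := by simp [hs, Series.IsA]
    rw [hdet hA 1 (by rw [h.det_SL hs, one_mul]), MulOpposite.op_one]
  · intro hs w hanti I
    rw [hw w 1 1 (one_mul 1) (h.det_SO hs w hanti) I, MulOpposite.op_one]

end QuantumGroup
end QuantumGroups

namespace QuantumGroups

namespace QuantumGroup

variable {G : QuantumGroup}

theorem Sat.map {B B' : Type} [Ring B] [Algebra ℂ B] [Ring B'] [Algebra ℂ B'] (φ : B →ₐ[ℂ] B')
    {U : Matrix (Fin G.N) (Fin G.N) B} {t : {_t : Unit // G.series = Series.typeGL} → B}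
    (h : Sat U t) : Sat (U.map φ) (fun x => φ (t x)) := by
  have hC : ∀ M : Matrix (Fin G.N) (Fin G.N) ℂ,
      (M.map (algebraMap ℂ B)).map φ = M.map (algebraMap ℂ B') := by
    intro M
    ext i j
    simp
  have h1 : (1 : Matrix (Fin G.N) (Fin G.N) B).map φ = 1 :=
    Matrix.map_one _ (map_zero _) (map_one _)
  refine ⟨?_, ?_, ?_, ?_, ?_, ?_, ?_⟩
  · intro i j k l
    simpa using congrArg φ (h.rtt i j k l)
  · intro hA
    have := congrArg (fun M : Matrix (Fin G.N) (Fin G.N) B => M.map φ) (h.metric_right hA)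
    simp only [Matrix.map_mul, hC, h1] at this
    exact this
  · intro hA
    have := congrArg (fun M : Matrix (Fin G.N) (Fin G.N) B => M.map φ) (h.metric_left hA)
    simp only [Matrix.map_mul, hC, h1] at this
    exact this
  · intro x
    rw [← map_qdet, ← map_mul, h.det_mul_inv, map_one]
  · intro x
    rw [← map_qdet, ← map_mul, h.inv_mul_det, map_one]
  · intro hs
    rw [← map_qdet, h.det_SL hs, map_one]
  · intro hs w hw I
    have := congrArg φ (h.det_SO hs w hw I)
    simpa only [map_sum, map_smul, map_tensorPow, map_one] using this

theorem sat_comul : Sat (B := G.Coord ⊗[ℂ] G.Coord)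
    (G.u.map (Algebra.TensorProduct.includeLeft (R := ℂ) (S := ℂ) (A := G.Coord) (B := G.Coord))
      * G.u.map (Algebra.TensorProduct.includeRight (R := ℂ) (A := G.Coord) (B := G.Coord)))
    (fun x => (1 ⊗ₜ G.detInv x) * (G.detInv x ⊗ₜ 1)) :=
  (sat_u.map (Algebra.TensorProduct.includeLeft (R := ℂ) (S := ℂ) (A := G.Coord)
    (B := G.Coord))).mul
    (sat_u.map (Algebra.TensorProduct.includeRight (R := ℂ) (A := G.Coord) (B := G.Coord))) fun i j k l => by
      simp [Commute, SemiconjBy]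

/-- The comultiplication, `Δ(u^i_j) = u^i_k ⊗ u^k_j`. -/
noncomputable def comulHom : G.Coord →ₐ[ℂ] G.Coord ⊗[ℂ] G.Coord := lift sat_comul

theorem comulHom_u (i j : Fin G.N) : comulHom (G.u i j) = ∑ k, G.u i k ⊗ₜ G.u k j := by
  simp [comulHom, lift_u, Matrix.mul_apply]

theorem comulHom_detInv (x : {_t : Unit // G.series = Series.typeGL}) :
    comulHom (G.detInv x) = G.detInv x ⊗ₜ G.detInv x := by
  simp [comulHom, lift_detInv]

/-- The counit, `ε(u^i_j) = δ_ij`. -/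
noncomputable def counitHom : G.Coord →ₐ[ℂ] ℂ := lift sat_one

theorem counitHom_u (i j : Fin G.N) :
    counitHom (G.u i j) = (1 : Matrix (Fin G.N) (Fin G.N) ℂ) i j := lift_u _ _ _

theorem counitHom_detInv (x : {_t : Unit // G.series = Series.typeGL}) :
    counitHom (G.detInv x) = 1 := lift_detInv _ _

noncomputable instance : Bialgebra ℂ G.Coord :=
  Bialgebra.ofAlgHom comulHom counitHom
    (by
      ext i j
      · simp [comulHom_u, TensorProduct.sum_tmul, TensorProduct.tmul_sum]
        rw [Finset.sum_comm]
      · simp [comulHom_detInv])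
    (by
      ext i j
      · simp [comulHom_u, counitHom_u, Matrix.one_apply, TensorProduct.ite_tmul]
      · simp [comulHom_detInv, counitHom_detInv])
    (by
      ext i j
      · simp [comulHom_u, counitHom_u, Matrix.one_apply, TensorProduct.tmul_ite]
      · simp [comulHom_detInv, counitHom_detInv])

theorem comul_u (i j : Fin G.N) :
    CoalgebraStruct.comul (R := ℂ) (G.u i j) = ∑ k, G.u i k ⊗ₜ G.u k j := comulHom_u i j

theorem comul_detInv (x : {_t : Unit // G.series = Series.typeGL}) :
    CoalgebraStruct.comul (R := ℂ) (G.detInv x) = G.detInv x ⊗ₜ G.detInv x := comulHom_detInv x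

theorem counit_u (i j : Fin G.N) :
    CoalgebraStruct.counit (R := ℂ) (G.u i j) = (1 : Matrix (Fin G.N) (Fin G.N) ℂ) i j :=
  counitHom_u i j

theorem counit_detInv (x : {_t : Unit // G.series = Series.typeGL}) :
    CoalgebraStruct.counit (R := ℂ) (G.detInv x) = 1 := counitHom_detInv x

variable (G) in
/-- The inverse of the matrix `u`. -/
noncomputable def uInv : Matrix (Fin G.N) (Fin G.N) G.Coord := (sat_u (G := G)).exists_inv.choose

theorem u_mul_uInv : G.u * G.uInv = 1 := (sat_u (G := G)).exists_inv.choose_spec.1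

theorem uInv_mul_u : G.uInv * G.u = 1 := (sat_u (G := G)).exists_inv.choose_spec.2

/-- The antipode, as an algebra homomorphism to the opposite algebra, `S(u^i_j) = (u⁻¹)^i_j`. -/
noncomputable def antipodeHom : G.Coord →ₐ[ℂ] G.Coordᵐᵒᵖ := lift (sat_u.op u_mul_uInv uInv_mul_u)

/-- The antipode as a linear map. -/
noncomputable def antipodeLin : G.Coord →ₗ[ℂ] G.Coord :=
  (MulOpposite.opLinearEquiv ℂ).symm.toLinearMap ∘ₗ antipodeHom.toLinearMap

theorem antipodeLin_mul (a b : G.Coord) :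
    antipodeLin (a * b) = antipodeLin b * antipodeLin a := by
  simp [antipodeLin]

theorem antipodeLin_algebraMap (c : ℂ) :
    antipodeLin (algebraMap ℂ G.Coord c) = algebraMap ℂ G.Coord c := by
  simp [antipodeLin]

theorem antipodeLin_one : antipodeLin (1 : G.Coord) = 1 := by
  simp [antipodeLin]

theorem antipodeLin_u (i j : Fin G.N) : antipodeLin (G.u i j) = G.uInv i j := by
  simp [antipodeLin, antipodeHom, lift_u]

theorem antipodeLin_detInv (x : {_t : Unit // G.series = Series.typeGL}) :
    antipodeLin (G.detInv x) = qdet G.q G.u := by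
  simp [antipodeLin, antipodeHom, lift_detInv]

theorem antipode_left_mul {z : G.Coord ⊗[ℂ] G.Coord} {c : ℂ}
    (hz : LinearMap.mul' ℂ G.Coord (antipodeLin.rTensor G.Coord z) = algebraMap ℂ G.Coord c)
    (w : G.Coord ⊗[ℂ] G.Coord) :
    LinearMap.mul' ℂ G.Coord (antipodeLin.rTensor G.Coord (z * w))
      = algebraMap ℂ G.Coord c * LinearMap.mul' ℂ G.Coord (antipodeLin.rTensor G.Coord w) := by
  induction w using TensorProduct.induction_on with
  | zero => simp
  | tmul b b' =>
    have : LinearMap.mul' ℂ G.Coord (antipodeLin.rTensor G.Coord (z * (b ⊗ₜ b')))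
        = antipodeLin b * LinearMap.mul' ℂ G.Coord (antipodeLin.rTensor G.Coord z) * b' := by
      clear hz
      induction z using TensorProduct.induction_on with
      | zero => simp
      | tmul a a' => simp [antipodeLin_mul, mul_assoc]
      | add z z' h h' => simp only [add_mul, mul_add, map_add, h, h']
    rw [this, hz, ← Algebra.commutes]
    simp [mul_assoc]
  | add w w' h h' => simp only [mul_add, map_add, h, h']

theorem antipode_right_mul {w : G.Coord ⊗[ℂ] G.Coord} {c : ℂ}
    (hw : LinearMap.mul' ℂ G.Coord (antipodeLin.lTensor G.Coord w) = algebraMap ℂ G.Coord c)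
    (z : G.Coord ⊗[ℂ] G.Coord) :
    LinearMap.mul' ℂ G.Coord (antipodeLin.lTensor G.Coord (z * w))
      = algebraMap ℂ G.Coord c * LinearMap.mul' ℂ G.Coord (antipodeLin.lTensor G.Coord z) := by
  induction z using TensorProduct.induction_on with
  | zero => simp
  | tmul b b' =>
    have : LinearMap.mul' ℂ G.Coord (antipodeLin.lTensor G.Coord ((b ⊗ₜ b') * w))
        = b * LinearMap.mul' ℂ G.Coord (antipodeLin.lTensor G.Coord w) * antipodeLin b' := by
      clear hw
      induction w using TensorProduct.induction_on with
      | zero => simp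
      | tmul a a' => simp [antipodeLin_mul, mul_assoc]
      | add z z' h h' => simp only [add_mul, mul_add, map_add, h, h']
    rw [this, hw, ← Algebra.commutes]
    simp [mul_assoc]
  | add w w' h h' => simp only [mul_add, add_mul, map_add, h, h']

theorem antipode_left (a : G.Coord) :
    LinearMap.mul' ℂ G.Coord (antipodeLin.rTensor G.Coord (CoalgebraStruct.comul (R := ℂ) a))
      = algebraMap ℂ G.Coord (CoalgebraStruct.counit (R := ℂ) a) := by
  induction a using Coord.induction with
  | hc c => simp [Algebra.TensorProduct.algebraMap_apply, antipodeLin_algebraMap]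
  | hu i j =>
    have := congrFun (congrFun (uInv_mul_u (G := G)) i) j
    rw [Matrix.mul_apply] at this
    simp only [comul_u, counit_u, map_sum, LinearMap.rTensor_tmul, LinearMap.mul'_apply,
      antipodeLin_u, this, Matrix.one_apply]
    split_ifs <;> simp
  | ht x => simp [comul_detInv, counit_detInv, antipodeLin_detInv, sat_u.det_mul_inv]
  | hm a b ha hb =>
    rw [Bialgebra.comul_mul, Bialgebra.counit_mul, antipode_left_mul ha, hb, map_mul]
  | ha a b ha hb => simp only [map_add, ha, hb]

theorem antipode_right (a : G.Coord) :
    LinearMap.mul' ℂ G.Coord (antipodeLin.lTensor G.Coord (CoalgebraStruct.comul (R := ℂ) a))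
      = algebraMap ℂ G.Coord (CoalgebraStruct.counit (R := ℂ) a) := by
  induction a using Coord.induction with
  | hc c => simp [Algebra.TensorProduct.algebraMap_apply, antipodeLin_one]
  | hu i j =>
    have := congrFun (congrFun (u_mul_uInv (G := G)) i) j
    rw [Matrix.mul_apply] at this
    simp only [comul_u, counit_u, map_sum, LinearMap.lTensor_tmul, LinearMap.mul'_apply,
      antipodeLin_u, this, Matrix.one_apply]
    split_ifs <;> simp
  | ht x => simp [comul_detInv, counit_detInv, antipodeLin_detInv, sat_u.inv_mul_det]
  | hm a b ha hb =>
    rw [Bialgebra.comul_mul, Bialgebra.counit_mul, antipode_right_mul hb, ha, map_mul,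
      Algebra.commutes]
  | ha a b ha hb => simp only [map_add, ha, hb]

noncomputable instance : HopfAlgebra ℂ G.Coord where
  antipode := antipodeLin
  mul_antipode_rTensor_comul := LinearMap.ext antipode_left
  mul_antipode_lTensor_comul := LinearMap.ext antipode_right

end QuantumGroup
end QuantumGroups

namespace QuantumGroups

/-! ### Functionals on coalgebras, universal `r`-forms -/

section Functionals

variable {E : Type} [AddCommGroup E] [Module ℂ E] [Coalgebra ℂ E]

/-- The convolution product `(X Y)(c) = X(c₍₁₎) Y(c₍₂₎)` of functionals. -/
noncomputable def conv (X Y : E →ₗ[ℂ] ℂ) : E →ₗ[ℂ] ℂ :=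
  LinearMap.mul' ℂ ℂ ∘ₗ TensorProduct.map X Y ∘ₗ CoalgebraStruct.comul

/-- `X ∗ c = c₍₁₎ X(c₍₂₎)`. -/
noncomputable def leftAct (X : E →ₗ[ℂ] ℂ) : E →ₗ[ℂ] E :=
  (TensorProduct.rid ℂ E).toLinearMap ∘ₗ X.lTensor E ∘ₗ CoalgebraStruct.comul

/-- `c ∗ X = X(c₍₁₎) c₍₂₎`. -/
noncomputable def rightAct (X : E →ₗ[ℂ] ℂ) : E →ₗ[ℂ] E :=
  (TensorProduct.lid ℂ E).toLinearMap ∘ₗ X.rTensor E ∘ₗ CoalgebraStruct.comul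

end Functionals

section HopfBimodules

variable {A : Type} [Ring A] [HopfAlgebra ℂ A]

/-- Universal `r`-forms of a Hopf algebra: convolution-invertible bilinear forms with
`r(a₍₁₎, b₍₁₎) a₍₂₎ b₍₂₎ = b₍₁₎ a₍₁₎ r(a₍₂₎, b₍₂₎)`, `r(a b, c) = r(a, c₍₁₎) r(b, c₍₂₎)` and
`r(a, b c) = r(a₍₁₎, c) r(a₍₂₎, b)`. -/
structure IsUniversalRForm (r : A →ₗ[ℂ] A →ₗ[ℂ] ℂ) : Prop where
  invertible : ∃ r' : A ⊗[ℂ] A →ₗ[ℂ] ℂ,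
    conv (TensorProduct.lift r) r' = CoalgebraStruct.counit ∧
    conv r' (TensorProduct.lift r) = CoalgebraStruct.counit
  comm : ∀ a b : A,
    LinearMap.mul' ℂ A (rightAct (TensorProduct.lift r) (a ⊗ₜ b)) =
      LinearMap.mul' ℂ A (TensorProduct.comm ℂ A A (leftAct (TensorProduct.lift r) (a ⊗ₜ b)))
  mul_left : ∀ a b : A, r (a * b) = conv (r a) (r b)
  mul_right : ∀ a b : A, r.flip (a * b) = conv (r.flip b) (r.flip a)

/-! ### Hopf bimodules `Γ = (v, f)` and their tensor powers -/

/-- The structure matrices of a Hopf bimodule `Γ` with respect to a basis `ω_i` of the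
left-coinvariant elements: `Δ_R(ω_j) = ∑ ω_i ⊗ v^i_j` and `ω_i ◁ a = ∑ f^i_j(a) ω_j`,
where `ω ◁ a = S(a₍₁₎) ω a₍₂₎`, so that `ω_i a = ∑ a₍₁₎ f^i_j(a₍₂₎) ω_j`. -/
structure BimoduleData (A ι : Type) [Ring A] [HopfAlgebra ℂ A] where
  v : Matrix ι ι A
  f : Matrix ι ι (A →ₗ[ℂ] ℂ)

/-- The `k`-th tensor power `Γ^{⊗k}` over `A`, a free left `A`-module with the basis
`ω_{i₁} ⊗ ⋯ ⊗ ω_{i_k}`; the element `∑_I ρ_I ω_I` is given by its coordinates `ρ_I`. -/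
abbrev Tens (A ι : Type) (k : ℕ) : Type := (Fin k → ι) → A

namespace BimoduleData

variable {ι : Type} [Fintype ι] [DecidableEq ι] (Γ : BimoduleData A ι)

/-- `ω_I ◁ a = ∑_J f^I_J(a) ω_J` on `Γ^{⊗k}`, with
`f^I_J = f^{i₁}_{j₁} f^{i₂}_{j₂} ⋯ f^{i_k}_{j_k}` (convolution products). -/
noncomputable def fPow {k : ℕ} (I J : Fin k → ι) : A →ₗ[ℂ] ℂ :=
  ((List.finRange k).map fun m => Γ.f (I m) (J m)).foldr conv CoalgebraStruct.counit

/-- The right multiplication `ρ a = ∑_{I, J} ρ_I a₍₁₎ f^I_J(a₍₂₎) ω_J` on `Γ^{⊗k}`. -/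
noncomputable def rmul (k : ℕ) : Tens A ι k →ₗ[ℂ] A →ₗ[ℂ] Tens A ι k :=
  ∑ I : Fin k → ι, LinearMap.compl₁₂ (LinearMap.mk₂ ℂ
      (fun (a : A) (b : Tens A ι k) => fun J => a * b J)
      (fun a b c => by funext J; simp [add_mul]) (fun c a b => by funext J; simp)
      (fun a b c => by funext J; simp [mul_add]) (fun c a b => by funext J; simp))
    (LinearMap.proj I) (LinearMap.pi fun J => leftAct (Γ.fPow I J))

/-- The left coaction `a ω_I ↦ a₍₁₎ ⊗ a₍₂₎ ω_I`. -/
noncomputable def coactL (k : ℕ) : Tens A ι k →ₗ[ℂ] A ⊗[ℂ] Tens A ι k :=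
  ∑ I : Fin k → ι,
    (LinearMap.single ℂ (fun _ : Fin k → ι => A) I).lTensor A ∘ₗ
      CoalgebraStruct.comul ∘ₗ LinearMap.proj I

/-- The right coaction
`a ω_I ↦ ∑_J a₍₁₎ ω_J ⊗ a₍₂₎ v^{j₁}_{i₁} v^{j₂}_{i₂} ⋯ v^{j_k}_{i_k}`. -/
noncomputable def coactR (k : ℕ) : Tens A ι k →ₗ[ℂ] Tens A ι k ⊗[ℂ] A :=
  ∑ I : Fin k → ι, ∑ J : Fin k → ι,
    TensorProduct.map (LinearMap.single ℂ (fun _ : Fin k → ι => A) J)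
        (LinearMap.mulRight ℂ (tensorPow Γ.v k J I)) ∘ₗ
      CoalgebraStruct.comul ∘ₗ LinearMap.proj I

/-- `ζ ⊗ ρ` for `ζ ∈ Γ` and `ρ ∈ Γ^{⊗k}`. -/
noncomputable def tensorLeft {k : ℕ} (ζ : Tens A ι 1) : Tens A ι k →ₗ[ℂ] Tens A ι (k + 1) :=
  LinearMap.pi fun K =>
    LinearMap.proj (fun _ => K 0) ∘ₗ Γ.rmul 1 ζ ∘ₗ LinearMap.proj (Fin.tail K)

/-- `ρ ⊗ ζ` for `ζ ∈ Γ` and `ρ ∈ Γ^{⊗k}`. -/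
noncomputable def tensorRight {k : ℕ} (ζ : Tens A ι 1) : Tens A ι k →ₗ[ℂ] Tens A ι (k + 1) :=
  LinearMap.pi fun K =>
    LinearMap.proj (Fin.init K) ∘ₗ (Γ.rmul k).flip (ζ fun _ => K (Fin.last k))

/-- The matrix of the braiding `σ : Γ ⊗ Γ → Γ ⊗ Γ`,
`σ(ω_a ⊗ ω_b) = ∑ ω_c ⊗ (ω_a ◁ v^c_b) = ∑ f^a_d(v^c_b) ω_c ⊗ ω_d`. -/
noncomputable def braiding : Matrix (ι × ι) (ι × ι) ℂ :=
  Matrix.of fun c a => Γ.f a.1 c.2 (Γ.v c.1 a.2)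

end BimoduleData

end HopfBimodules

/-! ### Antisymmetrisers -/

/-- The simple transpositions of the symmetric group. -/
def simpleSwap {k : ℕ} (i : Fin k) : Equiv.Perm (Fin (k + 1)) := Equiv.swap i.castSucc i.succ

/-- `π = s_{i₁} ⋯ s_{i_r}` with minimal `r`. -/
def IsReducedWord {k : ℕ} (π : Equiv.Perm (Fin (k + 1))) (w : List (Fin k)) : Prop :=
  (w.map simpleSwap).prod = π ∧
    ∀ w' : List (Fin k), (w'.map simpleSwap).prod = π → w.length ≤ w'.length

theorem exists_reducedWord {k : ℕ} (π : Equiv.Perm (Fin (k + 1))) : ∃ w, IsReducedWord π w := by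
  classical
  have hex : ∃ w : List (Fin k), (w.map simpleSwap).prod = π := by
    have h : π ∈ Submonoid.closure (Set.range (simpleSwap (k := k))) := by
      have := Equiv.Perm.mclosure_swap_castSucc_succ k
      change Submonoid.closure (Set.range (simpleSwap (k := k))) = ⊤ at this
      rw [this]
      trivial
    induction h using Submonoid.closure_induction with
    | mem x hx =>
      obtain ⟨i, rfl⟩ := hx
      exact ⟨[i], by simp⟩
    | one => exact ⟨[], by simp⟩
    | mul x y _ _ hx hy =>
      obtain ⟨w, rfl⟩ := hx
      obtain ⟨w', rfl⟩ := hy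
      exact ⟨w ++ w', by simp⟩
  have hlen : ∃ n, ∃ w : List (Fin k), (w.map simpleSwap).prod = π ∧ w.length = n :=
    hex.elim fun w hw => ⟨_, w, hw, rfl⟩
  obtain ⟨w, hw, hn⟩ := Nat.find_spec hlen
  exact ⟨w, hw, fun w' hw' => hn ▸ Nat.find_min' hlen ⟨w', hw', rfl⟩⟩

/-- A reduced word of `π`. -/
noncomputable def reducedWord {k : ℕ} (π : Equiv.Perm (Fin (k + 1))) : List (Fin k) :=
  (exists_reducedWord π).choose

/-- The permutations with `π(1) < ⋯ < π(i)` and `π(i + 1) < ⋯ < π(n)`. -/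
def IsShuffle {n : ℕ} (i : ℕ) (π : Equiv.Perm (Fin n)) : Prop :=
  ∀ a b : Fin n, a < b → ((b : ℕ) < i ∨ i ≤ (a : ℕ)) → π a < π b

section Antisymmetrisers

variable {A ι : Type} [Ring A] [Algebra ℂ A] [Fintype ι] (σ : Matrix (ι × ι) (ι × ι) ℂ)

/-- `σ_π = σ_{i₁} ⋯ σ_{i_r}` for a reduced word of `π`. -/
noncomputable def braidPerm {k : ℕ} (π : Equiv.Perm (Fin (k + 1))) :
    Module.End ℂ (Tens A ι (k + 1)) :=
  ((reducedWord π).map fun i => onLegs σ i.castSucc i.succ).prod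

/-- The antisymmetriser `A_k = ∑_π sgn(π) σ_π`. -/
noncomputable def antisymm : (k : ℕ) → Module.End ℂ (Tens A ι k)
  | 0 => 1
  | _ + 1 => ∑ π, ((Equiv.Perm.sign π : ℤ) : ℂ) • braidPerm σ π

open scoped Classical in
/-- The endomorphism `B_{i, n - i} = ∑ sgn(π) σ_π` of the `n`-th tensor power, `n = k + 1`, where
`π⁻¹` runs through the shuffle permutations. -/
noncomputable def shuffleSum (k i : ℕ) : Module.End ℂ (Tens A ι (k + 1)) :=
  ∑ π ∈ Finset.univ.filter fun π : Equiv.Perm (Fin (k + 1)) => IsShuffle i π⁻¹,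
    ((Equiv.Perm.sign π : ℤ) : ℂ) • braidPerm σ π

/-- The `k`-th component `Γ^{∧k} = Γ^{⊗k} / ker A_k` of the external algebra. -/
abbrev ExtPower (A : Type) {ι : Type} [Ring A] [Algebra ℂ A] [Fintype ι]
    (σ : Matrix (ι × ι) (ι × ι) ℂ) (k : ℕ) : Type :=
  Tens A ι k ⧸ LinearMap.ker (antisymm (A := A) σ k)

/-- The canonical projection. -/
noncomputable abbrev ExtPower.proj (k : ℕ) : Tens A ι k →ₗ[ℂ] ExtPower A σ k :=
  (LinearMap.ker (antisymm (A := A) σ k)).mkQ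

/-- The elements of `A`, as forms of degree zero. -/
noncomputable def ExtPower.ofCoeff : A →ₗ[ℂ] ExtPower A σ 0 :=
  ExtPower.proj σ 0 ∘ₗ LinearMap.pi fun _ => LinearMap.id

/-- A map on `Γ^{⊗k}` is well-defined on `Γ^{∧k}`. -/
def Descends {M : Type} [AddCommGroup M] [Module ℂ M] {k : ℕ} (φ : Tens A ι k →ₗ[ℂ] M) : Prop :=
  LinearMap.ker (antisymm (A := A) σ k) ≤ LinearMap.ker φ

open scoped Classical in
/-- The map on `Γ^{∧k}` induced by a map on `Γ^{⊗k}` (zero if the latter does not descend). -/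
noncomputable def ExtPower.induced {M : Type} [AddCommGroup M] [Module ℂ M] {k : ℕ}
    (φ : Tens A ι k →ₗ[ℂ] M) : ExtPower A σ k →ₗ[ℂ] M :=
  if h : Descends σ φ then (LinearMap.ker (antisymm (A := A) σ k)).liftQ φ h else 0

end Antisymmetrisers

/-! ### The calculi `Γ_{±,z}` over `O(G_q)` -/

/-- The two signs `+` and `-`. -/
inductive Pm
  | plus
  | minus

instance : Neg Pm := ⟨fun τ => match τ with
  | .plus => .minus
  | .minus => .plus⟩

namespace QuantumGroup

variable (G : QuantumGroup)

/-- The universal `r`-form `r_x` of `O(G_q)`, given by `r_x(u^i_j, u^k_l) = x⁻¹ R̂^{ki}_{jl}`. -/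
structure IsRForm (x : ℂ) (r : G.Coord →ₗ[ℂ] G.Coord →ₗ[ℂ] ℂ) : Prop where
  universal : IsUniversalRForm r
  apply_u : ∀ i j k l, r (G.u i j) (G.u k l) = x⁻¹ * G.Rhat (k, i) (j, l)

/-- The diagonal entries of `D`. -/
noncomputable def d (i : Fin G.N) : ℂ := G.D i i

/-- The index set of the basis `ω_ij` of the left-coinvariant forms. -/
abbrev Idx : Type := Fin G.N × Fin G.N

variable {G}
variable (rx ry : G.Coord →ₗ[ℂ] G.Coord →ₗ[ℂ] ℂ)

/-- The functionals `ℓ⁺^i_j(a) = r_x(a, u^i_j)`. -/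
noncomputable def lPlus (i j : Fin G.N) : G.Coord →ₗ[ℂ] ℂ := rx.flip (G.u i j)

/-- The functionals `ℓ⁻^i_j(a) = r_y(S(u^i_j), a)`. -/
noncomputable def lMinus (i j : Fin G.N) : G.Coord →ₗ[ℂ] ℂ :=
  ry (HopfAlgebra.antipode ℂ (G.u i j))

/-- The antipode `S(X) = X ∘ S` of functionals. -/
noncomputable def dualAntipode (X : G.Coord →ₗ[ℂ] ℂ) : G.Coord →ₗ[ℂ] ℂ :=
  X ∘ₗ HopfAlgebra.antipode ℂ

/-- The Hopf bimodules `Γ_{+,z}` and `Γ_{-,z}`, `z = x y`: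
* `Δ_R(ω⁺_ij) = ω⁺_kl ⊗ u^k_i S(u^j_l)` and
  `ω⁺_ij ◁ a = r_y(u^k_i, a₍₁₎) r_x(a₍₂₎, u^j_l) ω⁺_kl = (S(ℓ⁻^k_i) ℓ⁺^j_l)(a) ω⁺_kl`,
* `Δ_R(ω⁻_ij) = ω⁻_kl ⊗ S²(u^k_i) S(u^j_l)` and
  `ω⁻_ij ◁ a = r_x(a₍₁₎, S(u^k_i)) r_y(S(u^j_l), a₍₂₎) ω⁻_kl = (S⁻¹(ℓ⁺^k_i) ℓ⁻^j_l)(a) ω⁻_kl`. -/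
noncomputable def bimodule : Pm → BimoduleData G.Coord G.Idx
  | .plus =>
    { v := Matrix.of fun c b => G.u c.1 b.1 * HopfAlgebra.antipode ℂ (G.u b.2 c.2)
      f := Matrix.of fun b c => conv (ry (G.u c.1 b.1)) (rx.flip (G.u b.2 c.2)) }
  | .minus =>
    { v := Matrix.of fun c b => HopfAlgebra.antipode ℂ (HopfAlgebra.antipode ℂ (G.u c.1 b.1))
        * HopfAlgebra.antipode ℂ (G.u b.2 c.2)
      f := Matrix.of fun b c => conv (rx.flip (HopfAlgebra.antipode ℂ (G.u c.1 b.1)))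
        (ry (HopfAlgebra.antipode ℂ (G.u b.2 c.2))) }

/-- The coinvariant forms `ω⁺_0 = ∑ ω⁺_ii` and `ω⁻_0 = ∑ d_i⁻¹ ω⁻_ii`. -/
noncomputable def omega0 : Pm → Tens G.Coord G.Idx 1
  | .plus => fun I => if (I 0).1 = (I 0).2 then 1 else 0
  | .minus => fun I => if (I 0).1 = (I 0).2 then algebraMap ℂ G.Coord (G.d (I 0).1)⁻¹ else 0

/-- The basis of the quantum tangent space which is dual to the basis `ω_ij`:
`X⁺_ij = S(ℓ⁻^i_k) ℓ⁺^k_j - δ_ij ε` and `X⁻_ij = d_i⁻¹ (S(ℓ⁺^i_k) ℓ⁻^k_j - δ_ij ε)`. -/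
noncomputable def X : Pm → Fin G.N → Fin G.N → G.Coord →ₗ[ℂ] ℂ
  | .plus => fun i j => (∑ k, conv (dualAntipode (lMinus ry i k)) (lPlus rx k j))
      - (if i = j then CoalgebraStruct.counit else 0)
  | .minus => fun i j => (G.d i)⁻¹ • ((∑ k, conv (dualAntipode (lPlus rx i k)) (lMinus ry k j))
      - (if i = j then CoalgebraStruct.counit else 0))

/-- `X⁺_0 = 𝔰⁻¹ (D⁻¹)^i_j X⁺_ij` and `X⁻_0 = 𝔰⁻¹ ∑ X⁻_ii`. -/
noncomputable def X0 : Pm → G.Coord →ₗ[ℂ] ℂ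
  | .plus => G.s⁻¹ • ∑ i, ∑ j, G.D⁻¹ i j • X rx ry .plus i j
  | .minus => G.s⁻¹ • ∑ i, X rx ry .minus i i

variable (G) in
/-- The metric `g(ω^τ_ij, ω^{-τ}_kl)`, that is, `g(ω⁺_ij, ω⁻_kl) = D^j_k (D⁻¹)^l_i` and
`g(ω⁻_ij, ω⁺_kl) = δ_jk δ_il`. -/
noncomputable def metric : Pm → G.Idx → G.Idx → ℂ
  | .plus => fun a b => G.D a.2 b.1 * G.D⁻¹ b.2 a.1
  | .minus => fun a b => if a.2 = b.1 ∧ a.1 = b.2 then 1 else 0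

/-- The braiding of `Γ_τ` and its inverse, `σ^{±1}`. -/
noncomputable def braid (τ : Pm) : Pm → Matrix (G.Idx × G.Idx) (G.Idx × G.Idx) ℂ
  | .plus => (bimodule rx ry τ).braiding
  | .minus => (bimodule rx ry τ).braiding⁻¹

/-- `g̃(ρ, ζ)` for `ρ ∈ Γ_τ^{⊗(k+1)}` and `ζ ∈ Γ_{-τ}`. -/
noncomputable def pairRight (τ : Pm) {k : ℕ} (ζ : Tens G.Coord G.Idx 1) :
    Tens G.Coord G.Idx (k + 1) →ₗ[ℂ] Tens G.Coord G.Idx k :=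
  LinearMap.pi fun J => ∑ a, ∑ b, G.metric τ a b •
    (LinearMap.proj (Fin.snoc J a : Fin (k + 1) → G.Idx) ∘ₗ
      ((bimodule rx ry τ).rmul (k + 1)).flip (ζ fun _ => b))

/-- `g̃(ζ, ρ)` for `ζ ∈ Γ_{-τ}` and `ρ ∈ Γ_τ^{⊗(k+1)}`. -/
noncomputable def pairLeft (τ : Pm) {k : ℕ} (ζ : Tens G.Coord G.Idx 1) :
    Tens G.Coord G.Idx (k + 1) →ₗ[ℂ] Tens G.Coord G.Idx k :=
  LinearMap.pi fun J => ∑ a, ∑ b, G.metric (-τ) a b •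
    (LinearMap.proj (fun _ => a) ∘ₗ (bimodule rx ry (-τ)).rmul 1 ζ ∘ₗ
      LinearMap.proj (Fin.cons b J : Fin (k + 1) → G.Idx))

/-- The contraction `⟨ρ, ζ⟩_± = g̃(B^±_{k,1} ρ, ζ)` for `ρ ∈ Γ_τ^{⊗(k+1)}` and `ζ ∈ Γ_{-τ}`. -/
noncomputable def contrRight (τ ν : Pm) {k : ℕ} (ζ : Tens G.Coord G.Idx 1) :
    Tens G.Coord G.Idx (k + 1) →ₗ[ℂ] Tens G.Coord G.Idx k :=
  pairRight rx ry τ ζ ∘ₗ shuffleSum (braid rx ry τ ν) k k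

/-- The contraction `⟨ζ, ρ⟩_± = g̃(ζ, B^±_{1,k} ρ)` for `ζ ∈ Γ_{-τ}` and `ρ ∈ Γ_τ^{⊗(k+1)}`. -/
noncomputable def contrLeft (τ ν : Pm) {k : ℕ} (ζ : Tens G.Coord G.Idx 1) :
    Tens G.Coord G.Idx (k + 1) →ₗ[ℂ] Tens G.Coord G.Idx k :=
  pairLeft rx ry τ ζ ∘ₗ shuffleSum (braid rx ry τ ν) k 1

/-- The external algebra `Γ_τ^{∧k}`. -/
abbrev Form (τ : Pm) (k : ℕ) : Type := ExtPower G.Coord (braid rx ry τ .plus) k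

/-- The elements `a` of `O(G_q)`, as forms of degree zero. -/
noncomputable def coeff (τ : Pm) : G.Coord →ₗ[ℂ] Form rx ry τ 0 := ExtPower.ofCoeff _

/-- `ρ ↦ ω^τ_0 ∧ ρ - (-1)^k ρ ∧ ω^τ_0` on representatives. -/
noncomputable def dTens (τ : Pm) (k : ℕ) :
    Tens G.Coord G.Idx k →ₗ[ℂ] Form rx ry τ (k + 1) :=
  ExtPower.proj _ (k + 1) ∘ₗ ((bimodule rx ry τ).tensorLeft (omega0 τ)
    - (-1 : ℂ) ^ k • (bimodule rx ry τ).tensorRight (omega0 τ))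

/-- The differential `d_τ`. -/
noncomputable def diff (τ : Pm) (k : ℕ) : Form rx ry τ k →ₗ[ℂ] Form rx ry τ (k + 1) :=
  ExtPower.induced _ (dTens rx ry τ k)

/-- `ρ ↦ ⟨ρ, ω^{-τ}_0⟩_± + (-1)^{k+1} ⟨ω^{-τ}_0, ρ⟩_±` on representatives of degree `k + 1`. -/
noncomputable def codTens (τ ν : Pm) (k : ℕ) :
    Tens G.Coord G.Idx (k + 1) →ₗ[ℂ] Form rx ry τ k :=
  ExtPower.proj _ k ∘ₗ (contrRight rx ry τ ν (omega0 (-τ))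
    + (-1 : ℂ) ^ (k + 1) • contrLeft rx ry τ ν (omega0 (-τ)))

/-- The codifferential `∂^±_τ` on forms of degree `k + 1`; it is zero on forms of degree `0`. -/
noncomputable def codiff (τ ν : Pm) (k : ℕ) : Form rx ry τ (k + 1) →ₗ[ℂ] Form rx ry τ k :=
  ExtPower.induced _ (codTens rx ry τ ν k)

/-- The quantum Laplace-Beltrami operators `-d ∂^± + ∂^± d`. -/
noncomputable def laplace (τ ν : Pm) : (k : ℕ) → Form rx ry τ k →ₗ[ℂ] Form rx ry τ k
  | 0 => codiff rx ry τ ν 0 ∘ₗ diff rx ry τ 0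
  | k + 1 => -(diff rx ry τ k ∘ₗ codiff rx ry τ ν k)
      + codiff rx ry τ ν (k + 1) ∘ₗ diff rx ry τ (k + 1)

/-- `ρ ↦ ρ₍₀₎ ⊗ ρ₍₁₎` on representatives. -/
noncomputable def coactRTens (τ : Pm) (k : ℕ) :
    Tens G.Coord G.Idx k →ₗ[ℂ] Form rx ry τ k ⊗[ℂ] G.Coord :=
  (ExtPower.proj _ k).rTensor G.Coord ∘ₗ (bimodule rx ry τ).coactR k

/-- `ρ ↦ ρ₍₋₁₎ ⊗ ρ₍₀₎` on representatives. -/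
noncomputable def coactLTens (τ : Pm) (k : ℕ) :
    Tens G.Coord G.Idx k →ₗ[ℂ] G.Coord ⊗[ℂ] Form rx ry τ k :=
  (ExtPower.proj _ k).lTensor G.Coord ∘ₗ BimoduleData.coactL k

/-- `X ∗ ρ = ρ₍₀₎ X(ρ₍₁₎)`. -/
noncomputable def formLeftAct (τ : Pm) (k : ℕ) (X : G.Coord →ₗ[ℂ] ℂ) :
    Form rx ry τ k →ₗ[ℂ] Form rx ry τ k :=
  (TensorProduct.rid ℂ _).toLinearMap ∘ₗ X.lTensor _ ∘ₗ ExtPower.induced _ (coactRTens rx ry τ k)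

/-- `ρ ∗ X = X(ρ₍₋₁₎) ρ₍₀₎`. -/
noncomputable def formRightAct (τ : Pm) (k : ℕ) (X : G.Coord →ₗ[ℂ] ℂ) :
    Form rx ry τ k →ₗ[ℂ] Form rx ry τ k :=
  (TensorProduct.lid ℂ _).toLinearMap ∘ₗ X.rTensor _ ∘ₗ ExtPower.induced _ (coactLTens rx ry τ k)

end QuantumGroup
end QuantumGroups

open QuantumGroups

/-! In a basis of left-coinvariant forms an element of Γ_τ^{⊗k} is a tensor with entries in A, on
which the braiding acts through a scalar matrix. Everything reduces to four operators: ω₀ ⊗ ρ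
(`appendFirst`), ρ ⊗ ω₀ (`appendLast`), and the contractions with ω₀^{-τ} of the first leg
(`contrFirst`) and of the last leg (`contrLast`). The two operators at the first leg involve
functionals on A, because coefficients have to be moved past an invariant form; the two at the last
leg involve only scalars.

The computation is a cancellation. The shuffle sum for the last leg satisfies two recursions: it is
1 − σ_last (B ⊗ 1), with B the shuffle sum of one rank less, and it is also (1 ⊗ B) plus or minus
the full product σ_last ⋯ σ_first. The first recursion is applied to ρ ⊗ ω₀, the second to ω₀ ⊗ ρ,
and the shuffle sum for the first leg is treated as the mirror image. All mixed terms of ∂d are then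
matched by those of d∂. What remains is (−1)^k (X + Y − 2𝔰): in X the form ω₀ has travelled from the
left through all of ρ and is contracted at the right end, Y is the mirror image, and 2𝔰 comes from
contracting ω₀ directly with its dual. `IsContraction` lists the compatibilities that this needs,
and `laplace_succ` carries it out.

For σ, the operator X is the right coaction followed by one functional, and Y is the left coaction
followed by another. Up to the factor 𝔰 these functionals are X_0^τ + ε and X_0^{-τ} + ε
(`sum_contrCoeff_row`), so the counits cancel 2𝔰. For σ⁻¹, invariance of the contractions allows a
preceding σ to be inserted, which cancels σ⁻¹; the effect is that the two coactions are exchanged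
(`isContraction_braiding`, `isContraction_braiding_inv`).

Well-definedness rests on Matsumoto's theorem, which makes σ_π independent of the reduced word, and
on the factorisations of A_{k+1} with A_k ⊗ 1 or 1 ⊗ A_k as a left factor (for ∂) and as a right
factor (for d). For ∂⁻ the kernels of the antisymmetrisers of σ and σ⁻¹ have to agree; they do,
because multiplication by σ of the longest permutation turns one antisymmetriser into the other up
to sign.

The Hopf-algebraic input is that universal r-forms yield Yetter-Drinfeld modules, and that S² is
conjugation by D (`antipode_sq_u`). The latter makes Γ_+ and Γ_- dual with invariant metric and
invariant ω₀ (`invariantPairing`). Transcendence of q gives 𝔰 ≠ 0. -/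

namespace QuantumGroups

/-! ### Convolution of functionals -/

section Convolution

variable {E : Type} [AddCommGroup E] [Module ℂ E] [Coalgebra ℂ E]

/-- By this identification the convolution product inherits associativity and the unit from the
convolution ring. -/
theorem conv_eq (X Y : E →ₗ[ℂ] ℂ) :
    conv X Y = (WithConv.toConv X * WithConv.toConv Y : WithConv (E →ₗ[ℂ] ℂ)).ofConv := rfl

theorem conv_assoc (X Y Z : E →ₗ[ℂ] ℂ) : conv (conv X Y) Z = conv X (conv Y Z) := by
  simp only [conv_eq, WithConv.toConv_ofConv, mul_assoc]

theorem counit_eq :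
    (CoalgebraStruct.counit : E →ₗ[ℂ] ℂ) = (1 : WithConv (E →ₗ[ℂ] ℂ)).ofConv := rfl

@[simp]
theorem conv_counit (X : E →ₗ[ℂ] ℂ) : conv X CoalgebraStruct.counit = X := by
  rw [counit_eq, conv_eq, WithConv.toConv_ofConv, mul_one]

@[simp]
theorem counit_conv (X : E →ₗ[ℂ] ℂ) : conv CoalgebraStruct.counit X = X := by
  rw [counit_eq, conv_eq, WithConv.toConv_ofConv, one_mul]

/-- The convolution product as a bilinear map. -/
noncomputable def convBilin : (E →ₗ[ℂ] ℂ) →ₗ[ℂ] (E →ₗ[ℂ] ℂ) →ₗ[ℂ] (E →ₗ[ℂ] ℂ) :=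
  LinearMap.mk₂ ℂ conv
    (fun X Y Z => by simp [conv, TensorProduct.map_add_left, LinearMap.add_comp, LinearMap.comp_add])
    (fun c X Y => by simp [conv, TensorProduct.map_smul_left, LinearMap.smul_comp, LinearMap.comp_smul])
    (fun X Y Z => by simp [conv, TensorProduct.map_add_right, LinearMap.add_comp, LinearMap.comp_add])
    (fun c X Y => by simp [conv, TensorProduct.map_smul_right, LinearMap.smul_comp, LinearMap.comp_smul])

theorem conv_sum_left {κ : Type} (s : Finset κ) (X : κ → E →ₗ[ℂ] ℂ) (Y : E →ₗ[ℂ] ℂ) :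
    conv (∑ i ∈ s, X i) Y = ∑ i ∈ s, conv (X i) Y := by
  change convBilin (∑ i ∈ s, X i) Y = ∑ i ∈ s, convBilin (X i) Y
  simp

theorem conv_sum_right {κ : Type} (s : Finset κ) (X : E →ₗ[ℂ] ℂ) (Y : κ → E →ₗ[ℂ] ℂ) :
    conv X (∑ i ∈ s, Y i) = ∑ i ∈ s, conv X (Y i) := by
  change convBilin X (∑ i ∈ s, Y i) = ∑ i ∈ s, convBilin X (Y i)
  simp

@[simp]
theorem conv_smul_left (c : ℂ) (X Y : E →ₗ[ℂ] ℂ) : conv (c • X) Y = c • conv X Y := by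
  change convBilin (c • X) Y = c • convBilin X Y
  simp

@[simp]
theorem conv_smul_right (c : ℂ) (X Y : E →ₗ[ℂ] ℂ) : conv X (c • Y) = c • conv X Y := by
  change convBilin X (c • Y) = c • convBilin X Y
  simp

@[simp]
theorem conv_zero_left (Y : E →ₗ[ℂ] ℂ) : conv 0 Y = 0 := by
  change convBilin 0 Y = 0
  simp

@[simp]
theorem conv_zero_right (Y : E →ₗ[ℂ] ℂ) : conv Y 0 = 0 := by
  change convBilin Y 0 = 0
  simp

theorem conv_apply_repr (X Y : E →ₗ[ℂ] ℂ) {a : E} {κ : Type} (r : Coalgebra.Repr ℂ a κ) :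
    conv X Y a = ∑ i ∈ r.index, X (r.left i) * Y (r.right i) := by
  simp only [conv, LinearMap.comp_apply]
  rw [← r.eq]
  simp

theorem leftAct_apply_repr (X : E →ₗ[ℂ] ℂ) {a : E} {κ : Type} (r : Coalgebra.Repr ℂ a κ) :
    leftAct X a = ∑ i ∈ r.index, X (r.right i) • r.left i := by
  simp only [leftAct, LinearMap.comp_apply]
  rw [← r.eq]
  simp

theorem rightAct_apply_repr (X : E →ₗ[ℂ] ℂ) {a : E} {κ : Type} (r : Coalgebra.Repr ℂ a κ) :
    rightAct X a = ∑ i ∈ r.index, X (r.left i) • r.right i := by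
  simp only [rightAct, LinearMap.comp_apply]
  rw [← r.eq]
  simp

/-- `leftAct` as a linear map. -/
noncomputable def leftActLin : (E →ₗ[ℂ] ℂ) →ₗ[ℂ] (E →ₗ[ℂ] E) where
  toFun := leftAct
  map_add' X Y := by simp [leftAct, LinearMap.lTensor_add, LinearMap.add_comp, LinearMap.comp_add]
  map_smul' c X := by
    simp [leftAct, LinearMap.lTensor_smul, LinearMap.smul_comp, LinearMap.comp_smul]

/-- `rightAct` as a linear map. -/
noncomputable def rightActLin : (E →ₗ[ℂ] ℂ) →ₗ[ℂ] (E →ₗ[ℂ] E) where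
  toFun := rightAct
  map_add' X Y := by simp [rightAct, LinearMap.rTensor_add, LinearMap.add_comp, LinearMap.comp_add]
  map_smul' c X := by
    simp [rightAct, LinearMap.rTensor_smul, LinearMap.smul_comp, LinearMap.comp_smul]

theorem leftAct_sum {κ : Type} (s : Finset κ) (X : κ → E →ₗ[ℂ] ℂ) :
    leftAct (∑ i ∈ s, X i) = ∑ i ∈ s, leftAct (X i) := map_sum leftActLin X s

theorem rightAct_sum {κ : Type} (s : Finset κ) (X : κ → E →ₗ[ℂ] ℂ) :
    rightAct (∑ i ∈ s, X i) = ∑ i ∈ s, rightAct (X i) := map_sum rightActLin X s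

@[simp]
theorem leftAct_smul (c : ℂ) (X : E →ₗ[ℂ] ℂ) : leftAct (c • X) = c • leftAct X :=
  map_smul leftActLin c X

@[simp]
theorem rightAct_smul (c : ℂ) (X : E →ₗ[ℂ] ℂ) : rightAct (c • X) = c • rightAct X :=
  map_smul rightActLin c X

theorem leftAct_add (X Y : E →ₗ[ℂ] ℂ) : leftAct (X + Y) = leftAct X + leftAct Y :=
  map_add leftActLin X Y

theorem rightAct_add (X Y : E →ₗ[ℂ] ℂ) : rightAct (X + Y) = rightAct X + rightAct Y :=
  map_add rightActLin X Y

@[simp]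
theorem leftAct_counit : leftAct (CoalgebraStruct.counit : E →ₗ[ℂ] ℂ) = LinearMap.id := by
  ext a
  simp [leftAct]

@[simp]
theorem rightAct_counit : rightAct (CoalgebraStruct.counit : E →ₗ[ℂ] ℂ) = LinearMap.id := by
  ext a
  simp [rightAct]

/-- Pairing an action with a functional turns it into a convolution product. Since functionals
separate points, identities between actions become instances of associativity of `conv`. -/
theorem apply_leftAct (X Y : E →ₗ[ℂ] ℂ) (a : E) : X (leftAct Y a) = conv X Y a := by
  obtain ⟨κ, r⟩ : Nonempty (Σ κ : Type, Coalgebra.Repr ℂ a κ) := ⟨⟨_, Coalgebra.Repr.arbitrary ℂ a⟩⟩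
  rw [leftAct_apply_repr Y r, conv_apply_repr X Y r]
  simp [mul_comm]

theorem apply_rightAct (X Y : E →ₗ[ℂ] ℂ) (a : E) : Y (rightAct X a) = conv X Y a := by
  rw [rightAct_apply_repr X (Coalgebra.Repr.arbitrary ℂ a),
    conv_apply_repr X Y (Coalgebra.Repr.arbitrary ℂ a)]
  simp

end Convolution

/-! ### The commuting left and right actions of the dual algebra. -/

section Separation
variable {E : Type} [AddCommGroup E] [Module ℂ E] [Coalgebra ℂ E]

/-- Functionals separate points. -/
theorem eq_of_forall_functional {V : Type} [AddCommGroup V] [Module ℂ V] {a b : V}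
    (h : ∀ X : V →ₗ[ℂ] ℂ, X a = X b) : a = b := by
  rw [← sub_eq_zero]
  refine (Module.forall_dual_apply_eq_zero_iff ℂ _).mp fun X => ?_
  rw [map_sub, h, sub_self]

theorem leftAct_conv (X Y : E →ₗ[ℂ] ℂ) (a : E) : leftAct (conv X Y) a = leftAct X (leftAct Y a) :=
  eq_of_forall_functional fun Z => by simp only [apply_leftAct, conv_assoc]

theorem rightAct_conv (X Y : E →ₗ[ℂ] ℂ) (a : E) :
    rightAct (conv X Y) a = rightAct Y (rightAct X a) :=
  eq_of_forall_functional fun Z => by simp only [apply_rightAct, conv_assoc]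

theorem leftAct_rightAct (X Y : E →ₗ[ℂ] ℂ) (a : E) :
    leftAct X (rightAct Y a) = rightAct Y (leftAct X a) :=
  eq_of_forall_functional fun Z => by simp only [apply_leftAct, apply_rightAct, conv_assoc]

end Separation

/-! ### Functionals evaluated on products. -/

section Bialg
variable {A : Type} [Ring A] [HopfAlgebra ℂ A]

/-- Multiplicativity of the comultiplication lets the two coproduct formulas be inserted factor by
factor. This is the source of the multiplicativity of `f` on a tensor product of modules. -/
theorem conv_apply_mul {κ κ' : Type} [Fintype κ] [Fintype κ'] {X Y : A →ₗ[ℂ] ℂ}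
    {X₁ X₂ : κ → A →ₗ[ℂ] ℂ} {Y₁ Y₂ : κ' → A →ₗ[ℂ] ℂ}
    (hX : ∀ a b, X (a * b) = ∑ m, X₁ m a * X₂ m b)
    (hY : ∀ a b, Y (a * b) = ∑ n, Y₁ n a * Y₂ n b) (a b : A) :
    conv X Y (a * b) = ∑ m, ∑ n, conv (X₁ m) (Y₁ n) a * conv (X₂ m) (Y₂ n) b := by
  simp only [conv, LinearMap.comp_apply, Bialgebra.comul_mul]
  generalize (CoalgebraStruct.comul a : A ⊗[ℂ] A) = s
  generalize (CoalgebraStruct.comul b : A ⊗[ℂ] A) = t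
  induction s using TensorProduct.induction_on with
  | zero => simp
  | add s s' h h' => simp only [add_mul, map_add, h, h', Finset.sum_add_distrib]
  | tmul s s' =>
    induction t using TensorProduct.induction_on with
    | zero => simp
    | add t t' h h' => simp only [mul_add, map_add, h, h', Finset.sum_add_distrib]
    | tmul t t' =>
      simp only [Algebra.TensorProduct.tmul_mul_tmul, TensorProduct.map_tmul, hX, hY,
        LinearMap.mul'_apply, Finset.sum_mul_sum]
      refine Finset.sum_congr rfl fun m _ => Finset.sum_congr rfl fun n _ => ?_
      ring

/-- The functional `a ↦ X(a b)`. -/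
noncomputable def shiftR (X : A →ₗ[ℂ] ℂ) (b : A) : A →ₗ[ℂ] ℂ := X ∘ₗ LinearMap.mulRight ℂ b

@[simp]
theorem shiftR_apply (X : A →ₗ[ℂ] ℂ) (a b : A) : shiftR X b a = X (a * b) := rfl

end Bialg

end QuantumGroups

namespace QuantumGroups

/-! ### Yetter-Drinfeld structure matrices -/

section YetterDrinfeld

variable {A : Type} [Ring A] [HopfAlgebra ℂ A]
variable {ι κ : Type} [Fintype ι] [Fintype κ]

theorem leftAct_of_comul {a : A} {l r : κ → A}
    (h : CoalgebraStruct.comul (R := ℂ) a = ∑ k, l k ⊗ₜ r k) (X : A →ₗ[ℂ] ℂ) :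
    leftAct X a = ∑ k, X (r k) • l k := by
  simp [leftAct, h]

theorem rightAct_of_comul {a : A} {l r : κ → A}
    (h : CoalgebraStruct.comul (R := ℂ) a = ∑ k, l k ⊗ₜ r k) (X : A →ₗ[ℂ] ℂ) :
    rightAct X a = ∑ k, X (l k) • r k := by
  simp [rightAct, h]

theorem conv_of_comul {a : A} {l r : κ → A}
    (h : CoalgebraStruct.comul (R := ℂ) a = ∑ k, l k ⊗ₜ r k) (X Y : A →ₗ[ℂ] ℂ) :
    conv X Y a = ∑ k, X (l k) * Y (r k) := by
  simp [conv, h]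

variable [DecidableEq ι] [DecidableEq κ]

/-- The structure matrices `(v, f)` define a Yetter-Drinfeld module, that is, a Hopf bimodule,
with bijective braiding. -/
structure BimoduleData.IsYD (Γ : BimoduleData A ι) : Prop where
  f_one : ∀ i j, Γ.f i j 1 = if i = j then 1 else 0
  f_mul : ∀ i j a b, Γ.f i j (a * b) = ∑ k, Γ.f i k a * Γ.f k j b
  comul_v : ∀ i j, CoalgebraStruct.comul (R := ℂ) (Γ.v i j) = ∑ k, Γ.v i k ⊗ₜ Γ.v k j
  counit_v : ∀ i j, CoalgebraStruct.counit (R := ℂ) (Γ.v i j) = if i = j then 1 else 0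
  -- Compatibility of the right adjoint action with the right coaction, written for structure
  -- matrices.
  yd : ∀ i k a, ∑ j, leftAct (Γ.f i j) a * Γ.v k j = ∑ j, Γ.v j i * rightAct (Γ.f j k) a
  -- The factors stand in the opposite order, so `w` plays the role of S⁻¹(v); it yields the inverse
  -- of the braiding.
  exists_inv : ∃ w : Matrix ι ι A, ∀ y c, ∑ b, w b y * Γ.v c b = if c = y then 1 else 0

theorem conv_apply_one (X Y : A →ₗ[ℂ] ℂ) : conv X Y 1 = X 1 * Y 1 := by
  simp [conv, Algebra.TensorProduct.one_def]

/-- The tensor product over `ℂ` of two Yetter-Drinfeld modules. -/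
noncomputable def BimoduleData.tensor (Γ₁ : BimoduleData A ι) (Γ₂ : BimoduleData A κ) :
    BimoduleData A (ι × κ) where
  v := Matrix.of fun c b => Γ₁.v c.1 b.1 * Γ₂.v c.2 b.2
  f := Matrix.of fun b c => conv (Γ₁.f b.1 c.1) (Γ₂.f b.2 c.2)

/-- The element `a` is moved past the two factors one at a time: the condition for `Γ₁` replaces a
left action by a right action, the two actions commute, and the condition for `Γ₂` does the rest.
The calculi of both signs arise as such tensor products. -/
theorem BimoduleData.IsYD.tensor {Γ₁ : BimoduleData A ι} {Γ₂ : BimoduleData A κ}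
    (h₁ : Γ₁.IsYD) (h₂ : Γ₂.IsYD) : (Γ₁.tensor Γ₂).IsYD where
  f_one := by
    rintro ⟨i, i'⟩ ⟨j, j'⟩
    simp only [BimoduleData.tensor, Matrix.of_apply, conv_apply_one, h₁.f_one, h₂.f_one,
      Prod.mk.injEq]
    split_ifs <;> simp_all
  f_mul := by
    rintro ⟨i, i'⟩ ⟨j, j'⟩ a b
    simp only [BimoduleData.tensor, Matrix.of_apply, Fintype.sum_prod_type]
    exact conv_apply_mul (X₁ := fun m => Γ₁.f i m) (X₂ := fun m => Γ₁.f m j)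
      (Y₁ := fun m => Γ₂.f i' m) (Y₂ := fun m => Γ₂.f m j') (h₁.f_mul i j) (h₂.f_mul i' j') a b
  comul_v := by
    rintro ⟨i, i'⟩ ⟨j, j'⟩
    simp only [BimoduleData.tensor, Matrix.of_apply, Bialgebra.comul_mul, h₁.comul_v, h₂.comul_v,
      Finset.sum_mul_sum, Algebra.TensorProduct.tmul_mul_tmul, Fintype.sum_prod_type]
  counit_v := by
    rintro ⟨i, i'⟩ ⟨j, j'⟩
    simp only [BimoduleData.tensor, Matrix.of_apply, Bialgebra.counit_mul, h₁.counit_v,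
      h₂.counit_v, Prod.mk.injEq]
    split_ifs <;> simp_all
  yd := by
    rintro ⟨i, i'⟩ ⟨k, k'⟩ a
    simp only [BimoduleData.tensor, Matrix.of_apply, Fintype.sum_prod_type, leftAct_conv,
      rightAct_conv]
    calc ∑ x, ∑ y, leftAct (Γ₁.f i x) (leftAct (Γ₂.f i' y) a) * (Γ₁.v k x * Γ₂.v k' y)
        = ∑ y, (∑ x, leftAct (Γ₁.f i x) (leftAct (Γ₂.f i' y) a) * Γ₁.v k x) * Γ₂.v k' y := by
          rw [Finset.sum_comm]
          simp only [Finset.sum_mul, mul_assoc]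
      _ = ∑ x, Γ₁.v x i * ∑ y, leftAct (Γ₂.f i' y) (rightAct (Γ₁.f x k) a) * Γ₂.v k' y := by
          simp only [h₁.yd, Finset.sum_mul, Finset.mul_sum, mul_assoc, leftAct_rightAct]
          rw [Finset.sum_comm]
      _ = _ := by
          simp only [h₂.yd, Finset.mul_sum, mul_assoc]
  exists_inv := by
    obtain ⟨w₁, hw₁⟩ := h₁.exists_inv
    obtain ⟨w₂, hw₂⟩ := h₂.exists_inv
    refine ⟨Matrix.of fun b y => w₂ b.2 y.2 * w₁ b.1 y.1, ?_⟩
    rintro ⟨y, y'⟩ ⟨c, c'⟩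
    simp only [BimoduleData.tensor, Matrix.of_apply, Fintype.sum_prod_type, Prod.mk.injEq]
    calc ∑ x, ∑ x', w₂ x' y' * w₁ x y * (Γ₁.v c x * Γ₂.v c' x')
        = ∑ x', w₂ x' y' * (∑ x, w₁ x y * Γ₁.v c x) * Γ₂.v c' x' := by
          rw [Finset.sum_comm]
          simp only [Finset.sum_mul, Finset.mul_sum, mul_assoc]
      _ = _ := by
          rw [hw₁]
          by_cases h : c = y <;> simp [h, hw₂]

namespace BimoduleData.IsYD

variable {Γ : BimoduleData A ι} (hΓ : Γ.IsYD)
include hΓ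

/-- This is the Yetter-Drinfeld condition at a matrix entry of `v`, whose coproduct is again a
matrix product. -/
theorem rtt : RTT Γ.braiding Γ.v := by
  intro i j k l
  have h := hΓ.yd k j (Γ.v i l)
  simp only [leftAct_of_comul (hΓ.comul_v i l), rightAct_of_comul (hΓ.comul_v i l),
    Finset.sum_mul, Finset.mul_sum, smul_mul_assoc, mul_smul_comm] at h
  simp only [BimoduleData.braiding, Matrix.of_apply, Fintype.sum_prod_type]
  rw [← h, Finset.sum_comm]

/-- Since `f` is multiplicative, the product of the two matrices is `f` evaluated on the sum that
defines `w`, hence on a scalar. -/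
theorem braiding_mul_inv {w : Matrix ι ι A}
    (hw : ∀ y c, ∑ b, w b y * Γ.v c b = if c = y then 1 else 0) :
    Γ.braiding * (Matrix.of fun a c => Γ.f c.2 a.1 (w a.2 c.1)) = 1 := by
  ext ⟨e, g⟩ ⟨c, d⟩
  simp only [Matrix.mul_apply, BimoduleData.braiding, Matrix.of_apply, Fintype.sum_prod_type]
  calc ∑ a, ∑ b, Γ.f a g (Γ.v e b) * Γ.f d a (w b c)
      = Γ.f d g (∑ b, w b c * Γ.v e b) := by
        rw [Finset.sum_comm, map_sum]
        simp only [hΓ.f_mul, mul_comm]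
    _ = _ := by
        rw [hw, Matrix.one_apply]
        by_cases h : e = c <;> simp [h, hΓ.f_one, eq_comm]

theorem isUnit_braiding : IsUnit Γ.braiding := by
  obtain ⟨w, hw⟩ := hΓ.exists_inv
  exact (Matrix.isUnit_iff_isUnit_det _).mpr
    (Matrix.isUnit_det_of_right_inverse (hΓ.braiding_mul_inv hw))

/-- The entries of `f` form a representation of A; applying it to the relation `rtt` for `v` gives
the Yang-Baxter equation. -/
theorem yang_baxter (i j k x y z : ι) :
    ∑ a : ι × ι, ∑ b, Γ.braiding (i, j) a * Γ.braiding (a.2, k) (b, z) * Γ.braiding (a.1, b) (x, y)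
      = ∑ a : ι × ι, ∑ b,
        Γ.braiding (j, k) a * Γ.braiding (i, a.1) (x, b) * Γ.braiding (b, a.2) (y, z) := by
  have h := congrArg (Γ.f x k) (hΓ.rtt i j y z)
  simp only [map_sum, map_smul, hΓ.f_mul, smul_eq_mul, Fintype.sum_prod_type,
    BimoduleData.braiding, Matrix.of_apply, Finset.mul_sum] at h ⊢
  calc _ = _ := by
        refine Finset.sum_congr rfl fun a _ => Finset.sum_congr rfl fun b _ =>
          Finset.sum_congr rfl fun c _ => ?_
        ring
    _ = _ := h
    _ = ∑ m, ∑ a1, ∑ a2, Γ.f y a2 (Γ.v a1 z) * (Γ.f x m (Γ.v i a1) * Γ.f m k (Γ.v j a2)) := by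
        rw [Finset.sum_congr rfl fun a _ => Finset.sum_comm]
        rw [Finset.sum_comm]
    _ = _ := by
        refine Finset.sum_congr rfl fun m _ => ?_
        rw [Finset.sum_comm]
        refine Finset.sum_congr rfl fun b _ =>
          Finset.sum_congr rfl fun c _ => ?_
        ring

theorem comul_tensorPow (k : ℕ) (I J : Fin k → ι) :
    CoalgebraStruct.comul (R := ℂ) (tensorPow Γ.v k I J)
      = ∑ K, tensorPow Γ.v k I K ⊗ₜ tensorPow Γ.v k K J := by
  induction k with
  | zero => simp [tensorPow_zero, Algebra.TensorProduct.one_def]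
  | succ k ih =>
    rw [← Fin.cons_self_tail I, ← Fin.cons_self_tail J]
    simp only [tensorPow_cons, Bialgebra.comul_mul, ih, hΓ.comul_v, sum_cons, Finset.sum_mul_sum,
      Algebra.TensorProduct.tmul_mul_tmul]

theorem counit_tensorPow (k : ℕ) (I J : Fin k → ι) :
    CoalgebraStruct.counit (R := ℂ) (tensorPow Γ.v k I J) = if I = J then 1 else 0 := by
  induction k with
  | zero => simp [tensorPow_zero, Subsingleton.elim I J]
  | succ k ih =>
    rw [← Fin.cons_self_tail I, ← Fin.cons_self_tail J]
    simp only [tensorPow_cons, Bialgebra.counit_mul, ih, hΓ.counit_v, Fin.cons_inj]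
    split_ifs <;> simp_all

end BimoduleData.IsYD

end YetterDrinfeld

end QuantumGroups

namespace QuantumGroups

/-! ### Reduced words in the symmetric group -/

section Matsumoto

variable {k : ℕ}

/-- `i` is a left descent of `π`. -/
def LeftDescent (i : Fin k) (π : Equiv.Perm (Fin (k + 1))) : Prop :=
  π⁻¹ i.succ < π⁻¹ i.castSucc

theorem simpleSwap_apply_castSucc (i : Fin k) : simpleSwap i i.castSucc = i.succ :=
  Equiv.swap_apply_left _ _

theorem simpleSwap_apply_succ (i : Fin k) : simpleSwap i i.succ = i.castSucc :=
  Equiv.swap_apply_right _ _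

theorem simpleSwap_mul_self (i : Fin k) : simpleSwap i * simpleSwap i = 1 :=
  Equiv.swap_mul_self _ _

theorem simpleSwap_inv (i : Fin k) : (simpleSwap i)⁻¹ = simpleSwap i :=
  Equiv.swap_inv _ _

theorem simpleSwap_mul_cancel (i : Fin k) (π : Equiv.Perm (Fin (k + 1))) :
    simpleSwap i * (simpleSwap i * π) = π := by
  rw [← mul_assoc, simpleSwap_mul_self, one_mul]

theorem simpleSwap_val (i : Fin k) (x : Fin (k + 1)) : (simpleSwap i x : ℕ) =
    if (x : ℕ) = i then (i : ℕ) + 1 else if (x : ℕ) = i + 1 then (i : ℕ) else x := by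
  simp only [simpleSwap, Equiv.swap_apply_def, Fin.ext_iff, Fin.val_castSucc, Fin.val_succ]
  split_ifs <;> simp

/-- Left multiplication exchanges two neighbouring values, so only the pair of positions carrying
these values changes its relative order; it becomes one new inversion. -/
theorem inversions_simpleSwap_mul (i : Fin k) (π : Equiv.Perm (Fin (k + 1)))
    (h : π⁻¹ i.castSucc < π⁻¹ i.succ) : inversions (simpleSwap i * π) = inversions π + 1 := by
  classical
  have hx : ∀ a : Fin (k + 1), a = π⁻¹ i.castSucc ↔ (π a : ℕ) = i := by
    intro a
    rw [Equiv.Perm.eq_inv_iff_eq, Fin.ext_iff, Fin.val_castSucc]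
  have hy : ∀ a : Fin (k + 1), a = π⁻¹ i.succ ↔ (π a : ℕ) = i + 1 := by
    intro a
    rw [Equiv.Perm.eq_inv_iff_eq, Fin.ext_iff, Fin.val_succ]
  have hset : (Finset.univ.filter fun a : Fin (k + 1) × Fin (k + 1) =>
        a.1 < a.2 ∧ (simpleSwap i * π) a.2 < (simpleSwap i * π) a.1)
      = insert (π⁻¹ i.castSucc, π⁻¹ i.succ)
        (Finset.univ.filter fun a : Fin (k + 1) × Fin (k + 1) => a.1 < a.2 ∧ π a.2 < π a.1) := by
    ext ⟨a, b⟩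
    simp only [Finset.mem_filter, Finset.mem_univ, true_and, Finset.mem_insert, Prod.mk.injEq,
      Equiv.Perm.mul_apply, Fin.lt_def (a := simpleSwap i _), simpleSwap_val, hx, hy,
      Fin.lt_def (a := π _)]
    have hab : a < b → (π a : ℕ) ≠ π b := fun hab e => hab.ne (π.injective (Fin.ext e))
    by_cases h1 : (π a : ℕ) = i ∧ (π b : ℕ) = i + 1
    · have : a < b := by rw [(hx a).mpr h1.1, (hy b).mpr h1.2]; exact h
      simp [h1, this]
    · by_cases h2 : (π a : ℕ) = i + 1 ∧ (π b : ℕ) = i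
      · have : ¬ a < b := by rw [(hy a).mpr h2.1, (hx b).mpr h2.2]; exact h.not_gt
        simp [h2, this]
      · simp only [h1, false_or]
        refine and_congr_right fun hlt => ?_
        have := hab hlt
        split_ifs <;> omega
  rw [inversions, hset, Finset.card_insert_of_notMem, inversions]
  simp only [Finset.mem_filter, not_and, Finset.mem_univ, true_and]
  intro _
  simp [Fin.lt_def]

theorem LeftDescent.inversions {i : Fin k} {π : Equiv.Perm (Fin (k + 1))} (h : LeftDescent i π) :
    inversions π = inversions (simpleSwap i * π) + 1 := by
  conv_lhs => rw [← simpleSwap_mul_cancel i π]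
  refine inversions_simpleSwap_mul i _ ?_
  rw [mul_inv_rev, simpleSwap_inv, Equiv.Perm.mul_apply, Equiv.Perm.mul_apply,
    simpleSwap_apply_castSucc, simpleSwap_apply_succ]
  exact h

theorem not_leftDescent {i : Fin k} {π : Equiv.Perm (Fin (k + 1))} (h : ¬ LeftDescent i π) :
    π⁻¹ i.castSucc < π⁻¹ i.succ := by
  refine lt_of_le_of_ne (not_lt.mp h) fun e => ?_
  have := π⁻¹.injective e
  simp [Fin.ext_iff] at this

theorem perm_eq_one_of_strictMono {n : ℕ} {π : Equiv.Perm (Fin n)} (h : StrictMono π) : π = 1 := by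
  let f : Fin n ≃o Fin n := h.orderIsoOfSurjective π π.surjective
  have : f = OrderIso.refl _ := Subsingleton.elim _ _
  ext a
  have := DFunLike.congr_fun this a
  simpa [f] using congrArg Fin.val this

theorem eq_one_of_no_leftDescent {π : Equiv.Perm (Fin (k + 1))} (h : ∀ i, ¬ LeftDescent i π) :
    π = 1 := by
  rw [← inv_eq_one]
  exact perm_eq_one_of_strictMono (Fin.strictMono_iff_lt_succ.mpr fun i => not_leftDescent (h i))

theorem inversions_one (n : ℕ) : inversions (1 : Equiv.Perm (Fin n)) = 0 := by
  rw [inversions, Finset.card_eq_zero, Finset.filter_eq_empty_iff]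
  rintro ⟨a, b⟩ _ ⟨h1, h2⟩
  exact lt_asymm h1 h2

theorem inversions_prod_le (w : List (Fin k)) : inversions (w.map simpleSwap).prod ≤ w.length := by
  induction w with
  | nil => simp [inversions_one]
  | cons i w ih =>
    simp only [List.map_cons, List.prod_cons, List.length_cons]
    by_cases h : LeftDescent i (w.map simpleSwap).prod
    · have := h.inversions
      omega
    · rw [inversions_simpleSwap_mul i _ (not_leftDescent h)]
      omega

theorem exists_word (π : Equiv.Perm (Fin (k + 1))) :
    ∃ w : List (Fin k), (w.map simpleSwap).prod = π ∧ w.length = inversions π := by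
  induction hn : inversions π generalizing π with
  | zero =>
    refine ⟨[], ?_, rfl⟩
    rw [eq_one_of_no_leftDescent (π := π) fun i h => by have := h.inversions; omega]
    simp
  | succ n ih =>
    have : ∃ i, LeftDescent i π := by
      by_contra hcon
      push Not at hcon
      rw [eq_one_of_no_leftDescent hcon, inversions_one] at hn
      omega
    obtain ⟨i, hi⟩ := this
    obtain ⟨w, hw, hl⟩ := ih (simpleSwap i * π) (by have := hi.inversions; omega)
    exact ⟨i :: w, by simp [hw, simpleSwap_mul_cancel], by simp [hl]⟩

/-- One letter changes the number of inversions by one, which bounds the length from below; removing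
left descents until none is left produces a word attaining the bound. -/
theorem isReducedWord_iff {π : Equiv.Perm (Fin (k + 1))} {w : List (Fin k)} :
    IsReducedWord π w ↔ (w.map simpleSwap).prod = π ∧ w.length = inversions π := by
  constructor
  · rintro ⟨h1, h2⟩
    refine ⟨h1, le_antisymm ?_ (h1 ▸ inversions_prod_le w)⟩
    obtain ⟨w', h3, h4⟩ := exists_word π
    exact h4 ▸ h2 w' h3
  · rintro ⟨h1, h2⟩
    exact ⟨h1, fun w' h => by rw [h2, ← h]; exact inversions_prod_le w'⟩

theorem isReducedWord_cons {π : Equiv.Perm (Fin (k + 1))} {i : Fin k} {w : List (Fin k)}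
    (h : IsReducedWord π (i :: w)) : IsReducedWord (simpleSwap i * π) w ∧ LeftDescent i π := by
  rw [isReducedWord_iff] at h
  simp only [List.map_cons, List.prod_cons, List.length_cons] at h
  obtain ⟨rfl, h2⟩ := h
  have h3 := inversions_prod_le w
  have h4 : ¬ LeftDescent i (w.map simpleSwap).prod := fun h => by
    have := h.inversions
    omega
  have h5 := not_leftDescent h4
  have h6 := inversions_simpleSwap_mul i _ h5
  refine ⟨isReducedWord_iff.mpr ⟨by rw [simpleSwap_mul_cancel], ?_⟩, ?_⟩
  · rw [simpleSwap_mul_cancel]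
    omega
  · unfold LeftDescent
    rw [mul_inv_rev, simpleSwap_inv, Equiv.Perm.mul_apply, Equiv.Perm.mul_apply,
      simpleSwap_apply_castSucc, simpleSwap_apply_succ]
    exact h5

theorem IsReducedWord.cons {π : Equiv.Perm (Fin (k + 1))} {i : Fin k} {w : List (Fin k)}
    (h : IsReducedWord (simpleSwap i * π) w) (hi : LeftDescent i π) :
    IsReducedWord π (i :: w) := by
  rw [isReducedWord_iff] at h ⊢
  simp only [List.map_cons, List.prod_cons, List.length_cons]
  rw [h.1, h.2, simpleSwap_mul_cancel, hi.inversions]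
  exact ⟨rfl, rfl⟩

theorem reducedWord_spec (π : Equiv.Perm (Fin (k + 1))) : IsReducedWord π (reducedWord π) :=
  (exists_reducedWord π).choose_spec

/-- The relations of the braid group. -/
structure BraidRel {M : Type} [Monoid M] (s : Fin k → M) : Prop where
  comm : ∀ i j : Fin k, (i : ℕ) + 1 < j → s i * s j = s j * s i
  braid : ∀ i j : Fin k, (i : ℕ) + 1 = j → s i * s j * s i = s j * s i * s j

theorem leftDescent_iff (i : Fin k) (π : Equiv.Perm (Fin (k + 1))) :
    LeftDescent i π ↔ π⁻¹ i.succ < π⁻¹ i.castSucc := Iff.rfl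

theorem simpleSwap_braidRel : BraidRel (simpleSwap (k := k)) := by
  constructor
  · intro i j h
    ext x
    have h1 := simpleSwap_val i (simpleSwap j x)
    have h2 := simpleSwap_val j x
    have h3 := simpleSwap_val j (simpleSwap i x)
    have h4 := simpleSwap_val i x
    simp only [Equiv.Perm.mul_apply]
    split_ifs at h1 h2 h3 h4 <;> omega
  · intro i j h
    ext x
    have h1 := simpleSwap_val i (simpleSwap j (simpleSwap i x))
    have h2 := simpleSwap_val j (simpleSwap i x)
    have h3 := simpleSwap_val i x
    have h4 := simpleSwap_val j (simpleSwap i (simpleSwap j x))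
    have h5 := simpleSwap_val i (simpleSwap j x)
    have h6 := simpleSwap_val j x
    simp only [Equiv.Perm.mul_apply]
    grind

theorem simpleSwap_apply_of_ne (i : Fin k) (x : Fin (k + 1)) (h1 : (x : ℕ) ≠ i)
    (h2 : (x : ℕ) ≠ i + 1) : simpleSwap i x = x := by
  ext
  rw [simpleSwap_val, if_neg h1, if_neg h2]

theorem inv_simpleSwap_mul (i : Fin k) (π : Equiv.Perm (Fin (k + 1))) (x : Fin (k + 1)) :
    (simpleSwap i * π)⁻¹ x = π⁻¹ (simpleSwap i x) := by
  rw [mul_inv_rev, simpleSwap_inv, Equiv.Perm.mul_apply]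

/-- Two distinct first letters of reduced words can be exchanged by means of the braid
relations. -/
theorem exists_common_words {M : Type} [Monoid M] {s : Fin k → M} (hs : BraidRel s)
    {π : Equiv.Perm (Fin (k + 1))} {i j : Fin k} (hij : i < j) (hi : LeftDescent i π)
    (hj : LeftDescent j π) :
    ∃ w w' : List (Fin k), IsReducedWord π (i :: w) ∧ IsReducedWord π (j :: w') ∧
      s i * (w.map s).prod = s j * (w'.map s).prod := by
  have hlt : (i : ℕ) < j := hij
  -- With both descents present, π starts with the longest element of the subgroup generated by the
  -- two transpositions: this is s_i s_j s_i = s_j s_i s_j for neighbours and s_i s_j = s_j s_i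
  -- otherwise. A reduced word of the remaining permutation completes both words.
  by_cases h1 : (i : ℕ) + 1 = j
  · have e1 : i.succ = j.castSucc := Fin.ext (by simpa using h1)
    have a1 : simpleSwap i j.succ = j.succ :=
      simpleSwap_apply_of_ne _ _ (by simp; omega) (by simp; omega)
    have a2 : simpleSwap j i.castSucc = i.castSucc :=
      simpleSwap_apply_of_ne _ _ (by simp; omega) (by simp; omega)
    have a3 : simpleSwap i j.castSucc = i.castSucc := by rw [← e1, simpleSwap_apply_succ]
    have a4 : simpleSwap j i.succ = j.succ := by rw [e1, simpleSwap_apply_castSucc]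
    have hi' : π⁻¹ j.castSucc < π⁻¹ i.castSucc := e1 ▸ hi
    have d1 : LeftDescent j (simpleSwap i * π) := by
      rw [leftDescent_iff, inv_simpleSwap_mul, inv_simpleSwap_mul, a1, a3]
      exact hj.trans hi'
    have d2 : LeftDescent i (simpleSwap j * (simpleSwap i * π)) := by
      rw [leftDescent_iff]
      simp only [inv_simpleSwap_mul, a1, a2, simpleSwap_apply_castSucc, e1]
      exact hj
    have d3 : LeftDescent i (simpleSwap j * π) := by
      rw [leftDescent_iff, inv_simpleSwap_mul, inv_simpleSwap_mul, a4, a2]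
      exact hj.trans hi'
    have d4 : LeftDescent j (simpleSwap i * (simpleSwap j * π)) := by
      rw [leftDescent_iff]
      simp only [inv_simpleSwap_mul, a1, a2, simpleSwap_apply_succ, ← e1]
      rw [e1]
      exact hi'
    have hb := simpleSwap_braidRel.braid i j h1
    have e2 : simpleSwap j * (simpleSwap i * (simpleSwap j * π))
        = simpleSwap i * (simpleSwap j * (simpleSwap i * π)) := by
      simp only [← mul_assoc]
      rw [hb]
    have hr := reducedWord_spec (simpleSwap i * (simpleSwap j * (simpleSwap i * π)))
    set w := reducedWord (simpleSwap i * (simpleSwap j * (simpleSwap i * π)))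
    refine ⟨j :: i :: w, i :: j :: w, ((hr.cons d2).cons d1).cons hi,
      IsReducedWord.cons (IsReducedWord.cons (IsReducedWord.cons (e2 ▸ hr) d4) d3) hj, ?_⟩
    simp only [List.map_cons, List.prod_cons, ← mul_assoc]
    rw [hs.braid i j h1]
  · have h2 : (i : ℕ) + 1 < j := by omega
    have a1 : simpleSwap i j.succ = j.succ :=
      simpleSwap_apply_of_ne _ _ (by simp; omega) (by simp; omega)
    have a2 : simpleSwap i j.castSucc = j.castSucc :=
      simpleSwap_apply_of_ne _ _ (by simp; omega) (by simp; omega)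
    have a3 : simpleSwap j i.succ = i.succ :=
      simpleSwap_apply_of_ne _ _ (by simp; omega) (by simp; omega)
    have a4 : simpleSwap j i.castSucc = i.castSucc :=
      simpleSwap_apply_of_ne _ _ (by simp; omega) (by simp; omega)
    have d1 : LeftDescent j (simpleSwap i * π) := by
      rw [leftDescent_iff, inv_simpleSwap_mul, inv_simpleSwap_mul, a1, a2]
      exact hj
    have d2 : LeftDescent i (simpleSwap j * π) := by
      rw [leftDescent_iff, inv_simpleSwap_mul, inv_simpleSwap_mul, a3, a4]
      exact hi
    have e2 : simpleSwap j * (simpleSwap i * π) = simpleSwap i * (simpleSwap j * π) := by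
      rw [← mul_assoc, ← simpleSwap_braidRel.comm i j h2, mul_assoc]
    have hr := reducedWord_spec (simpleSwap j * (simpleSwap i * π))
    set w := reducedWord (simpleSwap j * (simpleSwap i * π))
    refine ⟨j :: w, i :: w, (hr.cons d1).cons hi,
      IsReducedWord.cons (IsReducedWord.cons (e2 ▸ hr) d2) hj, ?_⟩
    simp only [List.map_cons, List.prod_cons, ← mul_assoc]
    rw [hs.comm i j h2]

/-- Matsumoto's theorem for the symmetric group. -/
theorem prod_eq_of_isReducedWord {M : Type} [Monoid M] {s : Fin k → M} (hs : BraidRel s)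
    {π : Equiv.Perm (Fin (k + 1))} {w w' : List (Fin k)} (h : IsReducedWord π w)
    (h' : IsReducedWord π w') : (w.map s).prod = (w'.map s).prod := by
  induction hn : w.length generalizing π w w' with
  | zero =>
    have hl : w.length = w'.length := le_antisymm (h.2 _ h'.1) (h'.2 _ h.1)
    rw [List.length_eq_zero_iff.mp hn, List.length_eq_zero_iff.mp (hl.symm.trans hn)]
  | succ n ih =>
    have step : ∀ {i : Fin k} {v v' : List (Fin k)}, IsReducedWord π (i :: v) →
        IsReducedWord π (i :: v') → s i * (v.map s).prod = s i * (v'.map s).prod := by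
      intro i v v' h1 h2
      have hl : (i :: v).length = w.length := le_antisymm (h1.2 _ h.1) (h.2 _ h1.1)
      rw [ih (isReducedWord_cons h1).1 (isReducedWord_cons h2).1 (by simpa [hn] using hl)]
    have hl : w.length = w'.length := le_antisymm (h.2 _ h'.1) (h'.2 _ h.1)
    obtain ⟨i, v, rfl⟩ := List.exists_cons_of_length_eq_add_one hn
    obtain ⟨j, v', rfl⟩ := List.exists_cons_of_length_eq_add_one (hl ▸ hn)
    simp only [List.map_cons, List.prod_cons]
    -- Words with the same first letter are compared by induction. For different first letters a
    -- detour is taken through a pair of words that begin with these letters and are known to have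
    -- equal products.
    rcases lt_trichotomy i j with hij | rfl | hij
    · obtain ⟨u, u', h1, h2, h3⟩ := exists_common_words hs hij (isReducedWord_cons h).2
        (isReducedWord_cons h').2
      rw [step h h1, h3, step h2 h']
    · exact step h h'
    · obtain ⟨u, u', h1, h2, h3⟩ := exists_common_words hs hij (isReducedWord_cons h').2
        (isReducedWord_cons h).2
      rw [step h h2, ← h3, step h1 h']

end Matsumoto

end QuantumGroups

namespace QuantumGroups

/-! ### Evaluation of reduced words, antisymmetrisers -/

section WordProd

variable {k : ℕ}

/-- Induction along a reduced word: only multiplications that increase the length occur, and these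
are the ones for which `wordProd` is multiplicative. -/
theorem perm_induction {P : Equiv.Perm (Fin (k + 1)) → Prop} (one : P 1)
    (mul : ∀ i π, ¬ LeftDescent i π → P π → P (simpleSwap i * π)) (π : Equiv.Perm (Fin (k + 1))) :
    P π := by
  have h := reducedWord_spec π
  generalize reducedWord π = w at h
  induction w generalizing π with
  | nil =>
    have := h.1
    simp only [List.map_nil, List.prod_nil] at this
    exact this ▸ one
  | cons i w ih =>
    obtain ⟨h1, h2⟩ := isReducedWord_cons h
    rw [← simpleSwap_mul_cancel i π]
    refine mul _ _ ?_ (ih _ h1)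
    rw [leftDescent_iff] at h2 ⊢
    rw [inv_simpleSwap_mul, inv_simpleSwap_mul, simpleSwap_apply_castSucc, simpleSwap_apply_succ]
    exact h2.not_gt

theorem not_leftDescent_iff {i : Fin k} {π : Equiv.Perm (Fin (k + 1))} :
    ¬ LeftDescent i π ↔ π⁻¹ i.castSucc < π⁻¹ i.succ :=
  ⟨not_leftDescent, fun h => h.not_gt⟩

theorem perm_induction_right {P : Equiv.Perm (Fin (k + 1)) → Prop} (one : P 1)
    (mul : ∀ i π, π i.castSucc < π i.succ → P π → P (π * simpleSwap i))
    (π : Equiv.Perm (Fin (k + 1))) : P π := by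
  suffices ∀ π : Equiv.Perm (Fin (k + 1)), P π⁻¹ by simpa using this π⁻¹
  refine perm_induction (by simpa using one) fun i π h hP => ?_
  rw [mul_inv_rev, simpleSwap_inv]
  exact mul _ _ (not_leftDescent h) hP

theorem inversions_inv {n : ℕ} (π : Equiv.Perm (Fin n)) : inversions π⁻¹ = inversions π := by
  refine Finset.card_nbij' (fun a => (π⁻¹ a.2, π⁻¹ a.1)) (fun a => (π a.2, π a.1)) ?_ ?_ ?_ ?_
  all_goals
    rintro ⟨a, b⟩ h
    simp_all

theorem sign_simpleSwap (i : Fin k) : Equiv.Perm.sign (simpleSwap i) = -1 :=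
  Equiv.Perm.sign_swap (by simp [Fin.ext_iff])

/-- The sign of a permutation as a complex number. -/
noncomputable def csign {n : ℕ} (π : Equiv.Perm (Fin n)) : ℂ := ((Equiv.Perm.sign π : ℤ) : ℂ)

@[simp]
theorem csign_one {n : ℕ} : csign (1 : Equiv.Perm (Fin n)) = 1 := by simp [csign]

theorem csign_mul {n : ℕ} (π ρ : Equiv.Perm (Fin n)) : csign (π * ρ) = csign π * csign ρ := by
  simp [csign]

theorem csign_mul_simpleSwap (π : Equiv.Perm (Fin (k + 1))) (i : Fin k) :
    csign (π * simpleSwap i) = -csign π := by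
  simp [csign, sign_simpleSwap]

theorem csign_simpleSwap_mul (π : Equiv.Perm (Fin (k + 1))) (i : Fin k) :
    csign (simpleSwap i * π) = -csign π := by
  simp [csign, sign_simpleSwap]

theorem csign_mul_self {n : ℕ} (π : Equiv.Perm (Fin n)) : csign π * csign π = 1 := by
  rcases Int.units_eq_one_or (Equiv.Perm.sign π) with h | h <;> simp [csign, h]

/-- The product of the `s_i` along a reduced word of `π`. -/
noncomputable def wordProd {M : Type} [Monoid M] (s : Fin k → M) (π : Equiv.Perm (Fin (k + 1))) :
    M := ((reducedWord π).map s).prod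

section
variable {M : Type} [Monoid M] {s : Fin k → M} (hs : BraidRel s)
include hs

theorem wordProd_eq {π : Equiv.Perm (Fin (k + 1))} {w : List (Fin k)} (h : IsReducedWord π w) :
    wordProd s π = (w.map s).prod :=
  prod_eq_of_isReducedWord hs (reducedWord_spec π) h

theorem wordProd_one : wordProd s 1 = 1 :=
  (wordProd_eq hs (w := []) ⟨by simp, by simp⟩).trans (by simp)

theorem wordProd_simpleSwap_mul {i : Fin k} {π : Equiv.Perm (Fin (k + 1))}
    (h : ¬ LeftDescent i π) : wordProd s (simpleSwap i * π) = s i * wordProd s π := by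
  have : IsReducedWord (simpleSwap i * π) (i :: reducedWord π) := by
    refine IsReducedWord.cons (by rw [simpleSwap_mul_cancel]; exact reducedWord_spec π) ?_
    rw [leftDescent_iff, inv_simpleSwap_mul, inv_simpleSwap_mul, simpleSwap_apply_castSucc,
      simpleSwap_apply_succ]
    exact not_leftDescent h
  rw [wordProd_eq hs this]
  rfl

theorem wordProd_mul_simpleSwap {i : Fin k} {π : Equiv.Perm (Fin (k + 1))}
    (h : π i.castSucc < π i.succ) : wordProd s (π * simpleSwap i) = wordProd s π * s i := by
  have : IsReducedWord (π * simpleSwap i) (reducedWord π ++ [i]) := by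
    have h1 := isReducedWord_iff.mp (reducedWord_spec π)
    rw [isReducedWord_iff]
    refine ⟨by simp [h1.1], ?_⟩
    have h2 := inversions_simpleSwap_mul i π⁻¹ (by simpa using h)
    rw [← inversions_inv (π * simpleSwap i), mul_inv_rev, simpleSwap_inv, h2, inversions_inv]
    simp [h1.2]
  rw [wordProd_eq hs this]
  simp [wordProd]

/-- `Fin.revPerm` is the longest permutation and reverses the order, so a letter that lengthens π
shortens the reversed product. The new letter of `t` therefore cancels the last letter of a reduced
word in `s`. -/
theorem wordProd_rev_mul {t : Fin k → M} (ht : BraidRel t) (hst : ∀ i, s i * t i = 1)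
    (π : Equiv.Perm (Fin (k + 1))) :
    wordProd s Fin.revPerm * wordProd t π = wordProd s (Fin.revPerm * π) := by
  induction π using perm_induction_right with
  | one => rw [wordProd_one ht, mul_one, mul_one]
  | mul i π h ih =>
    rw [wordProd_mul_simpleSwap ht h, ← mul_assoc, ih]
    have h1 : ((Fin.revPerm * (π * simpleSwap i) : Equiv.Perm (Fin (k + 1)))) i.castSucc
        < ((Fin.revPerm * (π * simpleSwap i) : Equiv.Perm (Fin (k + 1)))) i.succ := by
      simp only [Equiv.Perm.mul_apply, simpleSwap_apply_castSucc, simpleSwap_apply_succ,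
        Fin.revPerm_apply, Fin.rev_lt_rev]
      exact h
    have h2 := wordProd_mul_simpleSwap hs h1
    rw [mul_assoc, mul_assoc, simpleSwap_mul_self, mul_one] at h2
    rw [h2, mul_assoc, hst, mul_one]

end

theorem wordProd_map {M M' : Type} [Monoid M] [Monoid M'] (φ : M →* M') (s : Fin k → M)
    (π : Equiv.Perm (Fin (k + 1))) : φ (wordProd s π) = wordProd (fun i => φ (s i)) π := by
  simp [wordProd, map_list_prod, Function.comp_def]

section
variable {M : Type} [Ring M] [Algebra ℂ M] {s : Fin k → M}

/-- The alternating sum `∑_π sgn(π) s_π`. -/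
noncomputable def altSum (s : Fin k → M) : M := ∑ π, csign π • wordProd s π

variable (hs : BraidRel s)
include hs

/-- Multiplication by the longest permutation merely reindexes the sum and multiplies all signs by
its own sign. For the braiding, this compares the antisymmetrisers of σ and σ⁻¹. -/
theorem wordProd_rev_mul_altSum {t : Fin k → M} (ht : BraidRel t) (hst : ∀ i, s i * t i = 1) :
    wordProd s Fin.revPerm * altSum t
      = csign (Fin.revPerm : Equiv.Perm (Fin (k + 1))) • altSum s := by
  simp only [altSum, Finset.mul_sum, mul_smul_comm, wordProd_rev_mul hs ht hst, Finset.smul_sum,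
    smul_smul, ← csign_mul]
  refine Fintype.sum_equiv (Equiv.mulLeft (Fin.revPerm : Equiv.Perm (Fin (k + 1)))) _ _ fun π => ?_
  simp only [Equiv.coe_mulLeft, csign_mul, ← mul_assoc, csign_mul_self, one_mul]

end

/-- Left multiplication by the inverse: the alternating sums of `s` and of `s⁻¹` differ by a
unit. -/
theorem exists_unit_mul_altSum {M : Type} [Ring M] [Algebra ℂ M] {s t : Fin k → M}
    (hs : BraidRel s) (ht : BraidRel t) (hst : ∀ i, s i * t i = 1) (hts : ∀ i, t i * s i = 1) :
    ∃ W W' : M, W * altSum t = altSum s ∧ W' * altSum s = altSum t := by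
  have key : ∀ {s t : Fin k → M}, BraidRel s → BraidRel t → (∀ i, s i * t i = 1) →
      ∃ W : M, W * altSum t = altSum s := fun {s t} hs ht hst => by
    refine ⟨csign (Fin.revPerm : Equiv.Perm (Fin (k + 1))) • wordProd s Fin.revPerm, ?_⟩
    rw [smul_mul_assoc, wordProd_rev_mul_altSum hs ht hst, smul_smul, csign_mul_self, one_smul]
  obtain ⟨W, hW⟩ := key hs ht hst
  obtain ⟨W', hW'⟩ := key ht hs hts
  exact ⟨W, W', hW, hW'⟩

end WordProd

/-! ### Factorisations of the alternating sum along cosets of point stabilisers. -/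

section Factorisation

section
variable {k : ℕ}

theorem lt_of_apply_eq_last {π : Equiv.Perm (Fin (k + 1))} {a b : Fin (k + 1)} (hab : a ≠ b)
    (h : π b = Fin.last k) : π a < π b := by
  rw [h]
  exact lt_of_le_of_ne (Fin.le_last _) fun e => hab (π.injective (e.trans h.symm))

theorem lt_of_apply_eq_zero {π : Equiv.Perm (Fin (k + 1))} {a b : Fin (k + 1)} (hab : a ≠ b)
    (h : π a = 0) : π a < π b := by
  rw [h]
  exact Fin.pos_of_ne_zero fun e => hab (π.injective (h.trans e.symm))

theorem castSucc_ne_succ (j : Fin k) : j.castSucc ≠ j.succ := by simp [Fin.ext_iff]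

end

/-- `1 - s_{k-1} + s_{k-1} s_{k-2} - ⋯ ± s_{k-1} ⋯ s_0`. -/
def shufR {M : Type} [Ring M] : (k : ℕ) → (Fin k → M) → M
  | 0, _ => 1
  | k + 1, s => 1 - s (Fin.last k) * shufR k (fun i => s i.castSucc)

/-- `1 - s_0 + s_0 s_1 - ⋯ ± s_0 ⋯ s_{k-1}`. -/
def shufL {M : Type} [Ring M] : (k : ℕ) → (Fin k → M) → M
  | 0, _ => 1
  | k + 1, s => 1 - s 0 * shufL k (fun i => s i.succ)

/-- `s_{k-1} ⋯ s_0`. -/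
def descProd {M : Type} [Monoid M] : (k : ℕ) → (Fin k → M) → M
  | 0, _ => 1
  | k + 1, s => s (Fin.last k) * descProd k (fun i => s i.castSucc)

/-- `s_0 ⋯ s_{k-1}`. -/
def ascProd {M : Type} [Monoid M] : (k : ℕ) → (Fin k → M) → M
  | 0, _ => 1
  | k + 1, s => s 0 * ascProd k (fun i => s i.succ)

section
variable {M : Type} [Ring M]

/-- The definition splits off the common left factor of all nontrivial terms; here the longest term
is split off instead, and the shorter ones no longer contain the letter of index 0. -/
theorem shufR_succ (k : ℕ) (s : Fin (k + 1) → M) :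
    shufR (k + 1) s = shufR k (fun i => s i.succ) + (-1) ^ (k + 1) * descProd (k + 1) s := by
  induction k with
  | zero => simp [shufR, descProd, sub_eq_add_neg]
  | succ k ih =>
    rw [shufR, ih, shufR]
    simp only [Fin.succ_castSucc, Fin.succ_last]
    rw [mul_add, pow_succ (-1 : M) (k + 1)]
    have : ∀ x : M, (-1) ^ (k + 1) * (s (Fin.last (k + 1)) * x) = s (Fin.last (k + 1)) * ((-1) ^ (k + 1) * x) :=
      ((Commute.neg_one_left _).pow_left _).left_comm
    rw [mul_assoc, neg_one_mul, mul_neg, descProd.eq_2 _ s, this]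
    abel

theorem shufL_succ (k : ℕ) (s : Fin (k + 1) → M) :
    shufL (k + 1) s = shufL k (fun i => s i.castSucc) + (-1) ^ (k + 1) * ascProd (k + 1) s := by
  induction k with
  | zero => simp [shufL, ascProd, sub_eq_add_neg]
  | succ k ih =>
    rw [shufL, ih, shufL]
    simp only [Fin.succ_castSucc, Fin.castSucc_zero]
    rw [mul_add, pow_succ (-1 : M) (k + 1)]
    have : ∀ x : M, (-1) ^ (k + 1) * (s 0 * x) = s 0 * ((-1) ^ (k + 1) * x) :=
      ((Commute.neg_one_left _).pow_left _).left_comm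
    rw [mul_assoc, neg_one_mul, mul_neg, ascProd.eq_2 _ s, this]
    abel

/-- Each term arises from its successor by one more right factor, so the sum is evaluated by a
Horner scheme from the last term downwards. -/
theorem sum_eq_mul_shufR (k : ℕ) (s : Fin k → M) (F : Fin (k + 1) → M)
    (h : ∀ j : Fin k, F j.castSucc = -(F j.succ * s j)) :
    ∑ m, F m = F (Fin.last k) * shufR k s := by
  induction k with
  | zero => simp [shufR]
  | succ k ih =>
    rw [Fin.sum_univ_castSucc, ih (fun i => s i.castSucc) (fun i => F i.castSucc)
      fun j => by rw [h, Fin.succ_castSucc], h, Fin.succ_last, shufR, mul_sub, mul_one, neg_mul,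
      mul_assoc]
    abel

theorem sum_eq_mul_shufL (k : ℕ) (s : Fin k → M) (F : Fin (k + 1) → M)
    (h : ∀ j : Fin k, F j.succ = -(F j.castSucc * s j)) :
    ∑ m, F m = F 0 * shufL k s := by
  induction k with
  | zero => simp [shufL]
  | succ k ih =>
    rw [Fin.sum_univ_succ, ih (fun i => s i.succ) (fun i => F i.succ)
      fun j => by rw [h, Fin.succ_castSucc], h, Fin.castSucc_zero, shufL, mul_sub, mul_one,
      neg_mul, mul_assoc]
    abel

end

section
variable {k : ℕ} {M : Type} [Ring M] [Algebra ℂ M] {s : Fin k → M} (hs : BraidRel s)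

open scoped Classical in
/-- The alternating sum over the permutations in a set. -/
noncomputable def altSumOn (s : Fin k → M) (P : Equiv.Perm (Fin (k + 1)) → Prop) : M :=
  ∑ π with P π, csign π • wordProd s π

theorem altSumOn_true (s : Fin k → M) : altSumOn s (fun _ => True) = altSum s := by
  simp [altSumOn, altSum]

theorem altSumOn_fiber (s : Fin k → M) (P : Equiv.Perm (Fin (k + 1)) → Prop)
    (f : Equiv.Perm (Fin (k + 1)) → Fin (k + 1)) :
    altSumOn s P = ∑ m, altSumOn s (fun π => P π ∧ f π = m) := by
  classical
  simp only [altSumOn, ← Finset.filter_filter]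
  rw [Finset.sum_fiberwise]

include hs

/-- Right multiplication by a simple transposition matches the two index sets. It changes the sign
and, by `hP`, appends one letter to reduced words. -/
theorem altSumOn_right {j : Fin k} {P Q : Equiv.Perm (Fin (k + 1)) → Prop}
    (hPQ : ∀ π, Q π ↔ P (π * simpleSwap j)) (hP : ∀ π, P π → π j.castSucc < π j.succ) :
    altSumOn s Q = -(altSumOn s P * s j) := by
  classical
  rw [altSumOn, altSumOn, Finset.sum_mul, ← Finset.sum_neg_distrib]
  refine Finset.sum_nbij' (· * simpleSwap j) (· * simpleSwap j) ?_ ?_ ?_ ?_ ?_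
  · intro π h
    simpa [hPQ] using h
  · intro π h
    simpa [hPQ, mul_assoc, simpleSwap_mul_self] using h
  · intro π _
    rw [mul_assoc, simpleSwap_mul_self, mul_one]
  · intro π _
    rw [mul_assoc, simpleSwap_mul_self, mul_one]
  · intro π h
    have h' : P (π * simpleSwap j) := (hPQ π).mp (by simpa using h)
    have h1 := wordProd_mul_simpleSwap hs (hP _ h')
    rw [mul_assoc, simpleSwap_mul_self, mul_one] at h1
    rw [csign_mul_simpleSwap, h1, smul_mul_assoc, neg_smul, neg_neg]

theorem altSumOn_left {j : Fin k} {P Q : Equiv.Perm (Fin (k + 1)) → Prop}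
    (hPQ : ∀ π, Q π ↔ P (simpleSwap j * π)) (hP : ∀ π, P π → ¬ LeftDescent j π) :
    altSumOn s Q = -(s j * altSumOn s P) := by
  classical
  rw [altSumOn, altSumOn, Finset.mul_sum, ← Finset.sum_neg_distrib]
  refine Finset.sum_nbij' (simpleSwap j * ·) (simpleSwap j * ·) ?_ ?_ ?_ ?_ ?_
  · intro π h
    simpa [hPQ] using h
  · intro π h
    simpa [hPQ, simpleSwap_mul_cancel] using h
  · intro π _
    rw [simpleSwap_mul_cancel]
  · intro π _
    rw [simpleSwap_mul_cancel]
  · intro π h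
    have h' : P (simpleSwap j * π) := (hPQ π).mp (by simpa using h)
    have h1 := wordProd_simpleSwap_mul hs (hP _ h')
    rw [simpleSwap_mul_cancel] at h1
    rw [csign_simpleSwap_mul, h1, mul_smul_comm, neg_smul, neg_neg]

/-- Permutations are grouped by the position of the largest value. Moving this position down by one
appends a letter on the right, so the fibres form a chain starting at the stabiliser of the last
point. -/
theorem altSum_eq_mul_shufR :
    altSum s = altSumOn s (fun π => π (Fin.last k) = Fin.last k) * shufR k s := by
  have h : ∀ j : Fin k, altSumOn s (fun π => True ∧ π⁻¹ (Fin.last k) = j.castSucc)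
      = -(altSumOn s (fun π => True ∧ π⁻¹ (Fin.last k) = j.succ) * s j) := fun j =>
    altSumOn_right hs (fun π => by
      simp only [true_and, Equiv.Perm.inv_eq_iff_eq, Equiv.Perm.mul_apply, simpleSwap_apply_succ])
      fun π h => lt_of_apply_eq_last (castSucc_ne_succ j) (Equiv.Perm.inv_eq_iff_eq.mp h.2).symm
  rw [← altSumOn_true, altSumOn_fiber s _ (fun π => π⁻¹ (Fin.last k)), sum_eq_mul_shufR k s _ h]
  congr 2
  ext π
  rw [true_and, Equiv.Perm.inv_eq_iff_eq, eq_comm]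

theorem altSum_eq_mul_shufL :
    altSum s = altSumOn s (fun π => π 0 = 0) * shufL k s := by
  have h : ∀ j : Fin k, altSumOn s (fun π => True ∧ π⁻¹ 0 = j.succ)
      = -(altSumOn s (fun π => True ∧ π⁻¹ 0 = j.castSucc) * s j) := fun j =>
    altSumOn_right hs (fun π => by
      simp only [true_and, Equiv.Perm.inv_eq_iff_eq, Equiv.Perm.mul_apply,
        simpleSwap_apply_castSucc])
      fun π h => lt_of_apply_eq_zero (castSucc_ne_succ j) (Equiv.Perm.inv_eq_iff_eq.mp h.2).symm
  rw [← altSumOn_true, altSumOn_fiber s _ (fun π => π⁻¹ 0), sum_eq_mul_shufL k s _ h]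
  congr 2
  ext π
  rw [true_and, Equiv.Perm.inv_eq_iff_eq, eq_comm]

/-- The permutations are now grouped by the image of the last point, and the fibres differ by left
factors. The shape of the resulting left factor is irrelevant: only the inclusion of kernels is used
later. -/
theorem exists_altSum_eq_mul_last :
    ∃ C : M, altSum s = C * altSumOn s (fun π => π (Fin.last k) = Fin.last k) := by
  have : ∀ m, ∃ C : M, altSumOn s (fun π => π (Fin.last k) = m)
      = C * altSumOn s (fun π => π (Fin.last k) = Fin.last k) := by
    intro m
    induction m using Fin.reverseInduction with
    | last => exact ⟨1, by rw [one_mul]⟩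
    | cast j ih =>
      obtain ⟨C, hC⟩ := ih
      refine ⟨-(s j * C), ?_⟩
      rw [neg_mul, mul_assoc, ← hC]
      refine altSumOn_left hs (fun π => ?_) fun π h => ?_
      · rw [Equiv.Perm.mul_apply]
        constructor
        · intro h; rw [h, simpleSwap_apply_castSucc]
        · intro h
          apply (simpleSwap j).injective
          rw [h, simpleSwap_apply_castSucc]
      · rw [not_leftDescent_iff]
        exact lt_of_apply_eq_last (castSucc_ne_succ j) (by simp [← h])
  choose C hC using this
  refine ⟨∑ m, C m, ?_⟩
  rw [← altSumOn_true, altSumOn_fiber s _ (fun π => π (Fin.last k)), Finset.sum_mul]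
  exact Finset.sum_congr rfl fun m _ => by simp only [true_and]; rw [hC]

theorem exists_altSum_eq_mul_zero :
    ∃ C : M, altSum s = C * altSumOn s (fun π => π 0 = 0) := by
  have : ∀ m, ∃ C : M, altSumOn s (fun π => π 0 = m) = C * altSumOn s (fun π => π 0 = 0) := by
    intro m
    induction m using Fin.induction with
    | zero => exact ⟨1, by rw [one_mul]⟩
    | succ j ih =>
      obtain ⟨C, hC⟩ := ih
      refine ⟨-(s j * C), ?_⟩
      rw [neg_mul, mul_assoc, ← hC]
      refine altSumOn_left hs (fun π => ?_) fun π h => ?_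
      · rw [Equiv.Perm.mul_apply]
        constructor
        · intro h; rw [h, simpleSwap_apply_succ]
        · intro h
          apply (simpleSwap j).injective
          rw [h, simpleSwap_apply_succ]
      · rw [not_leftDescent_iff]
        exact lt_of_apply_eq_zero (castSucc_ne_succ j) (by simp [← h])
  choose C hC using this
  refine ⟨∑ m, C m, ?_⟩
  rw [← altSumOn_true, altSumOn_fiber s _ (fun π => π 0), Finset.sum_mul]
  exact Finset.sum_congr rfl fun m _ => by simp only [true_and]; rw [hC]

end

end Factorisation

end QuantumGroups

namespace QuantumGroups

/-! ### Evaluation of the sums over shuffle permutations. -/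

section Shuffles

variable {k : ℕ}

theorem simpleSwap_lt_iff {j : Fin k} {x y : Fin (k + 1)}
    (h : (x ≠ j.castSucc ∧ y ≠ j.castSucc) ∨ (x ≠ j.succ ∧ y ≠ j.succ)) :
    simpleSwap j x < simpleSwap j y ↔ x < y := by
  have h1 := simpleSwap_val j x
  have h2 := simpleSwap_val j y
  simp only [ne_eq, Fin.ext_iff, Fin.lt_def, Fin.val_castSucc, Fin.val_succ] at *
  split_ifs at h1 h2 <;> omega

/-- Position `z` occurs in no order condition of a shuffle. Exchanging its value with a neighbouring
one leaves the relative order of all other values unchanged. -/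
theorem isShuffle_simpleSwap_mul {i : ℕ} {j : Fin k} {ρ : Equiv.Perm (Fin (k + 1))}
    {z : Fin (k + 1)} (hz : ∀ a b : Fin (k + 1), a < b → ((b : ℕ) < i ∨ i ≤ (a : ℕ)) → a ≠ z ∧ b ≠ z)
    (h : ρ z = j.castSucc ∨ ρ z = j.succ) :
    IsShuffle i (simpleSwap j * ρ) ↔ IsShuffle i ρ := by
  refine forall_congr' fun a => forall_congr' fun b => forall_congr' fun hab =>
    forall_congr' fun hi => ?_
  obtain ⟨ha, hb⟩ := hz a b hab hi
  rw [Equiv.Perm.mul_apply, Equiv.Perm.mul_apply]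
  apply simpleSwap_lt_iff
  rcases h with h | h <;> rw [← h]
  · exact Or.inl ⟨fun e => ha (ρ.injective e), fun e => hb (ρ.injective e)⟩
  · exact Or.inr ⟨fun e => ha (ρ.injective e), fun e => hb (ρ.injective e)⟩

theorem isShuffle_last_iff {ρ : Equiv.Perm (Fin (k + 1))} :
    IsShuffle k ρ ∧ ρ (Fin.last k) = Fin.last k ↔ ρ = 1 := by
  constructor
  · rintro ⟨h, h0⟩
    refine perm_eq_one_of_strictMono fun a b hab => ?_
    by_cases hb : b = Fin.last k
    · subst hb
      exact lt_of_apply_eq_last hab.ne h0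
    · exact h a b hab (Or.inl (by
        have := Fin.val_lt_last hb
        exact this))
  · rintro rfl
    exact ⟨fun a b h _ => h, rfl⟩

theorem isShuffle_zero_iff {ρ : Equiv.Perm (Fin (k + 1))} :
    IsShuffle 1 ρ ∧ ρ 0 = 0 ↔ ρ = 1 := by
  constructor
  · rintro ⟨h, h0⟩
    refine perm_eq_one_of_strictMono fun a b hab => ?_
    by_cases ha : a = 0
    · subst ha
      exact lt_of_apply_eq_zero hab.ne h0
    · exact h a b hab (Or.inr (Nat.one_le_iff_ne_zero.mpr fun e => ha (Fin.ext e)))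
  · rintro rfl
    exact ⟨fun a b h _ => h, rfl⟩

variable {M : Type} [Ring M] [Algebra ℂ M] {s : Fin k → M} (hs : BraidRel s)
include hs

theorem altSumOn_eq_one {P : Equiv.Perm (Fin (k + 1)) → Prop} (hP : ∀ π, P π ↔ π = 1) :
    altSumOn s P = 1 := by
  classical
  rw [altSumOn, Finset.sum_eq_single 1]
  · rw [wordProd_one hs, csign_one, one_smul]
  · intro π h1 h2
    exact absurd ((hP π).mp (by simpa using h1)) h2
  · intro h
    exact absurd ((hP 1).mpr rfl) (by simpa using h)

/-- A shuffle of this type is determined by the value at the last position. The fibres are single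
permutations forming one chain, which starts at the identity, and the Horner scheme applies. -/
theorem altSumOn_shuffleR : altSumOn s (fun π => IsShuffle k π⁻¹) = shufR k s := by
  have h : ∀ j : Fin k,
      altSumOn s (fun π => IsShuffle k π⁻¹ ∧ π⁻¹ (Fin.last k) = j.castSucc)
      = -(altSumOn s (fun π => IsShuffle k π⁻¹ ∧ π⁻¹ (Fin.last k) = j.succ) * s j) := fun j =>
    altSumOn_right hs (fun π => by
      have h2 : (simpleSwap j) (π⁻¹ (Fin.last k)) = j.succ ↔ π⁻¹ (Fin.last k) = j.castSucc := by
        rw [← simpleSwap_apply_castSucc, (simpleSwap j).injective.eq_iff]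
      rw [mul_inv_rev, simpleSwap_inv, Equiv.Perm.mul_apply, h2]
      refine and_congr_left fun hl => ?_
      refine (isShuffle_simpleSwap_mul (z := Fin.last k) (fun a b hab hb => ?_) (Or.inl hl)).symm
      simp only [ne_eq, Fin.ext_iff, Fin.lt_def, Fin.val_last] at hab ⊢
      omega)
      fun π h => lt_of_apply_eq_last (castSucc_ne_succ j) (Equiv.Perm.inv_eq_iff_eq.mp h.2).symm
  rw [altSumOn_fiber s _ (fun π => π⁻¹ (Fin.last k)), sum_eq_mul_shufR k s _ h,
    altSumOn_eq_one hs fun π => isShuffle_last_iff.trans inv_eq_one, one_mul]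

theorem altSumOn_shuffleL : altSumOn s (fun π => IsShuffle 1 π⁻¹) = shufL k s := by
  have h : ∀ j : Fin k,
      altSumOn s (fun π => IsShuffle 1 π⁻¹ ∧ π⁻¹ 0 = j.succ)
      = -(altSumOn s (fun π => IsShuffle 1 π⁻¹ ∧ π⁻¹ 0 = j.castSucc) * s j) := fun j =>
    altSumOn_right hs (fun π => by
      have h2 : (simpleSwap j) (π⁻¹ 0) = j.castSucc ↔ π⁻¹ 0 = j.succ := by
        rw [← simpleSwap_apply_succ, (simpleSwap j).injective.eq_iff]
      rw [mul_inv_rev, simpleSwap_inv, Equiv.Perm.mul_apply, h2]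
      refine and_congr_left fun hl => ?_
      refine (isShuffle_simpleSwap_mul (z := 0) (fun a b hab hb => ?_) (Or.inr hl)).symm
      simp only [ne_eq, Fin.ext_iff, Fin.lt_def, Fin.val_zero] at hab ⊢
      omega)
      fun π h => lt_of_apply_eq_zero (castSucc_ne_succ j) (Equiv.Perm.inv_eq_iff_eq.mp h.2).symm
  rw [altSumOn_fiber s _ (fun π => π⁻¹ 0), sum_eq_mul_shufL k s _ h,
    altSumOn_eq_one hs fun π => isShuffle_zero_iff.trans inv_eq_one, one_mul]

end Shuffles

/-! ### Permutations fixing one point. -/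

section Parabolic

/-- The extension of a permutation of `Fin n` along `z.succAbove` by a fixed point `z`. -/
noncomputable def extPerm {n : ℕ} (z : Fin (n + 1)) (p : Equiv.Perm (Fin n)) :
    Equiv.Perm (Fin (n + 1)) :=
  (finSuccEquiv' z).trans ((Equiv.optionCongr p).trans (finSuccEquiv' z).symm)

theorem extPerm_self {n : ℕ} (z : Fin (n + 1)) (p : Equiv.Perm (Fin n)) : extPerm z p z = z := by
  simp [extPerm]

theorem extPerm_succAbove {n : ℕ} (z : Fin (n + 1)) (p : Equiv.Perm (Fin n)) (i : Fin n) :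
    extPerm z p (z.succAbove i) = z.succAbove (p i) := by
  simp [extPerm]

theorem extPerm_one {n : ℕ} (z : Fin (n + 1)) : extPerm z 1 = 1 := by
  ext x
  induction x using Fin.succAboveCases z with
  | x => simp [extPerm_self]
  | p i => simp [extPerm_succAbove]

theorem extPerm_mul {n : ℕ} (z : Fin (n + 1)) (p p' : Equiv.Perm (Fin n)) :
    extPerm z (p * p') = extPerm z p * extPerm z p' := by
  ext x
  induction x using Fin.succAboveCases z with
  | x => simp [extPerm_self]
  | p i => simp [extPerm_succAbove]

theorem extPerm_inv {n : ℕ} (z : Fin (n + 1)) (p : Equiv.Perm (Fin n)) :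
    (extPerm z p)⁻¹ = extPerm z p⁻¹ := by
  rw [inv_eq_iff_mul_eq_one, ← extPerm_mul, mul_inv_cancel, extPerm_one]

theorem extPerm_injective {n : ℕ} (z : Fin (n + 1)) : Function.Injective (extPerm z) := by
  intro p p' h
  ext i
  have := DFunLike.congr_fun h (z.succAbove i)
  rw [extPerm_succAbove, extPerm_succAbove] at this
  rw [Fin.succAbove_right_injective this]

theorem exists_extPerm {n : ℕ} {z : Fin (n + 1)} {π : Equiv.Perm (Fin (n + 1))} (h : π z = z) :
    ∃ p, extPerm z p = π := by
  have h1 : ∀ i, ∃ j, z.succAbove j = π (z.succAbove i) := fun i =>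
    Fin.exists_succAbove_eq fun e => Fin.succAbove_ne z i (π.injective (e.trans h.symm))
  choose f hf using h1
  have hinj : Function.Injective f := by
    intro i j e
    have := (hf i).symm.trans (e ▸ hf j)
    exact Fin.succAbove_right_injective (π.injective this)
  refine ⟨Equiv.ofBijective f (Finite.injective_iff_bijective.mp hinj), ?_⟩
  ext x
  induction x using Fin.succAboveCases z with
  | x => rw [extPerm_self, h]
  | p i => rw [extPerm_succAbove, Equiv.ofBijective_apply, hf]

/-- The embedding `z.succAbove` is monotone and carries neighbours to neighbours, so it preserves
the property of not being a descent; reduced words are thus carried to reduced words. -/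
theorem extPerm_wordProd {k : ℕ} {M : Type} [Ring M] [Algebra ℂ M] {s : Fin (k + 1) → M}
    (hs : BraidRel s) {t : Fin k → Fin (k + 1)} (hst : BraidRel (fun i => s (t i)))
    {z : Fin (k + 2)} (h : ∀ i, extPerm z (simpleSwap i) = simpleSwap (t i))
    (h1 : ∀ i, z.succAbove i.castSucc = (t i).castSucc) (h2 : ∀ i, z.succAbove i.succ = (t i).succ)
    (p : Equiv.Perm (Fin (k + 1))) :
    wordProd s (extPerm z p) = wordProd (fun i => s (t i)) p ∧ csign (extPerm z p) = csign p := by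
  induction p using perm_induction with
  | one => simp [extPerm_one, wordProd_one hs, wordProd_one hst]
  | mul i p hi ih =>
    have hd : ¬ LeftDescent (t i) (extPerm z p) := by
      rw [not_leftDescent_iff, extPerm_inv, ← h1, ← h2, extPerm_succAbove, extPerm_succAbove,
        Fin.succAbove_lt_succAbove_iff]
      exact not_leftDescent hi
    rw [extPerm_mul, h, wordProd_simpleSwap_mul hs hd, wordProd_simpleSwap_mul hst hi, ih.1,
      csign_simpleSwap_mul, csign_simpleSwap_mul, ih.2]
    exact ⟨rfl, rfl⟩

theorem altSumOn_fixed {k : ℕ} {M : Type} [Ring M] [Algebra ℂ M] {s : Fin (k + 1) → M}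
    (hs : BraidRel s) {t : Fin k → Fin (k + 1)} (hst : BraidRel (fun i => s (t i)))
    {z : Fin (k + 2)} (h1 : ∀ i, z.succAbove i.castSucc = (t i).castSucc)
    (h2 : ∀ i, z.succAbove i.succ = (t i).succ) :
    altSumOn s (fun π => π z = z) = altSum (fun i => s (t i)) := by
  classical
  have h : ∀ i, extPerm z (simpleSwap i) = simpleSwap (t i) := by
    intro i
    ext x
    induction x using Fin.succAboveCases z with
    | x =>
      rw [extPerm_self, simpleSwap, Equiv.swap_apply_of_ne_of_ne]
      · rw [← h1]
        exact (Fin.succAbove_ne z _).symm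
      · rw [← h2]
        exact (Fin.succAbove_ne z _).symm
    | p j =>
      rw [extPerm_succAbove, simpleSwap, simpleSwap, ← h1, ← h2,
        (Fin.succAbove_right_injective).swap_apply]
  symm
  rw [altSum, altSumOn]
  refine Finset.sum_nbij (extPerm z) ?_ ?_ ?_ ?_
  · intro p _
    simp [extPerm_self]
  · exact (extPerm_injective z).injOn
  · intro π hπ
    obtain ⟨p, hp⟩ := exists_extPerm (z := z) (π := π) (by simpa using hπ)
    exact ⟨p, by simp, hp⟩
  · intro p _
    obtain ⟨e1, e2⟩ := extPerm_wordProd hs hst h h1 h2 p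
    rw [e1, e2]

theorem BraidRel.castSucc {k : ℕ} {M : Type} [Monoid M] {s : Fin (k + 1) → M} (hs : BraidRel s) :
    BraidRel (fun i => s i.castSucc) where
  comm i j h := hs.comm _ _ (by simpa using h)
  braid i j h := hs.braid _ _ (by simpa using h)

theorem BraidRel.succ {k : ℕ} {M : Type} [Monoid M] {s : Fin (k + 1) → M} (hs : BraidRel s) :
    BraidRel (fun i => s i.succ) where
  comm i j h := hs.comm _ _ (by simpa using h)
  braid i j h := hs.braid _ _ (by simpa using h)

theorem altSumOn_last {k : ℕ} {M : Type} [Ring M] [Algebra ℂ M] {s : Fin (k + 1) → M}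
    (hs : BraidRel s) :
    altSumOn s (fun π => π (Fin.last (k + 1)) = Fin.last (k + 1))
      = altSum (fun i => s i.castSucc) :=
  altSumOn_fixed hs hs.castSucc (fun i => by simp) (fun i => by simp)

theorem altSumOn_zero {k : ℕ} {M : Type} [Ring M] [Algebra ℂ M] {s : Fin (k + 1) → M}
    (hs : BraidRel s) :
    altSumOn s (fun π => π 0 = 0) = altSum (fun i => s i.succ) :=
  altSumOn_fixed hs hs.succ (fun i => by simp) (fun i => by simp)

end Parabolic

end QuantumGroups

namespace QuantumGroups

/-! ### Operators on tensor powers -/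

section Legs

section
variable {ι M : Type}

theorem funext_snoc {k : ℕ} {ρ ζ : (Fin (k + 1) → ι) → M}
    (h : ∀ (J : Fin k → ι) a, ρ (Fin.snoc J a : Fin (k + 1) → ι) = ζ (Fin.snoc J a : Fin (k + 1) → ι)) :
    ρ = ζ := by
  funext K
  rw [← Fin.snoc_init_self K]
  exact h _ _

theorem funext_cons {k : ℕ} {ρ ζ : (Fin (k + 1) → ι) → M}
    (h : ∀ (J : Fin k → ι) a, ρ (Fin.cons a J : Fin (k + 1) → ι) = ζ (Fin.cons a J : Fin (k + 1) → ι)) :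
    ρ = ζ := by
  funext K
  rw [← Fin.cons_self_tail K]
  exact h _ _

end

variable {ι M : Type} [Fintype ι] [AddCommGroup M] [Module ℂ M]

theorem onLegs_apply (S : Matrix (ι × ι) (ι × ι) ℂ) {k : ℕ} (i j : Fin k)
    (ρ : (Fin k → ι) → M) (J : Fin k → ι) :
    onLegs S i j ρ J = ∑ a : ι × ι,
      S (J i, J j) a • ρ (Function.update (Function.update J i a.1) j a.2) := rfl

theorem onLegs_mul (S T : Matrix (ι × ι) (ι × ι) ℂ) {k : ℕ} {i j : Fin k} (hij : i ≠ j) :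
    (onLegs S i j : Module.End ℂ ((Fin k → ι) → M)) * onLegs T i j = onLegs (S * T) i j := by
  ext1 ρ
  funext J
  simp only [Module.End.mul_apply, onLegs_apply, Matrix.mul_apply, Finset.sum_smul,
    Finset.smul_sum, smul_smul]
  rw [Finset.sum_comm]
  refine Finset.sum_congr rfl fun a _ => Finset.sum_congr rfl fun b _ => ?_
  have e : ∀ (x y z w : ι), Function.update (Function.update
      (Function.update (Function.update J i x) j y) i z) j w
      = Function.update (Function.update J i z) j w := by
    intro x y z w
    funext m
    simp only [Function.update_apply]
    split_ifs <;> rfl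
  simp [hij, e]

theorem onLegs_one [DecidableEq ι] {k : ℕ} (i j : Fin k) :
    onLegs (1 : Matrix (ι × ι) (ι × ι) ℂ) i j = (1 : Module.End ℂ ((Fin k → ι) → M)) := by
  refine LinearMap.ext fun ρ => funext fun J => ?_
  rw [onLegs_apply, Finset.sum_eq_single (J i, J j)]
  · simp
  · intro b _ hb
    rw [Matrix.one_apply_ne hb.symm, zero_smul]
  · simp

theorem onLegs_comm (S : Matrix (ι × ι) (ι × ι) ℂ) {k : ℕ} {i j l m : Fin k}
    (hil : i ≠ l) (him : i ≠ m) (hjl : j ≠ l) (hjm : j ≠ m) :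
    (onLegs S i j : Module.End ℂ ((Fin k → ι) → M)) * onLegs S l m
      = onLegs S l m * onLegs S i j := by
  ext1 ρ
  funext J
  simp only [Module.End.mul_apply, onLegs_apply, Finset.smul_sum, smul_smul]
  rw [Finset.sum_comm]
  refine Finset.sum_congr rfl fun a _ => Finset.sum_congr rfl fun b _ => ?_
  have e : ∀ (x y z w : ι), Function.update (Function.update
      (Function.update (Function.update J i x) j y) l z) m w
      = Function.update (Function.update (Function.update (Function.update J l z) m w) i x) j y := by
    intro x y z w
    funext n
    simp only [Function.update_apply]
    split_ifs <;> simp_all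
  simp [hil.symm, him.symm, hjl.symm, hjm.symm, hil, him, hjl, hjm, e, mul_comm]

/-- The Yang-Baxter equation in coordinates. -/
def YangBaxter (S : Matrix (ι × ι) (ι × ι) ℂ) : Prop :=
  ∀ i j k x y z : ι, ∑ a : ι × ι, ∑ b, S (i, j) a * S (a.2, k) (b, z) * S (a.1, b) (x, y)
    = ∑ a : ι × ι, ∑ b, S (j, k) a * S (i, a.1) (x, b) * S (b, a.2) (y, z)

theorem sum_collect {α β γ δ : Type} [Fintype α] [Fintype β] [Fintype γ] [Fintype δ]
    (T : α → β → γ → δ → ℂ) (F : γ → δ → M) :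
    ∑ a, ∑ b, ∑ c, ∑ d, T a b c d • F c d = ∑ c, ∑ d, (∑ a, ∑ b, T a b c d) • F c d := by
  simp only [Finset.sum_smul]
  calc _ = ∑ p : α × β, ∑ q : γ × δ, T p.1 p.2 q.1 q.2 • F q.1 q.2 := by
        simp only [Fintype.sum_prod_type]
    _ = _ := by
        rw [Finset.sum_comm]
        simp only [Fintype.sum_prod_type]

/-- Both sides are expanded over the three new index values, collected in `F`. The coefficients of
each entry are then the two sides of the Yang-Baxter equation. -/
theorem onLegs_braid {S : Matrix (ι × ι) (ι × ι) ℂ} (hS : YangBaxter S) {n : ℕ} {i j k : Fin n}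
    (hij : i ≠ j) (hik : i ≠ k) (hjk : j ≠ k) :
    (onLegs S i j : Module.End ℂ ((Fin n → ι) → M)) * onLegs S j k * onLegs S i j
      = onLegs S j k * onLegs S i j * onLegs S j k := by
  ext1 ρ
  funext J
  set F : ι → ι → ι → M := fun x y z =>
    ρ (Function.update (Function.update (Function.update J i x) j y) k z) with hF
  have e1 : ∀ x y z w u v : ι, ρ (Function.update (Function.update (Function.update (Function.update
      (Function.update (Function.update J i x) j y) j z) k w) i u) j v) = F u v w := by
    intro x y z w u v
    rw [hF]
    congr 1
    funext n
    simp only [Function.update_apply]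
    split_ifs <;> simp_all
  have e2 : ∀ x y z w u v : ι, ρ (Function.update (Function.update (Function.update (Function.update
      (Function.update (Function.update J j x) k y) i z) j w) j u) k v) = F z u v := by
    intro x y z w u v
    rw [hF]
    congr 1
    funext n
    simp only [Function.update_apply]
    split_ifs <;> simp_all
  have l1 : (onLegs S i j * onLegs S j k * onLegs S i j :
      Module.End ℂ ((Fin n → ι) → M)) ρ J
      = ∑ a : ι × ι, ∑ b, ∑ z, ∑ c : ι × ι,
        (S (J i, J j) a * S (a.2, J k) (b, z) * S (a.1, b) c) • F c.1 c.2 z := by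
    simp only [Module.End.mul_apply, onLegs_apply, Finset.smul_sum, smul_smul, e1]
    simp [hij, hik, hjk, hik.symm, hjk.symm, Fintype.sum_prod_type, mul_assoc]
  have l2 : (onLegs S j k * onLegs S i j * onLegs S j k :
      Module.End ℂ ((Fin n → ι) → M)) ρ J
      = ∑ a : ι × ι, ∑ b, ∑ x, ∑ c : ι × ι,
        (S (J j, J k) a * S (J i, a.1) (x, b) * S (b, a.2) c) • F x c.1 c.2 := by
    simp only [Module.End.mul_apply, onLegs_apply, Finset.smul_sum, smul_smul, e2]
    refine Finset.sum_congr rfl fun a _ => ?_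
    rw [Fintype.sum_prod_type, Finset.sum_comm]
    simp [hij, hik, hjk, hik.symm, hjk.symm, mul_assoc]
  rw [l1, l2, sum_collect (fun a b z c => S (J i, J j) a * S (a.2, J k) (b, z) * S (a.1, b) c)
    (fun z c => F c.1 c.2 z),
    sum_collect (fun a b x c => S (J j, J k) a * S (J i, a.1) (x, b) * S (b, a.2) c)
    (fun x c => F x c.1 c.2)]
  simp only [Fintype.sum_prod_type (f := fun c : ι × ι => (_ : ℂ) • (_ : M))]
  calc _ = ∑ z, ∑ x, ∑ y, (∑ a : ι × ι, ∑ b, S (J j, J k) a * S (J i, a.1) (x, b)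
            * S (b, a.2) (y, z)) • F x y z := by
        refine Finset.sum_congr rfl fun z _ => Finset.sum_congr rfl fun x _ =>
          Finset.sum_congr rfl fun y _ => ?_
        rw [hS]
    _ = _ := by
        rw [Finset.sum_comm]
        refine Finset.sum_congr rfl fun x _ => ?_
        rw [Finset.sum_comm]

/-- `S` acting on the neighbouring legs `i` and `i + 1`. -/
def legs (S : Matrix (ι × ι) (ι × ι) ℂ) (k : ℕ) (i : Fin k) :
    Module.End ℂ ((Fin (k + 1) → ι) → M) := onLegs S i.castSucc i.succ

theorem legs_braidRel {S : Matrix (ι × ι) (ι × ι) ℂ} (hS : YangBaxter S) (k : ℕ) :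
    BraidRel (legs (M := M) S k) where
  comm i j h := by
    refine onLegs_comm S ?_ ?_ ?_ ?_ <;>
      simp only [ne_eq, Fin.ext_iff, Fin.val_castSucc, Fin.val_succ] <;> omega
  braid i j h := by
    have e : i.succ = j.castSucc := Fin.ext (by simpa using h)
    unfold legs
    rw [e]
    refine onLegs_braid hS ?_ ?_ ?_ <;>
      simp only [ne_eq, Fin.ext_iff, Fin.val_castSucc, Fin.val_succ] <;> omega

theorem legs_mul_legs [DecidableEq ι] {S T : Matrix (ι × ι) (ι × ι) ℂ} (h : S * T = 1) (k : ℕ)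
    (i : Fin k) : legs (M := M) S k i * legs T k i = 1 := by
  rw [legs, legs, onLegs_mul _ _ (castSucc_ne_succ i), h, onLegs_one]

theorem BraidRel.inverse {k : ℕ} {N : Type} [Monoid N] {s t : Fin k → N} (hs : BraidRel s)
    (hst : ∀ i, s i * t i = 1) (hts : ∀ i, t i * s i = 1) : BraidRel t where
  comm i j h := by
    have e := hs.comm i j h
    calc t i * t j = t i * t j * (s i * s j) * (t j * t i) := by
          rw [mul_assoc, mul_assoc (s i), ← mul_assoc (s j), hst, one_mul, hst, mul_one]
      _ = t j * t i := by
          rw [e, mul_assoc (t i), ← mul_assoc (t j), hts, one_mul, hts, one_mul]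
  braid i j h := by
    have e := hs.braid i j h
    calc t i * t j * t i = t i * t j * t i * (s j * s i * s j) * (t j * t i * t j) := by
          have : s j * s i * s j * (t j * t i * t j) = 1 := by
            rw [mul_assoc, ← mul_assoc (s j) (t j * t i), ← mul_assoc (s j) (t j), hst, one_mul,
              mul_assoc, ← mul_assoc (s i), hst, one_mul, hst]
          rw [mul_assoc (t i * t j * t i), this, mul_one]
      _ = t j * t i * t j := by
          have : t i * t j * t i * (s i * s j * s i) = 1 := by
            rw [mul_assoc, ← mul_assoc (t i) (s i * s j), ← mul_assoc (t i) (s i), hts, one_mul,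
              mul_assoc, ← mul_assoc (t j), hts, one_mul, hts]
          rw [← e, this, one_mul]

/-- `T ⊗ 1` on the first `k` of `k + 1` legs. -/
noncomputable def liftInit (k : ℕ) :
    Module.End ℂ ((Fin k → ι) → M) →ₐ[ℂ] Module.End ℂ ((Fin (k + 1) → ι) → M) :=
  AlgHom.ofLinearMap
    { toFun := fun T => LinearMap.pi fun K => LinearMap.proj (Fin.init K) ∘ₗ T ∘ₗ
        LinearMap.pi fun J => LinearMap.proj (Fin.snoc J (K (Fin.last k)) : Fin (k + 1) → ι)
      map_add' := fun S T => by ext1 ρ; funext K; simp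
      map_smul' := fun c T => by ext1 ρ; funext K; simp }
    (by ext1 ρ; funext K; simp)
    (fun S T => by
      ext1 ρ; funext K
      simp only [LinearMap.coe_mk, AddHom.coe_mk, Module.End.mul_apply, LinearMap.pi_apply,
        LinearMap.comp_apply, LinearMap.proj_apply]
      refine congrFun (congrArg S (funext fun J => ?_)) _
      simp only [LinearMap.pi_apply, LinearMap.comp_apply, LinearMap.proj_apply, Fin.init_snoc,
        Fin.snoc_last])

omit [Fintype ι] in
theorem liftInit_apply {k : ℕ} (T : Module.End ℂ ((Fin k → ι) → M)) (ρ : (Fin (k + 1) → ι) → M)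
    (J : Fin k → ι) (a : ι) :
    liftInit k T ρ (Fin.snoc J a : Fin (k + 1) → ι)
      = T (fun J => ρ (Fin.snoc J a : Fin (k + 1) → ι)) J := by
  simp only [liftInit, AlgHom.ofLinearMap_apply, LinearMap.coe_mk, AddHom.coe_mk,
    LinearMap.pi_apply, LinearMap.comp_apply, LinearMap.proj_apply, Fin.init_snoc, Fin.snoc_last]
  rfl

/-- `1 ⊗ T` on the last `k` of `k + 1` legs. -/
noncomputable def liftTail (k : ℕ) :
    Module.End ℂ ((Fin k → ι) → M) →ₐ[ℂ] Module.End ℂ ((Fin (k + 1) → ι) → M) :=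
  AlgHom.ofLinearMap
    { toFun := fun T => LinearMap.pi fun K => LinearMap.proj (Fin.tail K) ∘ₗ T ∘ₗ
        LinearMap.pi fun J => LinearMap.proj (Fin.cons (K 0) J : Fin (k + 1) → ι)
      map_add' := fun S T => by ext1 ρ; funext K; simp
      map_smul' := fun c T => by ext1 ρ; funext K; simp }
    (by ext1 ρ; funext K; simp)
    (fun S T => by
      ext1 ρ; funext K
      simp only [LinearMap.coe_mk, AddHom.coe_mk, Module.End.mul_apply, LinearMap.pi_apply,
        LinearMap.comp_apply, LinearMap.proj_apply]
      congr 2)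

omit [Fintype ι] in
theorem liftTail_apply {k : ℕ} (T : Module.End ℂ ((Fin k → ι) → M)) (ρ : (Fin (k + 1) → ι) → M)
    (J : Fin k → ι) (a : ι) :
    liftTail k T ρ (Fin.cons a J : Fin (k + 1) → ι)
      = T (fun J => ρ (Fin.cons a J : Fin (k + 1) → ι)) J := rfl

theorem liftInit_onLegs (S : Matrix (ι × ι) (ι × ι) ℂ) {k : ℕ} (i j : Fin k) :
    liftInit k (onLegs (M := M) S i j) = onLegs S i.castSucc j.castSucc := by
  ext1 ρ
  refine funext_snoc fun J a => ?_
  rw [liftInit_apply, onLegs_apply, onLegs_apply]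
  simp only [Fin.snoc_castSucc, ← Fin.snoc_update]

theorem liftTail_onLegs (S : Matrix (ι × ι) (ι × ι) ℂ) {k : ℕ} (i j : Fin k) :
    liftTail k (onLegs (M := M) S i j) = onLegs S i.succ j.succ := by
  ext1 ρ
  refine funext_cons fun J a => ?_
  rw [liftTail_apply, onLegs_apply, onLegs_apply]
  simp only [Fin.cons_succ, Fin.cons_update]

theorem legs_castSucc (S : Matrix (ι × ι) (ι × ι) ℂ) (k : ℕ) (i : Fin k) :
    legs (M := M) S (k + 1) i.castSucc = liftInit (k + 1) (legs S k i) := by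
  rw [legs, legs, liftInit_onLegs, Fin.succ_castSucc]

theorem legs_succ (S : Matrix (ι × ι) (ι × ι) ℂ) (k : ℕ) (i : Fin k) :
    legs (M := M) S (k + 1) i.succ = liftTail (k + 1) (legs S k i) := by
  rw [legs, legs, liftTail_onLegs, Fin.succ_castSucc]

end Legs

/-! ### Compatibility of the alternating sums with algebra homomorphisms. -/

section MapSums
variable {M N : Type} [Ring M] [Algebra ℂ M] [Ring N] [Algebra ℂ N] (φ : M →ₐ[ℂ] N)

theorem map_altSum {k : ℕ} (s : Fin k → M) : φ (altSum s) = altSum fun i => φ (s i) := by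
  simp only [altSum, map_sum, map_smul]
  exact Finset.sum_congr rfl fun π _ => congrArg _ (wordProd_map (φ : M →* N) s π)

theorem map_shufR (k : ℕ) (s : Fin k → M) : φ (shufR k s) = shufR k fun i => φ (s i) := by
  induction k with
  | zero => simp [shufR]
  | succ k ih => simp [shufR, ih]

theorem map_shufL (k : ℕ) (s : Fin k → M) : φ (shufL k s) = shufL k fun i => φ (s i) := by
  induction k with
  | zero => simp [shufL]
  | succ k ih => simp [shufL, ih]

theorem map_descProd (k : ℕ) (s : Fin k → M) : φ (descProd k s) = descProd k fun i => φ (s i) := by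
  induction k with
  | zero => simp [descProd]
  | succ k ih => simp [descProd, ih]

theorem map_ascProd (k : ℕ) (s : Fin k → M) : φ (ascProd k s) = ascProd k fun i => φ (s i) := by
  induction k with
  | zero => simp [ascProd]
  | succ k ih => simp [ascProd, ih]

end MapSums

/-! ### Antisymmetrisers and shuffle sums on tensor powers. -/

section Antisymm

variable {A ι : Type} [Ring A] [Algebra ℂ A] [Fintype ι] {σ : Matrix (ι × ι) (ι × ι) ℂ}

theorem perm_fin_one (π : Equiv.Perm (Fin (0 + 1))) : π = 1 :=
  Equiv.ext fun _ => Subsingleton.elim (α := Fin 1) _ _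

theorem antisymm_succ (σ : Matrix (ι × ι) (ι × ι) ℂ) (k : ℕ) :
    antisymm (A := A) σ (k + 1) = altSum (legs σ k) := rfl

theorem shuffleSum_eq (σ : Matrix (ι × ι) (ι × ι) ℂ) (k i : ℕ) :
    shuffleSum (A := A) σ k i = altSumOn (legs σ k) (fun π => IsShuffle i π⁻¹) := rfl

variable (hσ : ∀ k, BraidRel (legs (M := A) σ k))
include hσ

theorem shuffleSum_right (k : ℕ) : shuffleSum (A := A) σ k k = shufR k (legs σ k) := by
  rw [shuffleSum_eq, altSumOn_shuffleR (hσ k)]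

theorem shuffleSum_left (k : ℕ) : shuffleSum (A := A) σ k 1 = shufL k (legs σ k) := by
  rw [shuffleSum_eq, altSumOn_shuffleL (hσ k)]

theorem altSumOn_legs_last (k : ℕ) :
    altSumOn (legs (M := A) σ k) (fun π => π (Fin.last k) = Fin.last k)
      = liftInit k (antisymm (A := A) σ k) := by
  cases k with
  | zero =>
    rw [antisymm, map_one]
    exact altSumOn_eq_one (hσ 0) fun π => by
      simp [perm_fin_one π]
  | succ k =>
    rw [altSumOn_last (hσ _), antisymm_succ, map_altSum]
    simp only [legs_castSucc]

theorem altSumOn_legs_zero (k : ℕ) :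
    altSumOn (legs (M := A) σ k) (fun π => π 0 = 0) = liftTail k (antisymm (A := A) σ k) := by
  cases k with
  | zero =>
    rw [antisymm, map_one]
    exact altSumOn_eq_one (hσ 0) fun π => by
      simp [perm_fin_one π]
  | succ k =>
    rw [altSumOn_zero (hσ _), antisymm_succ, map_altSum]
    simp only [legs_succ]

/-- With the smaller antisymmetriser on the left, contracting the last leg after the shuffle sum
maps the kernel of one antisymmetriser into the kernel of the next lower one. -/
theorem antisymm_eq_right (k : ℕ) :
    antisymm (A := A) σ (k + 1) = liftInit k (antisymm (A := A) σ k) * shuffleSum σ k k := by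
  rw [antisymm_succ, altSum_eq_mul_shufR (hσ k), altSumOn_legs_last hσ,
    shuffleSum_right hσ]

theorem antisymm_eq_left (k : ℕ) :
    antisymm (A := A) σ (k + 1) = liftTail k (antisymm (A := A) σ k) * shuffleSum σ k 1 := by
  rw [antisymm_succ, altSum_eq_mul_shufL (hσ k), altSumOn_legs_zero hσ,
    shuffleSum_left hσ]

/-- With the smaller antisymmetriser on the right, appending a leg maps kernels into kernels, so
that the wedge product by a form from the right is well defined. -/
theorem exists_antisymm_eq_init (k : ℕ) :
    ∃ C, antisymm (A := A) σ (k + 1) = C * liftInit k (antisymm (A := A) σ k) := by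
  obtain ⟨C, hC⟩ := exists_altSum_eq_mul_last (hσ k)
  exact ⟨C, by rw [antisymm_succ, hC, altSumOn_legs_last hσ]⟩

theorem exists_antisymm_eq_tail (k : ℕ) :
    ∃ C, antisymm (A := A) σ (k + 1) = C * liftTail k (antisymm (A := A) σ k) := by
  obtain ⟨C, hC⟩ := exists_altSum_eq_mul_zero (hσ k)
  exact ⟨C, by rw [antisymm_succ, hC, altSumOn_legs_zero hσ]⟩

/-- This recursion is meant for ρ ⊗ ω₀: the inner shuffle sum acts on ρ alone, and only one braiding
touches ω₀. -/
theorem shuffleSum_right_succ (k : ℕ) : shuffleSum (A := A) σ (k + 1) (k + 1)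
    = 1 - legs σ (k + 1) (Fin.last k) * liftInit (k + 1) (shuffleSum σ k k) := by
  rw [shuffleSum_right hσ, shuffleSum_right hσ, shufR, map_shufR]
  simp only [legs_castSucc]

theorem shuffleSum_left_succ (k : ℕ) : shuffleSum (A := A) σ (k + 1) 1
    = 1 - legs σ (k + 1) 0 * liftTail (k + 1) (shuffleSum σ k 1) := by
  rw [shuffleSum_left hσ, shuffleSum_left hσ, shufL, map_shufL]
  simp only [legs_succ]

/-- This recursion is meant for ω₀ ⊗ ρ: only the longest term moves ω₀, and it carries ω₀ through
all of ρ to the right end. -/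
theorem shuffleSum_right_succ' (k : ℕ) : shuffleSum (A := A) σ (k + 1) (k + 1)
    = liftTail (k + 1) (shuffleSum σ k k) + (-1) ^ (k + 1) * descProd (k + 1) (legs σ (k + 1)) := by
  rw [shuffleSum_right hσ, shuffleSum_right hσ, shufR_succ, map_shufR]
  simp only [legs_succ]

theorem shuffleSum_left_succ' (k : ℕ) : shuffleSum (A := A) σ (k + 1) 1
    = liftInit (k + 1) (shuffleSum σ k 1) + (-1) ^ (k + 1) * ascProd (k + 1) (legs σ (k + 1)) := by
  rw [shuffleSum_left hσ, shuffleSum_left hσ, shufL_succ, map_shufL]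
  simp only [legs_castSucc]

theorem shuffleSum_zero (i : ℕ) : shuffleSum (A := A) σ 0 i = 1 := by
  rw [shuffleSum_eq]
  exact altSumOn_eq_one (hσ 0) fun π => by
    simp only [perm_fin_one π, iff_true]
    intro a b h _
    exact h

end Antisymm

end QuantumGroups

namespace QuantumGroups

/-! ### The operations on tensor powers of a Hopf bimodule in coordinates -/

section Coordinates

variable {A : Type} [Ring A] [HopfAlgebra ℂ A] {ι : Type}

theorem sum_fin_one [Fintype ι] {M : Type} [AddCommMonoid M] (F : (Fin 1 → ι) → M) :
    ∑ I, F I = ∑ i, F fun _ => i :=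
  Fintype.sum_equiv (Equiv.funUnique (Fin 1) ι) _ _ fun I => by
    congr 1
    funext x
    simp [Subsingleton.elim x 0]

namespace BimoduleData

variable (Γ : BimoduleData A ι)

theorem fPow_zero (I J : Fin 0 → ι) : Γ.fPow I J = CoalgebraStruct.counit := by
  simp [fPow]

theorem fPow_cons {k : ℕ} (a b : ι) (I J : Fin k → ι) :
    Γ.fPow (Fin.cons a I : Fin (k + 1) → ι) (Fin.cons b J) = conv (Γ.f a b) (Γ.fPow I J) := by
  simp [fPow, List.finRange_succ, Function.comp_def]

theorem fPow_one (I J : Fin 1 → ι) : Γ.fPow I J = Γ.f (I 0) (J 0) := by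
  rw [← Fin.cons_self_tail I, ← Fin.cons_self_tail J, fPow_cons, fPow_zero, conv_counit]
  simp

variable [Fintype ι] [DecidableEq ι]

theorem fPow_apply_one {Γ : BimoduleData A ι} (hΓ : Γ.IsYD) {k : ℕ} (I J : Fin k → ι) :
    Γ.fPow I J 1 = if I = J then 1 else 0 := by
  induction k with
  | zero => simp [fPow_zero, Subsingleton.elim I J]
  | succ k ih =>
    rw [← Fin.cons_self_tail I, ← Fin.cons_self_tail J]
    simp only [fPow_cons, conv_apply_one, hΓ.f_one, ih, Fin.cons_inj]
    split_ifs <;> simp_all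

omit [DecidableEq ι] in
theorem rmul_apply {k : ℕ} (ρ : Tens A ι k) (a : A) (J : Fin k → ι) :
    Γ.rmul k ρ a J = ∑ I, ρ I * leftAct (Γ.fPow I J) a := by
  simp [rmul, LinearMap.sum_apply, Finset.sum_apply]

theorem leftAct_apply_algebraMap (X : A →ₗ[ℂ] ℂ) (z : ℂ) :
    leftAct X (algebraMap ℂ A z) = (z * X 1) • 1 := by
  have h : leftAct X 1 = X 1 • (1 : A) := by
    simp [leftAct, Algebra.TensorProduct.one_def]
  rw [Algebra.algebraMap_eq_smul_one, map_smul, h, smul_smul]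

theorem rmul_algebraMap {Γ : BimoduleData A ι} (hΓ : Γ.IsYD) {k : ℕ} (ρ : Tens A ι k) (z : ℂ) :
    Γ.rmul k ρ (algebraMap ℂ A z) = z • ρ := by
  funext J
  rw [rmul_apply, Finset.sum_eq_single J]
  · simp [leftAct_apply_algebraMap, fPow_apply_one hΓ]
  · intro I _ h
    simp [leftAct_apply_algebraMap, fPow_apply_one hΓ, h]
  · simp

omit [DecidableEq ι] in
-- The coefficient of ρ has to be moved to the left of an invariant form. In the coordinates of the
-- result this appears as the left action of a linear combination of the functionals `f`.
theorem tensorLeft_apply {k : ℕ} (c : ι → ℂ) (ρ : Tens A ι k) (K : Fin (k + 1) → ι) :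
    Γ.tensorLeft (fun I => algebraMap ℂ A (c (I 0))) ρ K
      = leftAct (∑ i, c i • Γ.f i (K 0)) (ρ (Fin.tail K)) := by
  simp only [tensorLeft, LinearMap.pi_apply, LinearMap.comp_apply, LinearMap.proj_apply,
    rmul_apply, sum_fin_one, fPow_one, leftAct_sum, leftAct_smul, ← Algebra.smul_def]
  rw [LinearMap.sum_apply]
  rfl

theorem tensorRight_apply {Γ : BimoduleData A ι} (hΓ : Γ.IsYD) {k : ℕ} (c : ι → ℂ)
    (ρ : Tens A ι k) (K : Fin (k + 1) → ι) :
    Γ.tensorRight (fun I => algebraMap ℂ A (c (I 0))) ρ K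
      = c (K (Fin.last k)) • ρ (Fin.init K) := by
  simp only [tensorRight, LinearMap.pi_apply, LinearMap.comp_apply, LinearMap.proj_apply,
    LinearMap.flip_apply, rmul_algebraMap hΓ, Pi.smul_apply]

/-- `σ_k ⋯ σ_1` moves the first tensor factor to the last position. -/
theorem descProd_legs_apply {Γ : BimoduleData A ι} (hΓ : Γ.IsYD) (k : ℕ) (ξ : Tens A ι (k + 1))
    (J : Fin k → ι) (d : ι) :
    descProd k (legs Γ.braiding k) ξ (Fin.snoc J d : Fin (k + 1) → ι)
      = ∑ j, ∑ I : Fin k → ι, Γ.f j d (tensorPow Γ.v k J I)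
        • ξ (Fin.cons j I : Fin (k + 1) → ι) := by
  induction k generalizing d with
  | zero =>
    have e : ∀ j, (Fin.cons j (default : Fin 0 → ι) : Fin (0 + 1) → ι) = fun _ => j := by
      intro j; funext x; rw [Subsingleton.elim (α := Fin 1) x 0]; rfl
    have e' : (Fin.snoc J d : Fin (0 + 1) → ι) = fun _ => d := by
      funext x; rw [Subsingleton.elim (α := Fin 1) x (Fin.last 0), Fin.snoc_last]
    simp [descProd, tensorPow_zero, hΓ.f_one, e, e']
  | succ k ih =>
    rw [← Fin.snoc_init_self J]
    generalize Fin.init J = J'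
    generalize J (Fin.last k) = b
    have hl : ∀ i : Fin k, legs (M := A) Γ.braiding (k + 1) i.castSucc
        = liftInit (k + 1) (legs Γ.braiding k i) := legs_castSucc _ _
    rw [descProd, Module.End.mul_apply]
    simp only [hl]
    rw [← map_descProd, legs, onLegs_apply]
    have e : ∀ a : ι × ι, Function.update (Function.update
        (Fin.snoc (Fin.snoc J' b : Fin (k + 1) → ι) d : Fin (k + 1 + 1) → ι)
          (Fin.last k).castSucc a.1) (Fin.last k).succ a.2
        = Fin.snoc (Fin.snoc J' a.1 : Fin (k + 1) → ι) a.2 := by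
      intro a
      rw [← Fin.snoc_update, Fin.update_snoc_last, Fin.succ_last, Fin.update_snoc_last]
    have e1 : (Fin.snoc (Fin.snoc J' b : Fin (k + 1) → ι) d : Fin (k + 1 + 1) → ι)
        (Fin.last k).castSucc = b := by simp
    have e2 : (Fin.snoc (Fin.snoc J' b : Fin (k + 1) → ι) d : Fin (k + 1 + 1) → ι)
        (Fin.last k).succ = d := by rw [Fin.succ_last, Fin.snoc_last]
    simp only [e, e1, e2, liftInit_apply, ih, Fintype.sum_prod_type]
    simp only [braiding, Matrix.of_apply, sum_snoc, tensorPow_snoc, hΓ.f_mul, Finset.sum_smul,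
      Finset.smul_sum, smul_smul, Fin.cons_snoc_eq_snoc_cons]
    -- By multiplicativity of `f`, the functional of the braiding applied last and the one from the
    -- induction hypothesis combine to `f` on the longer product of entries of `v`.
    calc _ = ∑ j, ∑ a1, ∑ a2, ∑ I, (Γ.f a1 d (Γ.v b a2) * Γ.f j a1 (tensorPow Γ.v k J' I)) •
          ξ (Fin.snoc (Fin.cons j I : Fin (k + 1) → ι) a2 : Fin (k + 1 + 1) → ι) := by
          rw [Finset.sum_congr rfl fun a1 _ => Finset.sum_comm, Finset.sum_comm]
      _ = _ := by
          refine Finset.sum_congr rfl fun j _ => ?_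
          rw [Finset.sum_comm]
          refine Finset.sum_congr rfl fun a2 _ => ?_
          rw [Finset.sum_comm]
          refine Finset.sum_congr rfl fun I _ => Finset.sum_congr rfl fun a1 _ => ?_
          rw [mul_comm]

/-- `σ_1 ⋯ σ_k` moves the last tensor factor to the first position. -/
theorem ascProd_legs_apply {Γ : BimoduleData A ι} (hΓ : Γ.IsYD) (k : ℕ) (ξ : Tens A ι (k + 1))
    (J : Fin k → ι) (b : ι) :
    ascProd k (legs Γ.braiding k) ξ (Fin.cons b J : Fin (k + 1) → ι)
      = ∑ I : Fin k → ι, ∑ j, Γ.fPow I J (Γ.v b j)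
        • ξ (Fin.snoc I j : Fin (k + 1) → ι) := by
  induction k generalizing b with
  | zero =>
    have e : (Fin.cons b J : Fin (0 + 1) → ι) = fun _ => b := by
      funext x; rw [Subsingleton.elim (α := Fin 1) x 0]; rfl
    have e' : ∀ j, (Fin.snoc (default : Fin 0 → ι) j : Fin (0 + 1) → ι) = fun _ => j := by
      intro j; funext x; rw [Subsingleton.elim (α := Fin 1) x (Fin.last 0), Fin.snoc_last]
    simp [ascProd, fPow_zero, hΓ.counit_v, e, e']
  | succ k ih =>
    rw [← Fin.cons_self_tail J]
    generalize Fin.tail J = J'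
    generalize J 0 = d
    have hl : ∀ i : Fin k, legs (M := A) Γ.braiding (k + 1) i.succ
        = liftTail (k + 1) (legs Γ.braiding k i) := legs_succ _ _
    rw [ascProd, Module.End.mul_apply]
    simp only [hl]
    rw [← map_ascProd, legs, onLegs_apply]
    have e : ∀ a : ι × ι, Function.update (Function.update
        (Fin.cons b (Fin.cons d J' : Fin (k + 1) → ι) : Fin (k + 1 + 1) → ι)
          (0 : Fin (k + 1)).castSucc a.1) (0 : Fin (k + 1)).succ a.2
        = Fin.cons a.1 (Fin.cons a.2 J' : Fin (k + 1) → ι) := by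
      intro a
      rw [Fin.castSucc_zero, Fin.update_cons_zero, ← Fin.cons_update, Fin.update_cons_zero]
    simp only [e, liftTail_apply, ih, Fintype.sum_prod_type]
    -- Here the additional leg enters through convolution: the matrix coproduct of `v` splits the
    -- functional of the longer tensor power.
    simp only [braiding, Matrix.of_apply, sum_cons, fPow_cons,
      conv_of_comul (hΓ.comul_v _ _), Finset.sum_smul,
      Finset.smul_sum, smul_smul, ← Fin.cons_snoc_eq_snoc_cons, Fin.castSucc_zero, Fin.cons_zero,
      Fin.cons_succ]
    refine Finset.sum_congr rfl fun a1 _ => ?_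
    rw [Finset.sum_comm]
    refine Finset.sum_congr rfl fun I _ => ?_
    rw [Finset.sum_comm]

end BimoduleData

end Coordinates

end QuantumGroups

namespace QuantumGroups

/-! ### Subalgebras of operators and the coactions on the external algebra -/

section Separation
variable {V A : Type} [AddCommGroup V] [Module ℂ V] [AddCommGroup A] [Module ℂ A]

/-- Coordinates of `t` with respect to a basis of A are contractions with coordinate functionals.
Statements on a coaction are thereby reduced to the operators X ∗ ρ. -/
theorem eq_zero_of_forall_lTensor {t : V ⊗[ℂ] A}
    (h : ∀ X : A →ₗ[ℂ] ℂ, TensorProduct.rid ℂ V (X.lTensor V t) = 0) : t = 0 := by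
  set b := Module.Free.chooseBasis ℂ A
  refine (TensorProduct.equivFinsuppOfBasisRight (M := V) b).map_eq_zero_iff.mp ?_
  ext i
  have : ∀ t : V ⊗[ℂ] A, TensorProduct.equivFinsuppOfBasisRight b t i
      = TensorProduct.rid ℂ V ((b.coord i).lTensor V t) := by
    intro t
    induction t using TensorProduct.induction_on with
    | zero => simp
    | add x y hx hy => simp only [map_add, Finsupp.add_apply, hx, hy]
    | tmul x y => simp
  rw [this, h]
  rfl

theorem eq_zero_of_forall_rTensor {t : A ⊗[ℂ] V}
    (h : ∀ X : A →ₗ[ℂ] ℂ, TensorProduct.lid ℂ V (X.rTensor V t) = 0) : t = 0 := by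
  refine (TensorProduct.comm ℂ A V).map_eq_zero_iff.mp (eq_zero_of_forall_lTensor fun X => ?_)
  rw [← h X]
  clear h
  induction t using TensorProduct.induction_on with
  | zero => simp
  | add x y hx hy => simp only [map_add, hx, hy]
  | tmul x y => simp

end Separation

section Subalgebras
variable {A ι : Type} [Ring A] [Algebra ℂ A] [Fintype ι] {σ : Matrix (ι × ι) (ι × ι) ℂ}

/-- Applied to centralisers, this transfers commutation from single braidings to all operators built
from them, without unfolding reduced words. -/
theorem braidPerm_mem {k : ℕ} {S : Subalgebra ℂ (Module.End ℂ (Tens A ι (k + 1)))}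
    (hS : ∀ i, legs σ k i ∈ S) (π : Equiv.Perm (Fin (k + 1))) : braidPerm σ π ∈ S := by
  refine list_prod_mem fun x hx => ?_
  obtain ⟨i, _, rfl⟩ := List.mem_map.mp hx
  exact hS i

theorem antisymm_mem {k : ℕ} {S : Subalgebra ℂ (Module.End ℂ (Tens A ι k))}
    (hS : ∀ i j : Fin k, (i : ℕ) + 1 = j → onLegs σ i j ∈ S) : antisymm (A := A) σ k ∈ S := by
  cases k with
  | zero => exact S.one_mem
  | succ k =>
    exact S.sum_mem fun π _ => S.smul_mem (braidPerm_mem (fun i => hS _ _ (by simp)) π) _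

theorem shuffleSum_mem {k : ℕ} {S : Subalgebra ℂ (Module.End ℂ (Tens A ι (k + 1)))}
    (hS : ∀ i, legs σ k i ∈ S) (i : ℕ) : shuffleSum (A := A) σ k i ∈ S :=
  S.sum_mem fun π _ => S.smul_mem (braidPerm_mem hS π) _

/-- The operators that commute with all coordinatewise linear maps. -/
def scalarOps (A ι : Type) [Ring A] [Algebra ℂ A] (k : ℕ) :
    Subalgebra ℂ (Module.End ℂ (Tens A ι k)) :=
  Subalgebra.centralizer ℂ (Set.range fun g : A →ₗ[ℂ] A => g.compLeft (Fin k → ι))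

omit [Fintype ι] in
theorem scalarOps_apply {k : ℕ} {T : Module.End ℂ (Tens A ι k)} (hT : T ∈ scalarOps A ι k)
    (g : A →ₗ[ℂ] A) (ρ : Tens A ι k) : T (fun J => g (ρ J)) = fun J => g (T ρ J) :=
  (LinearMap.congr_fun (Subalgebra.mem_centralizer_iff ℂ |>.mp hT _ ⟨g, rfl⟩) ρ).symm

theorem onLegs_mem_scalarOps {k : ℕ} (i j : Fin k) : onLegs σ i j ∈ scalarOps A ι k := by
  refine (Subalgebra.mem_centralizer_iff ℂ).mpr ?_
  rintro _ ⟨g, rfl⟩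
  refine LinearMap.ext fun ρ => funext fun J => ?_
  simp [onLegs_apply]

end Subalgebras

/-! ### The operators X ∗ ρ and ρ ∗ X on tensor powers. -/

section Coactions
variable {A : Type} [Ring A] [HopfAlgebra ℂ A] {ι : Type} [Fintype ι]

namespace BimoduleData

/-- `ρ ↦ X ∗ ρ` on `Γ^{⊗k}`. -/
noncomputable def actR (Γ : BimoduleData A ι) (k : ℕ) (X : A →ₗ[ℂ] ℂ) :
    Module.End ℂ (Tens A ι k) :=
  LinearMap.pi fun J => ∑ I, leftAct (shiftR X (tensorPow Γ.v k J I)) ∘ₗ LinearMap.proj I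

theorem actR_apply (Γ : BimoduleData A ι) {k : ℕ} (X : A →ₗ[ℂ] ℂ) (ρ : Tens A ι k)
    (J : Fin k → ι) :
    Γ.actR k X ρ J = ∑ I, leftAct (shiftR X (tensorPow Γ.v k J I)) (ρ I) := by
  simp [actR, LinearMap.sum_apply]

theorem shiftR_sum (X : A →ₗ[ℂ] ℂ) {κ : Type} (s : Finset κ) (c : κ → ℂ) (b : κ → A) :
    shiftR X (∑ i ∈ s, c i • b i) = ∑ i ∈ s, c i • shiftR X (b i) := by
  ext a
  simp [Finset.mul_sum, LinearMap.sum_apply]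

variable [DecidableEq ι]

theorem contract_coactL {k : ℕ} (X : A →ₗ[ℂ] ℂ) (ρ : Tens A ι k) :
    TensorProduct.lid ℂ _ (X.rTensor _ (coactL k ρ)) = fun J => rightAct X (ρ J) := by
  have h : ∀ (I : Fin k → ι) (t : A ⊗[ℂ] A), TensorProduct.lid ℂ _ (X.rTensor _
      ((LinearMap.single ℂ (fun _ : Fin k → ι => A) I).lTensor A t))
      = LinearMap.single ℂ (fun _ : Fin k → ι => A) I (TensorProduct.lid ℂ A (X.rTensor A t)) := by
    intro I t
    induction t using TensorProduct.induction_on with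
    | zero => simp
    | add x y hx hy => simp only [map_add, hx, hy]
    | tmul x y => simp only [LinearMap.lTensor_tmul, LinearMap.rTensor_tmul,
        TensorProduct.lid_tmul, map_smul]
  simp only [coactL, LinearMap.sum_apply, map_sum, LinearMap.comp_apply, h]
  funext J
  rw [Finset.sum_apply, Finset.sum_eq_single J]
  · simp [rightAct]
  · intro I _ hI
    simp [Pi.single_eq_of_ne hI.symm]
  · simp

theorem contract_coactR (Γ : BimoduleData A ι) {k : ℕ} (X : A →ₗ[ℂ] ℂ) (ρ : Tens A ι k) :
    TensorProduct.rid ℂ _ (X.lTensor _ (Γ.coactR k ρ)) = Γ.actR k X ρ := by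
  have h : ∀ (I : Fin k → ι) (b : A) (t : A ⊗[ℂ] A), TensorProduct.rid ℂ _ (X.lTensor _
      (TensorProduct.map (LinearMap.single ℂ (fun _ : Fin k → ι => A) I)
        (LinearMap.mulRight ℂ b) t))
      = LinearMap.single ℂ (fun _ : Fin k → ι => A) I
        (TensorProduct.rid ℂ A ((shiftR X b).lTensor A t)) := by
    intro I b t
    induction t using TensorProduct.induction_on with
    | zero => simp
    | add x y hx hy => simp only [map_add, hx, hy]
    | tmul x y => simp only [LinearMap.lTensor_tmul, TensorProduct.map_tmul,
        TensorProduct.rid_tmul, map_smul, shiftR_apply, LinearMap.mulRight_apply]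
  simp only [coactR, LinearMap.sum_apply, map_sum, LinearMap.comp_apply, h]
  funext J
  rw [Finset.sum_apply, actR_apply]
  refine Finset.sum_congr rfl fun I _ => ?_
  rw [Finset.sum_apply, Finset.sum_eq_single J]
  · simp [leftAct]
  · intro I _ hI
    simp [Pi.single_eq_of_ne hI.symm]
  · simp

/-- The braiding is a comodule map: the relation `rtt` moves it from the row indices to the column
indices of the tensor power of `v`. -/
theorem onLegs_actR {Γ : BimoduleData A ι} (hΓ : Γ.IsYD) {k : ℕ} (X : A →ₗ[ℂ] ℂ) (i j : Fin k)
    (hij : (i : ℕ) + 1 = j) (ρ : Tens A ι k) :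
    onLegs Γ.braiding i j (Γ.actR k X ρ) = Γ.actR k X (onLegs Γ.braiding i j ρ) := by
  have hne : i ≠ j := by
    rintro rfl
    omega
  funext J
  rw [onLegs_apply, actR_apply]
  simp only [actR_apply, onLegs_apply, map_sum, map_smul, Finset.smul_sum]
  rw [Finset.sum_comm]
  have key : ∀ I, ∑ a : ι × ι, Γ.braiding (J i, J j) a • leftAct (shiftR X (tensorPow Γ.v k
        (Function.update (Function.update J i a.1) j a.2) I)) (ρ I)
      = ∑ a : ι × ι, Γ.braiding a (I i, I j) • leftAct (shiftR X (tensorPow Γ.v k J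
        (Function.update (Function.update I i a.1) j a.2))) (ρ I) := by
    intro I
    have := congrArg (fun b => leftAct (shiftR X b) (ρ I)) (hΓ.rtt.tensorPow i j hij J I)
    simpa only [shiftR_sum, leftAct_sum, leftAct_smul, LinearMap.sum_apply,
      LinearMap.smul_apply] using this
  rw [Finset.sum_congr rfl fun I _ => key I]
  have := sum_update i j hne (fun I I' => Γ.braiding (I' i, I' j) (I i, I j) •
    leftAct (shiftR X (tensorPow Γ.v k J I')) (ρ I))
  simpa [hne, hne.symm] using this

end BimoduleData

end Coactions

/-! ### Descent of the coactions to the external algebra. -/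

section Descent
variable {A : Type} [Ring A] [HopfAlgebra ℂ A] {ι : Type} [Fintype ι] [DecidableEq ι]

omit [DecidableEq ι] in
-- The antisymmetriser has scalar coefficients, so it commutes with any linear map applied to all
-- entries. The left coaction is of this kind, as the basis forms are left-coinvariant.
theorem antisymm_coordinatewise {σ : Matrix (ι × ι) (ι × ι) ℂ} {k : ℕ} {ρ : Tens A ι k}
    (h : antisymm σ k ρ = 0) (g : A →ₗ[ℂ] A) : antisymm σ k (fun J => g (ρ J)) = 0 := by
  rw [scalarOps_apply (antisymm_mem fun i j _ => onLegs_mem_scalarOps i j), h]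
  funext J
  simp

theorem antisymm_actR {Γ : BimoduleData A ι} (hΓ : Γ.IsYD) {k : ℕ} {ρ : Tens A ι k}
    (h : antisymm Γ.braiding k ρ = 0) (X : A →ₗ[ℂ] ℂ) :
    antisymm Γ.braiding k (Γ.actR k X ρ) = 0 := by
  have : antisymm Γ.braiding k ∈ Subalgebra.centralizer ℂ {Γ.actR k X} := by
    refine antisymm_mem fun i j hij => (Subalgebra.mem_centralizer_iff ℂ).mpr ?_
    rintro _ rfl
    exact LinearMap.ext fun ρ => (BimoduleData.onLegs_actR hΓ X i j hij ρ).symm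
  have := LinearMap.congr_fun ((Subalgebra.mem_centralizer_iff ℂ).mp this _ rfl) ρ
  rw [Module.End.mul_apply, Module.End.mul_apply, h, map_zero] at this
  exact this.symm

omit [DecidableEq ι] in
theorem ExtPower.induced_proj {σ : Matrix (ι × ι) (ι × ι) ℂ} {M : Type} [AddCommGroup M]
    [Module ℂ M] {k : ℕ} {φ : Tens A ι k →ₗ[ℂ] M} (h : Descends σ φ) (ρ : Tens A ι k) :
    ExtPower.induced σ φ (ExtPower.proj (A := A) σ k ρ) = φ ρ := by
  rw [ExtPower.induced, dif_pos h]
  rfl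

omit [DecidableEq ι] in
theorem proj_eq_zero {σ : Matrix (ι × ι) (ι × ι) ℂ} {k : ℕ} {ρ : Tens A ι k} :
    ExtPower.proj (A := A) σ k ρ = 0 ↔ antisymm σ k ρ = 0 := by
  simp

theorem contract_proj_coactR (Γ : BimoduleData A ι) {k : ℕ} (σ : Matrix (ι × ι) (ι × ι) ℂ)
    (X : A →ₗ[ℂ] ℂ) (ρ : Tens A ι k) :
    TensorProduct.rid ℂ _ (X.lTensor _ ((ExtPower.proj (A := A) σ k).rTensor A (Γ.coactR k ρ)))
      = ExtPower.proj (A := A) σ k (Γ.actR k X ρ) := by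
  rw [← BimoduleData.contract_coactR]
  generalize Γ.coactR k ρ = t
  induction t using TensorProduct.induction_on with
  | zero => simp
  | add x y hx hy => simp only [map_add, hx, hy]
  | tmul x y => simp only [LinearMap.lTensor_tmul, LinearMap.rTensor_tmul,
        TensorProduct.rid_tmul, map_smul]

theorem contract_proj_coactL {k : ℕ} (σ : Matrix (ι × ι) (ι × ι) ℂ)
    (X : A →ₗ[ℂ] ℂ) (ρ : Tens A ι k) :
    TensorProduct.lid ℂ _ (X.rTensor _ ((ExtPower.proj (A := A) σ k).lTensor A (BimoduleData.coactL k ρ)))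
      = ExtPower.proj (A := A) σ k (fun J => rightAct X (ρ J)) := by
  rw [← BimoduleData.contract_coactL]
  generalize BimoduleData.coactL k ρ = t
  induction t using TensorProduct.induction_on with
  | zero => simp
  | add x y hx hy => simp only [map_add, hx, hy]
  | tmul x y => simp only [LinearMap.lTensor_tmul, LinearMap.rTensor_tmul,
        TensorProduct.lid_tmul, map_smul]

theorem descends_coactR {Γ : BimoduleData A ι} (hΓ : Γ.IsYD) (k : ℕ) :
    Descends Γ.braiding ((ExtPower.proj Γ.braiding k).rTensor A ∘ₗ Γ.coactR k) := by
  intro ρ hρ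
  refine eq_zero_of_forall_lTensor fun X => ?_
  rw [LinearMap.comp_apply, contract_proj_coactR, proj_eq_zero]
  exact antisymm_actR hΓ hρ X

theorem descends_coactL (σ : Matrix (ι × ι) (ι × ι) ℂ) (k : ℕ) :
    Descends σ ((ExtPower.proj (A := A) σ k).lTensor A ∘ₗ BimoduleData.coactL k) := by
  intro ρ hρ
  refine eq_zero_of_forall_rTensor fun X => ?_
  rw [LinearMap.comp_apply, contract_proj_coactL, proj_eq_zero]
  exact antisymm_coordinatewise hρ _

end Descent

end QuantumGroups

namespace QuantumGroups

/-! ### Contractions with invariant elements and the Laplacian -/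

section Contractions

variable {A : Type} [Ring A] [Algebra ℂ A] {ι : Type}

/-- The wedge product with an invariant element from the right: `ρ ↦ ρ ⊗ c`. -/
def appendLast (c : ι → ℂ) (k : ℕ) : Tens A ι k →ₗ[ℂ] Tens A ι (k + 1) :=
  LinearMap.pi fun K => c (K (Fin.last k)) • LinearMap.proj (Fin.init K)

theorem appendLast_apply (c : ι → ℂ) {k : ℕ} (ρ : Tens A ι k) (J : Fin k → ι) (a : ι) :
    appendLast c k ρ (Fin.snoc J a : Fin (k + 1) → ι) = c a • ρ J := by
  simp [appendLast]

variable [Fintype ι]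

/-- The contraction of the last tensor factor. -/
def contrLast (γ : ι → ℂ) (k : ℕ) : Tens A ι (k + 1) →ₗ[ℂ] Tens A ι k :=
  LinearMap.pi fun J => ∑ a, γ a • LinearMap.proj (Fin.snoc J a : Fin (k + 1) → ι)

theorem contrLast_apply (γ : ι → ℂ) {k : ℕ} (ρ : Tens A ι (k + 1)) (J : Fin k → ι) :
    contrLast γ k ρ J = ∑ a, γ a • ρ (Fin.snoc J a : Fin (k + 1) → ι) := by
  simp [contrLast, LinearMap.sum_apply]

/-- The contraction of the first tensor factor with a vector of scalars. -/
def contrHead (γ : ι → ℂ) (k : ℕ) : Tens A ι (k + 1) →ₗ[ℂ] Tens A ι k :=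
  LinearMap.pi fun J => ∑ a, γ a • LinearMap.proj (Fin.cons a J : Fin (k + 1) → ι)

theorem contrHead_apply (γ : ι → ℂ) {k : ℕ} (ρ : Tens A ι (k + 1)) (J : Fin k → ι) :
    contrHead γ k ρ J = ∑ a, γ a • ρ (Fin.cons a J : Fin (k + 1) → ι) := by
  simp [contrHead, LinearMap.sum_apply]

theorem contrLast_liftInit (γ : ι → ℂ) {k : ℕ} (T : Module.End ℂ (Tens A ι k))
    (ρ : Tens A ι (k + 1)) : contrLast γ k (liftInit k T ρ) = T (contrLast γ k ρ) := by
  have h : contrLast γ k ρ = ∑ a, γ a • fun J => ρ (Fin.snoc J a : Fin (k + 1) → ι) := by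
    funext J
    simp [contrLast_apply]
  funext J
  rw [contrLast_apply, h, map_sum, Finset.sum_apply]
  simp only [liftInit_apply, map_smul, Pi.smul_apply]

omit [Fintype ι] in
theorem liftInit_appendLast (c : ι → ℂ) {k : ℕ} (T : Module.End ℂ (Tens A ι k))
    (ρ : Tens A ι k) : liftInit k T (appendLast c k ρ) = appendLast c k (T ρ) := by
  refine funext_snoc fun J a => ?_
  rw [liftInit_apply, appendLast_apply]
  simp only [appendLast_apply]
  exact congrFun (map_smul T (c a) ρ) J

theorem contrLast_appendLast (γ c : ι → ℂ) {k : ℕ} (ρ : Tens A ι k) :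
    contrLast γ k (appendLast c k ρ) = (∑ a, γ a * c a) • ρ := by
  funext J
  simp only [contrLast_apply, appendLast_apply, smul_smul, ← Finset.sum_smul, Pi.smul_apply]

end Contractions

section Contractions2

variable {A : Type} [Ring A] [HopfAlgebra ℂ A] {ι : Type}

/-- The wedge product with an invariant element from the left, where `ω a = a₍₁₎ φ_j(a₍₂₎) ω_j`. -/
noncomputable def appendFirst (φ : ι → A →ₗ[ℂ] ℂ) (k : ℕ) : Tens A ι k →ₗ[ℂ] Tens A ι (k + 1) :=
  LinearMap.pi fun K => leftAct (φ (K 0)) ∘ₗ LinearMap.proj (Fin.tail K)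

theorem appendFirst_apply (φ : ι → A →ₗ[ℂ] ℂ) {k : ℕ} (ρ : Tens A ι k) (J : Fin k → ι) (a : ι) :
    appendFirst φ k ρ (Fin.cons a J : Fin (k + 1) → ι) = leftAct (φ a) (ρ J) := by
  simp [appendFirst]

/-- Appending on the left acts on the entries by a functional, so T must commute with linear maps of
the entries. No such condition is needed when a leg with scalar coefficients is appended on the
right. -/
theorem liftTail_appendFirst (φ : ι → A →ₗ[ℂ] ℂ) {k : ℕ} {T : Module.End ℂ (Tens A ι k)}
    (hT : T ∈ scalarOps A ι k) (ρ : Tens A ι k) :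
    liftTail k T (appendFirst φ k ρ) = appendFirst φ k (T ρ) := by
  refine funext_cons fun J a => ?_
  rw [liftTail_apply, appendFirst_apply]
  simp only [appendFirst_apply]
  rw [scalarOps_apply hT]

variable [Fintype ι]

/-- The contraction of the first tensor factor. -/
noncomputable def contrFirst (ψ : ι → A →ₗ[ℂ] ℂ) (k : ℕ) : Tens A ι (k + 1) →ₗ[ℂ] Tens A ι k :=
  LinearMap.pi fun J => ∑ b, leftAct (ψ b) ∘ₗ LinearMap.proj (Fin.cons b J : Fin (k + 1) → ι)

theorem contrFirst_apply (ψ : ι → A →ₗ[ℂ] ℂ) {k : ℕ} (ρ : Tens A ι (k + 1)) (J : Fin k → ι) :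
    contrFirst ψ k ρ J = ∑ b, leftAct (ψ b) (ρ (Fin.cons b J : Fin (k + 1) → ι)) := by
  simp [contrFirst, LinearMap.sum_apply]

theorem contrFirst_liftTail (ψ : ι → A →ₗ[ℂ] ℂ) {k : ℕ} {T : Module.End ℂ (Tens A ι k)}
    (hT : T ∈ scalarOps A ι k) (ρ : Tens A ι (k + 1)) :
    contrFirst ψ k (liftTail k T ρ) = T (contrFirst ψ k ρ) := by
  have h : contrFirst ψ k ρ
      = ∑ b, fun J => leftAct (ψ b) (ρ (Fin.cons b J : Fin (k + 1) → ι)) := by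
    funext J
    simp [contrFirst_apply]
  funext J
  rw [contrFirst_apply, h, map_sum, Finset.sum_apply]
  refine Finset.sum_congr rfl fun b _ => ?_
  rw [liftTail_apply, scalarOps_apply hT (leftAct (ψ b)) (fun J => ρ (Fin.cons b J))]

theorem contrFirst_appendFirst (ψ φ : ι → A →ₗ[ℂ] ℂ) {k : ℕ} (ρ : Tens A ι k) (J : Fin k → ι) :
    contrFirst ψ k (appendFirst φ k ρ) J = leftAct (∑ b, conv (ψ b) (φ b)) (ρ J) := by
  simp only [contrFirst_apply, appendFirst_apply, leftAct_sum, LinearMap.sum_apply, leftAct_conv]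

theorem contrLast_appendFirst (γ : ι → ℂ) (φ : ι → A →ₗ[ℂ] ℂ) {k : ℕ} (ρ : Tens A ι (k + 1)) :
    contrLast γ (k + 1) (appendFirst φ (k + 1) ρ) = appendFirst φ k (contrLast γ k ρ) := by
  refine funext_cons fun J a => ?_
  simp only [contrLast_apply, appendFirst_apply, map_sum, map_smul,
    ← Fin.cons_snoc_eq_snoc_cons]

theorem contrFirst_appendLast (ψ : ι → A →ₗ[ℂ] ℂ) (c : ι → ℂ) {k : ℕ} (ρ : Tens A ι (k + 1)) :
    contrFirst ψ (k + 1) (appendLast c (k + 1) ρ) = appendLast c k (contrFirst ψ k ρ) := by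
  refine funext_snoc fun J a => ?_
  simp only [contrFirst_apply, appendLast_apply, Finset.smul_sum, Fin.cons_snoc_eq_snoc_cons,
    map_smul]

end Contractions2

section Laplacian

variable {A : Type} [Ring A] [HopfAlgebra ℂ A] {ι : Type} [Fintype ι]

/-- The differential on representatives. -/
noncomputable def diffOp (c : ι → ℂ) (φ : ι → A →ₗ[ℂ] ℂ) (k : ℕ) :
    Tens A ι k →ₗ[ℂ] Tens A ι (k + 1) :=
  appendFirst φ k - (-1 : ℂ) ^ k • appendLast c k

/-- The codifferential on representatives. -/
noncomputable def codiffOp (σ : Matrix (ι × ι) (ι × ι) ℂ) (γ : ι → ℂ) (ψ : ι → A →ₗ[ℂ] ℂ) (k : ℕ) :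
    Tens A ι (k + 1) →ₗ[ℂ] Tens A ι k :=
  contrLast γ k ∘ₗ shuffleSum σ k k + (-1 : ℂ) ^ (k + 1) • (contrFirst ψ k ∘ₗ shuffleSum σ k 1)

/-- Compatibility of contractions and wedge products with a braiding. -/
structure IsContraction (σ : Matrix (ι × ι) (ι × ι) ℂ) (c γ : ι → ℂ) (φ ψ : ι → A →ₗ[ℂ] ℂ) (s : ℂ)
    (X Y : ∀ k, Module.End ℂ (Tens A ι k)) : Prop where
  braid : ∀ k, BraidRel (legs (M := A) σ k)
  last : ∀ k ρ, contrLast γ (k + 1) (legs (M := A) σ (k + 1) (Fin.last k) (appendLast c (k + 1) ρ))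
    = appendLast c k (contrLast γ k ρ)
  first : ∀ k ρ, contrFirst ψ (k + 1) (legs (M := A) σ (k + 1) 0 (appendFirst φ (k + 1) ρ))
    = appendFirst φ k (contrFirst ψ k ρ)
  desc : ∀ k ρ, contrLast γ k (descProd k (legs (M := A) σ k) (appendFirst φ k ρ)) = X k ρ
  asc : ∀ k ρ, contrFirst ψ k (ascProd k (legs (M := A) σ k) (appendLast c k ρ)) = Y k ρ
  last_self : ∑ a, γ a * c a = s
  first_self : ∑ b, conv (ψ b) (φ b) = s • CoalgebraStruct.counit

namespace IsContraction

variable {σ : Matrix (ι × ι) (ι × ι) ℂ} {c γ : ι → ℂ} {φ ψ : ι → A →ₗ[ℂ] ℂ} {s : ℂ}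
  {X Y : ∀ k, Module.End ℂ (Tens A ι k)}

theorem contrFirst_appendFirst (h : IsContraction σ c γ φ ψ s X Y) {k : ℕ} (ρ : Tens A ι k) :
    contrFirst ψ k (appendFirst φ k ρ) = s • ρ := by
  funext J
  rw [QuantumGroups.contrFirst_appendFirst, h.first_self]
  simp

/-- In degree zero the shuffle sums and the products of braidings are trivial, and the four terms
are X, Y and two direct contractions of ω₀ with its dual. -/
theorem laplace_zero (h : IsContraction σ c γ φ ψ s X Y) (ρ : Tens A ι 0) :
    codiffOp σ γ ψ 0 (diffOp c φ 0 ρ) = X 0 ρ + Y 0 ρ - (2 * s) • ρ := by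
  have hX := h.desc 0 ρ
  have hY := h.asc 0 ρ
  simp only [descProd, ascProd, Module.End.one_apply] at hX hY
  simp only [codiffOp, diffOp, shuffleSum_zero h.braid, LinearMap.add_apply, LinearMap.smul_apply,
    LinearMap.comp_apply, Module.End.one_apply, LinearMap.sub_apply, map_sub, map_smul, hX, hY,
    contrLast_appendLast, h.contrFirst_appendFirst, h.last_self]
  module

/-- Each of the four terms of ∂d splits into one term of d∂ and one additional term. The first kind
cancels; the additional terms are X, Y and twice the scalar `s`. -/
theorem laplace_succ (h : IsContraction σ c γ φ ψ s X Y) (k : ℕ) (ρ : Tens A ι (k + 1)) :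
    codiffOp σ γ ψ (k + 1) (diffOp c φ (k + 1) ρ) - diffOp c φ k (codiffOp σ γ ψ k ρ)
      = (-1 : ℂ) ^ (k + 1) • (X (k + 1) ρ + Y (k + 1) ρ - (2 * s) • ρ) := by
  have hR : shuffleSum σ k k ∈ scalarOps A ι (k + 1) :=
    shuffleSum_mem (fun i => onLegs_mem_scalarOps _ _) _
  have hL : shuffleSum σ k 1 ∈ scalarOps A ι (k + 1) :=
    shuffleSum_mem (fun i => onLegs_mem_scalarOps _ _) _
  have sgn_apply : ∀ (n : ℕ) (T : Module.End ℂ (Tens A ι (k + 2))) (ζ : Tens A ι (k + 2)),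
      ((-1) ^ n * T) ζ = (-1 : ℂ) ^ n • T ζ := by
    intro n T ζ
    have : (-1 : Module.End ℂ (Tens A ι (k + 2))) ^ n = algebraMap ℂ _ ((-1) ^ n) := by simp
    rw [this, ← Algebra.smul_def]
    rfl
  -- Recursion by the longest term: the other part leaves the first leg alone, so appending at the
  -- front and contracting at the end commute.
  have e1 : contrLast γ (k + 1) (shuffleSum σ (k + 1) (k + 1) (appendFirst φ (k + 1) ρ))
      = appendFirst φ k (contrLast γ k (shuffleSum σ k k ρ))
        + (-1 : ℂ) ^ (k + 1) • X (k + 1) ρ := by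
    rw [shuffleSum_right_succ' h.braid, LinearMap.add_apply, map_add, liftTail_appendFirst φ hR,
      contrLast_appendFirst, sgn_apply, map_smul, h.desc]
  -- Recursion with the inner shuffle sum acting on ρ: the term 1 contracts the invariant form with
  -- its dual, and in the other term `h.last` moves the form past the last leg of ρ.
  have e2 : contrLast γ (k + 1) (shuffleSum σ (k + 1) (k + 1) (appendLast c (k + 1) ρ))
      = s • ρ - appendLast c k (contrLast γ k (shuffleSum σ k k ρ)) := by
    rw [shuffleSum_right_succ h.braid, LinearMap.sub_apply, map_sub, Module.End.one_apply,
      Module.End.mul_apply, liftInit_appendLast, h.last, contrLast_appendLast, h.last_self]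
  have e3 : contrFirst ψ (k + 1) (shuffleSum σ (k + 1) 1 (appendFirst φ (k + 1) ρ))
      = s • ρ - appendFirst φ k (contrFirst ψ k (shuffleSum σ k 1 ρ)) := by
    rw [shuffleSum_left_succ h.braid, LinearMap.sub_apply, map_sub, Module.End.one_apply,
      Module.End.mul_apply, liftTail_appendFirst φ hL, h.first, h.contrFirst_appendFirst]
  have e4 : contrFirst ψ (k + 1) (shuffleSum σ (k + 1) 1 (appendLast c (k + 1) ρ))
      = appendLast c k (contrFirst ψ k (shuffleSum σ k 1 ρ))
        + (-1 : ℂ) ^ (k + 1) • Y (k + 1) ρ := by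
    rw [shuffleSum_left_succ' h.braid, LinearMap.add_apply, map_add, liftInit_appendLast,
      contrFirst_appendLast, sgn_apply, map_smul, h.asc]
  simp only [codiffOp, diffOp, LinearMap.add_apply, LinearMap.smul_apply, LinearMap.comp_apply,
    LinearMap.sub_apply, map_sub, map_add, map_smul, e1, e2, e3, e4]
  -- After fixing the parity of the degree, the signs are explicit and a linear identity in the
  -- remaining terms is left.
  rcases neg_one_pow_eq_or ℂ k with e | e <;> simp only [pow_succ, e] <;> module

/-- The larger antisymmetriser has the smaller one, extended by the identity on the first or the
last leg, as a right factor; extended operators pass through the appended form and annihilate ρ. -/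
theorem antisymm_diffOp (h : ∀ k, BraidRel (legs (M := A) σ k)) {k : ℕ} {ρ : Tens A ι k}
    (hρ : antisymm σ k ρ = 0) : antisymm σ (k + 1) (diffOp c φ k ρ) = 0 := by
  obtain ⟨C, hC⟩ := exists_antisymm_eq_init h k
  obtain ⟨C', hC'⟩ := exists_antisymm_eq_tail h k
  have hT : antisymm σ k ∈ scalarOps A ι k := antisymm_mem fun i j _ => onLegs_mem_scalarOps i j
  have e1 : antisymm σ (k + 1) (appendFirst φ k ρ) = 0 := by
    rw [hC', Module.End.mul_apply, liftTail_appendFirst φ hT, hρ, map_zero, map_zero]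
  have e2 : antisymm σ (k + 1) (appendLast c k ρ) = 0 := by
    rw [hC, Module.End.mul_apply, liftInit_appendLast, hρ, map_zero, map_zero]
  simp only [diffOp, LinearMap.sub_apply, LinearMap.smul_apply, map_sub, map_smul, e1, e2,
    smul_zero, sub_zero]

theorem antisymm_codiffOp (h : ∀ k, BraidRel (legs (M := A) σ k)) {k : ℕ} {ρ : Tens A ι (k + 1)}
    (hρ : antisymm σ (k + 1) ρ = 0) : antisymm σ k (codiffOp σ γ ψ k ρ) = 0 := by
  have hT : antisymm σ k ∈ scalarOps A ι k := antisymm_mem fun i j _ => onLegs_mem_scalarOps i j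
  have e1 : antisymm σ k (contrLast γ k (shuffleSum σ k k ρ)) = 0 := by
    rw [← contrLast_liftInit, ← Module.End.mul_apply, ← antisymm_eq_right h, hρ, map_zero]
  have e2 : antisymm σ k (contrFirst ψ k (shuffleSum σ k 1 ρ)) = 0 := by
    rw [← contrFirst_liftTail ψ hT, ← Module.End.mul_apply, ← antisymm_eq_left h, hρ, map_zero]
  simp only [codiffOp, LinearMap.add_apply, LinearMap.smul_apply, LinearMap.comp_apply, map_add,
    map_smul, e1, e2, smul_zero, add_zero]

end IsContraction

/-- Each antisymmetriser is a left multiple of the other. Consequently ∂⁻, which is built from σ⁻¹,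
lives on the same quotient as ∂⁺. -/
theorem antisymm_inverse_eq_zero [DecidableEq ι] {σ σ' : Matrix (ι × ι) (ι × ι) ℂ}
    (h : ∀ k, BraidRel (legs (M := A) σ k)) (h1 : σ * σ' = 1) (h2 : σ' * σ = 1) (k : ℕ)
    (ρ : Tens A ι k) : antisymm σ' k ρ = 0 ↔ antisymm σ k ρ = 0 := by
  cases k with
  | zero => rfl
  | succ k =>
    obtain ⟨W, W', e, e'⟩ := exists_unit_mul_altSum (h k)
      ((h k).inverse (legs_mul_legs h1 k) (legs_mul_legs h2 k))
      (legs_mul_legs h1 k) (legs_mul_legs h2 k)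
    rw [antisymm_succ, antisymm_succ]
    constructor <;> intro hρ
    · rw [← e, Module.End.mul_apply, hρ, map_zero]
    · rw [← e', Module.End.mul_apply, hρ, map_zero]

end Laplacian

end QuantumGroups

namespace QuantumGroups

/-! ### Contractions that are compatible with the braiding and with its inverse -/

section LegsApply
variable {ι M : Type} [Fintype ι] [AddCommGroup M] [Module ℂ M]

theorem legs_last_apply (S : Matrix (ι × ι) (ι × ι) ℂ) (k : ℕ) (ξ : (Fin (k + 2) → ι) → M)
    (J : Fin k → ι) (b d : ι) :
    legs S (k + 1) (Fin.last k) ξ (Fin.snoc (Fin.snoc J b : Fin (k + 1) → ι) d : Fin (k + 2) → ι)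
      = ∑ i, ∑ j, S (b, d) (i, j) •
        ξ (Fin.snoc (Fin.snoc J i : Fin (k + 1) → ι) j : Fin (k + 2) → ι) := by
  have e : ∀ a : ι × ι, Function.update (Function.update
      (Fin.snoc (Fin.snoc J b : Fin (k + 1) → ι) d : Fin (k + 1 + 1) → ι)
        (Fin.last k).castSucc a.1) (Fin.last k).succ a.2
      = Fin.snoc (Fin.snoc J a.1 : Fin (k + 1) → ι) a.2 := by
    intro a
    rw [← Fin.snoc_update, Fin.update_snoc_last, Fin.succ_last, Fin.update_snoc_last]
  have e1 : (Fin.snoc (Fin.snoc J b : Fin (k + 1) → ι) d : Fin (k + 1 + 1) → ι)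
      (Fin.last k).castSucc = b := by simp
  have e2 : (Fin.snoc (Fin.snoc J b : Fin (k + 1) → ι) d : Fin (k + 1 + 1) → ι)
      (Fin.last k).succ = d := by rw [Fin.succ_last, Fin.snoc_last]
  rw [legs, onLegs_apply]
  simp only [e, e1, e2, Fintype.sum_prod_type]

theorem legs_zero_apply (S : Matrix (ι × ι) (ι × ι) ℂ) (k : ℕ) (ξ : (Fin (k + 2) → ι) → M)
    (J : Fin k → ι) (b d : ι) :
    legs S (k + 1) 0 ξ (Fin.cons b (Fin.cons d J : Fin (k + 1) → ι) : Fin (k + 2) → ι)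
      = ∑ i, ∑ j, S (b, d) (i, j) •
        ξ (Fin.cons i (Fin.cons j J : Fin (k + 1) → ι) : Fin (k + 2) → ι) := by
  have e : ∀ a : ι × ι, Function.update (Function.update
      (Fin.cons b (Fin.cons d J : Fin (k + 1) → ι) : Fin (k + 1 + 1) → ι)
        (0 : Fin (k + 1)).castSucc a.1) (0 : Fin (k + 1)).succ a.2
      = Fin.cons a.1 (Fin.cons a.2 J : Fin (k + 1) → ι) := by
    intro a
    rw [Fin.castSucc_zero, Fin.update_cons_zero, ← Fin.cons_update, Fin.update_cons_zero]
  rw [legs, onLegs_apply]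
  simp only [e]
  simp only [Fintype.sum_prod_type, Fin.castSucc_zero, Fin.cons_zero, Fin.cons_succ]

end LegsApply

section Inverse

theorem descProd_succ' {M : Type} [Monoid M] (k : ℕ) (t : Fin (k + 1) → M) :
    descProd (k + 1) t = descProd k (fun i => t i.succ) * t 0 := by
  induction k with
  | zero => simp [descProd]
  | succ k ih =>
    rw [descProd, ih, descProd, mul_assoc]
    rfl

theorem descProd_mul_ascProd {M : Type} [Monoid M] (k : ℕ) {s t : Fin k → M}
    (h : ∀ i, t i * s i = 1) : descProd k t * ascProd k s = 1 := by
  induction k with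
  | zero => simp [descProd, ascProd]
  | succ k ih =>
    rw [descProd_succ', ascProd, mul_assoc, ← mul_assoc (t 0), h, one_mul]
    exact ih fun i => h _

theorem ascProd_mul_descProd {M : Type} [Monoid M] (k : ℕ) {s t : Fin k → M}
    (h : ∀ i, t i * s i = 1) : ascProd k t * descProd k s = 1 := by
  induction k with
  | zero => simp [descProd, ascProd]
  | succ k ih =>
    rw [descProd_succ', ascProd, mul_assoc, ← mul_assoc (ascProd k _), ih fun i => h _, one_mul, h]

end Inverse

variable {A : Type} [Ring A] [HopfAlgebra ℂ A] {ι : Type} [Fintype ι] [DecidableEq ι]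

/-- The functionals `φ_j` with `ω a = a₍₁₎ φ_j(a₍₂₎) ω_j` for `ω = ∑ c_i ω_i`. -/
noncomputable def BimoduleData.row (Γ : BimoduleData A ι) (c : ι → ℂ) (j : ι) : A →ₗ[ℂ] ℂ :=
  ∑ i, c i • Γ.f i j

namespace BimoduleData.IsYD

variable {Γ : BimoduleData A ι} (hΓ : Γ.IsYD)
include hΓ

theorem row_mul (c : ι → ℂ) (d : ι) (a b : A) : Γ.row c d (a * b) = ∑ k, Γ.row c k a * Γ.f k d b := by
  simp only [BimoduleData.row, LinearMap.sum_apply, LinearMap.smul_apply, hΓ.f_mul,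
    Finset.mul_sum, Finset.sum_mul, smul_eq_mul, mul_assoc]
  rw [Finset.sum_comm]

/-- The Yetter-Drinfeld condition is summed against `c`; invariance of the form removes the matrix
`v` from one side. -/
theorem row_v {c : ι → ℂ} (hc : ∀ b, ∑ d, c d • Γ.v b d = c b • 1) (k : ι) (a : A) :
    ∑ j, leftAct (Γ.row c j) a * Γ.v k j = rightAct (Γ.row c k) a := by
  simp only [BimoduleData.row, leftAct_sum, rightAct_sum, leftAct_smul, rightAct_smul,
    LinearMap.sum_apply, LinearMap.smul_apply, Finset.sum_mul, smul_mul_assoc]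
  rw [Finset.sum_comm]
  simp only [← Finset.smul_sum, hΓ.yd]
  simp only [Finset.smul_sum]
  rw [Finset.sum_comm]
  refine Finset.sum_congr rfl fun j _ => ?_
  simp only [← smul_mul_assoc, ← Finset.sum_mul, hc]
  rw [smul_mul_assoc, one_mul]

end BimoduleData.IsYD

/-- An invariant element `∑ c_i ω_i` of a Hopf bimodule, together with the contractions with an
invariant element of a dual Hopf bimodule. -/
structure InvariantPairing (Γ : BimoduleData A ι) (c γ : ι → ℂ) (ψ : ι → A →ₗ[ℂ] ℂ) (s : ℂ) :
    Prop where
  yd : Γ.IsYD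
  v_c : ∀ b, ∑ d, c d • Γ.v b d = c b • 1
  γ_v : ∀ d, ∑ b, γ b • Γ.v b d = γ d • 1
  ψ_v : ∀ j a, ∑ b, rightAct (ψ b) a * Γ.v b j = leftAct (ψ j) a
  -- The metric is a bimodule map: acting simultaneously on the invariant form, already shifted by
  -- `a`, and on ω_j reduces to the counit.
  ψ_f : ∀ j a, ∑ d, conv (ψ d ∘ₗ LinearMap.mulLeft ℂ a) (Γ.f j d) = ψ j a • CoalgebraStruct.counit
  γ_c : ∑ a, γ a * c a = s
  ψ_φ : ∑ b, conv (ψ b) (Γ.row c b) = s • CoalgebraStruct.counit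

namespace InvariantPairing

variable {Γ : BimoduleData A ι} {c γ : ι → ℂ} {ψ : ι → A →ₗ[ℂ] ℂ} {s : ℂ}
  (h : InvariantPairing Γ c γ ψ s)
include h

theorem row_mul (d : ι) (a b : A) : Γ.row c d (a * b) = ∑ k, Γ.row c k a * Γ.f k d b :=
  h.yd.row_mul c d a b

theorem row_v (k : ι) (a : A) :
    ∑ j, leftAct (Γ.row c j) a * Γ.v k j = rightAct (Γ.row c k) a :=
  h.yd.row_v h.v_c k a

/-- Invariance of the form turns the right action into a left action followed by `v`, and invariance
of the contraction then removes `v`. Centrality is the reason why X_0 ∗ a = a ∗ X_0. -/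
theorem central_row (a : A) : leftAct (∑ j, γ j • Γ.row c j) a
    = rightAct (∑ j, γ j • Γ.row c j) a := by
  simp only [leftAct_sum, rightAct_sum, leftAct_smul, rightAct_smul, LinearMap.sum_apply,
    LinearMap.smul_apply, ← h.row_v, Finset.smul_sum, ← mul_smul_comm]
  rw [Finset.sum_comm]
  refine Finset.sum_congr rfl fun j _ => ?_
  rw [← Finset.mul_sum, h.γ_v, mul_smul_comm, mul_one]

theorem central_col (a : A) : leftAct (∑ j, c j • ψ j) a = rightAct (∑ j, c j • ψ j) a := by
  simp only [leftAct_sum, rightAct_sum, leftAct_smul, rightAct_smul, LinearMap.sum_apply,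
    LinearMap.smul_apply, ← h.ψ_v, Finset.smul_sum, ← mul_smul_comm]
  rw [Finset.sum_comm]
  refine Finset.sum_congr rfl fun j _ => ?_
  rw [← Finset.mul_sum, h.v_c, mul_smul_comm, mul_one]

/-- An invariant functional sees the braiding as a flip: `f` is applied to the invariance relation,
whose right side is a scalar. -/
theorem γ_braiding (a i j : ι) : ∑ b, γ b * Γ.braiding (b, a) (i, j)
    = if i = a then γ j else 0 := by
  have := congrArg (Γ.f i a) (h.γ_v j)
  simp only [map_sum, map_smul, h.yd.f_one, smul_eq_mul] at this
  simp only [BimoduleData.braiding, Matrix.of_apply, this]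
  split_ifs <;> simp

theorem braiding_c (a b i : ι) : ∑ j, Γ.braiding (b, a) (i, j) * c j
    = if i = a then c b else 0 := by
  have := congrArg (Γ.f i a) (h.v_c b)
  simp only [map_sum, map_smul, h.yd.f_one, smul_eq_mul] at this
  simp only [BimoduleData.braiding, Matrix.of_apply, mul_comm _ (c _), this]
  split_ifs <;> simp

/-- By `ψ_v` the entries of `v` are absorbed into a left action, and the multiplicativity of the row
absorbs `f`. This is the compatibility of the first leg with σ in coordinates. -/
theorem conv_row_ψ (d j : ι) : ∑ b, ∑ i, Γ.f i d (Γ.v b j) • conv (ψ b) (Γ.row c i)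
    = conv (Γ.row c d) (ψ j) := by
  ext a
  rw [← apply_leftAct, ← h.ψ_v, map_sum]
  simp only [LinearMap.sum_apply, LinearMap.smul_apply, h.row_mul, apply_rightAct, smul_eq_mul,
    mul_comm]

/-- Multiplicativity of the row on a product with an entry of the tensor power. The coefficients on
the right are those produced when the form passes k legs, so its final contraction is an action
through the right coaction. -/
theorem shiftR_row {k : ℕ} (J I : Fin k → ι) : shiftR (∑ j, γ j • Γ.row c j) (tensorPow Γ.v k J I)
    = ∑ d, ∑ j, (γ d * Γ.f j d (tensorPow Γ.v k J I)) • Γ.row c j := by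
  ext a
  simp only [shiftR_apply, LinearMap.sum_apply, LinearMap.smul_apply, h.row_mul, smul_eq_mul,
    Finset.mul_sum]
  refine Finset.sum_congr rfl fun d _ => Finset.sum_congr rfl fun j _ => ?_
  ring

/-- The condition `ψ_f` is evaluated on an entry of the tensor power of `v`, whose coproduct is a
matrix product. It undoes the passage of the first leg through k legs at the level of functionals.
-/
theorem shiftR_ψ {k : ℕ} (K I : Fin k → ι) (j : ι) :
    ∑ J : Fin k → ι, ∑ b, Γ.f j b (tensorPow Γ.v k J I) • shiftR (ψ b) (tensorPow Γ.v k K J)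
      = if K = I then ψ j else 0 := by
  ext a
  have := LinearMap.congr_fun (h.ψ_f j a) (tensorPow Γ.v k K I)
  simp only [LinearMap.sum_apply, conv_of_comul (h.yd.comul_tensorPow k K I),
    LinearMap.smul_apply, h.yd.counit_tensorPow, LinearMap.comp_apply,
    LinearMap.mulLeft_apply] at this
  rw [Finset.sum_comm] at this
  simp only [LinearMap.sum_apply, LinearMap.smul_apply, shiftR_apply, smul_eq_mul, mul_comm]
  simp only [smul_eq_mul] at this
  rw [this]
  split_ifs <;> simp

/-- Invariance of `γ` makes it indifferent whether the last leg is contracted in place or first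
braided to the front. For σ⁻¹ the inserted product of braidings cancels. -/
theorem contrLast_eq_ascProd {k : ℕ} (ξ : Tens A ι (k + 1)) :
    contrLast γ k ξ = contrHead γ k (ascProd k (legs Γ.braiding k) ξ) := by
  funext J
  have key : ∀ (I : Fin k → ι) j, ∑ b, γ b * Γ.fPow I J (Γ.v b j) = if I = J then γ j else 0 := by
    intro I j
    have := congrArg (Γ.fPow I J) (h.γ_v j)
    simp only [map_sum, map_smul, BimoduleData.fPow_apply_one h.yd, smul_eq_mul] at this
    rw [this]
    split_ifs <;> simp
  simp only [contrLast_apply, contrHead_apply, BimoduleData.ascProd_legs_apply h.yd]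
  calc _ = ∑ I : Fin k → ι, ∑ j, (if I = J then γ j else 0) • ξ (Fin.snoc I j) := by
        rw [Finset.sum_comm]
        simp
    _ = ∑ b, ∑ I : Fin k → ι, ∑ j, (γ b * Γ.fPow I J (Γ.v b j)) • ξ (Fin.snoc I j) := by
        conv_rhs => rw [Finset.sum_comm]
        refine Finset.sum_congr rfl fun I _ => ?_
        conv_rhs => rw [Finset.sum_comm]
        simp only [← Finset.sum_smul, key]
    _ = _ := by simp only [Finset.smul_sum, smul_smul]

/-- The contraction of the first leg is carried to the last leg. It carries functionals on A, so the
passage leaves a shift by the tensor power of `v`; this shift is what later becomes the right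
coaction. -/
theorem contrFirst_eq_descProd {k : ℕ} (ξ : Tens A ι (k + 1)) (K : Fin k → ι) :
    contrFirst ψ k ξ K = ∑ J : Fin k → ι, ∑ b, leftAct (shiftR (ψ b) (tensorPow Γ.v k K J))
      (descProd k (legs Γ.braiding k) ξ (Fin.snoc J b : Fin (k + 1) → ι)) := by
  simp only [contrFirst_apply, BimoduleData.descProd_legs_apply h.yd, map_sum, map_smul]
  have key : ∀ j (I : Fin k → ι), (if K = I then leftAct (ψ j) (ξ (Fin.cons j I)) else 0)
      = ∑ J : Fin k → ι, ∑ b, Γ.f j b (tensorPow Γ.v k J I) •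
        leftAct (shiftR (ψ b) (tensorPow Γ.v k K J)) (ξ (Fin.cons j I : Fin (k + 1) → ι)) := by
    intro j I
    have := congrArg (fun X => leftAct X (ξ (Fin.cons j I : Fin (k + 1) → ι))) (h.shiftR_ψ K I j)
    simp only [leftAct_sum, leftAct_smul, LinearMap.sum_apply, LinearMap.smul_apply] at this
    rw [this]
    split_ifs
    · rfl
    · exact (LinearMap.congr_fun (map_zero leftActLin) _).symm
  calc _ = ∑ j, ∑ I : Fin k → ι, (if K = I then leftAct (ψ j) (ξ (Fin.cons j I)) else 0) := by
        simp
    _ = ∑ j, ∑ I : Fin k → ι, ∑ J : Fin k → ι, ∑ b, Γ.f j b (tensorPow Γ.v k J I) •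
        leftAct (shiftR (ψ b) (tensorPow Γ.v k K J)) (ξ (Fin.cons j I : Fin (k + 1) → ι)) := by
        simp only [key]
    _ = ∑ p : ι × (Fin k → ι), ∑ q : (Fin k → ι) × ι, Γ.f p.1 q.2 (tensorPow Γ.v k q.1 p.2) •
        leftAct (shiftR (ψ q.2) (tensorPow Γ.v k K q.1))
          (ξ (Fin.cons p.1 p.2 : Fin (k + 1) → ι)) := by
        simp only [Fintype.sum_prod_type]
    _ = _ := by
        rw [Finset.sum_comm]
        simp only [Fintype.sum_prod_type]

/-- The version with a single braiding, which serves the compatibility of σ⁻¹ with the last leg. -/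
theorem contrLast_eq_legs {k : ℕ} (ξ : Tens A ι (k + 2)) (J : Fin k → ι) (a : ι) :
    contrLast γ (k + 1) ξ (Fin.snoc J a : Fin (k + 1) → ι)
      = ∑ b, γ b • legs Γ.braiding (k + 1) (Fin.last k) ξ
        (Fin.snoc (Fin.snoc J b : Fin (k + 1) → ι) a : Fin (k + 2) → ι) := by
  simp only [contrLast_apply, legs_last_apply]
  calc _ = ∑ i, ∑ j, (if i = a then γ j else 0) •
          ξ (Fin.snoc (Fin.snoc J i : Fin (k + 1) → ι) j : Fin (k + 2) → ι) := by
        rw [Finset.sum_comm]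
        simp
    _ = ∑ b, ∑ i, ∑ j, (γ b * Γ.braiding (b, a) (i, j)) •
          ξ (Fin.snoc (Fin.snoc J i : Fin (k + 1) → ι) j : Fin (k + 2) → ι) := by
        conv_rhs => rw [Finset.sum_comm]
        refine Finset.sum_congr rfl fun I _ => ?_
        conv_rhs => rw [Finset.sum_comm]
        simp only [← Finset.sum_smul, h.γ_braiding]
    _ = _ := by simp only [Finset.smul_sum, smul_smul]

theorem sum_shiftR_ψ (d i j : ι) :
    ∑ e, ∑ b, Γ.f j b (Γ.v e i) • shiftR (ψ b) (Γ.v d e) = if d = i then ψ j else 0 := by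
  ext a
  have := LinearMap.congr_fun (h.ψ_f j a) (Γ.v d i)
  simp only [LinearMap.sum_apply, conv_of_comul (h.yd.comul_v d i),
    LinearMap.smul_apply, h.yd.counit_v, LinearMap.comp_apply,
    LinearMap.mulLeft_apply] at this
  rw [Finset.sum_comm] at this
  simp only [LinearMap.sum_apply, LinearMap.smul_apply, shiftR_apply, smul_eq_mul, mul_comm]
  simp only [smul_eq_mul, mul_comm] at this
  rw [this]
  split_ifs <;> simp

theorem contrFirst_eq_legs {k : ℕ} (ξ : Tens A ι (k + 2)) (J : Fin k → ι) (d : ι) :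
    contrFirst ψ (k + 1) ξ (Fin.cons d J : Fin (k + 1) → ι)
      = ∑ e, ∑ b, leftAct (shiftR (ψ b) (Γ.v d e)) (legs Γ.braiding (k + 1) 0 ξ
        (Fin.cons e (Fin.cons b J : Fin (k + 1) → ι) : Fin (k + 2) → ι)) := by
  simp only [contrFirst_apply, legs_zero_apply, map_sum, map_smul]
  have key : ∀ j i (a : A), (if d = i then leftAct (ψ j) a else 0)
      = ∑ e, ∑ b, Γ.braiding (e, b) (j, i) • leftAct (shiftR (ψ b) (Γ.v d e)) a := by
    intro j i a
    have := congrArg (fun X => leftAct X a) (h.sum_shiftR_ψ d i j)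
    simp only [leftAct_sum, leftAct_smul, LinearMap.sum_apply, LinearMap.smul_apply] at this
    simp only [BimoduleData.braiding, Matrix.of_apply]
    rw [this]
    split_ifs
    · rfl
    · exact (LinearMap.congr_fun (map_zero leftActLin) _).symm
  calc _ = ∑ j, ∑ i, (if d = i then leftAct (ψ j)
          (ξ (Fin.cons j (Fin.cons i J : Fin (k + 1) → ι) : Fin (k + 2) → ι)) else 0) := by
        simp
    _ = ∑ p : ι × ι, ∑ q : ι × ι, Γ.braiding q p • leftAct (shiftR (ψ q.2) (Γ.v d q.1))
          (ξ (Fin.cons p.1 (Fin.cons p.2 J : Fin (k + 1) → ι) : Fin (k + 2) → ι)) := by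
        simp only [Fintype.sum_prod_type, key]
    _ = _ := by
        rw [Finset.sum_comm]
        simp only [Fintype.sum_prod_type]

/-- Passing from left to right, the form meets the matrix `v` of every leg, which builds up the
right coaction in X. Passing from right to left, invariance of the form gives a plain flip, so Y
acts on the entries only; centrality then allows it to be written as a right action. -/
theorem isContraction_braiding : IsContraction Γ.braiding c γ (Γ.row c) ψ s
    (fun k => Γ.actR k (∑ j, γ j • Γ.row c j))
    (fun k => (rightAct (∑ j, c j • ψ j)).compLeft (Fin k → ι)) where
  braid k := legs_braidRel h.yd.yang_baxter k
  last k ρ := by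
    refine funext_snoc fun J a => ?_
    rw [contrLast_apply, appendLast_apply]
    simp only [legs_last_apply, appendLast_apply, smul_smul, ← Finset.sum_smul, h.braiding_c]
    simp [contrLast_apply, Finset.smul_sum, smul_smul, mul_comm]
  first k ρ := by
    refine funext_cons fun J d => ?_
    rw [contrFirst_apply, appendFirst_apply, contrFirst_apply, map_sum]
    simp only [legs_zero_apply, appendFirst_apply, map_sum, map_smul, ← leftAct_conv]
    calc _ = ∑ p : ι × ι, ∑ j, Γ.f p.2 d (Γ.v p.1 j) • leftAct (conv (ψ p.1) (Γ.row c p.2))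
            (ρ (Fin.cons j J : Fin (k + 1) → ι)) := by
          simp only [Fintype.sum_prod_type, BimoduleData.braiding, Matrix.of_apply]
      _ = _ := by
          rw [Finset.sum_comm]
          simp only [← h.conv_row_ψ, Fintype.sum_prod_type, leftAct_sum, leftAct_smul,
            LinearMap.sum_apply, LinearMap.smul_apply]
  desc k ρ := by
    funext J
    simp only [contrLast_apply, BimoduleData.descProd_legs_apply h.yd, appendFirst_apply,
      BimoduleData.actR_apply, h.shiftR_row, leftAct_sum, leftAct_smul, LinearMap.sum_apply,
      LinearMap.smul_apply, Finset.smul_sum, smul_smul]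
    conv_rhs => rw [Finset.sum_comm]
    refine Finset.sum_congr rfl fun d _ => ?_
    rw [Finset.sum_comm]
  asc k ρ := by
    funext J
    have key : ∀ (I : Fin k → ι) b, ∑ j, Γ.fPow I J (Γ.v b j) * c j
        = if I = J then c b else 0 := by
      intro I b
      have := congrArg (Γ.fPow I J) (h.v_c b)
      simp only [map_sum, map_smul, BimoduleData.fPow_apply_one h.yd, smul_eq_mul] at this
      simp only [mul_comm _ (c _), this]
      split_ifs <;> simp
    simp only [contrFirst_apply, BimoduleData.ascProd_legs_apply h.yd, appendLast_apply,
      smul_smul, ← Finset.sum_smul, key, LinearMap.compLeft_apply, Function.comp_apply,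
      ← h.central_col]
    simp [leftAct_sum, LinearMap.sum_apply]
  last_self := h.γ_c
  first_self := h.ψ_φ

theorem braiding_inv_mul : Γ.braiding⁻¹ * Γ.braiding = 1 :=
  Matrix.nonsing_inv_mul _ ((Matrix.isUnit_iff_isUnit_det _).mp h.yd.isUnit_braiding)

theorem braiding_mul_inv : Γ.braiding * Γ.braiding⁻¹ = 1 :=
  Matrix.mul_nonsing_inv _ ((Matrix.isUnit_iff_isUnit_det _).mp h.yd.isUnit_braiding)

/-- No formula for σ⁻¹ is needed. Each contraction is rewritten as one preceded by σ, which cancels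
σ⁻¹. Now X is the contraction at the front and acts on entries only, whereas Y picks up the shift by
`v`; compared with σ the two coactions are exchanged. -/
theorem isContraction_braiding_inv : IsContraction Γ.braiding⁻¹ c γ (Γ.row c) ψ s
    (fun k => (rightAct (∑ j, γ j • Γ.row c j)).compLeft (Fin k → ι))
    (fun k => Γ.actR k (∑ j, c j • ψ j)) where
  braid k := (legs_braidRel h.yd.yang_baxter k).inverse (legs_mul_legs h.braiding_mul_inv k)
    (legs_mul_legs h.braiding_inv_mul k)
  last k ρ := by
    refine funext_snoc fun J a => ?_
    rw [h.contrLast_eq_legs, ← Module.End.mul_apply, legs_mul_legs h.braiding_mul_inv]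
    simp only [Module.End.one_apply, appendLast_apply, contrLast_apply, Finset.smul_sum,
      smul_smul, mul_comm]
  first k ρ := by
    refine funext_cons fun J d => ?_
    rw [h.contrFirst_eq_legs, ← Module.End.mul_apply, legs_mul_legs h.braiding_mul_inv,
      appendFirst_apply, contrFirst_apply, map_sum]
    simp only [Module.End.one_apply, appendFirst_apply, ← leftAct_conv]
    rw [Finset.sum_comm]
    refine Finset.sum_congr rfl fun b _ => ?_
    rw [← LinearMap.sum_apply, ← leftAct_sum]
    congr 2
    ext a
    rw [← apply_rightAct, ← h.row_v, map_sum]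
    simp only [LinearMap.sum_apply, ← apply_leftAct, shiftR_apply]
  desc k ρ := by
    rw [h.contrLast_eq_ascProd, ← Module.End.mul_apply,
      ascProd_mul_descProd k (legs_mul_legs h.braiding_mul_inv k)]
    funext J
    simp only [Module.End.one_apply, contrHead_apply, appendFirst_apply,
      LinearMap.compLeft_apply, Function.comp_apply, ← h.central_row]
    simp only [leftAct_sum, leftAct_smul, LinearMap.sum_apply, LinearMap.smul_apply]
  asc k ρ := by
    funext K
    rw [h.contrFirst_eq_descProd, ← Module.End.mul_apply,
      descProd_mul_ascProd k (legs_mul_legs h.braiding_mul_inv k)]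
    simp only [Module.End.one_apply, appendLast_apply, BimoduleData.actR_apply, map_smul]
    refine Finset.sum_congr rfl fun J _ => ?_
    have : shiftR (∑ j, c j • ψ j) (tensorPow Γ.v k K J)
        = ∑ j, c j • shiftR (ψ j) (tensorPow Γ.v k K J) := by
      ext a
      simp [LinearMap.sum_apply]
    simp only [this, leftAct_sum, leftAct_smul, LinearMap.sum_apply, LinearMap.smul_apply]
  last_self := h.γ_c
  first_self := h.ψ_φ

end InvariantPairing

end QuantumGroups

namespace QuantumGroups

/-! ### Matrix corepresentations and universal `r`-forms -/

section Corepresentations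

variable {A : Type} [Ring A] [HopfAlgebra ℂ A] {n : Type} [Fintype n] [DecidableEq n]

local notation "S" => HopfAlgebra.antipode (A := A) ℂ

/-- The matrix `b` is a matrix corepresentation. -/
structure IsCorep (b : Matrix n n A) : Prop where
  comul : ∀ i j, CoalgebraStruct.comul (R := ℂ) (b i j) = ∑ m, b i m ⊗ₜ b m j
  counit : ∀ i j, CoalgebraStruct.counit (R := ℂ) (b i j) = if i = j then 1 else 0

namespace IsCorep

variable {b : Matrix n n A}

theorem antipode_mul (hb : IsCorep b) (i j : n) :
    ∑ m, S (b i m) * b m j = if i = j then 1 else 0 := by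
  have := HopfAlgebra.mul_antipode_rTensor_comul_apply (R := ℂ) (b i j)
  rw [hb.comul, hb.counit] at this
  simp only [map_sum, LinearMap.rTensor_tmul, LinearMap.mul'_apply] at this
  rw [this]
  split_ifs <;> simp

theorem mul_antipode (hb : IsCorep b) (i j : n) :
    ∑ m, b i m * S (b m j) = if i = j then 1 else 0 := by
  have := HopfAlgebra.mul_antipode_lTensor_comul_apply (R := ℂ) (b i j)
  rw [hb.comul, hb.counit] at this
  simp only [map_sum, LinearMap.lTensor_tmul, LinearMap.mul'_apply] at this
  rw [this]
  split_ifs <;> simp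

/-- The contragredient corepresentation. -/
theorem contra (hb : IsCorep b) : IsCorep (Matrix.of fun i j => S (b j i)) where
  comul i j := by
    simp only [Matrix.of_apply]
    -- The matrix `V` of expected coproducts is a left inverse of Δ(b), and the matrix of actual
    -- coproducts Δ(S(b)) is a right inverse; hence they agree.
    set V : Matrix n n (A ⊗[ℂ] A) := Matrix.of fun i j => ∑ m, S (b m j) ⊗ₜ S (b i m) with hV
    set U : Matrix n n (A ⊗[ℂ] A) := Matrix.of fun i j => CoalgebraStruct.comul (R := ℂ) (b i j)
    set W : Matrix n n (A ⊗[ℂ] A) :=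
      Matrix.of fun i j => CoalgebraStruct.comul (R := ℂ) (S (b i j))
    have h1 : V * U = 1 := by
      ext i k
      simp only [V, U, Matrix.mul_apply, Matrix.of_apply, hb.comul, Finset.sum_mul_sum,
        Algebra.TensorProduct.tmul_mul_tmul]
      calc _ = ∑ x, ∑ y, (∑ j, S (b x j) * b j y) ⊗ₜ[ℂ] (S (b i x) * b y k) := by
            rw [Finset.sum_comm]
            refine Finset.sum_congr rfl fun x _ => ?_
            rw [Finset.sum_comm]
            simp only [TensorProduct.sum_tmul]
        _ = (1 : A) ⊗ₜ[ℂ] ∑ x, (S (b i x) * b x k) := by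
            rw [TensorProduct.tmul_sum]
            simp only [hb.antipode_mul, TensorProduct.ite_tmul, Finset.sum_ite_eq,
              Finset.mem_univ, if_true]
        _ = _ := by
            rw [hb.antipode_mul, Matrix.one_apply]
            split_ifs <;> simp [Algebra.TensorProduct.one_def]
    have h2 : U * W = 1 := by
      ext i k
      simp only [W, U, Matrix.mul_apply, Matrix.of_apply, ← Bialgebra.comul_mul, ← map_sum,
        hb.mul_antipode]
      rw [Matrix.one_apply]
      split_ifs <;> simp
    have h3 : W = V := by rw [← one_mul W, ← h1, mul_assoc, h2, mul_one]
    exact congrFun (congrFun h3 j) i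
  counit i j := by
    simp only [Matrix.of_apply, HopfAlgebra.counit_antipode, hb.counit, eq_comm]

theorem antipode_sq_mul (hb : IsCorep b) (i j : n) :
    ∑ m, S (S (b m j)) * S (b i m) = if i = j then 1 else 0 := by
  have := hb.contra.antipode_mul j i
  simp only [Matrix.of_apply] at this
  simp only [this, eq_comm]

theorem mul_antipode_sq (hb : IsCorep b) (i j : n) :
    ∑ m, S (b m j) * S (S (b i m)) = if i = j then 1 else 0 := by
  have := hb.contra.mul_antipode j i
  simp only [Matrix.of_apply] at this
  simp only [this, eq_comm]

end IsCorep

theorem conv_ite_zero {X Y : A →ₗ[ℂ] ℂ} {p : Prop} [Decidable p] :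
    conv X (if p then Y else 0) = if p then conv X Y else 0 := by
  split_ifs <;> simp

theorem ite_zero_conv {X Y : A →ₗ[ℂ] ℂ} {p : Prop} [Decidable p] :
    conv (if p then X else 0) Y = if p then conv X Y else 0 := by
  split_ifs <;> simp

theorem eq_of_matrix_conv {κ : Type} [Fintype κ] [DecidableEq κ] {P Q R : κ → κ → A →ₗ[ℂ] ℂ}
    (hQ : ∀ i j, ∑ m, conv (Q i m) (P m j) = if i = j then CoalgebraStruct.counit else 0)
    (hR : ∀ i j, ∑ m, conv (P i m) (R m j) = if i = j then CoalgebraStruct.counit else 0)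
    (i j : κ) : Q i j = R i j := by
  have h1 : ∑ m, conv (Q i m) (∑ l, conv (P m l) (R l j)) = Q i j := by
    simp [hR, conv_ite_zero]
  have h2 : ∑ l, conv (∑ m, conv (Q i m) (P m l)) (R l j) = R i j := by
    simp [hQ, ite_zero_conv]
  rw [← h1, ← h2]
  simp only [conv_sum_left, conv_sum_right, conv_assoc]
  rw [Finset.sum_comm]

/-- A multiplicative matrix of functionals is inverted by the antipode. -/
theorem sum_conv_antipode {κ : Type} [Fintype κ] [DecidableEq κ] {F : κ → κ → A →ₗ[ℂ] ℂ}
    (hF : ∀ i j a b, F i j (a * b) = ∑ m, F i m a * F m j b)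
    (h1 : ∀ i j, F i j 1 = if i = j then 1 else 0) (i j : κ) :
    ∑ m, conv (F i m) (F m j ∘ₗ S) = if i = j then CoalgebraStruct.counit else 0 := by
  ext a
  have := congrArg (F i j) (HopfAlgebra.mul_antipode_lTensor_comul_apply (R := ℂ) a)
  rw [Algebra.algebraMap_eq_smul_one, map_smul, h1] at this
  have e : ∀ t : A ⊗[ℂ] A, F i j (LinearMap.mul' ℂ A ((S).lTensor A t))
      = ∑ m, LinearMap.mul' ℂ ℂ (TensorProduct.map (F i m) (F m j ∘ₗ S) t) := by
    intro t
    induction t using TensorProduct.induction_on with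
    | zero => simp
    | add x y hx hy => simp only [map_add, hx, hy, Finset.sum_add_distrib]
    | tmul x y => simp [hF]
  rw [e] at this
  simp only [LinearMap.sum_apply, conv, LinearMap.comp_apply, this]
  split_ifs <;> simp

theorem rightAct_tmul (r : A →ₗ[ℂ] A →ₗ[ℂ] ℂ) {κ κ' : Type} [Fintype κ] [Fintype κ'] {a b : A}
    {l l' : κ → A} {m m' : κ' → A} (ha : CoalgebraStruct.comul (R := ℂ) a = ∑ k, l k ⊗ₜ l' k)
    (hb : CoalgebraStruct.comul (R := ℂ) b = ∑ k, m k ⊗ₜ m' k) :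
    rightAct (TensorProduct.lift r) (a ⊗ₜ b)
      = ∑ i, ∑ j, r (l i) (m j) • (l' i ⊗ₜ[ℂ] m' j) := by
  simp [rightAct, TensorProduct.comul_tmul, ha, hb, TensorProduct.sum_tmul, TensorProduct.tmul_sum]
  rw [Finset.sum_comm]

theorem leftAct_tmul (r : A →ₗ[ℂ] A →ₗ[ℂ] ℂ) {κ κ' : Type} [Fintype κ] [Fintype κ'] {a b : A}
    {l l' : κ → A} {m m' : κ' → A} (ha : CoalgebraStruct.comul (R := ℂ) a = ∑ k, l k ⊗ₜ l' k)
    (hb : CoalgebraStruct.comul (R := ℂ) b = ∑ k, m k ⊗ₜ m' k) :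
    leftAct (TensorProduct.lift r) (a ⊗ₜ b)
      = ∑ i, ∑ j, r (l' i) (m' j) • (l i ⊗ₜ[ℂ] m j) := by
  simp [leftAct, TensorProduct.comul_tmul, ha, hb, TensorProduct.sum_tmul, TensorProduct.tmul_sum]
  rw [Finset.sum_comm]

theorem exists_comul (a : A) : ∃ (κ : Type) (_ : Fintype κ) (l l' : κ → A),
    CoalgebraStruct.comul (R := ℂ) a = ∑ k, l k ⊗ₜ l' k := by
  have R := Coalgebra.Repr.arbitrary ℂ a
  refine ⟨R.index, inferInstance, fun k => R.left k, fun k => R.right k, ?_⟩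
  rw [← R.eq, Finset.sum_coe_sort R.index fun k => R.left k ⊗ₜ[ℂ] R.right k]

namespace IsUniversalRForm

variable {r : A →ₗ[ℂ] A →ₗ[ℂ] ℂ} (hr : IsUniversalRForm r)
include hr

/-- The functional is idempotent for convolution because 1 · 1 = 1, and it has a right inverse
obtained from the inverse of the r-form; so it is the unit. -/
theorem one_left : r 1 = CoalgebraStruct.counit := by
  obtain ⟨r', h, -⟩ := hr.invertible
  set p' : A →ₗ[ℂ] ℂ := r' ∘ₗ TensorProduct.mk ℂ A A 1
  have e : conv (r 1) p' = CoalgebraStruct.counit := by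
    ext a
    obtain ⟨κ, _, l, l', ha⟩ := exists_comul a
    have := LinearMap.congr_fun h (1 ⊗ₜ a)
    rw [← apply_rightAct, rightAct_tmul r (l := fun _ : Unit => 1) (l' := fun _ => 1)
      (by simp [Algebra.TensorProduct.one_def]) ha] at this
    rw [conv_of_comul ha]
    simpa [p'] using this
  have e2 := hr.mul_left 1 1
  rw [mul_one] at e2
  rw [← conv_counit (r 1), ← e, ← conv_assoc, ← e2, e]

theorem one_right : r.flip 1 = CoalgebraStruct.counit := by
  obtain ⟨r', h, -⟩ := hr.invertible
  set p' : A →ₗ[ℂ] ℂ := r' ∘ₗ (TensorProduct.mk ℂ A A).flip 1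
  have e : conv (r.flip 1) p' = CoalgebraStruct.counit := by
    ext a
    obtain ⟨κ, _, l, l', ha⟩ := exists_comul a
    have := LinearMap.congr_fun h (a ⊗ₜ 1)
    rw [← apply_rightAct, rightAct_tmul r (m := fun _ : Unit => 1) (m' := fun _ => 1) ha
      (by simp [Algebra.TensorProduct.one_def])] at this
    rw [conv_of_comul ha]
    simpa [p'] using this
  have e2 := hr.mul_right 1 1
  rw [mul_one] at e2
  rw [← conv_counit (r.flip 1), ← e, ← conv_assoc, ← e2, e]

variable {b : Matrix n n A}

theorem flip_mul_apply (hb : IsCorep b) (x y : A) (i j : n) :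
    r.flip (b i j) (x * y) = ∑ m, r.flip (b i m) x * r.flip (b m j) y := by
  rw [LinearMap.flip_apply, hr.mul_left, conv_of_comul (hb.comul i j)]
  rfl

theorem mul_apply (hb : IsCorep b) (x y : A) (i j : n) :
    r (b i j) (x * y) = ∑ m, r (b m j) x * r (b i m) y := by
  rw [← LinearMap.flip_apply, hr.mul_right, conv_of_comul (hb.comul i j)]
  simp only [LinearMap.flip_apply, mul_comm]

theorem one_apply_corep (hb : IsCorep b) (i j : n) : r (b i j) 1 = if i = j then 1 else 0 := by
  rw [← LinearMap.flip_apply, hr.one_right, hb.counit]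

theorem flip_one_apply (hb : IsCorep b) (i j : n) :
    r.flip (b i j) 1 = if i = j then 1 else 0 := by
  rw [LinearMap.flip_apply, hr.one_left, hb.counit]

theorem comm_left (hb : IsCorep b) (i j : n) (a : A) :
    ∑ m, b m j * rightAct (r (b i m)) a = ∑ m, leftAct (r (b m j)) a * b i m := by
  obtain ⟨κ, _, l, l', ha⟩ := exists_comul a
  have := hr.comm (b i j) a
  rw [rightAct_tmul r (hb.comul i j) ha, leftAct_tmul r (hb.comul i j) ha] at this
  simpa only [map_sum, map_smul, LinearMap.mul'_apply, TensorProduct.comm_tmul,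
    rightAct_of_comul ha, leftAct_of_comul ha, Finset.mul_sum, Finset.sum_mul, mul_smul_comm,
    smul_mul_assoc] using this

theorem comm_right (hb : IsCorep b) (i j : n) (a : A) :
    ∑ m, rightAct (r.flip (b i m)) a * b m j = ∑ m, b i m * leftAct (r.flip (b m j)) a := by
  obtain ⟨κ, _, l, l', ha⟩ := exists_comul a
  have := hr.comm a (b i j)
  rw [rightAct_tmul r ha (hb.comul i j), leftAct_tmul r ha (hb.comul i j)] at this
  simp only [map_sum, map_smul, LinearMap.mul'_apply, TensorProduct.comm_tmul] at this
  simp only [rightAct_of_comul ha, leftAct_of_comul ha, Finset.mul_sum, Finset.sum_mul,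
    mul_smul_comm, smul_mul_assoc, LinearMap.flip_apply]
  rw [Finset.sum_comm, this, Finset.sum_comm]

/-- Over the convolution algebra, r(·, b) and r(S(·), S(b)) are a left and a right inverse of the
same matrix, that of r(·, S(b)); hence they coincide. -/
theorem antipode_antipode (hb : IsCorep b) (a : A) (i j : n) :
    r (S a) (S (b i j)) = r a (b i j) := by
  have hb' := hb.contra
  have h1 : ∀ i j, ∑ m, conv (r.flip (b m i)) (r.flip (S (b j m)))
      = if i = j then CoalgebraStruct.counit else 0 := by
    intro i j
    simp only [← hr.mul_right, ← map_sum, hb.antipode_mul]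
    split_ifs with h h' h'
    · exact hr.one_right
    · exact absurd h.symm h'
    · exact absurd h'.symm h
    · exact map_zero _
  have h2 := sum_conv_antipode (F := fun i j => r.flip (S (b j i)))
    (fun i j x y => hr.flip_mul_apply hb' x y i j) (fun i j => hr.flip_one_apply hb' i j)
  exact (LinearMap.congr_fun (eq_of_matrix_conv (P := fun i j => r.flip (S (b j i)))
    (Q := fun i j => r.flip (b j i)) h1 h2 j i) a).symm

theorem antipode_antipode_left (hb : IsCorep b) (a : A) (i j : n) :
    r (S (b i j)) (S a) = r (b i j) a := by
  have hb' := hb.contra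
  have h1 : ∀ i j, ∑ m, conv (r (b i m)) (r (S (b m j)))
      = if i = j then CoalgebraStruct.counit else 0 := by
    intro i j
    simp only [← hr.mul_left, ← map_sum, hb.mul_antipode]
    split_ifs
    · exact hr.one_left
    · exact map_zero _
  have h2 := sum_conv_antipode (F := fun i j => r (S (b i j)))
    (fun i j x y => hr.mul_apply hb' x y j i)
    (fun i j => (hr.one_apply_corep hb' j i).trans (by simp only [eq_comm]))
  exact (LinearMap.congr_fun (eq_of_matrix_conv (P := fun i j => r (S (b i j)))
    (Q := fun i j => r (b i j)) h1 h2 i j) a).symm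

/-- The Yetter-Drinfeld module given by `b` and the functionals `r(b, ·)`. -/
theorem isYD_left (hb : IsCorep b)
    (hw : ∃ w : Matrix n n A, ∀ y c, ∑ m, w m y * b c m = if c = y then 1 else 0) :
    (BimoduleData.mk b (Matrix.of fun i j => r (b j i))).IsYD where
  f_one i j := (hr.one_apply_corep hb j i).trans (by simp only [eq_comm])
  f_mul i j x y := hr.mul_apply hb x y j i
  comul_v := hb.comul
  counit_v := hb.counit
  yd i k a := (hr.comm_left hb k i a).symm
  exists_inv := hw

/-- The Yetter-Drinfeld module given by the contragredient of `b` and the functionals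
`r(·, b)`. -/
theorem isYD_right (hb : IsCorep b) :
    (BimoduleData.mk (Matrix.of fun i j => S (b j i))
      (Matrix.of fun i j => r.flip (b i j))).IsYD where
  f_one i j := hr.flip_one_apply hb i j
  f_mul i j x y := hr.flip_mul_apply hb x y i j
  comul_v := hb.contra.comul
  counit_v := hb.contra.counit
  yd i k a := by
    simp only [Matrix.of_apply]
    -- The commutation relation of the r-form is multiplied by S(b) on both sides, which removes b
    -- and leaves the relation for the contragredient.
    have e1 : ∀ q, ∑ p, S (b i p) * ∑ m, b p m * leftAct (r.flip (b m q)) a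
        = leftAct (r.flip (b i q)) a := by
      intro q
      simp only [Finset.mul_sum, ← mul_assoc]
      rw [Finset.sum_comm]
      simp only [← Finset.sum_mul, hb.antipode_mul]
      simp
    have e2 : ∀ p, ∑ q, (∑ m, rightAct (r.flip (b p m)) a * b m q) * S (b q k)
        = rightAct (r.flip (b p k)) a := by
      intro p
      simp only [Finset.sum_mul, mul_assoc]
      rw [Finset.sum_comm]
      simp only [← Finset.mul_sum, hb.mul_antipode]
      simp
    simp only [← e1, ← e2, hr.comm_right hb, Finset.sum_mul, Finset.mul_sum, mul_assoc]
    rw [Finset.sum_comm]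
  exists_inv := ⟨b.transpose, fun y c => by
    simp only [Matrix.of_apply, Matrix.transpose_apply, hb.mul_antipode, eq_comm]⟩

end IsUniversalRForm

end Corepresentations

end QuantumGroups

namespace QuantumGroups
namespace QuantumGroup

/-! ### The square of the antipode -/

section Scalars

variable {G : QuantumGroup}

theorem q_ne_zero : G.q ≠ 0 := ne_zero_of_transcendental G.transcendental

theorem rho2_rev (i : Fin G.N) : G.rho2 i.rev = -G.rho2 i := by
  unfold rho2
  rw [Fin.rev_rev]
  rcases lt_trichotomy i i.rev with h | h | h
  · simp [h, h.not_gt, h.ne']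
  · rw [← h]
    simp
  · simp [h, h.not_gt, h.ne']

/-- The nonzero entries of the matrix of the metric. -/
noncomputable def metricEntry (G : QuantumGroup) (i : Fin G.N) : ℂ := G.sgn i * G.p ^ (-G.rho2 i)

theorem metricEntry_ne_zero (i : Fin G.N) : G.metricEntry i ≠ 0 :=
  mul_ne_zero (G.sgn_ne_zero i) (zpow_ne_zero _ G.p_ne_zero)

theorem C_apply (i j : Fin G.N) : G.C i j = if j = i.rev then G.metricEntry i else 0 := rfl

theorem C_inv_apply (i j : Fin G.N) :
    G.C⁻¹ i j = if j = i.rev then (G.metricEntry j)⁻¹ else 0 := by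
  have : G.C⁻¹ = Matrix.of fun i j => if j = i.rev then (G.metricEntry j)⁻¹ else 0 := by
    refine Matrix.inv_eq_right_inv ?_
    ext i j
    rw [Matrix.mul_apply, Finset.sum_eq_single i.rev]
    · simp only [C_apply, Matrix.of_apply, Fin.rev_rev, if_true, Matrix.one_apply]
      by_cases h : j = i
      · subst h
        simp [metricEntry_ne_zero]
      · simp [h, Ne.symm h]
    · intro b _ hb
      simp [C_apply, hb]
    · simp
  rw [this]
  rfl

theorem D_eq_metricEntry (hA : ¬ G.series.IsA) :
    G.D = Matrix.diagonal fun i => G.metricEntry i.rev * (G.metricEntry i)⁻¹ := by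
  have : G.D = G.C.transpose * G.C⁻¹ := by
    unfold D
    revert hA
    cases G.series <;> simp [Series.IsA]
  rw [this]
  ext i j
  rw [Matrix.mul_apply, Finset.sum_eq_single i.rev]
  · simp only [Matrix.transpose_apply, C_apply, C_inv_apply, Fin.rev_rev, if_true]
    by_cases h : j = i
    · subst h
      simp
    · simp [h, Ne.symm h]
  · intro b _ hb
    have : i ≠ b.rev := by
      rintro rfl
      simp at hb
    simp [C_apply, this]
  · simp

theorem D_eq_zpow (hA : G.series.IsA) :
    G.D = Matrix.diagonal fun i : Fin G.N => G.q ^ ((G.N : ℤ) - 1 - 2 * (i : ℤ)) := by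
  unfold D
  revert hA
  cases G.series <;> simp [Series.IsA]

theorem exists_sgn_rev : ∃ κ : ℂ, κ * κ = 1 ∧ ∀ i : Fin G.N, G.sgn i.rev * (G.sgn i)⁻¹ = κ := by
  by_cases h : G.series = .typeSp
  · refine ⟨-1, by simp, fun i => ?_⟩
    have hN : Even G.N := by
      have := G.size
      rw [h] at this
      exact this.2
    -- For even N no index is its own mirror image, so the two signs are opposite.
    have hne : i ≠ i.rev := by
      intro e
      have := congrArg Fin.val e
      rw [Fin.val_rev] at this
      obtain ⟨m, hm⟩ := hN
      have := i.isLt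
      omega
    unfold sgn
    rw [h, Fin.rev_rev]
    rcases lt_or_gt_of_ne hne with h' | h'
    · simp [h', h'.not_gt]
    · simp [h', h'.not_gt]
  · refine ⟨1, by simp, fun i => ?_⟩
    unfold sgn
    revert h
    cases G.series <;> simp

/-- A common form of D for all series: the exponents are antisymmetric under the mirror image of the
index, and κ is −1 for the symplectic series and 1 otherwise. In particular inverting the entries of
D amounts to reversing the index. -/
theorem exists_D_eq : ∃ (κ : ℂ) (n : Fin G.N → ℤ), κ * κ = 1 ∧ (∀ i, n i.rev = -n i) ∧
    G.D = Matrix.diagonal fun i => κ * G.q ^ n i := by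
  by_cases hA : G.series.IsA
  · refine ⟨1, fun i => (G.N : ℤ) - 1 - 2 * (i : ℤ), by simp, fun i => ?_, ?_⟩
    · change (G.N : ℤ) - 1 - 2 * (i.rev : ℕ) = -((G.N : ℤ) - 1 - 2 * (i : ℤ))
      rw [Fin.val_rev]
      have := i.isLt
      omega
    · rw [D_eq_zpow hA]
      simp
  · obtain ⟨κ, hκ, h⟩ := exists_sgn_rev (G := G)
    refine ⟨κ, G.rho2, hκ, rho2_rev, ?_⟩
    rw [D_eq_metricEntry hA]
    congr 1
    funext i
    have hp := G.p_ne_zero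
    rw [metricEntry, metricEntry, rho2_rev, neg_neg, mul_inv, zpow_neg, inv_inv, ← h, ← G.sq,
      ← zpow_natCast, ← zpow_mul, mul_comm _ (G.rho2 i), zpow_mul, zpow_natCast]
    ring

theorem D_eq : G.D = Matrix.diagonal G.d := by
  obtain ⟨κ, n, -, -, h⟩ := exists_D_eq (G := G)
  have : G.d = fun i => κ * G.q ^ n i := by
    funext i
    simp [d, h]
  rw [this, h]

theorem d_mul_d_rev (i : Fin G.N) : G.d i * G.d i.rev = 1 := by
  obtain ⟨κ, n, hκ, hn, h⟩ := exists_D_eq (G := G)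
  simp only [d, h, Matrix.diagonal_apply_eq, hn, zpow_neg]
  have := zpow_ne_zero (n i) (q_ne_zero (G := G))
  field_simp
  rw [pow_two, hκ]

theorem d_ne_zero (i : Fin G.N) : G.d i ≠ 0 := left_ne_zero_of_mul_eq_one (d_mul_d_rev i)

theorem inv_d (i : Fin G.N) : (G.d i)⁻¹ = G.d i.rev :=
  (eq_inv_of_mul_eq_one_right (d_mul_d_rev i)).symm

theorem D_inv : G.D⁻¹ = Matrix.diagonal fun i => (G.d i)⁻¹ := by
  refine Matrix.inv_eq_right_inv ?_
  rw [D_eq, Matrix.diagonal_mul_diagonal]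
  simp [d_ne_zero]

theorem sum_d_inv : ∑ i, (G.d i)⁻¹ = G.s := by
  simp only [inv_d]
  exact Fintype.sum_equiv Fin.revPerm _ _ fun i => rfl

/-- After multiplication by a power of q the sum is a polynomial in q with rational coefficients. If
it vanished the polynomial would be zero, but its value at 1 is N. -/
theorem sum_zpow_ne_zero {q : ℂ} (hq : Transcendental ℚ q) {N : ℕ} (hN : 0 < N) (n : Fin N → ℤ) :
    ∑ i, q ^ n i ≠ 0 := by
  have hq0 := ne_zero_of_transcendental hq
  obtain ⟨M, hM⟩ : ∃ M : ℕ, ∀ i, 0 ≤ n i + M := by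
    refine ⟨∑ i, (n i).natAbs, fun i => ?_⟩
    have := Finset.single_le_sum (f := fun i => (n i).natAbs) (fun _ _ => Nat.zero_le _)
      (Finset.mem_univ i)
    change (n i).natAbs ≤ _ at this
    omega
  intro h
  have hP : (∑ i, Polynomial.X ^ (n i + M).toNat : Polynomial ℚ) = 0 := by
    refine (transcendental_iff.mp hq) _ ?_
    have e : ∀ i, q ^ (n i + M).toNat = q ^ n i * q ^ M := by
      intro i
      rw [← zpow_natCast, Int.toNat_of_nonneg (hM i), zpow_add₀ hq0, zpow_natCast]
    simp only [map_sum, map_pow, Polynomial.aeval_X, e, ← Finset.sum_mul, h, zero_mul]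
  have := congrArg (Polynomial.eval 1) hP
  simp [Polynomial.eval_finsetSum] at this
  omega

theorem s_ne_zero : G.s ≠ 0 := by
  obtain ⟨κ, n, hκ, -, h⟩ := exists_D_eq (G := G)
  rw [s, h, Matrix.trace_diagonal, ← Finset.mul_sum]
  exact mul_ne_zero (left_ne_zero_of_mul_eq_one hκ) (sum_zpow_ne_zero G.transcendental G.N_pos n)

end Scalars

section Antipode

variable {G : QuantumGroup}

local notation "S" => HopfAlgebra.antipode (A := Coord G) ℂ

theorem corep_u : IsCorep G.u where
  comul := comul_u
  counit i j := (counit_u i j).trans (by rw [Matrix.one_apply])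

theorem antipode_u_of_metric (hA : ¬ G.series.IsA) (i j : Fin G.N) :
    S (G.u i j) = (G.metricEntry i * (G.metricEntry j)⁻¹) • G.u j.rev i.rev := by
  have h1 := (sat_u (G := G)).metric_right hA
  have h2 := uInv_mul_u (G := G)
  have h3 : G.uInv = G.C.map (algebraMap ℂ G.Coord) * G.u.transpose
      * G.C⁻¹.map (algebraMap ℂ G.Coord) := by
    rw [← mul_one G.uInv, ← h1, mul_assoc, mul_assoc, ← mul_assoc G.uInv, h2, one_mul, mul_assoc]
  change antipodeLin (G.u i j) = _
  rw [antipodeLin_u, h3, Matrix.mul_apply, Finset.sum_eq_single j.rev, Matrix.mul_apply,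
    Finset.sum_eq_single i.rev]
  · simp only [Matrix.map_apply, C_apply, C_inv_apply, Fin.rev_rev, if_true,
      Matrix.transpose_apply]
    rw [← Algebra.commutes, ← mul_assoc, ← map_mul, Algebra.smul_def, mul_comm]
  · intro b _ hb
    simp [C_apply, hb]
  · simp
  · intro b _ hb
    have : j ≠ b.rev := by
      rintro rfl
      simp at hb
    simp [C_inv_apply, this]
  · simp

/-- The weights are those of D up to a common factor: a partial trace of R̂ with these weights is
scalar, because the contributions of the part q − q⁻¹ form a geometric sum that telescopes with the
diagonal one. -/
theorem sum_braidA_diagonal (N : ℕ) {q : ℂ} (hq : q ≠ 0) (m n : Fin N) :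
    ∑ j : Fin N, q ^ (-2 * (j : ℤ)) * braidA N q (j, m) (j, n) = if m = n then q else 0 := by
  have geom : ∀ k : ℕ, q ^ (-2 * (k : ℤ)) * q
      + (q - q⁻¹) * ∑ j ∈ Finset.range k, q ^ (-2 * (j : ℤ)) = q := by
    intro k
    induction k with
    | zero => simp
    | succ k ih =>
      rw [Finset.sum_range_succ]
      have e : q ^ (-2 * ((k + 1 : ℕ) : ℤ)) = q ^ (-2 * (k : ℤ)) * (q⁻¹ * q⁻¹) := by
        rw [Nat.cast_succ, mul_add, zpow_add₀ hq]
        congr 1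
        rw [mul_one, zpow_neg, zpow_ofNat, pow_two, mul_inv]
      rw [e]
      linear_combination ih + q ^ (-2 * (k : ℤ)) * q⁻¹ * (mul_inv_cancel₀ hq)
  by_cases h : m = n
  · subst h
    have e1 : ∑ j : Fin N, (if j < m then q ^ (-2 * (j : ℤ)) else 0)
        = ∑ j ∈ Finset.range m, q ^ (-2 * (j : ℤ)) := by
      rw [← Finset.sum_filter]
      refine Finset.sum_bij' (fun j _ => (j : ℕ)) (fun j hj => ⟨j, by
        have := m.isLt; rw [Finset.mem_range] at hj; omega⟩) ?_ ?_ ?_ ?_ ?_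
      · simp
      · exact fun a ha => Finset.mem_filter.mpr
          ⟨Finset.mem_univ _, Fin.lt_def.mpr (Finset.mem_range.mp ha)⟩
      · simp
      · simp
      · simp
    rw [if_pos rfl]
    refine Eq.trans ?_ (geom m)
    rw [← e1, Finset.mul_sum]
    have e2 : q ^ (-2 * (m : ℤ)) * q
        = ∑ j : Fin N, if j = m then q ^ (-2 * (j : ℤ)) * q else 0 := by simp
    rw [e2, ← Finset.sum_add_distrib]
    refine Finset.sum_congr rfl fun j _ => ?_
    simp only [braidA, Matrix.of_apply, and_true]
    by_cases h1 : j = m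
    · subst h1
      simp
    · simp only [h1, Ne.symm h1]
      split_ifs <;> simp_all [mul_comm]
  · rw [if_neg h]
    refine Finset.sum_eq_zero fun j _ => ?_
    have h1 : ¬ (j = n ∧ m = j) := fun ⟨a, b⟩ => h (b.trans a)
    simp [braidA, h1, h]

variable {x : ℂ} {rx : G.Coord →ₗ[ℂ] G.Coord →ₗ[ℂ] ℂ}

theorem admissible_ne_zero_of_isA (hA : G.series.IsA) (hx : G.Admissible x) : x ≠ 0 := by
  have hN := G.N_pos
  unfold Admissible at hx
  revert hA hx
  cases G.series <;> simp only [Series.IsA, false_implies, true_implies, imp_self]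
  rintro h rfl
  rw [zero_pow hN.ne'] at h
  exact q_ne_zero h.symm

/-- The r-form is evaluated on u · S(u) = 1 in its second argument. This relation contains R̂; its
weighted partial trace replaces R̂ by a scalar and leaves the sum in question. -/
theorem sum_rform_antipode (hA : G.series.IsA) (hx : G.Admissible x) (hr : G.IsRForm x rx)
    (i l : Fin G.N) : ∑ m, rx (G.u i m) (S (G.u m l))
      = if i = l then x * G.q⁻¹ * G.q ^ (-2 * (i : ℤ)) else 0 := by
  have hx0 := admissible_ne_zero_of_isA hA hx
  have h1 : ∀ j k, ∑ n, ∑ m, rx (G.u i m) (S (G.u n l)) * (x⁻¹ * G.Rhat (k, m) (j, n))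
      = if i = j ∧ k = l then 1 else 0 := by
    intro j k
    have := congrArg (fun a => rx.flip a (G.u i j)) (corep_u.mul_antipode k l)
    simp only [map_sum, LinearMap.sum_apply, hr.universal.mul_right,
      conv_of_comul (comul_u i j), LinearMap.flip_apply, hr.apply_u] at this
    rw [this]
    by_cases h : k = l
    · simp only [h, if_true, and_true]
      rw [← LinearMap.flip_apply, hr.universal.one_right, corep_u.counit]
    · simp [h]
  have h2 : ∑ j : Fin G.N, G.q ^ (-2 * (j : ℤ)) *
      (∑ n, ∑ m, rx (G.u i m) (S (G.u n l)) * (x⁻¹ * G.Rhat (j, m) (j, n)))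
      = (∑ m, rx (G.u i m) (S (G.u m l))) * (x⁻¹ * G.q) := by
    calc _ = ∑ n, ∑ m, rx (G.u i m) (S (G.u n l)) * x⁻¹ * (if m = n then G.q else 0) := by
          rw [Rhat_of_isA hA]
          simp only [← sum_braidA_diagonal G.N q_ne_zero, Finset.mul_sum]
          rw [Finset.sum_comm]
          refine Finset.sum_congr rfl fun n _ => ?_
          rw [Finset.sum_comm]
          refine Finset.sum_congr rfl fun m _ => Finset.sum_congr rfl fun j _ => ?_
          ring
      _ = _ := by
          simp [Finset.sum_mul, mul_assoc]
  have h3 : ∑ j : Fin G.N, G.q ^ (-2 * (j : ℤ)) * (if i = j ∧ j = l then 1 else 0)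
      = if i = l then G.q ^ (-2 * (i : ℤ)) else 0 := by
    rw [Finset.sum_eq_single i]
    · simp
    · intro b _ hb
      simp [hb.symm]
    · simp
  simp only [h1, h3] at h2
  have hq := q_ne_zero (G := G)
  have h4 : ∑ m, rx (G.u i m) (S (G.u m l))
      = x * G.q⁻¹ * ((∑ m, rx (G.u i m) (S (G.u m l))) * (x⁻¹ * G.q)) := by
    field_simp
  rw [h4, ← h2]
  split_ifs <;> simp

/-- The square of the antipode is conjugation by `D`. -/
theorem antipode_sq_u (hx : G.Admissible x) (hr : G.IsRForm x rx) (i j : Fin G.N) :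
    S (S (G.u i j)) = ((G.d i)⁻¹ * G.d j) • G.u i j := by
  by_cases hA : G.series.IsA
  -- These are the diagonal values on u of the functional a ↦ r(a₍₁₎, S(a₍₂₎)); they are
  -- proportional to the entries of D.
  · set μ : Fin G.N → ℂ := fun i => x * G.q⁻¹ * G.q ^ (-2 * (i : ℤ)) with hμ
    have hx0 := admissible_ne_zero_of_isA hA hx
    have hq := q_ne_zero (G := G)
    have hM : ∀ i l, ∑ m, rx (G.u i m) (S (G.u m l)) = if i = l then μ i else 0 :=
      fun i l => sum_rform_antipode hA hx hr i l
    -- The commutation relation between u and its contragredient is contracted over `j`. On one side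
    -- u · S(u) collapses, on the other the functional above appears as a weight.
    have h1 : ∀ i p, ∑ m, μ m • (S (G.u m p) * G.u i m) = if i = p then μ i • 1 else 0 := by
      intro i p
      have h : ∀ j, ∑ m, ∑ t, rx (G.u i t) (S (G.u m p)) • (G.u t j * S (G.u j m))
          = ∑ m, ∑ t, rx (G.u t j) (S (G.u j m)) • (S (G.u m p) * G.u i t) := by
        intro j
        have := hr.universal.comm_right corep_u.contra p j (G.u i j)
        simpa only [rightAct_of_comul (comul_u i j), leftAct_of_comul (comul_u i j),
          Matrix.of_apply, LinearMap.flip_apply, Finset.sum_mul, Finset.mul_sum, smul_mul_assoc,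
          mul_smul_comm] using this
      have hs := Finset.sum_congr rfl fun j (_ : j ∈ (Finset.univ : Finset (Fin G.N))) => h j
      have hL : ∑ j, ∑ m, ∑ t, rx (G.u i t) (S (G.u m p)) • (G.u t j * S (G.u j m))
          = if i = p then μ i • 1 else 0 := by
        rw [Finset.sum_comm]
        calc _ = ∑ m, rx (G.u i m) (S (G.u m p)) • (1 : G.Coord) := by
              refine Finset.sum_congr rfl fun m _ => ?_
              rw [Finset.sum_comm]
              simp only [← Finset.smul_sum, corep_u.mul_antipode]
              simp
          _ = _ := by
              rw [← Finset.sum_smul, hM]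
              split_ifs <;> simp
      have hR : ∑ j, ∑ m, ∑ t, rx (G.u t j) (S (G.u j m)) • (S (G.u m p) * G.u i t)
          = ∑ m, μ m • (S (G.u m p) * G.u i m) := by
        rw [Finset.sum_comm]
        refine Finset.sum_congr rfl fun m _ => ?_
        rw [Finset.sum_comm]
        simp only [← Finset.sum_smul, hM]
        simp
      rw [← hL, hs, hR]
    have h2 : μ j • G.u i j = μ i • S (S (G.u i j)) := by
      calc μ j • G.u i j = ∑ p, S (S (G.u p j)) * ∑ m, μ m • (S (G.u m p) * G.u i m) := by
            simp only [Finset.mul_sum, mul_smul_comm, ← mul_assoc]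
            rw [Finset.sum_comm]
            simp only [← Finset.smul_sum, ← Finset.sum_mul, corep_u.antipode_sq_mul]
            simp
        _ = _ := by
            simp [h1]
    have hμ0 : μ i ≠ 0 := by simp [hμ, hx0, hq, zpow_ne_zero]
    have h3 : S (S (G.u i j)) = ((μ i)⁻¹ * μ j) • G.u i j := by
      rw [mul_smul, h2, smul_smul, inv_mul_cancel₀ hμ0, one_smul]
    rw [h3]
    congr 1
    simp only [hμ, d, D_eq_zpow hA, Matrix.diagonal_apply_eq]
    have e : ∀ i : Fin G.N, G.q ^ ((G.N : ℤ) - 1 - 2 * (i : ℤ))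
        = G.q ^ ((G.N : ℤ) - 1) * G.q ^ (-2 * (i : ℤ)) := by
      intro i
      rw [← zpow_add₀ hq]
      ring_nf
    rw [e, e]
    have := zpow_ne_zero ((G.N : ℤ) - 1) hq
    field_simp
  -- For the other series S(u) is u conjugated by the metric and transposed; applying this twice
  -- produces the quotients of metric entries that define D.
  · rw [antipode_u_of_metric hA, map_smul, antipode_u_of_metric hA, smul_smul, Fin.rev_rev,
      Fin.rev_rev]
    congr 1
    simp only [d, D_eq_metricEntry hA, Matrix.diagonal_apply_eq, mul_inv, inv_inv]
    ring

end Antipode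

end QuantumGroup
end QuantumGroups

namespace QuantumGroups

/-! ### The dual pairs of calculi -/

section Dual

variable {A : Type} [Ring A] [HopfAlgebra ℂ A] {ι : Type} [Fintype ι] [DecidableEq ι]

/-- The contractions with an invariant element of a dual Hopf bimodule. -/
theorem InvariantPairing.of_dual {Γ Γ' : BimoduleData A ι} (hΓ : Γ.IsYD) (hΓ' : Γ'.IsYD)
    {c e : ι → ℂ} {m m' : ι → ι → ℂ} {s : ℂ}
    (hc : ∀ b, ∑ d, c d • Γ.v b d = c b • 1) (he : ∀ b, ∑ d, e d • Γ'.v b d = e b • 1)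
    (hm : ∀ i j, ∑ a, ∑ b, m a b • (Γ.v a i * Γ'.v b j) = m i j • 1)
    (hm' : ∀ i j, ∑ a, ∑ b, m' a b • (Γ'.v a i * Γ.v b j) = m' i j • 1)
    (hf : ∀ i j, ∑ a, ∑ b, m' a b • conv (Γ'.f i a) (Γ.f j b)
      = m' i j • CoalgebraStruct.counit)
    (hs : ∑ a, ∑ b, m a b * e b * c a = s) (hs' : ∑ a, ∑ b, m' a b * e a * c b = s) :
    InvariantPairing Γ c (fun a => ∑ b, m a b * e b) (fun b => ∑ a, m' a b • Γ'.row e a) s where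
  yd := hΓ
  v_c := hc
  γ_v d := by
    calc _ = ∑ a, ∑ b, m a b • (Γ.v a d * (e b • 1)) := by
          simp only [Finset.sum_smul, mul_smul_comm, mul_one, smul_smul]
      _ = ∑ j, e j • ∑ a, ∑ b, m a b • (Γ.v a d * Γ'.v b j) := by
          simp only [← he, Finset.mul_sum, Finset.smul_sum, mul_smul_comm]
          conv_rhs => rw [Finset.sum_comm]
          refine Finset.sum_congr rfl fun a _ => ?_
          rw [Finset.sum_comm]
          refine Finset.sum_congr rfl fun b _ => Finset.sum_congr rfl fun j _ => ?_
          rw [smul_comm]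
      _ = _ := by
          simp only [hm, Finset.sum_smul, smul_smul, mul_comm]
  ψ_v j a := by
    simp only [rightAct_sum, leftAct_sum, rightAct_smul, leftAct_smul, LinearMap.sum_apply,
      LinearMap.smul_apply, ← hΓ'.row_v he]
    calc _ = ∑ k, leftAct (Γ'.row e k) a * ∑ i, ∑ b, m' i b • (Γ'.v i k * Γ.v b j) := by
          simp only [Finset.smul_sum, Finset.sum_mul, Finset.mul_sum, smul_mul_assoc,
            mul_smul_comm, mul_assoc]
          rw [Finset.sum_comm]
          conv_rhs => rw [Finset.sum_comm]
          refine Finset.sum_congr rfl fun i _ => ?_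
          rw [Finset.sum_comm]
      _ = _ := by
          simp only [hm', mul_smul_comm, mul_one]
  ψ_f j a := by
    have e1 : ∀ d, (∑ i, m' i d • Γ'.row e i) ∘ₗ LinearMap.mulLeft ℂ a
        = ∑ i, ∑ k, (m' i d * Γ'.row e k a) • Γ'.f k i := by
      intro d
      ext x
      simp only [LinearMap.comp_apply, LinearMap.sum_apply, LinearMap.smul_apply,
        LinearMap.mulLeft_apply, hΓ'.row_mul, smul_eq_mul, Finset.mul_sum, mul_assoc]
    calc _ = ∑ k, Γ'.row e k a • ∑ i, ∑ d, m' i d • conv (Γ'.f k i) (Γ.f j d) := by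
          simp only [e1, conv_sum_left, conv_smul_left, Finset.smul_sum, smul_smul]
          rw [Finset.sum_comm]
          conv_rhs => rw [Finset.sum_comm]
          refine Finset.sum_congr rfl fun i _ => ?_
          rw [Finset.sum_comm]
          simp only [mul_comm]
      _ = _ := by
          simp only [hf, smul_smul, ← Finset.sum_smul, LinearMap.sum_apply, LinearMap.smul_apply,
            smul_eq_mul, mul_comm]
  γ_c := by
    rw [← hs]
    simp only [Finset.sum_mul]
  ψ_φ := by
    calc _ = ∑ i, ∑ j, (e i * c j) • ∑ a, ∑ b, m' a b • conv (Γ'.f i a) (Γ.f j b) := by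
          simp only [BimoduleData.row, conv_sum_left, conv_sum_right, conv_smul_left,
            conv_smul_right, Finset.smul_sum, smul_smul]
          calc _ = ∑ p : ι × ι, ∑ q : ι × ι, (m' p.2 p.1 * (e q.1 * c q.2)) •
                conv (Γ'.f q.1 p.2) (Γ.f q.2 p.1) := by
                simp only [Fintype.sum_prod_type]
                refine Finset.sum_congr rfl fun b _ => ?_
                rw [Finset.sum_comm]
                refine Finset.sum_congr rfl fun a _ => ?_
                rw [Finset.sum_comm]
                refine Finset.sum_congr rfl fun i _ => Finset.sum_congr rfl fun j _ => ?_
                congr 1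
                ring
            _ = _ := by
                rw [Finset.sum_comm]
                simp only [Fintype.sum_prod_type]
                refine Finset.sum_congr rfl fun i _ => Finset.sum_congr rfl fun j _ => ?_
                rw [Finset.sum_comm]
                simp only [mul_comm]
      _ = _ := by
          simp only [hf, smul_smul, ← Finset.sum_smul, ← hs']
          congr 1
          refine Finset.sum_congr rfl fun i _ => Finset.sum_congr rfl fun j _ => ?_
          ring

end Dual

namespace QuantumGroup

variable {G : QuantumGroup} {x y : ℂ} {rx ry : G.Coord →ₗ[ℂ] G.Coord →ₗ[ℂ] ℂ}

local notation "S" => HopfAlgebra.antipode (A := Coord G) ℂ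

/-- Both calculi are tensor products of a module built from one r-form through its first argument
and one built from the other r-form through its second argument. For the sign minus u is replaced
throughout by its contragredient, and the two factors are interchanged. -/
theorem isYD_bimodule (hx : G.Admissible x) (hrx : G.IsRForm x rx) (hry : G.IsRForm y ry) (τ : Pm) :
    (bimodule rx ry τ).IsYD := by
  cases τ with
  | plus =>
    refine BimoduleData.IsYD.tensor (hry.universal.isYD_left corep_u ?_)
      (hrx.universal.isYD_right corep_u)
    -- This is S⁻¹(u), expressed through S by means of the formula for S².
    refine ⟨Matrix.of fun m y => (G.d m * (G.d y)⁻¹) • S (G.u m y), fun y c => ?_⟩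
    have h : ∀ m, (G.d m * (G.d y)⁻¹) • S (G.u m y) * G.u c m
        = ((G.d y)⁻¹ * G.d c) • (S (G.u m y) * S (S (G.u c m))) := by
      intro m
      have := d_ne_zero c
      rw [antipode_sq_u hx hrx, smul_mul_assoc, mul_smul_comm, smul_smul]
      congr 1
      field_simp
    simp only [Matrix.of_apply, h, ← Finset.smul_sum, corep_u.mul_antipode_sq]
    split_ifs with h'
    · subst h'
      rw [inv_mul_cancel₀ (d_ne_zero _), one_smul]
    · simp
  | minus =>
    refine BimoduleData.IsYD.tensor (hrx.universal.isYD_right corep_u.contra)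
      (hry.universal.isYD_left corep_u.contra ⟨G.u.transpose, fun y c => ?_⟩)
    simp only [Matrix.of_apply, Matrix.transpose_apply, corep_u.mul_antipode, eq_comm]

/-- The coordinates of `ω_0`. -/
noncomputable def omegaCoeff (G : QuantumGroup) : Pm → G.Idx → ℂ
  | .plus => fun a => if a.1 = a.2 then 1 else 0
  | .minus => fun a => if a.1 = a.2 then (G.d a.1)⁻¹ else 0

theorem omega0_eq (τ : Pm) :
    omega0 (G := G) τ = fun I => algebraMap ℂ G.Coord (G.omegaCoeff τ (I 0)) := by
  cases τ <;> funext I <;> simp only [omega0, omegaCoeff] <;> split_ifs <;> simp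

/-- The factors are in the wrong order for the antipode axiom; the weights convert u into S²(u), for
which the axiom of the contragredient applies. -/
theorem sum_d_inv_mul (hx : G.Admissible x) (hrx : G.IsRForm x rx) (i j : Fin G.N) :
    ∑ m, (G.d m)⁻¹ • (G.u m j * S (G.u i m)) = if i = j then (G.d j)⁻¹ • 1 else 0 := by
  have h : ∀ m, (G.d m)⁻¹ • (G.u m j * S (G.u i m))
      = (G.d j)⁻¹ • (S (S (G.u m j)) * S (G.u i m)) := by
    intro m
    have := d_ne_zero j
    rw [antipode_sq_u hx hrx, smul_mul_assoc, smul_smul]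
    congr 1
    field_simp
  simp only [h, ← Finset.smul_sum, corep_u.antipode_sq_mul]
  split_ifs <;> simp

theorem sum_d_mul_antipode_sq (hx : G.Admissible x) (hrx : G.IsRForm x rx) (i j : Fin G.N) :
    ∑ m, G.d m • (S (G.u i m) * S (S (G.u m j))) = if i = j then G.d j • 1 else 0 := by
  have h : ∀ m, G.d m • (S (G.u i m) * S (S (G.u m j)))
      = G.d j • (S (G.u i m) * G.u m j) := by
    intro m
    have := d_ne_zero m
    rw [antipode_sq_u hx hrx, mul_smul_comm, smul_smul]
    congr 1
    field_simp
  simp only [h, ← Finset.smul_sum, corep_u.antipode_mul]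
  split_ifs <;> simp

theorem sum_d_antipode_mul (hx : G.Admissible x) (hrx : G.IsRForm x rx) (i j : Fin G.N) :
    ∑ m, G.d m • (S (G.u m j) * G.u i m) = if i = j then G.d i • 1 else 0 := by
  have h : ∀ m, G.d m • (S (G.u m j) * G.u i m)
      = G.d i • (S (G.u m j) * S (S (G.u i m))) := by
    intro m
    have := d_ne_zero i
    rw [antipode_sq_u hx hrx, mul_smul_comm, smul_smul]
    congr 1
    field_simp
  simp only [h, ← Finset.smul_sum, corep_u.mul_antipode_sq]
  split_ifs <;> simp

theorem omegaCoeff_invariant (hx : G.Admissible x) (hrx : G.IsRForm x rx) (τ : Pm) (b : G.Idx) :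
    ∑ a, G.omegaCoeff τ a • (bimodule rx ry τ).v b a = G.omegaCoeff τ b • 1 := by
  cases τ with
  | plus =>
    simp only [omegaCoeff, bimodule, Matrix.of_apply, Fintype.sum_prod_type, ite_smul, one_smul,
      zero_smul, Finset.sum_ite_eq, Finset.mem_univ, if_true, corep_u.mul_antipode]
  | minus =>
    have h : ∀ m, (G.d m)⁻¹ • (S (S (G.u b.1 m)) * S (G.u m b.2))
        = (G.d b.1)⁻¹ • (G.u b.1 m * S (G.u m b.2)) := by
      intro m
      have := d_ne_zero m
      rw [antipode_sq_u hx hrx, smul_mul_assoc, smul_smul]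
      congr 1
      field_simp
    simp only [omegaCoeff, bimodule, Matrix.of_apply, Fintype.sum_prod_type, ite_smul,
      zero_smul, Finset.sum_ite_eq, Finset.mem_univ, if_true, h, ← Finset.smul_sum,
      corep_u.mul_antipode]
    split_ifs <;> simp

theorem metric_plus (a b : G.Idx) : G.metric .plus a b
    = if a.2 = b.1 ∧ a.1 = b.2 then G.d a.2 * (G.d a.1)⁻¹ else 0 := by
  simp only [metric, D_inv]
  rw [D_eq, Matrix.diagonal_apply, Matrix.diagonal_apply]
  by_cases h1 : a.2 = b.1 <;> by_cases h2 : a.1 = b.2 <;> simp [h1, h2, eq_comm]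

theorem metric_minus (a b : G.Idx) : G.metric .minus a b
    = if a.2 = b.1 ∧ a.1 = b.2 then 1 else 0 := rfl

theorem sum_metric {M : Type} [AddCommGroup M] [Module ℂ M] (τ : Pm) (F : G.Idx → G.Idx → M) :
    ∑ a, ∑ b, G.metric τ a b • F a b = ∑ k, ∑ l, G.metric τ (k, l) (l, k) • F (k, l) (l, k) := by
  rw [Fintype.sum_prod_type]
  refine Finset.sum_congr rfl fun k _ => Finset.sum_congr rfl fun l _ => ?_
  refine Finset.sum_eq_single (l, k) (fun b _ hb => ?_) (by simp)
  have h : ¬ (l = b.1 ∧ k = b.2) := fun ⟨h1, h2⟩ => hb (Prod.ext h1.symm h2.symm)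
  cases τ
  · rw [metric_plus, if_neg h, zero_smul]
  · rw [metric_minus, if_neg h, zero_smul]

/-- The metric pairs neighbouring indices, so the two inner factors of the product of
corepresentations collapse first, and after them the two outer ones. The weights in the metric are
exactly what each collapse needs. -/
theorem metric_covariant (hx : G.Admissible x) (hrx : G.IsRForm x rx) (τ : Pm) (i j : G.Idx) :
    ∑ a, ∑ b, G.metric τ a b • ((bimodule rx ry τ).v a i * (bimodule rx ry (-τ)).v b j)
      = G.metric τ i j • 1 := by
  rw [sum_metric]
  cases τ with
  | plus =>
    simp only [metric_plus, and_self, if_true, bimodule, Matrix.of_apply]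
    calc _ = ∑ k, (G.d k)⁻¹ • (G.u k i.1 * (∑ l, G.d l • (S (G.u i.2 l) * S (S (G.u l j.1))))
          * S (G.u j.2 k)) := by
          simp only [Finset.mul_sum, Finset.sum_mul, Finset.smul_sum, mul_smul_comm,
            smul_mul_assoc, smul_smul, mul_assoc]
          simp only [mul_comm (G.d _)]
      _ = _ := by
          simp only [sum_d_mul_antipode_sq hx hrx]
          by_cases h : i.2 = j.1
          · simp only [h, if_true, mul_smul_comm, mul_one, smul_mul_assoc]
            simp only [smul_comm _ (G.d j.1), ← Finset.smul_sum, sum_d_inv_mul hx hrx]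
            by_cases h' : i.1 = j.2
            · simp [h', smul_smul]
            · simp [h', Ne.symm h']
          · simp [h]
  | minus =>
    simp only [metric_minus, and_self, if_true, bimodule, Matrix.of_apply, one_smul]
    calc _ = ∑ k, (S (S (G.u k i.1)) * (∑ l, (S (G.u i.2 l) * G.u l j.1))
          * S (G.u j.2 k)) := by
          simp only [Finset.mul_sum, Finset.sum_mul, mul_assoc]
      _ = _ := by
          simp only [corep_u.antipode_mul]
          by_cases h : i.2 = j.1
          · simp only [h, if_true, mul_one, corep_u.antipode_sq_mul]
            by_cases h' : i.1 = j.2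
            · simp [h']
            · simp [h', Ne.symm h']
          · simp [h]

/-- The nested collapse takes place inside the r-forms: the inner convolution combines values of one
r-form on u and S(u) to the counit, then the outer one does so for the other r-form. -/
theorem metric_conv (hx : G.Admissible x) (hrx : G.IsRForm x rx) (hry : G.IsRForm y ry) (τ : Pm)
    (i j : G.Idx) : ∑ a, ∑ b, G.metric τ a b •
      conv ((bimodule rx ry τ).f i a) ((bimodule rx ry (-τ)).f j b)
      = G.metric τ i j • CoalgebraStruct.counit := by
  have smul_ite_one : ∀ (r : G.Coord →ₗ[ℂ] G.Coord →ₗ[ℂ] ℂ), r 1 = CoalgebraStruct.counit →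
      ∀ (p : Prop) [Decidable p] (z : ℂ), r (if p then z • 1 else 0)
        = if p then z • CoalgebraStruct.counit else 0 := by
    intro r hr p _ z
    split_ifs <;> simp [hr]
  have ite_one : ∀ (r : G.Coord →ₗ[ℂ] G.Coord →ₗ[ℂ] ℂ), r 1 = CoalgebraStruct.counit →
      ∀ (p : Prop) [Decidable p], r (if p then 1 else 0)
        = if p then CoalgebraStruct.counit else 0 := by
    intro r hr p _
    split_ifs <;> simp [hr]
  rw [sum_metric]
  cases τ with
  | plus =>
    simp only [metric_plus, and_self, if_true, bimodule, Matrix.of_apply]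
    calc _ = ∑ k, (G.d k)⁻¹ • conv (ry (G.u k i.1))
          (conv (rx.flip (∑ l, G.d l • (S (G.u l j.1) * G.u i.2 l))) (ry (S (G.u j.2 k)))) := by
          simp only [map_sum, map_smul, conv_sum_left, conv_sum_right, conv_smul_left,
            conv_smul_right, Finset.smul_sum, smul_smul, hrx.universal.mul_right, conv_assoc]
          simp only [mul_comm (G.d _)]
      _ = _ := by
          rw [sum_d_antipode_mul hx hrx, smul_ite_one rx.flip hrx.universal.one_right]
          by_cases h : i.2 = j.1
          · simp only [h, if_true, conv_smul_left, conv_smul_right, counit_conv,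
              ← hry.universal.mul_left]
            simp only [smul_comm _ (G.d j.1), ← Finset.smul_sum, ← map_smul, ← map_sum,
              sum_d_inv_mul hx hrx]
            by_cases h' : i.1 = j.2
            · simp [h', smul_smul, hry.universal.one_left]
            · simp [h', Ne.symm h']
          · simp [h]
  | minus =>
    simp only [metric_minus, and_self, if_true, bimodule, Matrix.of_apply, one_smul]
    calc _ = ∑ k, conv (rx.flip (S (G.u k i.1)))
          (conv (ry (∑ l, S (G.u i.2 l) * G.u l j.1)) (rx.flip (G.u j.2 k))) := by
          simp only [map_sum, conv_sum_left, conv_sum_right, hry.universal.mul_left, conv_assoc]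
      _ = _ := by
          rw [corep_u.antipode_mul, ite_one ry hry.universal.one_left]
          by_cases h : i.2 = j.1
          · simp only [h, if_true, counit_conv, ← hrx.universal.mul_right]
            simp only [← map_sum, corep_u.mul_antipode, ite_one rx.flip hrx.universal.one_right]
            by_cases h' : i.1 = j.2
            · simp [h']
            · simp [h', Ne.symm h']
          · simp [h]

theorem sum_metric_omegaCoeff (τ : Pm) (a : G.Idx) :
    ∑ b, G.metric τ a b * G.omegaCoeff (-τ) b
      = if a.1 = a.2 then (match τ with | .plus => (G.d a.1)⁻¹ | .minus => 1) else 0 := by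
  rw [Finset.sum_eq_single (a.2, a.1)]
  · cases τ
    · rw [metric_plus]
      simp only [and_self, if_true, omegaCoeff]
      by_cases h : a.1 = a.2
      · have := d_ne_zero a.2
        simp [h, this]
      · simp [h, Ne.symm h]
    · rw [metric_minus]
      simp only [and_self, if_true, omegaCoeff]
      simp [eq_comm]
  · intro b _ hb
    have h : ¬ (a.2 = b.1 ∧ a.1 = b.2) := fun ⟨h1, h2⟩ => hb (Prod.ext h1.symm h2.symm)
    cases τ
    · rw [metric_plus, if_neg h, zero_mul]
    · rw [metric_minus, if_neg h, zero_mul]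
  · simp

theorem sum_metric_omegaCoeff_omegaCoeff (τ : Pm) :
    ∑ a, ∑ b, G.metric τ a b * G.omegaCoeff (-τ) b * G.omegaCoeff τ a = G.s := by
  simp only [← Finset.sum_mul, sum_metric_omegaCoeff]
  rw [Fintype.sum_prod_type]
  cases τ <;> simp [omegaCoeff, sum_d_inv]

theorem neg_neg_pm (τ : Pm) : - -τ = τ := by cases τ <;> rfl

/-- The coordinates of the contraction with `ω_0^{-τ}` from the right. -/
noncomputable def contrCoeff (G : QuantumGroup) (τ : Pm) (a : G.Idx) : ℂ :=
  ∑ b, G.metric τ a b * G.omegaCoeff (-τ) b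

/-- The functionals of the contraction with `ω_0^{-τ}` from the left. -/
noncomputable def contrFunctional (rx ry : G.Coord →ₗ[ℂ] G.Coord →ₗ[ℂ] ℂ) (τ : Pm) (b : G.Idx) :
    G.Coord →ₗ[ℂ] ℂ :=
  ∑ a, G.metric (-τ) a b • (bimodule rx ry (-τ)).row (G.omegaCoeff (-τ)) a

theorem invariantPairing (hx : G.Admissible x) (hrx : G.IsRForm x rx) (hry : G.IsRForm y ry)
    (τ : Pm) : InvariantPairing (bimodule rx ry τ) (G.omegaCoeff τ) (G.contrCoeff τ)
      (contrFunctional rx ry τ) G.s := by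
  refine InvariantPairing.of_dual (isYD_bimodule hx hrx hry τ) (isYD_bimodule hx hrx hry (-τ))
    (omegaCoeff_invariant hx hrx τ) (omegaCoeff_invariant hx hrx (-τ))
    (metric_covariant hx hrx τ) ?_ ?_ (sum_metric_omegaCoeff_omegaCoeff τ) ?_
  -- The metric on Γ_{-τ} ⊗ Γ_τ is the one attached to −τ, so the remaining conditions are the
  -- earlier ones with the sign reversed.
  · have := metric_covariant (ry := ry) hx hrx (-τ)
    rwa [neg_neg_pm] at this
  · have := metric_conv hx hrx hry (-τ)
    rwa [neg_neg_pm] at this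
  · have := sum_metric_omegaCoeff_omegaCoeff (G := G) (-τ)
    rw [neg_neg_pm] at this
    rw [← this]
    refine Finset.sum_congr rfl fun i _ => Finset.sum_congr rfl fun j _ => ?_
    ring

/-- The left side is a quantum trace of products of r-form functionals, with weights d_i⁻¹ on the
outer index after S² has been removed. Subtracting the counit inside each generator X_ij accounts
for the extra term, since these weights sum to 𝔰. -/
theorem sum_contrCoeff_row (hx : G.Admissible x) (hrx : G.IsRForm x rx) (hry : G.IsRForm y ry)
    (τ : Pm) : ∑ j, G.contrCoeff τ j • (bimodule rx ry τ).row (G.omegaCoeff τ) j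
      = G.s • X0 rx ry τ + G.s • CoalgebraStruct.counit := by
  have hs := s_ne_zero (G := G)
  simp only [contrCoeff, sum_metric_omegaCoeff, BimoduleData.row]
  simp only [Fintype.sum_prod_type]
  cases τ with
  | plus =>
    have h : ∀ i k, dualAntipode (lMinus ry i k) = ry (G.u i k) := by
      intro i k
      ext a
      exact hry.universal.antipode_antipode_left corep_u a i k
    have hX : G.s • X0 rx ry .plus = ∑ i, (G.d i)⁻¹ •
        ((∑ k, conv (ry (G.u i k)) (rx.flip (G.u k i))) - CoalgebraStruct.counit) := by
      simp only [X0, smul_smul, mul_inv_cancel₀ hs, one_smul, D_inv, Matrix.diagonal_apply,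
        ite_smul, zero_smul, Finset.sum_ite_eq, Finset.mem_univ, if_true, X, h]
      rfl
    rw [hX]
    simp only [smul_sub, Finset.sum_sub_distrib, ← Finset.sum_smul, sum_d_inv, sub_add_cancel]
    simp [omegaCoeff, bimodule]
  | minus =>
    -- The r-form is invariant under S in both arguments at once, and the resulting S² on u is
    -- evaluated by D.
    have h : ∀ i k, rx.flip (S (G.u i k))
        = ((G.d i)⁻¹ * G.d k) • dualAntipode (lPlus rx i k) := by
      intro i k
      ext a
      have := hrx.universal.antipode_antipode corep_u.contra a k i
      simp only [Matrix.of_apply] at this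
      rw [LinearMap.flip_apply, ← this, antipode_sq_u hx hrx, map_smul]
      rfl
    have hX : G.s • X0 rx ry .minus = ∑ i, (G.d i)⁻¹ •
        ((∑ k, conv (dualAntipode (lPlus rx i k)) (ry (S (G.u k i))))
          - CoalgebraStruct.counit) := by
      simp only [X0, smul_smul, mul_inv_cancel₀ hs, one_smul, X, if_true]
      rfl
    rw [hX]
    simp only [smul_sub, Finset.sum_sub_distrib, ← Finset.sum_smul, sum_d_inv, sub_add_cancel]
    simp [omegaCoeff, bimodule, h, smul_smul, Finset.smul_sum]
    refine Finset.sum_congr rfl fun i _ => Finset.sum_congr rfl fun k _ => ?_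
    congr 1
    rw [mul_left_comm, inv_mul_cancel₀ (d_ne_zero k), mul_one]

/-- Contracting ω₀^{-τ} with ω₀^τ from the left for τ is contracting from the right for −τ; the
second functional of the Laplacian is therefore the trace functional of the dual calculus. -/
theorem sum_omegaCoeff_contrFunctional (τ : Pm) :
    ∑ j, G.omegaCoeff τ j • contrFunctional rx ry τ j
      = ∑ j, G.contrCoeff (-τ) j • (bimodule rx ry (-τ)).row (G.omegaCoeff (-τ)) j := by
  simp only [contrFunctional, contrCoeff, Finset.smul_sum, Finset.sum_smul, neg_neg_pm, smul_smul]
  rw [Finset.sum_comm]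
  simp only [mul_comm]

end QuantumGroup
end QuantumGroups

namespace QuantumGroups

/-! ### Translation to the external algebra and conclusion. -/

section Operators
variable {A : Type} [Ring A] [HopfAlgebra ℂ A] {ι : Type} [Fintype ι] [DecidableEq ι]

namespace BimoduleData

omit [DecidableEq ι] in
theorem tensorLeft_eq (Γ : BimoduleData A ι) (c : ι → ℂ) (k : ℕ) :
    Γ.tensorLeft (fun I => algebraMap ℂ A (c (I 0))) = appendFirst (Γ.row c) k := by
  refine LinearMap.ext fun ρ => funext fun K => ?_
  rw [tensorLeft_apply]
  rfl

theorem tensorRight_eq {Γ : BimoduleData A ι} (hΓ : Γ.IsYD) (c : ι → ℂ) (k : ℕ) :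
    Γ.tensorRight (fun I => algebraMap ℂ A (c (I 0))) = appendLast c k := by
  refine LinearMap.ext fun ρ => funext fun K => ?_
  rw [tensorRight_apply hΓ]
  rfl

theorem actR_add_smul {Γ : BimoduleData A ι} (hΓ : Γ.IsYD) (k : ℕ) (s t : ℂ) (X : A →ₗ[ℂ] ℂ)
    (ρ : Tens A ι k) : Γ.actR k (s • X + t • CoalgebraStruct.counit) ρ
      = s • Γ.actR k X ρ + t • ρ := by
  funext J
  have h : ∀ I, shiftR (s • X + t • CoalgebraStruct.counit) (tensorPow Γ.v k J I)
      = s • shiftR X (tensorPow Γ.v k J I)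
        + (if J = I then t else 0) • CoalgebraStruct.counit := by
    intro I
    ext a
    by_cases e : J = I <;> simp [hΓ.counit_tensorPow, e]
  simp only [actR_apply, h, Pi.add_apply, Pi.smul_apply]
  simp only [leftAct_add, leftAct_smul, LinearMap.add_apply, LinearMap.smul_apply, leftAct_counit,
    LinearMap.id_apply, Finset.sum_add_distrib, ← Finset.smul_sum]
  congr 1
  rw [Finset.sum_eq_single J]
  · rw [if_pos rfl]
  · exact fun I _ hI => by rw [if_neg hI.symm, zero_smul]
  · exact fun hJ => absurd (Finset.mem_univ J) hJ

omit [DecidableEq ι] in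
theorem actR_zero (Γ : BimoduleData A ι) (X : A →ₗ[ℂ] ℂ) (ρ : Tens A ι 0) :
    Γ.actR 0 X ρ = fun J => leftAct X (ρ J) := by
  funext J
  have h : shiftR X 1 = X := by
    ext a
    simp
  rw [actR_apply, Finset.sum_eq_single J]
  · rw [tensorPow_zero, h]
  · exact fun I _ hI => absurd (Subsingleton.elim I J) hI
  · exact fun hJ => absurd (Finset.mem_univ J) hJ

end BimoduleData

omit [Fintype ι] [DecidableEq ι] in
theorem compLeft_rightAct (k : ℕ) (s t : ℂ) (X : A →ₗ[ℂ] ℂ) (ρ : Tens A ι k) :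
    (rightAct (s • X + t • CoalgebraStruct.counit)).compLeft (Fin k → ι) ρ
      = s • (fun J => rightAct X (ρ J)) + t • ρ := by
  funext J
  simp [rightAct_add]

end Operators

namespace QuantumGroup

variable {G : QuantumGroup} {x y : ℂ} {rx ry : G.Coord →ₗ[ℂ] G.Coord →ₗ[ℂ] ℂ}

theorem dTens_eq {τ : Pm} (hΓ : (bimodule rx ry τ).IsYD) (k : ℕ) :
    dTens rx ry τ k = ExtPower.proj (A := G.Coord) _ (k + 1) ∘ₗ
      diffOp (G.omegaCoeff τ) ((bimodule rx ry τ).row (G.omegaCoeff τ)) k := by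
  rw [dTens, omega0_eq, BimoduleData.tensorLeft_eq, BimoduleData.tensorRight_eq hΓ]
  rfl

theorem codTens_eq {τ : Pm} (hΓ : (bimodule rx ry τ).IsYD) (ν : Pm) (k : ℕ) :
    codTens rx ry τ ν k = ExtPower.proj (A := G.Coord) _ k ∘ₗ
      codiffOp (braid rx ry τ ν) (G.contrCoeff τ) (contrFunctional rx ry τ) k := by
  have h1 : pairRight rx ry τ (k := k) (omega0 (-τ)) = contrLast (G.contrCoeff τ) k := by
    refine LinearMap.ext fun ρ => funext fun J => ?_
    rw [contrLast_apply, omega0_eq]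
    simp only [pairRight, LinearMap.pi_apply, LinearMap.sum_apply, LinearMap.smul_apply,
      LinearMap.comp_apply, LinearMap.flip_apply, LinearMap.proj_apply,
      BimoduleData.rmul_algebraMap hΓ, Pi.smul_apply, contrCoeff, Finset.sum_smul, smul_smul]
  have h2 : pairLeft rx ry τ (k := k) (omega0 (-τ)) = contrFirst (contrFunctional rx ry τ) k := by
    refine LinearMap.ext fun ρ => funext fun J => ?_
    have e : ∀ (a : G.Idx) (z : G.Coord), (bimodule rx ry (-τ)).rmul 1
        (fun I => algebraMap ℂ G.Coord (G.omegaCoeff (-τ) (I 0))) z (fun _ => a)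
        = leftAct ((bimodule rx ry (-τ)).row (G.omegaCoeff (-τ)) a) z := by
      intro a z
      rw [BimoduleData.rmul_apply, sum_fin_one, BimoduleData.row, leftAct_sum,
        LinearMap.sum_apply]
      refine Finset.sum_congr rfl fun i _ => ?_
      rw [BimoduleData.fPow_one, leftAct_smul, LinearMap.smul_apply, Algebra.smul_def]
    rw [contrFirst_apply, omega0_eq]
    simp only [pairLeft, LinearMap.pi_apply, LinearMap.sum_apply, LinearMap.smul_apply,
      LinearMap.comp_apply, LinearMap.proj_apply, e, contrFunctional, leftAct_sum, leftAct_smul]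
    rw [Finset.sum_comm]
  rw [codTens, contrRight, contrLeft, h1, h2]
  rfl

theorem braid_mul_braid {τ : Pm} {c γ : G.Idx → ℂ} {ψ : G.Idx → G.Coord →ₗ[ℂ] ℂ} {s : ℂ}
    (h : InvariantPairing (bimodule rx ry τ) c γ ψ s) (ν : Pm) (k : ℕ)
    (ρ : Tens G.Coord G.Idx k) :
    antisymm (braid rx ry τ ν) k ρ = 0 ↔ antisymm (braid rx ry τ .plus) k ρ = 0 := by
  cases ν with
  | plus => rfl
  | minus =>
    exact antisymm_inverse_eq_zero h.isContraction_braiding.braid h.braiding_mul_inv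
      h.braiding_inv_mul k ρ

theorem braid_braidRel {τ : Pm} {c γ : G.Idx → ℂ} {ψ : G.Idx → G.Coord →ₗ[ℂ] ℂ} {s : ℂ}
    (h : InvariantPairing (bimodule rx ry τ) c γ ψ s) (ν : Pm) (k : ℕ) :
    BraidRel (legs (M := G.Coord) (braid rx ry τ ν) k) := by
  cases ν with
  | plus => exact h.isContraction_braiding.braid k
  | minus => exact h.isContraction_braiding_inv.braid k

theorem descends_dTens (hx : G.Admissible x) (hrx : G.IsRForm x rx) (hry : G.IsRForm y ry)
    (τ : Pm) (k : ℕ) : Descends (braid rx ry τ .plus) (dTens rx ry τ k) := by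
  have h := invariantPairing hx hrx hry τ
  intro ρ hρ
  rw [LinearMap.mem_ker, dTens_eq h.yd, LinearMap.comp_apply, proj_eq_zero]
  exact IsContraction.antisymm_diffOp (braid_braidRel h .plus) hρ

theorem descends_codTens (hx : G.Admissible x) (hrx : G.IsRForm x rx) (hry : G.IsRForm y ry)
    (τ ν : Pm) (k : ℕ) : Descends (braid rx ry τ .plus) (codTens rx ry τ ν k) := by
  have h := invariantPairing hx hrx hry τ
  intro ρ hρ
  rw [LinearMap.mem_ker, codTens_eq h.yd, LinearMap.comp_apply, proj_eq_zero,
    ← braid_mul_braid h ν]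
  exact IsContraction.antisymm_codiffOp (braid_braidRel h ν) ((braid_mul_braid h ν _ _).mpr hρ)

theorem laplace_proj_zero (hx : G.Admissible x) (hrx : G.IsRForm x rx) (hry : G.IsRForm y ry)
    (τ ν : Pm) (ρ : Tens G.Coord G.Idx 0) :
    laplace rx ry τ ν 0 (ExtPower.proj (A := G.Coord) _ 0 ρ) = ExtPower.proj (A := G.Coord) _ 0
      (codiffOp (braid rx ry τ ν) (G.contrCoeff τ) (contrFunctional rx ry τ) 0
        (diffOp (G.omegaCoeff τ) ((bimodule rx ry τ).row (G.omegaCoeff τ)) 0 ρ)) := by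
  have h := invariantPairing hx hrx hry τ
  rw [laplace, LinearMap.comp_apply, diff, ExtPower.induced_proj (descends_dTens hx hrx hry τ 0),
    dTens_eq h.yd, LinearMap.comp_apply, codiff,
    ExtPower.induced_proj (descends_codTens hx hrx hry τ ν 0), codTens_eq h.yd]
  rfl

theorem laplace_proj_succ (hx : G.Admissible x) (hrx : G.IsRForm x rx) (hry : G.IsRForm y ry)
    (τ ν : Pm) (k : ℕ) (ρ : Tens G.Coord G.Idx (k + 1)) :
    laplace rx ry τ ν (k + 1) (ExtPower.proj (A := G.Coord) _ (k + 1) ρ) = ExtPower.proj (A := G.Coord) _ (k + 1)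
      (codiffOp (braid rx ry τ ν) (G.contrCoeff τ) (contrFunctional rx ry τ) (k + 1)
        (diffOp (G.omegaCoeff τ) ((bimodule rx ry τ).row (G.omegaCoeff τ)) (k + 1) ρ)
      - diffOp (G.omegaCoeff τ) ((bimodule rx ry τ).row (G.omegaCoeff τ)) k
        (codiffOp (braid rx ry τ ν) (G.contrCoeff τ) (contrFunctional rx ry τ) k ρ)) := by
  have h := invariantPairing hx hrx hry τ
  rw [laplace, LinearMap.add_apply, LinearMap.neg_apply, LinearMap.comp_apply,
    LinearMap.comp_apply, diff, diff, codiff, codiff,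
    ExtPower.induced_proj (descends_dTens hx hrx hry τ (k + 1)),
    ExtPower.induced_proj (descends_codTens hx hrx hry τ ν k),
    dTens_eq h.yd (k + 1), codTens_eq h.yd ν k, LinearMap.comp_apply, LinearMap.comp_apply,
    ExtPower.induced_proj (descends_dTens hx hrx hry τ k),
    ExtPower.induced_proj (descends_codTens hx hrx hry τ ν (k + 1)),
    dTens_eq h.yd k, codTens_eq h.yd ν (k + 1), map_sub, neg_add_eq_sub]
  rfl

theorem formLeftAct_proj {τ : Pm} (hΓ : (bimodule rx ry τ).IsYD) (k : ℕ) (X : G.Coord →ₗ[ℂ] ℂ)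
    (ρ : Tens G.Coord G.Idx k) : formLeftAct rx ry τ k X (ExtPower.proj (A := G.Coord) _ k ρ)
      = ExtPower.proj (A := G.Coord) _ k ((bimodule rx ry τ).actR k X ρ) := by
  have h : Descends (braid rx ry τ .plus) (coactRTens rx ry τ k) := descends_coactR hΓ k
  rw [formLeftAct, LinearMap.comp_apply, LinearMap.comp_apply, ExtPower.induced_proj h]
  exact contract_proj_coactR _ _ X ρ

theorem formRightAct_proj (τ : Pm) (k : ℕ) (X : G.Coord →ₗ[ℂ] ℂ)
    (ρ : Tens G.Coord G.Idx k) : formRightAct rx ry τ k X (ExtPower.proj (A := G.Coord) _ k ρ)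
      = ExtPower.proj (A := G.Coord) _ k (fun J => rightAct X (ρ J)) := by
  have h : Descends (braid rx ry τ .plus) (coactLTens rx ry τ k) := descends_coactL _ k
  rw [formRightAct, LinearMap.comp_apply, LinearMap.comp_apply, ExtPower.induced_proj h]
  exact contract_proj_coactL _ X ρ

/-- The functionals that occur in the Laplace-Beltrami operator `Δ^ν` on `Γ_τ`. -/
theorem isContraction_braid (hx : G.Admissible x) (hrx : G.IsRForm x rx) (hry : G.IsRForm y ry)
    (τ ν : Pm) : ∃ X Y : ∀ k, Module.End ℂ (Tens G.Coord G.Idx k),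
      IsContraction (braid rx ry τ ν) (G.omegaCoeff τ) (G.contrCoeff τ)
        ((bimodule rx ry τ).row (G.omegaCoeff τ)) (contrFunctional rx ry τ) G.s X Y ∧
      ∀ k ρ, X k ρ + Y k ρ - (2 * G.s) • ρ
        = G.s • ((bimodule rx ry τ).actR k (X0 rx ry (match ν with | .plus => τ | .minus => -τ)) ρ
          + fun J => rightAct (X0 rx ry (match ν with | .plus => -τ | .minus => τ)) (ρ J)) := by
  have h := invariantPairing hx hrx hry τ
  have e1 := sum_contrCoeff_row hx hrx hry τ
  have e2 := (sum_omegaCoeff_contrFunctional (rx := rx) (ry := ry) τ).trans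
    (sum_contrCoeff_row hx hrx hry (-τ))
  cases ν with
  | plus =>
    refine ⟨_, _, h.isContraction_braiding, fun k ρ => ?_⟩
    -- Each of the two functionals is 𝔰 X_0 + 𝔰 ε; the two counit terms cancel 2𝔰.
    simp only [e1, e2, BimoduleData.actR_add_smul h.yd, compLeft_rightAct]
    module
  | minus =>
    refine ⟨_, _, h.isContraction_braiding_inv, fun k ρ => ?_⟩
    simp only [e1, e2, BimoduleData.actR_add_smul h.yd, compLeft_rightAct]
    module

theorem laplace_eq (hx : G.Admissible x) (hrx : G.IsRForm x rx) (hry : G.IsRForm y ry)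
    (τ ν : Pm) (k : ℕ) (ρ : Form rx ry τ k) :
    laplace rx ry τ ν k ρ = ((-1) ^ k * G.s) •
      (formLeftAct rx ry τ k (X0 rx ry (match ν with | .plus => τ | .minus => -τ)) ρ
        + formRightAct rx ry τ k (X0 rx ry (match ν with | .plus => -τ | .minus => τ)) ρ) := by
  have h := invariantPairing hx hrx hry τ
  obtain ⟨X, Y, hc, hXY⟩ := isContraction_braid hx hrx hry τ ν
  obtain ⟨ρ, rfl⟩ := Submodule.mkQ_surjective _ ρ
  rw [formLeftAct_proj h.yd, formRightAct_proj, ← map_add, ← map_smul, mul_smul, ← hXY]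
  cases k with
  | zero => rw [laplace_proj_zero hx hrx hry, hc.laplace_zero, pow_zero, one_smul]
  | succ k => rw [laplace_proj_succ hx hrx hry, hc.laplace_succ]

/-- The trace functional is central, and so is the counit; division by 𝔰 ≠ 0 gives the centrality of
X_0. -/
theorem leftAct_X0 (hx : G.Admissible x) (hrx : G.IsRForm x rx) (hry : G.IsRForm y ry)
    (τ : Pm) (a : G.Coord) : leftAct (X0 rx ry τ) a = rightAct (X0 rx ry τ) a := by
  have h := (invariantPairing hx hrx hry τ).central_row a
  rw [sum_contrCoeff_row hx hrx hry τ] at h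
  simp only [leftAct_add, rightAct_add, leftAct_smul, rightAct_smul, leftAct_counit,
    rightAct_counit, LinearMap.add_apply, add_left_inj, LinearMap.smul_apply] at h
  exact smul_right_injective _ s_ne_zero h

theorem laplace_coeff (hx : G.Admissible x) (hrx : G.IsRForm x rx) (hry : G.IsRForm y ry)
    (τ ν : Pm) (a : G.Coord) : laplace rx ry τ ν 0 (coeff rx ry τ a)
      = G.s • coeff rx ry τ (leftAct (X0 rx ry .plus + X0 rx ry .minus) a) := by
  have h := invariantPairing hx hrx hry τ
  have e : ∀ a, coeff rx ry τ a = ExtPower.proj (A := G.Coord) _ 0 (fun _ => a) := fun a => rfl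
  rw [laplace_eq hx hrx hry, e, formLeftAct_proj h.yd, formRightAct_proj, e, ← map_add,
    BimoduleData.actR_zero, pow_zero, one_mul]
  congr 2
  funext J
  simp only [Pi.add_apply, ← leftAct_X0 hx hrx hry, leftAct_add, LinearMap.add_apply]
  -- In degree zero both actions are by central functionals, so the four choices of signs differ
  -- only in the order of the two summands.
  cases τ <;> cases ν <;> first | rfl | exact add_comm _ _

end QuantumGroup

end QuantumGroups

theorem proposition5p3 (G : QuantumGroup) (x y : ℂ)
    (hx : G.Admissible x) (hy : G.Admissible y)
    (rx ry : G.Coord →ₗ[ℂ] G.Coord →ₗ[ℂ] ℂ)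
    (hrx : G.IsRForm x rx) (hry : G.IsRForm y ry) (τ : Pm) :
    -- the maps in question are well-defined on the external algebra
    (∀ k : ℕ,
      Descends (QuantumGroup.braid rx ry τ .plus) (QuantumGroup.dTens rx ry τ k) ∧
      (∀ ν : Pm,
        Descends (QuantumGroup.braid rx ry τ .plus) (QuantumGroup.codTens rx ry τ ν k)) ∧
      Descends (QuantumGroup.braid rx ry τ .plus) (QuantumGroup.coactRTens rx ry τ k) ∧
      Descends (QuantumGroup.braid rx ry τ .plus) (QuantumGroup.coactLTens rx ry τ k)) ∧
    (∀ (k : ℕ) (ρ : QuantumGroup.Form rx ry τ k),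
      QuantumGroup.laplace rx ry τ .plus k ρ = ((-1) ^ k * G.s) •
        (QuantumGroup.formLeftAct rx ry τ k (QuantumGroup.X0 rx ry τ) ρ
          + QuantumGroup.formRightAct rx ry τ k (QuantumGroup.X0 rx ry (-τ)) ρ)) ∧
    (∀ (k : ℕ) (ρ : QuantumGroup.Form rx ry τ k),
      QuantumGroup.laplace rx ry τ .minus k ρ = ((-1) ^ k * G.s) •
        (QuantumGroup.formLeftAct rx ry τ k (QuantumGroup.X0 rx ry (-τ)) ρ
          + QuantumGroup.formRightAct rx ry τ k (QuantumGroup.X0 rx ry τ) ρ)) ∧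
    (∀ (ν : Pm) (a : G.Coord),
      QuantumGroup.laplace rx ry τ ν 0 (QuantumGroup.coeff rx ry τ a) =
        G.s • QuantumGroup.coeff rx ry τ
          (leftAct (QuantumGroup.X0 rx ry .plus + QuantumGroup.X0 rx ry .minus) a) ∧
      QuantumGroup.laplace rx ry τ ν 0 (QuantumGroup.coeff rx ry τ a) =
        G.s • QuantumGroup.coeff rx ry τ
          (rightAct (QuantumGroup.X0 rx ry .plus + QuantumGroup.X0 rx ry .minus) a)) := by 
  refine ⟨fun k => ⟨QuantumGroup.descends_dTens hx hrx hry τ k,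
    fun ν => QuantumGroup.descends_codTens hx hrx hry τ ν k,
    descends_coactR (QuantumGroup.isYD_bimodule hx hrx hry τ) k, descends_coactL _ k⟩,
    QuantumGroup.laplace_eq hx hrx hry τ .plus, QuantumGroup.laplace_eq hx hrx hry τ .minus,
    fun ν a => ⟨QuantumGroup.laplace_coeff hx hrx hry τ ν a, ?_⟩⟩
  have h : leftAct (QuantumGroup.X0 rx ry .plus + QuantumGroup.X0 rx ry .minus) a
      = rightAct (QuantumGroup.X0 rx ry .plus + QuantumGroup.X0 rx ry .minus) a := by
    simp only [leftAct_add, rightAct_add, LinearMap.add_apply,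
      QuantumGroup.leftAct_X0 hx hrx hry]
  rw [QuantumGroup.laplace_coeff hx hrx hry τ ν a, h]
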